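/- Let $M\ge 3$ and let $A_1,\dots,A_M\in\mathbb{R}^2$ be the vertices of a convex polygon with non-empty interior, without artificial vertices (each $A_n$ is an extreme point of the closed polygon $K$, the $A_n$ are pairwise distinct), enumerated so that the boundary of $K$ is the union of the segments $[A_n,A_{n+1}]$, $1\le n\le M$, where $A_{M+1}:=A_1$. Put $\ell_n:=|A_{n+1}-A_n|$ and $\Omega:=\mathbb{R}^2\setminus K$. For $\alpha>0$ let $H_\alpha$ be the self-adjoint operator in $L^2(\Omega)$ generated by the sesquilinear form $$h_\alpha(u,u)=\int_\Omega|\nabla u|^2\,\mathrm{d}x-\alpha\int_{\partial\Omega}|u|^2\,\mathrm{d}\sigma,\qquad \operatorname{dom}(h_\alpha)=W^{1,2}(\Omega),$$ where $\sigma$ is the one-dimensional Hausdorff measure and $u|_{\partial\Omega}$ is the boundary trace; thus $H_\alpha$ is the Laplacian $u\mapsto-\Delta u$ in $\Omega$ with the Robin boundary condition $\partial u/\partial\nu=\alpha u$, where $\nu$ is the outer unit normal of $\Omega$. Let $E_1(\alpha)\le E_2(\alpha)\le\cdots$ be the discrete eigenvalues of $H_\alpha$ (isolated points of its spectrum that are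 eigenvalues of finite multiplicity), repeated according to multiplicity. Let $D_n$ be the Dirichlet Laplacian $f\mapsto-f''$ in $L^2(0,\ell_n)$, and let $\mu^D_m$ be the $m$th eigenvalue, counted with multiplicity, of $D_1\oplus\dots\oplus D_M$. Then for each fixed integer $m\ge1$ the eigenvalue $E_m(\alpha)$ exists for all sufficiently large $\alpha$, and $$E_m(\alpha)=-\alpha^2+\mu^D_m+\mathcal{O}\Big(\frac{1}{\sqrt{\alpha}}\Big)\quad\text{as }\alpha\to+\infty .$$ -/

import Mathlib

open Set Filter Topology MeasureTheory
open scoped ContDiff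

noncomputable section

namespace RobinExterior

/-! ### Unbounded operators: form operators, direct sums, spectra -/

section Operators

variable {H : Type*} [NormedAddCommGroup H] [InnerProductSpace ℂ H]

/-- The graph of the operator generated by a sesquilinear form `h` (conjugate-linear in the first
variable) with form domain `V`, embedded in the Hilbert space `H` by `j`: the pairs `(j u, w)` with
`h(v, u) = ⟪j v, w⟫` for every `v` in the form domain. -/
def formGraph {V : Type*} [AddCommGroup V] [Module ℂ V] (j : V →ₗ[ℂ] H)
    (h : V →ₗ⋆[ℂ] V →ₗ[ℂ] ℂ) : Submodule ℂ (H × H) where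
  carrier := {p | ∃ u : V, j u = p.1 ∧ ∀ v : V, h v u = inner ℂ (j v) p.2}
  add_mem' := by
    rintro p q ⟨u, hu, hu'⟩ ⟨v, hv, hv'⟩
    refine ⟨u + v, by simp [hu, hv], fun w => ?_⟩
    simp [hu' w, hv' w]
  zero_mem' := ⟨0, by simp, fun w => by simp⟩
  smul_mem' := by
    rintro c p ⟨u, hu, hu'⟩
    refine ⟨c • u, by simp [hu], fun w => ?_⟩
    simp [hu' w]

/-- The operator generated by a sesquilinear form (for a densely embedded form domain, the graph
above is the graph of an operator). -/
def formOperator {V : Type*} [AddCommGroup V] [Module ℂ V] (j : V →ₗ[ℂ] H)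
    (h : V →ₗ⋆[ℂ] V →ₗ[ℂ] ℂ) : H →ₗ.[ℂ] H :=
  (formGraph j h).toLinearPMap

/-- The direct sum of finitely many unbounded operators, in the Hilbert direct sum. -/
def directSum {ι : Type*} [Fintype ι] {K : ι → Type*} [∀ i, NormedAddCommGroup (K i)]
    [∀ i, InnerProductSpace ℂ (K i)] (T : ∀ i, K i →ₗ.[ℂ] K i) :
    PiLp 2 K →ₗ.[ℂ] PiLp 2 K where
  domain :=
    { carrier := {f | ∀ i, f i ∈ (T i).domain}
      add_mem' := fun hf hg i => (T i).domain.add_mem (hf i) (hg i)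
      zero_mem' := fun i => (T i).domain.zero_mem
      smul_mem' := fun c _ hf i => (T i).domain.smul_mem c (hf i) }
  toFun :=
    { toFun := fun f => WithLp.toLp 2 fun i => T i ⟨(f : PiLp 2 K) i, f.2 i⟩
      map_add' := fun f g => by
        ext i
        exact (T i).map_add ⟨(f : PiLp 2 K) i, f.2 i⟩ ⟨(g : PiLp 2 K) i, g.2 i⟩
      map_smul' := fun c f => by
        ext i
        exact (T i).map_smul c ⟨(f : PiLp 2 K) i, f.2 i⟩ }

/-- The resolvent set: those `z` for which `T - z` is a bijection from the domain of `T` onto `H`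
with bounded inverse. -/
def resolventSet (T : H →ₗ.[ℂ] H) : Set ℂ :=
  {z | ∃ R : H →L[ℂ] H, (∀ f : H, ∃ u : T.domain, (u : H) = R f ∧ T u - z • (u : H) = f) ∧
    ∀ u : T.domain, R (T u - z • (u : H)) = u}

/-- The spectrum of an unbounded operator. -/
def opSpectrum (T : H →ₗ.[ℂ] H) : Set ℂ := (resolventSet T)ᶜ

/-- The kernel of `T - z`, as a subspace of `H`. -/
def eigenspace (T : H →ₗ.[ℂ] H) (z : ℂ) : Submodule ℂ H :=
  (LinearMap.ker (T.toFun - z • T.domain.subtype)).map T.domain.subtype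

/-- The discrete spectrum (of a self-adjoint operator): the isolated points of the spectrum that
are eigenvalues of finite multiplicity. -/
def discreteSpectrum (T : H →ₗ.[ℂ] H) : Set ℝ :=
  {l | (l : ℂ) ∈ opSpectrum T ∧
    (∃ ε > 0, ∀ z ∈ opSpectrum T, ‖z - (l : ℂ)‖ < ε → z = (l : ℂ)) ∧
    eigenspace T (l : ℂ) ≠ ⊥ ∧ FiniteDimensional ℂ (eigenspace T (l : ℂ))}

/-- `E` is the `m`th discrete eigenvalue of `T` (`m = 1, 2, …`), the discrete eigenvalues being
enumerated in non-decreasing order and repeated according to their multiplicities: fewer than `m`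
of them are smaller than `E`, and at least `m` of them are at most `E`.  The number of eigenvalues
is counted as the dimension of the sum of the eigenspaces. -/
def IsNthDiscreteEigenvalue (T : H →ₗ.[ℂ] H) (m : ℕ) (E : ℝ) : Prop :=
  E ∈ discreteSpectrum T ∧
    Module.rank ℂ ↥(⨆ l ∈ {l ∈ discreteSpectrum T | l < E}, eigenspace T ((l : ℝ) : ℂ)) < m ∧
    m ≤ Module.rank ℂ ↥(⨆ l ∈ {l ∈ discreteSpectrum T | l ≤ E}, eigenspace T ((l : ℝ) : ℂ))

/-- There is at most one `m`th discrete eigenvalue. -/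
theorem IsNthDiscreteEigenvalue.unique {T : H →ₗ.[ℂ] H} {m : ℕ} {E E' : ℝ}
    (h : IsNthDiscreteEigenvalue T m E) (h' : IsNthDiscreteEigenvalue T m E') : E = E' := by
  have key : ∀ {a b : ℝ}, IsNthDiscreteEigenvalue T m a → IsNthDiscreteEigenvalue T m b →
      ¬ a < b := by
    intro a b ha hb hab
    refine absurd (ha.2.2.trans (Submodule.rank_mono ?_)) (not_le.mpr hb.2.1)
    exact biSup_mono fun l hl => ⟨hl.1, hl.2.trans_lt hab⟩
  exact le_antisymm (not_lt.mp (key h' h)) (not_lt.mp (key h h'))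

end Operators

/-! ### Sobolev spaces -/

section Sobolev

variable {E : Type*} [NormedAddCommGroup E] [InnerProductSpace ℝ E] [FiniteDimensional ℝ E]
  [MeasurableSpace E] [BorelSpace E]

/-- The complex Hilbert space `L²(Ω)`. -/
abbrev L2 (Ω : TopologicalSpace.Opens E) : Type _ :=
  Lp ℂ 2 ((volume : Measure E).restrict (Ω : Set E))

/-- `g` is the weak derivative of `u` on `Ω` in the direction `e`. -/
def HasWeakDeriv (Ω : TopologicalSpace.Opens E) (e : E) (u g : L2 Ω) : Prop :=
  ∀ φ : E → ℝ, ContDiff ℝ ∞ φ → HasCompactSupport φ → tsupport φ ⊆ (Ω : Set E) →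
    ∫ x in (Ω : Set E), (fderiv ℝ φ x e) • u x = - ∫ x in (Ω : Set E), φ x • g x

variable {Ω : TopologicalSpace.Opens E} {e : E}

theorem integrable_test_smul {φ : E → ℝ} (hφ : Continuous φ) (hc : HasCompactSupport φ)
    (u : L2 Ω) : Integrable (fun x => φ x • u x) ((volume : Measure E).restrict (Ω : Set E)) := by
  have h1 : MemLp φ 2 ((volume : Measure E).restrict (Ω : Set E)) :=
    (hφ.memLp_of_hasCompactSupport hc).restrict _
  exact memLp_one_iff_integrable.mp ((Lp.memLp u).smul h1)

theorem integrable_fderiv_smul {φ : E → ℝ} (hφ : ContDiff ℝ ∞ φ) (hc : HasCompactSupport φ)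
    (u : L2 Ω) : Integrable (fun x => (fderiv ℝ φ x e) • u x)
      ((volume : Measure E).restrict (Ω : Set E)) :=
  integrable_test_smul (φ := fun x => fderiv ℝ φ x e)
    ((hφ.continuous_fderiv (by simp)).clm_apply continuous_const) (hc.fderiv_apply (𝕜 := ℝ) e) u

theorem HasWeakDeriv.add {u v g k : L2 Ω} (hu : HasWeakDeriv Ω e u g) (hv : HasWeakDeriv Ω e v k) :
    HasWeakDeriv Ω e (u + v) (g + k) := by
  intro φ h1 h2 h3
  have a : ∀ (f : E → ℝ) (x y : L2 Ω), Integrable (fun z => f z • x z)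
      ((volume : Measure E).restrict (Ω : Set E)) → Integrable (fun z => f z • y z)
      ((volume : Measure E).restrict (Ω : Set E)) → ∫ z in (Ω : Set E), f z • (x + y : L2 Ω) z =
      (∫ z in (Ω : Set E), f z • x z) + ∫ z in (Ω : Set E), f z • y z := by
    intro f x y hx hy
    rw [← integral_add hx hy]
    refine integral_congr_ae ?_
    filter_upwards [Lp.coeFn_add x y] with z hz
    rw [hz, Pi.add_apply, smul_add]
  rw [a _ _ _ (integrable_fderiv_smul h1 h2 u) (integrable_fderiv_smul h1 h2 v),
    a _ _ _ (integrable_test_smul h1.continuous h2 g) (integrable_test_smul h1.continuous h2 k),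
    hu φ h1 h2 h3, hv φ h1 h2 h3]
  ring

theorem HasWeakDeriv.smul {u g : L2 Ω} (c : ℂ) (hu : HasWeakDeriv Ω e u g) :
    HasWeakDeriv Ω e (c • u) (c • g) := by
  intro φ h1 h2 h3
  have a : ∀ (f : E → ℝ) (x : L2 Ω), ∫ z in (Ω : Set E), f z • (c • x : L2 Ω) z =
      c • ∫ z in (Ω : Set E), f z • x z := by
    intro f x
    rw [← integral_smul]
    refine integral_congr_ae ?_
    filter_upwards [Lp.coeFn_smul c x] with z hz
    rw [hz, Pi.smul_apply, smul_comm]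
  rw [a, a, hu φ h1 h2 h3, smul_neg]

theorem HasWeakDeriv.zero : HasWeakDeriv Ω e (0 : L2 Ω) (0 : L2 Ω) := by
  have h : ∀ f : E → ℝ, ∫ z in (Ω : Set E), f z • (0 : L2 Ω) z = 0 := by
    intro f
    rw [← integral_zero E ℂ (μ := (volume : Measure E).restrict (Ω : Set E))]
    refine integral_congr_ae ?_
    filter_upwards [Lp.coeFn_zero ℂ 2 ((volume : Measure E).restrict (Ω : Set E))] with z hz
    rw [hz, Pi.zero_apply, smul_zero]
  intro φ _ _ _
  rw [h, h, neg_zero]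

theorem HasWeakDeriv.unique {u g k : L2 Ω} (hg : HasWeakDeriv Ω e u g)
    (hk : HasWeakDeriv Ω e u k) : g = k := by
  have h0 : HasWeakDeriv Ω e (0 : L2 Ω) (g - k) := by
    have := hg.add (hk.smul (-1))
    simpa [sub_eq_add_neg] using this
  rw [← sub_eq_zero]
  refine (Lp.eq_zero_iff_ae_eq_zero).mpr ?_
  have hloc : LocallyIntegrableOn (g - k : L2 Ω) (Ω : Set E) volume :=
    locallyIntegrableOn_of_locallyIntegrable_restrict
      ((Lp.memLp (g - k : L2 Ω)).locallyIntegrable (by norm_num))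
  have := Ω.isOpen.ae_eq_zero_of_integral_contDiff_smul_eq_zero hloc (by
    intro φ h1 h2 h3
    have h := h0 φ h1 h2 h3
    have hz : ∫ x in (Ω : Set E), (fderiv ℝ φ x e) • (0 : L2 Ω) x = 0 := by
      rw [← integral_zero E ℂ (μ := (volume : Measure E).restrict (Ω : Set E))]
      refine integral_congr_ae ?_
      filter_upwards [Lp.coeFn_zero ℂ 2 ((volume : Measure E).restrict (Ω : Set E))] with z hz
      rw [hz, Pi.zero_apply, smul_zero]
    rw [hz, eq_comm, neg_eq_zero] at h
    rw [← h]
    refine (setIntegral_eq_integral_of_forall_compl_eq_zero fun x hx => ?_).symm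
    rw [image_eq_zero_of_notMem_tsupport fun hx' => hx (h3 hx'), zero_smul])
  exact (ae_restrict_iff' Ω.isOpen.measurableSet).mpr this

/-- The Sobolev space `W^{1,2}(Ω)`: the functions in `L²(Ω)` whose weak derivatives in all
directions are in `L²(Ω)`. -/
def sobolev (Ω : TopologicalSpace.Opens E) : Submodule ℂ (L2 Ω) where
  carrier := {u | ∀ e : E, ∃ g : L2 Ω, HasWeakDeriv Ω e u g}
  add_mem' := fun hu hv e => ⟨_, (hu e).choose_spec.add (hv e).choose_spec⟩
  zero_mem' := fun _ => ⟨0, HasWeakDeriv.zero⟩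
  smul_mem' := fun c _ hu e => ⟨_, (hu e).choose_spec.smul c⟩

/-- The weak derivative in the direction `e` on `W^{1,2}(Ω)`. -/
def weakDeriv (Ω : TopologicalSpace.Opens E) (e : E) : sobolev Ω →ₗ[ℂ] L2 Ω where
  toFun := fun u => (u.2 e).choose
  map_add' := fun u v =>
    ((u + v).2 e).choose_spec.unique ((u.2 e).choose_spec.add (v.2 e).choose_spec)
  map_smul' := fun c u => ((c • u).2 e).choose_spec.unique ((u.2 e).choose_spec.smul c)

theorem tendsto_eLpNorm_add {u v w : L2 Ω} {φ ψ : ℕ → E → ℂ}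
    (hu : Tendsto (fun k => eLpNorm (fun x => u x - φ k x) 2 (volume.restrict (Ω : Set E)))
      atTop (𝓝 0))
    (hv : Tendsto (fun k => eLpNorm (fun x => v x - ψ k x) 2 (volume.restrict (Ω : Set E)))
      atTop (𝓝 0))
    (hw : w =ᵐ[volume.restrict (Ω : Set E)] ⇑u + ⇑v)
    (hφ : ∀ k, Continuous (φ k)) (hψ : ∀ k, Continuous (ψ k)) :
    Tendsto (fun k => eLpNorm (fun x => w x - (φ k x + ψ k x)) 2 (volume.restrict (Ω : Set E)))
      atTop (𝓝 0) := by
  have h := hu.add hv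
  rw [add_zero] at h
  refine tendsto_of_tendsto_of_tendsto_of_le_of_le tendsto_const_nhds h (fun _ => zero_le)
    fun k => ?_
  refine le_trans (le_of_eq (eLpNorm_congr_ae ?_)) (eLpNorm_add_le
    ((Lp.aestronglyMeasurable u).sub (hφ k).aestronglyMeasurable)
    ((Lp.aestronglyMeasurable v).sub (hψ k).aestronglyMeasurable) (by norm_num))
  filter_upwards [hw] with x hx
  simp only [hx, Pi.add_apply]
  ring

theorem tendsto_eLpNorm_smul {u w : L2 Ω} (c : ℂ) {φ : ℕ → E → ℂ}
    (hu : Tendsto (fun k => eLpNorm (fun x => u x - φ k x) 2 (volume.restrict (Ω : Set E)))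
      atTop (𝓝 0))
    (hw : w =ᵐ[volume.restrict (Ω : Set E)] c • ⇑u) :
    Tendsto (fun k => eLpNorm (fun x => w x - c • φ k x) 2 (volume.restrict (Ω : Set E)))
      atTop (𝓝 0) := by
  have h := ENNReal.Tendsto.const_mul hu (a := ‖c‖ₑ) (Or.inr enorm_ne_top)
  rw [mul_zero] at h
  refine h.congr fun k => ?_
  rw [← eLpNorm_const_smul]
  refine eLpNorm_congr_ae ?_
  filter_upwards [hw] with x hx
  simp only [hx, Pi.smul_apply, smul_sub]

/-- The space `W₀^{1,2}(Ω)`: the closure in `W^{1,2}(Ω)` of the smooth functions with compact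
support in `Ω`. -/
def sobolevZero (Ω : TopologicalSpace.Opens E) : Submodule ℂ (sobolev Ω) where
  carrier := {u | ∃ φ : ℕ → E → ℂ,
    (∀ k, ContDiff ℝ ∞ (φ k) ∧ HasCompactSupport (φ k) ∧ tsupport (φ k) ⊆ (Ω : Set E)) ∧
    Tendsto (fun k => eLpNorm (fun x => (u : L2 Ω) x - φ k x) 2 (volume.restrict (Ω : Set E)))
      atTop (𝓝 0) ∧
    ∀ e : E, Tendsto (fun k => eLpNorm (fun x => weakDeriv Ω e u x - fderiv ℝ (φ k) x e) 2
      (volume.restrict (Ω : Set E))) atTop (𝓝 0)}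
  add_mem' := by
    rintro u v ⟨φ, hφ, hu, hu'⟩ ⟨ψ, hψ, hv, hv'⟩
    refine ⟨fun k => φ k + ψ k, fun k => ⟨(hφ k).1.add (hψ k).1, (hφ k).2.1.add (hψ k).2.1,
      (tsupport_add _ _).trans (union_subset (hφ k).2.2 (hψ k).2.2)⟩,
      tendsto_eLpNorm_add hu hv (Lp.coeFn_add _ _)
        (fun k => (hφ k).1.continuous) (fun k => (hψ k).1.continuous), fun e => ?_⟩
    have key := tendsto_eLpNorm_add (hu' e) (hv' e) (Lp.coeFn_add _ _)
      (fun k => ((hφ k).1.continuous_fderiv (by simp)).clm_apply continuous_const)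
      (fun k => ((hψ k).1.continuous_fderiv (by simp)).clm_apply continuous_const)
    rw [map_add]
    refine key.congr fun k => ?_
    congr 1
    ext x
    rw [fderiv_add ((hφ k).1.differentiable (by simp) x) ((hψ k).1.differentiable (by simp) x)]
    rfl
  zero_mem' := by
    refine ⟨fun _ => 0, fun _ => ⟨contDiff_const, HasCompactSupport.zero, by simp⟩, ?_, fun e => ?_⟩
    · refine tendsto_const_nhds.congr fun k => ?_
      rw [eq_comm, ← eLpNorm_zero (p := 2) (μ := (volume : Measure E).restrict (Ω : Set E))
        (ε := ℂ)]
      refine eLpNorm_congr_ae ?_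
      filter_upwards [Lp.coeFn_zero ℂ 2 ((volume : Measure E).restrict (Ω : Set E))] with z hz
      simpa using hz
    · refine tendsto_const_nhds.congr fun k => ?_
      rw [eq_comm, ← eLpNorm_zero (p := 2) (μ := (volume : Measure E).restrict (Ω : Set E))
        (ε := ℂ), map_zero]
      refine eLpNorm_congr_ae ?_
      filter_upwards [Lp.coeFn_zero ℂ 2 ((volume : Measure E).restrict (Ω : Set E))] with z hz
      simpa using hz
  smul_mem' := by
    rintro c u ⟨φ, hφ, hu, hu'⟩
    refine ⟨fun k => c • φ k, fun k => ⟨(hφ k).1.const_smul c, (hφ k).2.1.comp_left (g := fun z => c • z) (smul_zero c),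
      (closure_mono (Function.support_const_smul_subset c (φ k))).trans (hφ k).2.2⟩,
      tendsto_eLpNorm_smul c hu (Lp.coeFn_smul _ _), fun e => ?_⟩
    have key := tendsto_eLpNorm_smul c (hu' e) (Lp.coeFn_smul _ _)
    rw [map_smul]
    refine key.congr fun k => ?_
    congr 1
    ext x
    rw [fderiv_const_smul ((hφ k).1.differentiable (by simp) x)]
    rfl

end Sobolev

/-! ### The Dirichlet Laplacian on an interval -/

/-- The interval `(0, ℓ)`. -/
def interval (ℓ : ℝ) : TopologicalSpace.Opens ℝ := ⟨Ioo 0 ℓ, isOpen_Ioo⟩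

/-- The Dirichlet Laplacian `f ↦ -f''` on `(0, ℓ)`: the operator in `L²(0, ℓ)` generated by the
form `∫ |f'|²` on `W₀^{1,2}(0, ℓ)`. -/
def dirichletLaplacian (ℓ : ℝ) : L2 (interval ℓ) →ₗ.[ℂ] L2 (interval ℓ) :=
  let d : sobolevZero (interval ℓ) →ₗ[ℂ] L2 (interval ℓ) :=
    (weakDeriv (interval ℓ) 1).comp (sobolevZero (interval ℓ)).subtype
  formOperator ((sobolev (interval ℓ)).subtype.comp (sobolevZero (interval ℓ)).subtype)
    (((innerₛₗ ℂ).comp d).compl₂ d)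

/-! ### The Robin Laplacian on a planar domain -/

/-- The Euclidean plane. -/
abbrev Plane : Type := EuclideanSpace ℝ (Fin 2)

/-- The weak partial derivative `∂ᵢ` on `W^{1,2}(Ω)`. -/
abbrev partialDeriv (Ω : TopologicalSpace.Opens Plane) (i : Fin 2) : sobolev Ω →ₗ[ℂ] L2 Ω :=
  weakDeriv Ω (EuclideanSpace.single i 1)

/-- The length measure `σ` on the boundary of `Ω` (one-dimensional Hausdorff measure). -/
def boundaryMeasure (Ω : TopologicalSpace.Opens Plane) : Measure Plane :=
  (Measure.hausdorffMeasure 1).restrict (frontier (Ω : Set Plane))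

/-- The Hilbert space `L²(∂Ω, σ)`. -/
abbrev BoundaryL2 (Ω : TopologicalSpace.Opens Plane) : Type _ := Lp ℂ 2 (boundaryMeasure Ω)

/-- `T` is the boundary trace on `W^{1,2}(Ω)`: it is bounded from `W^{1,2}(Ω)` to `L²(∂Ω, σ)`, and
it is the restriction to the boundary on functions that are smooth up to the boundary with bounded
support. -/
def IsTrace (Ω : TopologicalSpace.Opens Plane) (T : sobolev Ω →ₗ[ℂ] BoundaryL2 Ω) : Prop :=
  (∃ C : ℝ, ∀ u : sobolev Ω,
    ‖T u‖ ^ 2 ≤ C * (‖(u : L2 Ω)‖ ^ 2 + ∑ i : Fin 2, ‖partialDeriv Ω i u‖ ^ 2)) ∧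
  ∀ (u : sobolev Ω) (f : Plane → ℂ), ContDiff ℝ ∞ f → HasCompactSupport f →
    (u : L2 Ω) =ᵐ[volume.restrict (Ω : Set Plane)] f → T u =ᵐ[boundaryMeasure Ω] f

open Classical in
/-- The boundary trace (it exists and is unique for Lipschitz domains with compact boundary). -/
def trace (Ω : TopologicalSpace.Opens Plane) : sobolev Ω →ₗ[ℂ] BoundaryL2 Ω :=
  if h : ∃ T, IsTrace Ω T then h.choose else 0

/-- The form `h_α(v, u) = ∫_Ω ⟪∇v, ∇u⟫ dx - α ∫_{∂Ω} v̄ u dσ` on `W^{1,2}(Ω)`. -/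
def robinForm (Ω : TopologicalSpace.Opens Plane) (α : ℝ) :
    sobolev Ω →ₗ⋆[ℂ] sobolev Ω →ₗ[ℂ] ℂ :=
  (∑ i : Fin 2, ((innerₛₗ ℂ).comp (partialDeriv Ω i)).compl₂ (partialDeriv Ω i)) -
    (α : ℂ) • ((innerₛₗ ℂ).comp (trace Ω)).compl₂ (trace Ω)

/-- The Robin Laplacian: the operator in `L²(Ω)` generated by the form `h_α`, that is, `u ↦ -Δu`
with the boundary condition `∂u/∂ν = αu`, for the exterior unit normal `ν`. -/
def robinLaplacian (Ω : TopologicalSpace.Opens Plane) (α : ℝ) : L2 Ω →ₗ.[ℂ] L2 Ω :=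
  formOperator (sobolev Ω).subtype (robinForm Ω α)

/-! ### Convex polygons -/

/-- The points `P 0, …, P (M-1)`, `M ≥ 3`, are the vertices of a convex polygon (none of them
artificial, that is, each is an extreme point), enumerated in such a way that the boundary of the
polygon is the union of the segments between cyclically consecutive vertices. -/
structure IsConvexPolygon {M : ℕ} (P : Polygon Plane M) : Prop where
  three_le : 3 ≤ M
  convexIndependent : ConvexIndependent ℝ P.vertices
  frontier_eq : frontier (convexHull ℝ (range P.vertices)) = P.boundary ℝ

/-- The exterior of the polygon. -/
def exterior {M : ℕ} (P : Polygon Plane M) : TopologicalSpace.Opens Plane :=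
  ⟨(convexHull ℝ (range P.vertices))ᶜ,
    ((finite_range P.vertices).isCompact_convexHull ℝ).isClosed.isOpen_compl⟩

/-- The length of the `n`th side. -/
def sideLength {M : ℕ} (P : Polygon Plane M) (n : Fin M) : ℝ := dist (P n) (P (finRotate M n))

end RobinExterior

end

open RobinExterior

/-!
# Robin eigenvalues outside a convex polygon

As `α → ∞` the eigenfunctions of `H_α` concentrate at the boundary and look like `f(s) e^{-αt}` next
to each side, with `s` the arc length and `t` the distance to the side.  The factor `e^{-αt}` is the
ground state of the Robin Laplacian on the half-line, of energy `-α²`, and what is left is a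
one-dimensional problem for `f` on each side.  In the limit `f` satisfies Dirichlet conditions at the
ends of the side, because the exterior of the polygon has, between the half-strips over two adjacent
sides, a sector that contains none of the boundary: nothing compensates the energy of `u` there.

**Min-max principle.**  Both operators are generated by closed semibounded forms (`IsFormOperator`).
A lower bound `b` of the form up to the square of a finite-rank map (`BoundedBelowUpTo`) makes
`A - z j†j` a finite-rank perturbation of a coercive operator for `z < b`, so the spectrum below `b`
consists of finitely many levels of finite multiplicity below each `a < b`.  The rank of the
correction bounds the eigenvalues from below (`IsFormOperator.le_of_isNthDiscreteEigenvalue`), and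
the dimension of a space of trial functions bounds them from above and gives their existence
(`IsFormOperator.exists_isNthDiscreteEigenvalue`).  For the direct sum of the Dirichlet Laplacians
both bounds come from sine series
(`isNthDiscreteEigenvalue_directSum_dirichletLaplacian`), and show that its eigenvalues are the
numbers `(πk/ℓₙ)²` in increasing order.

**Lower bound.**  The nearest point of the polygon shows that the half-strips over the sides and the
sectors at the vertices are disjoint subsets of the exterior.  In a half-strip let `f(s)` be the
coefficient of `u(s, ·)` along the normalized ground state; then `∫ |∇u|² - α ∫ |u|² + α² ∫ |f|²`
over the half-strip is at least `∫ |f'|²` (`halfStrip_form_ge`).  In a sector the one-dimensional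
trace inequality at the scale `1/α` bounds `κα` times the norms of `u` on the two boundary rays by
the energy (`exists_sector_rays_le`); these norms dominate the values of `f` at the ends of the sides.
Together (`IsSideFrame.exists_form_ge`), the Robin form shifted by `α²` is at least the sum over the
sides of `∫ |f'|² + κα (|f(0)|² + |f(ℓ)|²)`, plus a contribution of order `α²` from the part of `u`
not described by the `f`.  Subtracting from `f` its linear interpolant compares this energy with the
Dirichlet energy up to an error of order `1/α` (`robin_energy_lower_bound`), so that up to finitely
many modes the form is at least `-α² + x - C/α` (`IsSideFrame.exists_lower_bound`).

**Upper bound.**  Dirichlet eigenfunctions are approximated in `W^{1,2}` by test functions supported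
inside the sides, and multiplied by `e^{-αt}` cut off to a bounded range of `t`
(`IsSideFrame.exists_trial_space`).  The products for different sides have disjoint supports in the
exterior, so their energies add up.  The cutoff costs an exponentially small amount of energy
(`exists_transverse`).

**Density and trace.**  The inequalities are proved for smooth functions with compact support in the
plane.  These are dense in `W^{1,2}` of the exterior of a convex body (`denseRange_ofTest`): averaging
`u` over the dilations about the points of a ball in the polygon mollifies it using its values in the
exterior only, since such dilations move the exterior away from the polygon.  This gives the existence
of the boundary trace as well (`IsTraceDomain.exists_trace`).

The argument gives the error `O(1/α)`, which is `O(1/√α)`.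
-/

noncomputable section

namespace RobinExterior

/-! ### Counting discrete eigenvalues of a form operator -/

section Abstract

open ContinuousLinearMap

variable {H W : Type*} [NormedAddCommGroup H] [InnerProductSpace ℂ H]
  [NormedAddCommGroup W] [InnerProductSpace ℂ W]

/-- `T` is the operator in `H` generated by the closed semibounded form `(v, u) ↦ ⟪v, A u⟫`, whose
domain is the Hilbert space `W`, embedded in `H` by `j`. -/
structure IsFormOperator (j : W →L[ℂ] H) (A : W →L[ℂ] W) (T : H →ₗ.[ℂ] H) : Prop where
  injective : Function.Injective j
  symm : ∀ u v, inner ℂ (A u) v = inner ℂ u (A v)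
  coercive : ∃ δ > 0, ∃ c : ℝ, ∀ u, δ * ‖u‖ ^ 2 ≤ (inner ℂ u (A u)).re + c * ‖j u‖ ^ 2
  mem_graph : ∀ f w, (f, w) ∈ T.graph ↔ ∃ u, j u = f ∧ ∀ v, inner ℂ v (A u) = inner ℂ (j v) w

/-- The form `⟪u, A u⟫` is at least `b ‖j u‖²`, up to the square of the norm of the auxiliary map
`B`.  For a map `B` of rank `N`, this says that the form is at least `b` on a subspace of
codimension `N`; in this shape the bound passes to limits. -/
def BoundedBelowUpTo {F : Type*} [NormedAddCommGroup F] [InnerProductSpace ℂ F]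
    (j : W →L[ℂ] H) (A : W →L[ℂ] W) (b : ℝ) (B : W →L[ℂ] F) : Prop :=
  ∀ u, b * ‖j u‖ ^ 2 ≤ (inner ℂ u (A u)).re + ‖B u‖ ^ 2

/-- A perturbation of the identity that factors through a finite-dimensional space is bijective as
soon as it is injective. -/
theorem bijective_sub_comp_of_injective {F : Type*} [AddCommGroup F] [Module ℂ F]
    [FiniteDimensional ℂ F] (X : F →ₗ[ℂ] W) (B : W →ₗ[ℂ] F)
    (h : ∀ u : W, u = X (B u) → u = 0) : Function.Bijective fun u : W => u - X (B u) := by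
  constructor
  · intro u v huv
    have := h (u - v) (by
      rw [map_sub, map_sub]
      exact sub_eq_sub_iff_sub_eq_sub.mp huv)
    exact sub_eq_zero.mp this
  · have hinj : Function.Injective (LinearMap.id - B.comp X : F →ₗ[ℂ] F) := by
      rw [← LinearMap.ker_eq_bot, LinearMap.ker_eq_bot']
      intro f hf
      have hf' : f = B (X f) := by simpa [sub_eq_zero] using hf
      have h0 : X f = 0 := h _ (by rw [← hf'])
      rw [hf', h0, map_zero]
    have hsurj := LinearMap.surjective_of_injective hinj
    intro w
    obtain ⟨f, hf⟩ := hsurj (B w)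
    have hf' : f = B w + B (X f) := by
      simp only [LinearMap.sub_apply, LinearMap.id_apply, LinearMap.comp_apply] at hf
      rw [← hf]; abel
    refine ⟨w + X f, ?_⟩
    simp only [map_add]
    nth_rewrite 1 [hf']
    simp only [map_add]
    abel

/-- Below `b` the shifted form is coercive up to `‖B u‖²`: a convex combination of the coercivity
estimate `hc`, which controls `‖u‖` but has a large constant `c`, and of the sharp bound `hB`. -/
theorem exists_coercive {F : Type*} [NormedAddCommGroup F] [InnerProductSpace ℂ F]
    {j : W →L[ℂ] H} {A : W →L[ℂ] W} {b x : ℝ} {B : W →L[ℂ] F}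
    (hc : ∃ δ > 0, ∃ c : ℝ, ∀ u, δ * ‖u‖ ^ 2 ≤ (inner ℂ u (A u)).re + c * ‖j u‖ ^ 2)
    (hB : BoundedBelowUpTo j A b B) (hx : x < b) :
    ∃ κ > 0, ∀ u, κ * ‖u‖ ^ 2 ≤ (inner ℂ u (A u)).re - x * ‖j u‖ ^ 2 + ‖B u‖ ^ 2 := by
  obtain ⟨δ, hδ, c, hc⟩ := hc
  -- the weight `t` of `hc` is small enough for the constant to stay above `x`
  set d : ℝ := |b + c| + (b - x) with hd
  have hd0 : 0 < d := by have := abs_nonneg (b + c); linarith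
  set t : ℝ := (b - x) / d with ht
  have ht0 : 0 < t := div_pos (by linarith) hd0
  have ht1 : t ≤ 1 := (div_le_one hd0).mpr (by have := abs_nonneg (b + c); linarith)
  have htd : t * (b + c) ≤ b - x := by
    calc t * (b + c) ≤ t * d := by
          refine mul_le_mul_of_nonneg_left ?_ ht0.le
          have := le_abs_self (b + c); linarith
      _ = b - x := by rw [ht]; field_simp
  refine ⟨t * δ, mul_pos ht0 hδ, fun u => ?_⟩
  have h1 := mul_le_mul_of_nonneg_left (hc u) ht0.le
  have h2 := mul_le_mul_of_nonneg_left (hB u) (sub_nonneg.mpr ht1)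
  have h3 := mul_le_mul_of_nonneg_right htd (sq_nonneg ‖j u‖)
  have h4 : 0 ≤ t * ‖B u‖ ^ 2 := by positivity
  nlinarith

/-- For a non-negative symmetric operator the form controls the image: this is the non-negativity of
the form at `u - M⁻¹ X u` for `M = ‖X‖ + 1`. -/
theorem norm_sq_apply_le_of_nonneg {X : W →L[ℂ] W} (hsymm : ∀ u v, inner ℂ (X u) v = inner ℂ u (X v))
    (hX : ∀ u, 0 ≤ (inner ℂ u (X u)).re) (u : W) :
    ‖X u‖ ^ 2 ≤ (‖X‖ + 1) * (inner ℂ u (X u)).re := by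
  set M := ‖X‖ + 1
  have hM : 0 < M := by positivity
  have h := hX (u - ((M⁻¹ : ℝ) : ℂ) • X u)
  have h3 : (inner ℂ (X u) (X (X u))).re ≤ M * ‖X u‖ ^ 2 := by
    calc _ ≤ ‖inner ℂ (X u) (X (X u))‖ := Complex.re_le_norm _
      _ ≤ ‖X u‖ * ‖X (X u)‖ := norm_inner_le_norm _ _
      _ ≤ ‖X u‖ * (‖X‖ * ‖X u‖) := by gcongr; exact X.le_opNorm _
      _ ≤ _ := by nlinarith [sq_nonneg ‖X u‖]
  have h4 : (inner ℂ (X u) (X u)).re = ‖X u‖ ^ 2 := by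
    rw [inner_self_eq_norm_sq_to_K]; simp [← Complex.ofReal_pow]
  have h5 : inner ℂ u (X (X u)) = inner ℂ (X u) (X u) := (hsymm u (X u)).symm
  simp only [map_sub, map_smul, inner_sub_left, inner_sub_right, inner_smul_left,
    inner_smul_right, h5, Complex.sub_re, Complex.conj_ofReal, Complex.re_ofReal_mul, h4] at h
  have h6 : M⁻¹ * (M⁻¹ * (inner ℂ (X u) (X (X u))).re) ≤ M⁻¹ * ‖X u‖ ^ 2 := by
    refine mul_le_mul_of_nonneg_left ?_ (by positivity)
    rw [inv_mul_le_iff₀ hM]; exact h3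
  have h7 : M⁻¹ * ‖X u‖ ^ 2 ≤ (inner ℂ u (X u)).re := by linarith
  rwa [inv_mul_le_iff₀ hM] at h7

/-- A non-negative symmetric operator with bounded inverse is coercive. -/
theorem exists_coercive_of_isUnit {X : W →L[ℂ] W}
    (hsymm : ∀ u v, inner ℂ (X u) v = inner ℂ u (X v))
    (hX : ∀ u, 0 ≤ (inner ℂ u (X u)).re) (hu : IsUnit X) :
    ∃ κ > 0, ∀ u, κ * ‖u‖ ^ 2 ≤ (inner ℂ u (X u)).re := by
  obtain ⟨Y, hY⟩ := hu
  set R : W →L[ℂ] W := ↑Y⁻¹ with hR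
  have hinv : ∀ w, R (X w) = w := fun w => by
    have := Y.inv_mul
    rw [hY] at this
    exact congrArg (fun f : W →L[ℂ] W => f w) this
  refine ⟨((‖R‖ + 1) ^ 2 * (‖X‖ + 1))⁻¹, by positivity, fun u => ?_⟩
  rw [inv_mul_le_iff₀ (by positivity)]
  have h1 : ‖u‖ ≤ (‖R‖ + 1) * ‖X u‖ := by
    calc ‖u‖ = ‖R (X u)‖ := by rw [hinv]
      _ ≤ ‖R‖ * ‖X u‖ := R.le_opNorm _
      _ ≤ _ := by gcongr; linarith
  calc ‖u‖ ^ 2 ≤ ((‖R‖ + 1) * ‖X u‖) ^ 2 := by gcongr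
    _ = (‖R‖ + 1) ^ 2 * ‖X u‖ ^ 2 := by ring
    _ ≤ (‖R‖ + 1) ^ 2 * ((‖X‖ + 1) * (inner ℂ u (X u)).re) := by
        gcongr; exact norm_sq_apply_le_of_nonneg hsymm hX u
    _ = _ := by ring

variable [CompleteSpace W]

section Pencil

variable [CompleteSpace H]

/-- The operator of the form `⟪v, A u⟫ - z ⟪j v, j u⟫`. -/
def pencil (j : W →L[ℂ] H) (A : W →L[ℂ] W) (z : ℂ) : W →L[ℂ] W :=
  A - z • (adjoint j ∘L j)

theorem inner_pencil (j : W →L[ℂ] H) (A : W →L[ℂ] W) (z : ℂ) (v u : W) :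
    inner ℂ v (pencil j A z u) = inner ℂ v (A u) - z * inner ℂ (j v) (j u) := by
  simp [pencil, adjoint_inner_right]

theorem pencil_eq_zero_iff {j : W →L[ℂ] H} {A : W →L[ℂ] W} {z : ℂ} {u : W} :
    pencil j A z u = 0 ↔ ∀ v, inner ℂ v (A u) = z * inner ℂ (j v) (j u) := by
  constructor
  · intro h v
    have := inner_pencil j A z v u
    rw [h, inner_zero_right] at this
    exact (sub_eq_zero.mp this.symm)
  · intro h
    refine ext_inner_left ℂ fun v => ?_
    rw [inner_pencil, h, sub_self, inner_zero_right]

/-- Below the bound `b`, the pencil is a finite-rank perturbation of a coercive operator, so it is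
invertible when it is injective. -/
theorem isUnit_pencil {F : Type*} [NormedAddCommGroup F] [InnerProductSpace ℂ F]
    [FiniteDimensional ℂ F] {j : W →L[ℂ] H} {A : W →L[ℂ] W} {b : ℝ} {z : ℂ} {B : W →L[ℂ] F}
    (hc : ∃ δ > 0, ∃ c : ℝ, ∀ u, δ * ‖u‖ ^ 2 ≤ (inner ℂ u (A u)).re + c * ‖j u‖ ^ 2)
    (hB : BoundedBelowUpTo j A b B) (hz : z.re < b)
    (hinj : ∀ u, pencil j A z u = 0 → u = 0) : IsUnit (pencil j A z) := by
  have : CompleteSpace F := FiniteDimensional.complete ℂ F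
  obtain ⟨κ, hκ, hcoer⟩ := exists_coercive hc hB hz
  set S : W →L[ℂ] W := pencil j A z + adjoint B ∘L B with hS
  have hSu : IsUnit S := by
    refine isUnit_of_forall_le_norm_inner_map S (c := ⟨κ, hκ.le⟩) hκ fun u => ?_
    have h1 : inner ℂ u (S u) = inner ℂ u (A u) - z * inner ℂ (j u) (j u) + inner ℂ (B u) (B u) := by
      rw [hS, add_apply, inner_add_right, inner_pencil, comp_apply, adjoint_inner_right]
    have h2 : (inner ℂ u (S u)).re = (inner ℂ u (A u)).re - z.re * ‖j u‖ ^ 2 + ‖B u‖ ^ 2 := by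
      rw [h1, inner_self_eq_norm_sq_to_K, inner_self_eq_norm_sq_to_K]
      simp [← Complex.ofReal_pow]
    rw [norm_inner_symm]
    calc ‖u‖ ^ 2 * κ = κ * ‖u‖ ^ 2 := mul_comm _ _
      _ ≤ (inner ℂ u (S u)).re := by rw [h2]; exact hcoer u
      _ ≤ _ := Complex.re_le_norm _
  obtain ⟨S', hS'⟩ := hSu
  have hinv1 : ∀ w, S ((↑S'⁻¹ : W →L[ℂ] W) w) = w := fun w => by
    have := S'.mul_inv
    rw [hS'] at this
    exact congrArg (fun f : W →L[ℂ] W => f w) this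
  have hinv2 : ∀ w, (↑S'⁻¹ : W →L[ℂ] W) (S w) = w := fun w => by
    have := S'.inv_mul
    rw [hS'] at this
    exact congrArg (fun f : W →L[ℂ] W => f w) this
  set R : W →L[ℂ] W := ↑S'⁻¹
  have hfac : ∀ u, pencil j A z u = S (u - R (adjoint B (B u))) := by
    intro u
    rw [map_sub, hinv1, hS]
    simp
  have hbij := bijective_sub_comp_of_injective (R ∘L adjoint B).toLinearMap B.toLinearMap (by
    intro u hu
    refine hinj u ?_
    rw [hfac]
    have : u - R (adjoint B (B u)) = 0 := sub_eq_zero.mpr hu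
    rw [this, map_zero])
  rw [ContinuousLinearMap.isUnit_iff_bijective]
  have hSb : Function.Bijective S :=
    ⟨fun u v h => by rw [← hinv2 u, h, hinv2], fun w => ⟨_, hinv1 w⟩⟩
  have : (pencil j A z : W → W) = S ∘ fun u => u - R (adjoint B (B u)) := funext hfac
  rw [this]
  exact hSb.comp hbij

theorem pencil_symm {j : W →L[ℂ] H} {A : W →L[ℂ] W}
    (hsymm : ∀ u v, inner ℂ (A u) v = inner ℂ u (A v)) (x : ℝ) (u v : W) :
    inner ℂ (pencil j A x u) v = inner ℂ u (pencil j A x v) := by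
  rw [← inner_conj_symm, inner_pencil, inner_pencil, ← hsymm u v, map_sub, inner_conj_symm, map_mul,
    inner_conj_symm, Complex.conj_ofReal]

/-- If the pencil is injective for all `x ≤ a`, then the form is positive definite relative to
`a`. -/
theorem form_gt_of_forall_injective {F : Type*} [NormedAddCommGroup F] [InnerProductSpace ℂ F]
    [FiniteDimensional ℂ F] {j : W →L[ℂ] H} {A : W →L[ℂ] W} {a b : ℝ} {B : W →L[ℂ] F}
    (hsymm : ∀ u v, inner ℂ (A u) v = inner ℂ u (A v))
    (hc : ∃ δ > 0, ∃ c : ℝ, ∀ u, δ * ‖u‖ ^ 2 ≤ (inner ℂ u (A u)).re + c * ‖j u‖ ^ 2)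
    (hB : BoundedBelowUpTo j A b B) (hab : a < b)
    (hinj : ∀ x : ℝ, x ≤ a → ∀ u, pencil j A x u = 0 → u = 0) (u : W) (hu : u ≠ 0) :
    a * ‖j u‖ ^ 2 < (inner ℂ u (A u)).re := by
  have hre : ∀ (x : ℝ) (u : W),
      (inner ℂ u (pencil j A x u)).re = (inner ℂ u (A u)).re - x * ‖j u‖ ^ 2 := by
    intro x u
    rw [inner_pencil, inner_self_eq_norm_sq_to_K]
    simp [← Complex.ofReal_pow]
  -- `N` is the set of levels at which the form is nonnegative; it contains its supremum `ρ`.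
  set N : Set ℝ := {x | x ≤ a ∧ ∀ u, x * ‖j u‖ ^ 2 ≤ (inner ℂ u (A u)).re} with hN
  have hNne : N.Nonempty := by
    obtain ⟨δ, hδ, c, hc⟩ := hc
    refine ⟨min a (-c), min_le_left _ _, fun u => ?_⟩
    have h1 := hc u
    have h2 : min a (-c) * ‖j u‖ ^ 2 ≤ -c * ‖j u‖ ^ 2 := by gcongr; exact min_le_right _ _
    nlinarith [mul_nonneg hδ.le (sq_nonneg ‖u‖)]
  have hNbdd : BddAbove N := ⟨a, fun x hx => hx.1⟩
  have hNcl : IsClosed N := by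
    rw [hN, Set.ofPred_and, Set.ofPred_forall]
    refine isClosed_Iic.inter (isClosed_iInter fun u => ?_)
    exact isClosed_le (by fun_prop) continuous_const
  set ρ := sSup N with hρ
  have hρN : ρ ∈ N := hNcl.csSup_mem hNne hNbdd
  obtain ⟨κ, hκ, hcoer⟩ := exists_coercive_of_isUnit (pencil_symm (j := j) hsymm ρ)
    (fun u => by rw [hre]; linarith [hρN.2 u])
    (isUnit_pencil hc hB (z := (ρ : ℂ)) (by simpa using hρN.1.trans_lt hab) (hinj ρ hρN.1))
  -- at `ρ` the form is coercive, so it stays non-negative slightly above `ρ`, unless `ρ = a`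
  have hρa : ρ = a := by
    by_contra hne
    have hlt : ρ < a := lt_of_le_of_ne hρN.1 hne
    set η := min (a - ρ) (κ / (‖j‖ ^ 2 + 1)) with hη
    have hη0 : 0 < η := lt_min (by linarith) (by positivity)
    have : ρ + η ∈ N := by
      refine ⟨by have := min_le_left (a - ρ) (κ / (‖j‖ ^ 2 + 1)); linarith, fun u => ?_⟩
      have h1 := hcoer u
      rw [hre] at h1
      have h2 : η * ‖j u‖ ^ 2 ≤ κ * ‖u‖ ^ 2 := by
        calc η * ‖j u‖ ^ 2 ≤ κ / (‖j‖ ^ 2 + 1) * (‖j‖ * ‖u‖) ^ 2 := by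
              gcongr
              · exact min_le_right _ _
              · exact j.le_opNorm u
          _ = κ * ‖u‖ ^ 2 * (‖j‖ ^ 2 / (‖j‖ ^ 2 + 1)) := by ring
          _ ≤ κ * ‖u‖ ^ 2 * 1 := by
              gcongr
              rw [div_le_one (by positivity)]; linarith
          _ = _ := mul_one _
      nlinarith
    have := le_csSup hNbdd this
    linarith
  have h1 := hcoer u
  rw [hre, hρa] at h1
  have : 0 < κ * ‖u‖ ^ 2 := by have := norm_pos_iff.mpr hu; positivity
  linarith

/-- The span, in the form domain, of the eigenvectors with eigenvalue in `Λ`. -/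
def levelSpace (j : W →L[ℂ] H) (A : W →L[ℂ] W) (Λ : Set ℝ) : Submodule ℂ W :=
  ⨆ x ∈ Λ, LinearMap.ker (pencil j A (x : ℂ)).toLinearMap

theorem ker_le_levelSpace {j : W →L[ℂ] H} {A : W →L[ℂ] W} {Λ : Set ℝ} {x : ℝ} (hx : x ∈ Λ) {u : W}
    (hu : pencil j A x u = 0) : u ∈ levelSpace j A Λ :=
  Submodule.mem_iSup_of_mem x (Submodule.mem_iSup_of_mem hx hu)

theorem exists_sum_of_mem_levelSpace {j : W →L[ℂ] H} {A : W →L[ℂ] W} {Λ : Set ℝ} {u : W}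
    (hu : u ∈ levelSpace j A Λ) : ∃ (s : Finset ℝ) (v : ℝ → W),
      (∀ x ∈ s, x ∈ Λ ∧ pencil j A x (v x) = 0) ∧ u = ∑ x ∈ s, v x := by
  obtain ⟨f, hf, rfl⟩ := (Submodule.mem_iSup_iff_exists_finsupp _ _).mp hu
  refine ⟨f.support, f, fun x hx => ?_, rfl⟩
  by_cases hΛ : x ∈ Λ
  · have := hf x
    simp only [hΛ, iSup_pos] at this
    exact ⟨hΛ, this⟩
  · have := hf x
    simp only [hΛ, iSup_neg, not_false_eq_true, Submodule.mem_bot] at this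
    exact absurd this (Finsupp.mem_support_iff.mp hx)

/-- Eigenvectors for different eigenvalues are orthogonal. -/
theorem inner_eq_zero_of_pencil {j : W →L[ℂ] H} {A : W →L[ℂ] W}
    (hsymm : ∀ u v, inner ℂ (A u) v = inner ℂ u (A v)) {x y : ℝ} {u v : W}
    (hu : pencil j A x u = 0) (hv : pencil j A y v = 0) (hxy : x ≠ y) :
    inner ℂ (j u) (j v) = 0 := by
  have h1 := pencil_eq_zero_iff.mp hv u
  have h2 := pencil_eq_zero_iff.mp hu v
  rw [← hsymm, ← inner_conj_symm, h2, map_mul, inner_conj_symm, Complex.conj_ofReal] at h1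
  have h3 : ((x : ℂ) - y) * inner ℂ (j u) (j v) = 0 := by rw [sub_mul, h1, sub_self]
  refine (mul_eq_zero.mp h3).resolve_left ?_
  rw [← Complex.ofReal_sub]
  exact_mod_cast sub_ne_zero.mpr hxy

/-- The form is at most `a` on the span of the eigenvectors with eigenvalue at most `a`, as it is
diagonal there. -/
theorem form_le_of_mem_levelSpace {j : W →L[ℂ] H} {A : W →L[ℂ] W}
    (hsymm : ∀ u v, inner ℂ (A u) v = inner ℂ u (A v)) {Λ : Set ℝ} {a : ℝ} (hΛ : Λ ⊆ Iic a)
    {u : W} (hu : u ∈ levelSpace j A Λ) : (inner ℂ u (A u)).re ≤ a * ‖j u‖ ^ 2 := by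
  obtain ⟨s, v, hv, rfl⟩ := exists_sum_of_mem_levelSpace hu
  have horth : ∀ x ∈ s, ∀ y ∈ s, x ≠ y → inner ℂ (j (v x)) (j (v y)) = 0 := fun x hx y hy hxy =>
    inner_eq_zero_of_pencil hsymm (hv x hx).2 (hv y hy).2 hxy
  have h1 : inner ℂ (∑ x ∈ s, v x) (A (∑ x ∈ s, v x)) =
      ∑ x ∈ s, (x : ℂ) * inner ℂ (j (v x)) (j (v x)) := by
    rw [sum_inner]
    refine Finset.sum_congr rfl fun x hx => ?_
    rw [map_sum, inner_sum, Finset.sum_eq_single x]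
    · exact pencil_eq_zero_iff.mp (hv x hx).2 _
    · intro y hy hyx
      rw [pencil_eq_zero_iff.mp (hv y hy).2, horth x hx y hy (Ne.symm hyx), mul_zero]
    · exact fun h => absurd hx h
  have h2 : ‖j (∑ x ∈ s, v x)‖ ^ 2 = ∑ x ∈ s, ‖j (v x)‖ ^ 2 := by
    have : (inner ℂ (j (∑ x ∈ s, v x)) (j (∑ x ∈ s, v x)) : ℂ) =
        ∑ x ∈ s, inner ℂ (j (v x)) (j (v x)) := by
      rw [map_sum, sum_inner]
      refine Finset.sum_congr rfl fun x hx => ?_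
      rw [inner_sum, Finset.sum_eq_single x]
      · exact fun y hy hyx => horth x hx y hy (Ne.symm hyx)
      · exact fun h => absurd hx h
    simp only [inner_self_eq_norm_sq_to_K] at this
    exact_mod_cast this
  rw [h1, h2, Complex.re_sum, Finset.mul_sum]
  refine Finset.sum_le_sum fun x hx => ?_
  rw [inner_self_eq_norm_sq_to_K]
  simp only [Complex.re_ofReal_mul, Complex.coe_algebraMap, ← Complex.ofReal_pow,
    Complex.ofReal_re]
  exact mul_le_mul_of_nonneg_right (hΛ (hv x hx).1) (sq_nonneg _)

namespace IsFormOperator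

variable {j : W →L[ℂ] H} {A : W →L[ℂ] W} {T : H →ₗ.[ℂ] H}
  {F : Type*} [NormedAddCommGroup F] [InnerProductSpace ℂ F] {a b : ℝ} {B : W →L[ℂ] F}

/-- On the eigenvectors below `b` the form is too small for `BoundedBelowUpTo`, unless the auxiliary
map `B` sees them. -/
theorem eq_zero_of_mem_levelSpace (hT : IsFormOperator j A T) (hB : BoundedBelowUpTo j A b B)
    (hab : a < b) {Λ : Set ℝ} (hΛ : Λ ⊆ Iic a) {u : W} (hu : u ∈ levelSpace j A Λ) (h : B u = 0) :
    u = 0 := by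
  have h1 := hB u
  have h2 := form_le_of_mem_levelSpace hT.symm hΛ hu
  rw [h, norm_zero] at h1
  have h3 : (b - a) * ‖j u‖ ^ 2 ≤ 0 := by nlinarith
  have h4 : ‖j u‖ ^ 2 ≤ 0 := by
    by_contra hc
    have := mul_pos (sub_pos.mpr hab) (not_le.mp hc)
    linarith
  have h5 : j u = 0 := by
    rw [← norm_eq_zero]; exact pow_eq_zero_iff (two_ne_zero) |>.mp (le_antisymm h4 (sq_nonneg _))
  exact hT.injective (by rw [h5, map_zero])

variable [FiniteDimensional ℂ F]

/-- The auxiliary map `B` is injective on the span of the eigenvectors below `b`. -/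
theorem finiteDimensional_levelSpace (hT : IsFormOperator j A T) (hB : BoundedBelowUpTo j A b B)
    (hab : a < b) {Λ : Set ℝ} (hΛ : Λ ⊆ Iic a) : FiniteDimensional ℂ (levelSpace j A Λ) ∧
      Module.finrank ℂ (levelSpace j A Λ) ≤ Module.finrank ℂ F := by
  have hinj : Function.Injective (B.toLinearMap.domRestrict (levelSpace j A Λ)) := by
    rw [← LinearMap.ker_eq_bot, LinearMap.ker_eq_bot']
    intro u hu
    exact Subtype.ext (hT.eq_zero_of_mem_levelSpace hB hab hΛ u.2 hu)
  exact ⟨FiniteDimensional.of_injective _ hinj, LinearMap.finrank_le_finrank_of_injective hinj⟩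

/-- There are at most `finrank F` eigenvalues below `b`, by orthogonality of the eigenvectors. -/
theorem finite_eigenvalues (hT : IsFormOperator j A T) (hB : BoundedBelowUpTo j A b B)
    (hab : a < b) : {x : ℝ | x ≤ a ∧ ∃ u, u ≠ 0 ∧ pencil j A x u = 0}.Finite := by
  by_contra hinf
  obtain ⟨s, hs, hcard⟩ := Set.Infinite.exists_subset_card_eq hinf (Module.finrank ℂ F + 1)
  have hs' : ∀ x : s, (x : ℝ) ≤ a ∧ ∃ u, u ≠ 0 ∧ pencil j A ((x : ℝ) : ℂ) u = 0 := fun x => hs x.2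
  choose hxa v hv0 hv using hs'
  have hlin : LinearIndependent ℂ fun x : s => j (v x) := by
    refine linearIndependent_of_ne_zero_of_inner_eq_zero (𝕜 := ℂ) (fun x h => ?_) fun x y hxy => ?_
    · exact hv0 x (hT.injective (by rw [h, map_zero]))
    · exact inner_eq_zero_of_pencil hT.symm (hv x) (hv y) fun h => hxy (Subtype.ext h)
  obtain ⟨hfin, hle⟩ := hT.finiteDimensional_levelSpace hB hab (Λ := Iic a) subset_rfl
  have hlinW : LinearIndependent ℂ v := LinearIndependent.of_comp j.toLinearMap hlin
  have hspan : Submodule.span ℂ (range v) ≤ levelSpace j A (Iic a) := by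
    rw [Submodule.span_le]
    rintro _ ⟨x, rfl⟩
    exact ker_le_levelSpace (Λ := Iic a) (mem_Iic.mpr (hxa x)) (hv x)
  have := Submodule.finrank_mono hspan
  rw [finrank_span_eq_card hlinW] at this
  rw [Fintype.card_coe, hcard] at this
  omega

/-- The eigenvectors of `T` are the images of the kernel of the pencil. -/
theorem mem_eigenspace_iff (hT : IsFormOperator j A T) {z : ℂ} {f : H} :
    f ∈ eigenspace T z ↔ ∃ u, pencil j A z u = 0 ∧ j u = f := by
  have key : f ∈ eigenspace T z ↔ (f, z • f) ∈ T.graph := by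
    rw [LinearPMap.mem_graph_iff, eigenspace, Submodule.mem_map]
    constructor
    · rintro ⟨d, hd, rfl⟩
      refine ⟨d, rfl, ?_⟩
      exact sub_eq_zero.mp hd
    · rintro ⟨d, hd, hd'⟩
      refine ⟨d, ?_, hd⟩
      simp only at hd hd'
      subst hd
      exact sub_eq_zero.mpr hd'
  rw [key, hT.mem_graph]
  constructor
  · rintro ⟨u, rfl, hu⟩
    exact ⟨u, pencil_eq_zero_iff.mpr fun v => by rw [hu, inner_smul_right], rfl⟩
  · rintro ⟨u, hu, rfl⟩
    exact ⟨u, rfl, fun v => by rw [pencil_eq_zero_iff.mp hu, inner_smul_right]⟩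

theorem eigenspace_eq (hT : IsFormOperator j A T) (z : ℂ) :
    eigenspace T z = (LinearMap.ker (pencil j A z).toLinearMap).map j.toLinearMap := by
  ext f
  rw [hT.mem_eigenspace_iff, Submodule.mem_map]
  rfl

/-- Where the pencil is invertible, the resolvent is `j (A - z j†j)⁻¹ j†`. -/
theorem mem_resolventSet_of_isUnit (hT : IsFormOperator j A T) {z : ℂ}
    (h : IsUnit (pencil j A z)) : z ∈ resolventSet T := by
  obtain ⟨Y, hY⟩ := h
  set R : W →L[ℂ] W := ↑Y⁻¹ with hR
  have hinv1 : ∀ w, pencil j A z (R w) = w := fun w => by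
    have := Y.mul_inv
    rw [hY] at this
    exact congrArg (fun f : W →L[ℂ] W => f w) this
  have hinv2 : ∀ w, R (pencil j A z w) = w := fun w => by
    have := Y.inv_mul
    rw [hY] at this
    exact congrArg (fun f : W →L[ℂ] W => f w) this
  refine ⟨j ∘L R ∘L adjoint j, fun f => ?_, fun d => ?_⟩
  · have hg : (j (R (adjoint j f)), f + z • j (R (adjoint j f))) ∈ T.graph := by
      rw [hT.mem_graph]
      refine ⟨_, rfl, fun v => ?_⟩
      have := inner_pencil j A z v (R (adjoint j f))
      rw [hinv1, adjoint_inner_right] at this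
      rw [inner_add_right, inner_smul_right, this]
      ring
    obtain ⟨d, hd, hd'⟩ := T.mem_graph_iff.mp hg
    refine ⟨d, hd, ?_⟩
    simp only at hd hd'
    rw [hd, hd', add_sub_cancel_right]
  · obtain ⟨u, hu, hu'⟩ := (hT.mem_graph _ _).mp (T.mem_graph d)
    have : adjoint j (T d - z • (d : H)) = pencil j A z u := by
      refine ext_inner_left ℂ fun v => ?_
      rw [adjoint_inner_right, inner_pencil, hu', inner_sub_right, inner_smul_right, hu]
    rw [comp_apply, comp_apply, this, hinv2, hu]

theorem notMem_resolventSet (hT : IsFormOperator j A T) {z : ℂ} {u : W} (hu0 : u ≠ 0)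
    (hu : pencil j A z u = 0) : z ∉ resolventSet T := by
  rintro ⟨R, -, hR⟩
  have hg : (j u, z • j u) ∈ T.graph := by
    rw [hT.mem_graph]
    exact ⟨u, rfl, fun v => by rw [pencil_eq_zero_iff.mp hu, inner_smul_right]⟩
  obtain ⟨d, hd, hd'⟩ := T.mem_graph_iff.mp hg
  simp only at hd hd'
  have := hR d
  rw [hd', hd, sub_self, map_zero] at this
  exact hu0 (hT.injective (by rw [← this, map_zero]))

theorem exists_pencil_of_mem_opSpectrum (hT : IsFormOperator j A T) (hB : BoundedBelowUpTo j A b B)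
    {z : ℂ} (hz : z ∈ opSpectrum T) (hzb : z.re < b) : ∃ u, u ≠ 0 ∧ pencil j A z u = 0 := by
  by_contra! hne
  refine hz (hT.mem_resolventSet_of_isUnit (isUnit_pencil hT.coercive hB hzb fun u hu => ?_))
  by_contra h0
  exact hne u h0 hu

theorem im_eq_zero_of_pencil (hT : IsFormOperator j A T) {z : ℂ} {u : W} (hu0 : u ≠ 0)
    (hu : pencil j A z u = 0) : z.im = 0 := by
  have h1 := pencil_eq_zero_iff.mp hu u
  have h2 : (inner ℂ u (A u)).im = 0 := by
    rw [← Complex.conj_eq_iff_im, inner_conj_symm, hT.symm]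
  rw [h1, inner_self_eq_norm_sq_to_K] at h2
  simp only [Complex.coe_algebraMap, ← Complex.ofReal_pow, Complex.im_mul_ofReal] at h2
  refine (mul_eq_zero.mp h2).resolve_right ?_
  refine pow_ne_zero 2 (norm_ne_zero_iff.mpr fun h => hu0 (hT.injective (by rw [h, map_zero])))

/-- Below `b` the discrete spectrum is the set of all eigenvalues. -/
theorem mem_discreteSpectrum_iff (hT : IsFormOperator j A T) (hB : BoundedBelowUpTo j A b B)
    {x : ℝ} (hx : x < b) : x ∈ discreteSpectrum T ↔ ∃ u, u ≠ 0 ∧ pencil j A x u = 0 := by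
  constructor
  · rintro ⟨h, -⟩
    exact hT.exists_pencil_of_mem_opSpectrum hB h (by simpa using hx)
  · rintro ⟨u, hu0, hu⟩
    refine ⟨hT.notMem_resolventSet hu0 hu, ?_, ?_, ?_⟩
    · set a := (x + b) / 2 with ha
      have hfin := hT.finite_eigenvalues hB (a := a) (by linarith)
      set S := {y : ℝ | y ≤ a ∧ ∃ u, u ≠ 0 ∧ pencil j A y u = 0} \ {x}
      have hS : IsClosed S := (hfin.subset sdiff_subset).isClosed
      obtain ⟨ε, hε, hball⟩ := Metric.isOpen_iff.mp hS.isOpen_compl x (by simp [S])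
      refine ⟨min ε (a - x), lt_min hε (by linarith), fun z hz hzx => ?_⟩
      have hre : |z.re - x| < min ε (a - x) := by
        refine lt_of_le_of_lt ?_ hzx
        simpa using Complex.abs_re_le_norm (z - x)
      have hza : z.re < a := by
        have := (le_abs_self _).trans_lt (hre.trans_le (min_le_right _ _)); linarith
      obtain ⟨v, hv0, hv⟩ := hT.exists_pencil_of_mem_opSpectrum hB hz (by linarith)
      have him := hT.im_eq_zero_of_pencil hv0 hv
      have hzr : z = (z.re : ℂ) := Complex.ext rfl (by simpa using him)
      by_contra hne
      refine hball (a := z.re) ?_ ⟨⟨hza.le, v, hv0, hzr ▸ hv⟩, fun h => hne ?_⟩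
      · rw [Metric.mem_ball, Real.dist_eq]; exact hre.trans_le (min_le_left _ _)
      · rw [hzr, show z.re = x from h]
    · intro h
      have : j u ∈ eigenspace T x := hT.mem_eigenspace_iff.mpr ⟨u, hu, rfl⟩
      rw [h, Submodule.mem_bot] at this
      exact hu0 (hT.injective (by rw [this, map_zero]))
    · have := (hT.finiteDimensional_levelSpace hB hx (Λ := {x}) (by simp)).1
      have h2 : levelSpace j A {x} = LinearMap.ker (pencil j A (x : ℂ)).toLinearMap := by
        simp [levelSpace]
      rw [hT.eigenspace_eq, ← h2]
      infer_instance

/-- The discrete spectrum below `b` misses no eigenvector, so its eigenspaces span the image of the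
level space. -/
theorem iSup_eigenspace_eq (hT : IsFormOperator j A T) (hB : BoundedBelowUpTo j A b B)
    {Λ : Set ℝ} (hΛ : ∀ x ∈ Λ, x < b) :
    (⨆ l ∈ {l ∈ discreteSpectrum T | l ∈ Λ}, eigenspace T ((l : ℝ) : ℂ)) =
      (levelSpace j A Λ).map j.toLinearMap := by
  rw [levelSpace, Submodule.map_iSup]
  refine iSup_congr fun x => ?_
  rw [Submodule.map_iSup]
  by_cases hx : x ∈ Λ
  · by_cases hd : x ∈ discreteSpectrum T
    · simp [hx, hd, hT.eigenspace_eq]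
    · have : LinearMap.ker (pencil j A (x : ℂ)).toLinearMap = ⊥ := by
        rw [LinearMap.ker_eq_bot']
        intro u hu
        by_contra h0
        exact hd ((hT.mem_discreteSpectrum_iff hB (hΛ x hx)).mpr ⟨u, h0, hu⟩)
      simp [hd, this]
  · simp [hx]

theorem rank_iSup_eigenspace (hT : IsFormOperator j A T) (hB : BoundedBelowUpTo j A b B)
    (hab : a < b) {Λ : Set ℝ} (hΛ : Λ ⊆ Iic a) :
    Module.rank ℂ ↥(⨆ l ∈ {l ∈ discreteSpectrum T | l ∈ Λ}, eigenspace T ((l : ℝ) : ℂ)) =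
      (Module.finrank ℂ (levelSpace j A Λ) : ℕ) := by
  have := (hT.finiteDimensional_levelSpace hB hab hΛ).1
  rw [hT.iSup_eigenspace_eq hB fun x hx => (hΛ hx).trans_lt hab]
  have e := Submodule.equivMapOfInjective j.toLinearMap hT.injective (levelSpace j A Λ)
  have := e.finiteDimensional
  rw [← Module.finrank_eq_rank, e.finrank_eq]

/-- An upper bound for the codimension of a subspace on which the form is at least `b` gives a
lower bound for the eigenvalues. -/
theorem le_of_isNthDiscreteEigenvalue (hT : IsFormOperator j A T) (hB : BoundedBelowUpTo j A b B)
    {m : ℕ} {E : ℝ} (hE : IsNthDiscreteEigenvalue T m E) (hm : Module.finrank ℂ F < m) : b ≤ E := by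
  by_contra! hlt
  have h := hE.2.2
  have h2 : Module.rank ℂ ↥(⨆ l ∈ {l ∈ discreteSpectrum T | l ≤ E}, eigenspace T ((l : ℝ) : ℂ)) =
      (Module.finrank ℂ (levelSpace j A (Iic E)) : ℕ) :=
    hT.rank_iSup_eigenspace hB hlt (Λ := Iic E) subset_rfl
  rw [h2] at h
  have h3 := (hT.finiteDimensional_levelSpace hB hlt (Λ := Iic E) subset_rfl).2
  have : m ≤ Module.finrank ℂ (levelSpace j A (Iic E)) := by exact_mod_cast h
  omega

/-- The span of the eigenvectors with eigenvalue at most `a` is at least as large as any space on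
which the form is at most `a`. -/
theorem finrank_le_levelSpace (hT : IsFormOperator j A T) (hB : BoundedBelowUpTo j A b B)
    (hab : a < b) (G : Submodule ℂ W) [FiniteDimensional ℂ G]
    (hG : ∀ u ∈ G, (inner ℂ u (A u)).re ≤ a * ‖j u‖ ^ 2) :
    Module.finrank ℂ G ≤ Module.finrank ℂ (levelSpace j A (Iic a)) := by
  have hfin := (hT.finiteDimensional_levelSpace hB hab (Λ := Iic a) subset_rfl).1
  set L := (levelSpace j A (Iic a)).map j.toLinearMap with hL
  have : FiniteDimensional ℂ L := by rw [hL]; infer_instance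
  -- Raise the eigenvalues up to `a` by a multiple `τ` of the projection onto `L`.
  set C : W →L[ℂ] L := L.orthogonalProjectionOnto ∘L j with hC
  obtain ⟨δ, hδ, c, hc⟩ := hT.coercive
  set τ : ℝ := |a| + |c| + 1 with hτ
  have hτ0 : 0 < τ := by positivity
  set A' : W →L[ℂ] W := A + (τ : ℂ) • (adjoint C ∘L C) with hA'
  have hA'i : ∀ v u, inner ℂ v (A' u) = inner ℂ v (A u) + τ * inner ℂ (C v) (C u) := by
    intro v u
    rw [hA', add_apply, inner_add_right, smul_apply, inner_smul_right, comp_apply,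
      adjoint_inner_right]
  have hCi : ∀ v u, j v ∈ L → inner ℂ (C v) (C u) = inner ℂ (j v) (j u) := by
    intro v u hv
    have h := L.inner_orthogonalProjectionOnto_eq_of_mem_left ⟨j v, hv⟩ (j u)
    have h2 : C v = ⟨j v, hv⟩ := L.orthogonalProjectionOnto_mem_subspace_eq_self ⟨j v, hv⟩
    rw [h2, ← h]
    rfl
  have hre : ∀ u, (inner ℂ u (A' u)).re = (inner ℂ u (A u)).re + τ * ‖C u‖ ^ 2 := by
    intro u
    rw [hA'i, inner_self_eq_norm_sq_to_K]
    simp [← Complex.ofReal_pow]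
  have hsymm' : ∀ u v, inner ℂ (A' u) v = inner ℂ u (A' v) := by
    intro u v
    rw [← inner_conj_symm, hA'i, hA'i, map_add, map_mul, inner_conj_symm, inner_conj_symm, hT.symm,
      Complex.conj_ofReal]
  have hge : ∀ u, (inner ℂ u (A u)).re ≤ (inner ℂ u (A' u)).re := by
    intro u
    rw [hre]
    have : 0 ≤ τ * ‖C u‖ ^ 2 := by positivity
    linarith
  -- an eigenvector of `A'` with eigenvalue at most `a` is orthogonal to `L`, hence an eigenvector of `A`,
  -- hence in `L`
  have hinj : ∀ x : ℝ, x ≤ a → ∀ u, pencil j A' x u = 0 → u = 0 := by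
    intro x hx u hu
    have hu' := pencil_eq_zero_iff.mp hu
    have horth : ∀ g ∈ L, inner ℂ g (j u) = 0 := by
      intro g hg
      obtain ⟨g, hg, rfl⟩ := hg
      obtain ⟨s, v, hv, rfl⟩ := exists_sum_of_mem_levelSpace hg
      simp only [ContinuousLinearMap.coe_coe, map_sum, sum_inner]
      refine Finset.sum_eq_zero fun y hy => ?_
      by_cases hv0 : v y = 0
      · simp [hv0]
      have hyL : j (v y) ∈ L := ⟨v y, ker_le_levelSpace (hv y hy).1 (hv y hy).2, rfl⟩
      have h1 := hu' (v y)
      rw [hA'i, hCi _ _ hyL, ← hT.symm, ← inner_conj_symm, pencil_eq_zero_iff.mp (hv y hy).2,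
        map_mul, inner_conj_symm, Complex.conj_ofReal] at h1
      have h2 : (((y + τ - x : ℝ)) : ℂ) * inner ℂ (j (v y)) (j u) = 0 := by
        push_cast
        linear_combination h1
      refine (mul_eq_zero.mp h2).resolve_left ?_
      -- The eigenvalue `y` is at least `-c`.
      have h3 := hc (v y)
      have h4 : (inner ℂ (v y) (A (v y))).re = y * ‖j (v y)‖ ^ 2 := by
        rw [pencil_eq_zero_iff.mp (hv y hy).2, inner_self_eq_norm_sq_to_K]
        simp [← Complex.ofReal_pow]
      have h5 : 0 < ‖j (v y)‖ ^ 2 := by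
        have : j (v y) ≠ 0 := fun h => hv0 (hT.injective (by rw [h, map_zero]))
        positivity
      have h6 : 0 ≤ y + c := by
        by_contra hneg
        have := mul_pos_of_neg_of_neg (not_le.mp hneg) (neg_lt_zero.mpr h5)
        nlinarith [mul_nonneg hδ.le (sq_nonneg ‖v y‖)]
      have h7 : 0 < y + τ - x := by
        have := le_abs_self a; have := le_abs_self c; linarith
      exact_mod_cast h7.ne'
    have hCu : C u = 0 := by
      rw [hC, comp_apply, Submodule.orthogonalProjectionOnto_eq_zero_iff]
      exact fun g hg => horth g hg
    have hAu : pencil j A x u = 0 := by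
      refine pencil_eq_zero_iff.mpr fun v => ?_
      have := hu' v
      rwa [hA'i, hCu, inner_zero_right, mul_zero, add_zero] at this
    have huL : j u ∈ L := ⟨u, ker_le_levelSpace (Λ := Iic a) hx hAu, rfl⟩
    exact hT.injective (by rw [inner_self_eq_zero.mp (horth _ huL), map_zero])
  have hgt := form_gt_of_forall_injective (a := a) (b := b) (B := B) hsymm'
    ⟨δ, hδ, c, fun u => (hc u).trans (add_le_add_left (hge u) _)⟩
    (fun u => (hB u).trans (add_le_add_left (hge u) _)) hab hinj
  -- so the form of `A` is more than `a` on the kernel of `C`, which therefore meets `G` trivially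
  have hCinj : Function.Injective (C.toLinearMap.domRestrict G) := by
    rw [← LinearMap.ker_eq_bot, LinearMap.ker_eq_bot']
    intro u hu
    by_contra h0
    have h1 := hgt u (fun h => h0 (Subtype.ext h))
    have h2 : C (u : W) = 0 := hu
    rw [hre, h2, norm_zero] at h1
    have := hG u u.2
    nlinarith
  calc Module.finrank ℂ G ≤ Module.finrank ℂ L := LinearMap.finrank_le_finrank_of_injective hCinj
    _ ≤ _ := Submodule.finrank_map_le _ _

/-- **Min-max principle**: if the form is at least `b` up to a finite-rank correction, and at most
`a < b` on a space of dimension at least `m`, then the `m`th discrete eigenvalue exists and is at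
most `a`. -/
theorem exists_isNthDiscreteEigenvalue (hT : IsFormOperator j A T) (hB : BoundedBelowUpTo j A b B)
    (hab : a < b) (G : Submodule ℂ W) [FiniteDimensional ℂ G]
    (hG : ∀ u ∈ G, (inner ℂ u (A u)).re ≤ a * ‖j u‖ ^ 2) {m : ℕ} (hm : 1 ≤ m)
    (hmG : m ≤ Module.finrank ℂ G) : ∃ E ≤ a, IsNthDiscreteEigenvalue T m E := by
  set S := {x : ℝ | x ≤ a ∧ ∃ u, u ≠ 0 ∧ pencil j A x u = 0} with hS
  have hSfin : S.Finite := hT.finite_eigenvalues hB hab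
  have hlevel : ∀ {Λ Λ' : Set ℝ}, Λ ⊆ Iic a → (∀ x ∈ Λ ∩ S, x ∈ Λ') →
      levelSpace j A Λ ≤ levelSpace j A Λ' := by
    intro Λ Λ' hΛ h
    refine iSup₂_le fun x hx u hu => ?_
    by_cases h0 : u = 0
    · rw [h0]; exact Submodule.zero_mem _
    · exact ker_le_levelSpace (h x ⟨hx, hΛ hx, u, h0, hu⟩) hu
  have hmono : ∀ {Λ Λ' : Set ℝ}, Λ' ⊆ Iic a → levelSpace j A Λ ≤ levelSpace j A Λ' →
      Module.finrank ℂ (levelSpace j A Λ) ≤ Module.finrank ℂ (levelSpace j A Λ') := by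
    intro Λ Λ' hΛ' h
    have := (hT.finiteDimensional_levelSpace hB hab hΛ').1
    exact Submodule.finrank_mono h
  have hempty : ∀ {Λ : Set ℝ}, Λ ⊆ Iic a → Λ ∩ S = ∅ →
      Module.finrank ℂ (levelSpace j A Λ) = 0 := by
    intro Λ hΛ h
    have h1 : levelSpace j A Λ ≤ levelSpace j A ∅ := hlevel hΛ (by simp [h])
    have h2 : levelSpace j A Λ = ⊥ := by simpa [levelSpace] using h1
    rw [h2, finrank_bot]
  have hma : m ≤ Module.finrank ℂ (levelSpace j A (Iic a)) :=
    hmG.trans (hT.finrank_le_levelSpace hB hab G hG)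
  set S' := {x ∈ S | m ≤ Module.finrank ℂ (levelSpace j A (Iic x))} with hS'
  have hS'fin : S'.Finite := hSfin.subset (sep_subset _ _)
  have hS'ne : S'.Nonempty := by
    have hSne : S.Nonempty := by
      by_contra h
      have := hempty (Λ := Iic a) subset_rfl (by rw [not_nonempty_iff_eq_empty.mp h, inter_empty])
      omega
    obtain ⟨x, hxS, hx⟩ := hSfin.exists_maximalFor id S hSne
    refine ⟨x, hxS, hma.trans (hmono (Iic_subset_Iic.mpr hxS.1) (hlevel subset_rfl ?_))⟩
    intro y hy
    by_contra hlt
    exact hlt (hx hy.2 (not_le.mp hlt).le)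
  obtain ⟨E, hES, hE⟩ := hS'fin.exists_minimalFor id S' hS'ne
  have hEa : E ≤ a := hES.1.1
  refine ⟨E, hEa, (hT.mem_discreteSpectrum_iff hB (hEa.trans_lt hab)).mpr hES.1.2, ?_, ?_⟩
  · have h1 : Module.rank ℂ ↥(⨆ l ∈ {l ∈ discreteSpectrum T | l < E}, eigenspace T ((l : ℝ) : ℂ)) =
      (Module.finrank ℂ (levelSpace j A (Iio E)) : ℕ) :=
    hT.rank_iSup_eigenspace hB hab (Λ := Iio E) (fun x hx => (mem_Iio.mp hx).le.trans hEa)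
    rw [h1, Nat.cast_lt]
    have hsub : Iio E ⊆ Iic a := fun x hx => (mem_Iio.mp hx).le.trans hEa
    by_cases hne : (Iio E ∩ S).Nonempty
    · obtain ⟨x, hxS, hx⟩ := (hSfin.subset inter_subset_right).exists_maximalFor id (Iio E ∩ S) hne
      by_contra! hcon
      have hxS' : x ∈ S' := by
        refine ⟨hxS.2, hcon.trans (hmono (Iic_subset_Iic.mpr hxS.2.1) (hlevel hsub ?_))⟩
        intro y hy
        by_contra hlt
        exact hlt (hx hy (not_le.mp hlt).le)
      have := hE hxS' (mem_Iio.mp hxS.1).le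
      exact absurd hxS.1 (not_lt.mpr this)
    · have := hempty hsub (not_nonempty_iff_eq_empty.mp hne)
      omega
  · have h1 : Module.rank ℂ ↥(⨆ l ∈ {l ∈ discreteSpectrum T | l ≤ E}, eigenspace T ((l : ℝ) : ℂ)) =
      (Module.finrank ℂ (levelSpace j A (Iic E)) : ℕ) :=
    hT.rank_iSup_eigenspace hB hab (Λ := Iic E) (Iic_subset_Iic.mpr hEa)
    rw [h1, Nat.cast_le]
    exact hES.2

end IsFormOperator

end Pencil

end Abstract

/-! ### Sobolev spaces as Hilbert spaces -/

section SobolevHilbert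

variable {E : Type*} [NormedAddCommGroup E] [InnerProductSpace ℝ E] [FiniteDimensional ℝ E]
  [MeasurableSpace E] [BorelSpace E]

variable (E) in
/-- The smooth complex functions with compact support. -/
def testFunctions : Submodule ℂ (E → ℂ) where
  carrier := {f | ContDiff ℝ ∞ f ∧ HasCompactSupport f}
  add_mem' := fun hf hg => ⟨hf.1.add hg.1, hf.2.add hg.2⟩
  zero_mem' := ⟨contDiff_const, HasCompactSupport.zero⟩
  smul_mem' := fun c f hf => ⟨hf.1.const_smul c, hf.2.comp_left (g := fun z => c • z) (smul_zero c)⟩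

namespace testFunctions

theorem contDiff (f : testFunctions E) : ContDiff ℝ ∞ (f : E → ℂ) := f.2.1

theorem continuous (f : testFunctions E) : Continuous (f : E → ℂ) := f.2.1.continuous

theorem hasCompactSupport (f : testFunctions E) : HasCompactSupport (f : E → ℂ) := f.2.2

theorem differentiable (f : testFunctions E) : Differentiable ℝ (f : E → ℂ) :=
  (testFunctions.contDiff f).differentiable (by simp)

theorem memLp (f : testFunctions E) (μ : Measure E) [IsFiniteMeasureOnCompacts μ] :
    MemLp (f : E → ℂ) 2 μ :=
  (testFunctions.continuous f).memLp_of_hasCompactSupport (testFunctions.hasCompactSupport f)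

theorem contDiff_fderiv_apply (f : testFunctions E) (e : E) :
    ContDiff ℝ ∞ fun x => fderiv ℝ (f : E → ℂ) x e := by
  have h : ContDiff ℝ ∞ (fderiv ℝ (f : E → ℂ)) :=
    (testFunctions.contDiff f).fderiv_right (m := ∞) (by simp)
  exact h.clm_apply contDiff_const

/-- The directional derivative of a test function. -/
def deriv (e : E) : testFunctions E →ₗ[ℂ] testFunctions E where
  toFun := fun f => ⟨fun x => fderiv ℝ (f : E → ℂ) x e, contDiff_fderiv_apply f e,
    (testFunctions.hasCompactSupport f).fderiv_apply (𝕜 := ℝ) e⟩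
  map_add' := fun f g => by
    ext x
    simp [fderiv_add ((testFunctions.differentiable f) x) ((testFunctions.differentiable g) x)]
  map_smul' := fun c f => by
    ext x
    have : fderiv ℝ (c • (f : E → ℂ)) x = c • fderiv ℝ (f : E → ℂ) x :=
      fderiv_const_smul ((testFunctions.differentiable f) x) c
    simp [this]

@[simp]
theorem deriv_apply (e : E) (f : testFunctions E) (x : E) :
    (deriv e f : E → ℂ) x = fderiv ℝ (f : E → ℂ) x e := rfl

/-- The class in `L²(μ)` of a test function. -/
def toL2 (μ : Measure E) [IsFiniteMeasureOnCompacts μ] : testFunctions E →ₗ[ℂ] Lp ℂ 2 μ where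
  toFun := fun f => ((testFunctions.memLp f) μ).toLp f
  map_add' := fun f g => MemLp.toLp_add ((testFunctions.memLp f) μ) ((testFunctions.memLp g) μ)
  map_smul' := fun c f => MemLp.toLp_const_smul c ((testFunctions.memLp f) μ)

theorem coeFn_toL2 (μ : Measure E) [IsFiniteMeasureOnCompacts μ] (f : testFunctions E) :
    toL2 μ f =ᵐ[μ] (f : E → ℂ) := MemLp.coeFn_toLp (testFunctions.memLp f μ)

end testFunctions

theorem norm_sq_eq_integral {X : Type*} [MeasurableSpace X] {μ : Measure X} (u : Lp ℂ 2 μ) :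
    ‖u‖ ^ 2 = ∫ x, ‖u x‖ ^ 2 ∂μ := by
  have h : (inner ℂ u u : ℂ) = ((∫ x, ‖u x‖ ^ 2 ∂μ : ℝ) : ℂ) := by
    rw [L2.inner_def, ← integral_complex_ofReal]
    refine integral_congr_ae (Eventually.of_forall fun x => ?_)
    simp only [inner_self_eq_norm_sq_to_K]
    norm_cast
  rw [inner_self_eq_norm_sq_to_K] at h
  change (‖u‖ : ℂ) ^ 2 = _ at h
  rw [← Complex.ofReal_pow] at h
  exact Complex.ofReal_injective h

theorem testFunctions.norm_sq_toL2 (μ : Measure E) [IsFiniteMeasureOnCompacts μ]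
    (f : testFunctions E) : ‖testFunctions.toL2 μ f‖ ^ 2 = ∫ x, ‖(f : E → ℂ) x‖ ^ 2 ∂μ := by
  rw [norm_sq_eq_integral]
  refine integral_congr_ae ?_
  filter_upwards [testFunctions.coeFn_toL2 μ f] with x hx
  rw [hx]

variable {Ω : TopologicalSpace.Opens E} {e : E}

/-- A test function has its classical derivatives as weak derivatives. -/
theorem testFunctions.hasWeakDeriv (f : testFunctions E) :
    HasWeakDeriv Ω e (toL2 _ f) (toL2 _ (deriv e f)) := by
  intro φ h1 h2 h3
  have ha : ∫ x in (Ω : Set E), (fderiv ℝ φ x e) • toL2 (volume.restrict (Ω : Set E)) f x =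
      ∫ x, fderiv ℝ φ x e • (f : E → ℂ) x := by
    rw [← setIntegral_eq_integral_of_forall_compl_eq_zero (μ := volume) (s := (Ω : Set E))
      (f := fun x => fderiv ℝ φ x e • (f : E → ℂ) x)]
    · refine integral_congr_ae ?_
      filter_upwards [testFunctions.coeFn_toL2 _ f] with x hx
      rw [hx]
    · intro x hx
      have : x ∉ tsupport (fderiv ℝ φ) := fun h => hx (h3 (tsupport_fderiv_subset (𝕜 := ℝ) h))
      rw [image_eq_zero_of_notMem_tsupport this]
      simp
  have hb : ∫ x in (Ω : Set E), φ x • toL2 (volume.restrict (Ω : Set E)) (deriv e f) x =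
      ∫ x, φ x • fderiv ℝ (f : E → ℂ) x e := by
    rw [← setIntegral_eq_integral_of_forall_compl_eq_zero (μ := volume) (s := (Ω : Set E))
      (f := fun x => φ x • fderiv ℝ (f : E → ℂ) x e)]
    · refine integral_congr_ae ?_
      filter_upwards [testFunctions.coeFn_toL2 _ (deriv e f)] with x hx
      rw [hx, deriv_apply]
    · intro x hx
      rw [image_eq_zero_of_notMem_tsupport fun hx' => hx (h3 hx'), zero_smul]
  rw [ha, hb, eq_neg_iff_add_eq_zero]
  have hφ' : Continuous fun x => fderiv ℝ φ x e :=
    (h1.continuous_fderiv (by simp)).clm_apply continuous_const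
  have hc : HasCompactSupport fun x => fderiv ℝ φ x e := h2.fderiv_apply (𝕜 := ℝ) e
  have key := integral_bilinear_fderiv_right_eq_neg_left_of_integrable
    (B := ContinuousLinearMap.lsmul ℝ ℝ (E := ℂ)) (f := φ) (g := (f : E → ℂ)) (v := e) (μ := volume)
    ((hφ'.smul (testFunctions.continuous f)).integrable_of_hasCompactSupport hc.smul_right)
    ((h1.continuous.smul (testFunctions.continuous (deriv e f))).integrable_of_hasCompactSupport h2.smul_right)
    ((h1.continuous.smul (testFunctions.continuous f)).integrable_of_hasCompactSupport h2.smul_right)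
    (fun x _ => h1.differentiable (by simp) x) (fun x _ => (testFunctions.differentiable f) x)
  simp only [ContinuousLinearMap.lsmul_apply] at key
  rw [key, add_neg_cancel]

theorem continuous_integral_smul {ψ : E → ℝ} (hψ : Continuous ψ) (hc : HasCompactSupport ψ) :
    Continuous fun u : L2 Ω => ∫ x in (Ω : Set E), ψ x • u x := by
  have h1 : MemLp (fun x => (ψ x : ℂ)) 2 ((volume : Measure E).restrict (Ω : Set E)) :=
    ((hψ.memLp_of_hasCompactSupport hc).restrict _).ofReal
  have : (fun u : L2 Ω => ∫ x in (Ω : Set E), ψ x • u x) = fun u => inner ℂ (h1.toLp _) u := by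
    ext u
    rw [L2.inner_def]
    refine integral_congr_ae ?_
    filter_upwards [h1.coeFn_toLp] with x hx
    rw [hx]
    simp [mul_comm]
  rw [this]
  fun_prop

theorem eq_zero_of_forall_integral_smul {w : L2 Ω}
    (h : ∀ φ : E → ℝ, ContDiff ℝ ∞ φ → HasCompactSupport φ → tsupport φ ⊆ (Ω : Set E) →
      ∫ x in (Ω : Set E), φ x • w x = 0) : w = 0 := by
  refine (Lp.eq_zero_iff_ae_eq_zero).mpr ?_
  have hloc : LocallyIntegrableOn w (Ω : Set E) volume :=
    locallyIntegrableOn_of_locallyIntegrable_restrict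
      ((Lp.memLp w).locallyIntegrable (by norm_num))
  have := Ω.isOpen.ae_eq_zero_of_integral_contDiff_smul_eq_zero hloc (by
    intro φ h1 h2 h3
    rw [← h φ h1 h2 h3]
    refine (setIntegral_eq_integral_of_forall_compl_eq_zero fun x hx => ?_).symm
    rw [image_eq_zero_of_notMem_tsupport fun hx' => hx (h3 hx'), zero_smul])
  exact (ae_restrict_iff' Ω.isOpen.measurableSet).mpr this

theorem HasWeakDeriv.add_dir {e' : E} {u g k : L2 Ω} (hg : HasWeakDeriv Ω e u g)
    (hk : HasWeakDeriv Ω e' u k) : HasWeakDeriv Ω (e + e') u (g + k) := by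
  intro φ h1 h2 h3
  have h4 : ∫ x in (Ω : Set E), φ x • (g + k : L2 Ω) x =
      (∫ x in (Ω : Set E), φ x • g x) + ∫ x in (Ω : Set E), φ x • k x := by
    rw [← integral_add (integrable_test_smul h1.continuous h2 g)
      (integrable_test_smul h1.continuous h2 k)]
    refine integral_congr_ae ?_
    filter_upwards [Lp.coeFn_add g k] with z hz
    rw [hz, Pi.add_apply, smul_add]
  have h5 : ∫ x in (Ω : Set E), (fderiv ℝ φ x (e + e')) • u x =
      (∫ x in (Ω : Set E), (fderiv ℝ φ x e) • u x) +
      ∫ x in (Ω : Set E), (fderiv ℝ φ x e') • u x := by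
    rw [← integral_add (integrable_fderiv_smul h1 h2 u) (integrable_fderiv_smul h1 h2 u)]
    refine integral_congr_ae (Eventually.of_forall fun x => ?_)
    simp only [map_add, add_smul]
  rw [h4, h5, hg φ h1 h2 h3, hk φ h1 h2 h3]
  ring

theorem HasWeakDeriv.smul_dir {u g : L2 Ω} (r : ℝ) (hg : HasWeakDeriv Ω e u g) :
    HasWeakDeriv Ω (r • e) u ((r : ℂ) • g) := by
  intro φ h1 h2 h3
  have h4 : ∫ x in (Ω : Set E), φ x • ((r : ℂ) • g : L2 Ω) x =
      r • ∫ x in (Ω : Set E), φ x • g x := by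
    rw [← integral_smul]
    refine integral_congr_ae ?_
    filter_upwards [Lp.coeFn_smul (r : ℂ) g] with z hz
    rw [hz, Pi.smul_apply, smul_comm]
    simp
  have h5 : ∫ x in (Ω : Set E), (fderiv ℝ φ x (r • e)) • u x =
      r • ∫ x in (Ω : Set E), (fderiv ℝ φ x e) • u x := by
    rw [← integral_smul]
    refine integral_congr_ae (Eventually.of_forall fun x => ?_)
    simp only [map_smul, smul_assoc]
  rw [h4, h5, hg φ h1 h2 h3, smul_neg]

theorem HasWeakDeriv.zero_dir {u : L2 Ω} : HasWeakDeriv Ω 0 u 0 := by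
  intro φ h1 h2 h3
  have h4 : ∫ x in (Ω : Set E), φ x • (0 : L2 Ω) x = 0 := by
    rw [← integral_zero E ℂ (μ := (volume : Measure E).restrict (Ω : Set E))]
    refine integral_congr_ae ?_
    filter_upwards [Lp.coeFn_zero ℂ 2 ((volume : Measure E).restrict (Ω : Set E))] with z hz
    rw [hz, Pi.zero_apply, smul_zero]
  rw [h4]
  simp

/-- Weak derivatives in the directions of a spanning family give weak derivatives in all
directions. -/
theorem exists_hasWeakDeriv {ι : Type*} {d : ι → E} (hd : Submodule.span ℝ (range d) = ⊤) {u : L2 Ω}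
    (h : ∀ i, ∃ g, HasWeakDeriv Ω (d i) u g) (e : E) : ∃ g, HasWeakDeriv Ω e u g := by
  have he : e ∈ Submodule.span ℝ (range d) := hd ▸ Submodule.mem_top
  induction he using Submodule.span_induction with
  | mem x hx => obtain ⟨i, rfl⟩ := hx; exact h i
  | zero => exact ⟨0, HasWeakDeriv.zero_dir⟩
  | add x y _ _ hx hy => exact ⟨_, hx.choose_spec.add_dir hy.choose_spec⟩
  | smul r x _ hx => exact ⟨_, hx.choose_spec.smul_dir r⟩

theorem weakDeriv_spec (u : sobolev Ω) (e : E) : HasWeakDeriv Ω e u (weakDeriv Ω e u) :=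
  (u.2 e).choose_spec

theorem weakDeriv_eq {u : sobolev Ω} {g : L2 Ω} (h : HasWeakDeriv Ω e u g) :
    weakDeriv Ω e u = g := (weakDeriv_spec u e).unique h

variable {ι : Type*} [Fintype ι]

/-- The space `W^{1,2}(Ω)` with its Hilbert space structure: the functions together with their weak
derivatives in the directions `d i`, as a subspace of a power of `L²(Ω)`. -/
def sobolevHilbert (Ω : TopologicalSpace.Opens E) (d : ι → E) :
    Submodule ℂ (PiLp 2 fun _ : Option ι => L2 Ω) where
  carrier := {p | ∀ i, HasWeakDeriv Ω (d i) (p none) (p (some i))}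
  add_mem' := fun hp hq i => (hp i).add (hq i)
  zero_mem' := fun _ => HasWeakDeriv.zero
  smul_mem' := fun c _ hp i => (hp i).smul c

theorem isClosed_sobolevHilbert (d : ι → E) :
    IsClosed (sobolevHilbert Ω d : Set (PiLp 2 fun _ : Option ι => L2 Ω)) := by
  have : (sobolevHilbert Ω d : Set (PiLp 2 fun _ : Option ι => L2 Ω)) =
      ⋂ (i : ι) (φ : E → ℝ) (_ : ContDiff ℝ ∞ φ) (_ : HasCompactSupport φ)
        (_ : tsupport φ ⊆ (Ω : Set E)), {p | ∫ x in (Ω : Set E), (fderiv ℝ φ x (d i)) • p none x =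
          - ∫ x in (Ω : Set E), φ x • p (some i) x} := by
    ext p
    simp only [mem_iInter]
    rfl
  rw [this]
  refine isClosed_iInter fun i => isClosed_iInter fun φ => isClosed_iInter fun h1 =>
    isClosed_iInter fun h2 => isClosed_iInter fun _ => isClosed_eq ?_ ?_
  · exact (continuous_integral_smul ((h1.continuous_fderiv (by simp)).clm_apply continuous_const)
      (h2.fderiv_apply (𝕜 := ℝ) (d i))).comp (PiLp.continuous_apply 2 _ _)
  · exact ((continuous_integral_smul (Ω := Ω) h1.continuous h2).comp
      (PiLp.continuous_apply 2 (fun _ : Option ι => L2 Ω) (some i))).neg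

instance (d : ι → E) : CompleteSpace (sobolevHilbert Ω d) :=
  (isClosed_sobolevHilbert d).completeSpace_coe

namespace sobolevHilbert

variable (Ω) (d : ι → E)

/-- The inclusion of `W^{1,2}(Ω)` in `L²(Ω)`. -/
def incl : sobolevHilbert Ω d →L[ℂ] L2 Ω :=
  (PiLp.proj (𝕜 := ℂ) 2 (fun _ : Option ι => L2 Ω) none).comp (sobolevHilbert Ω d).subtypeL

/-- The weak derivative in the direction `d i`. -/
def pderiv (i : ι) : sobolevHilbert Ω d →L[ℂ] L2 Ω :=
  (PiLp.proj (𝕜 := ℂ) 2 (fun _ : Option ι => L2 Ω) (some i)).comp (sobolevHilbert Ω d).subtypeL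

variable {Ω} {d}

theorem hasWeakDeriv (p : sobolevHilbert Ω d) (i : ι) :
    HasWeakDeriv Ω (d i) (incl Ω d p) (pderiv Ω d i p) := p.2 i

theorem norm_sq (p : sobolevHilbert Ω d) :
    ‖p‖ ^ 2 = ‖incl Ω d p‖ ^ 2 + ∑ i, ‖pderiv Ω d i p‖ ^ 2 := by
  rw [Submodule.coe_norm, PiLp.norm_sq_eq_of_L2, Fintype.sum_option]
  rfl

theorem incl_injective : Function.Injective (incl Ω d) := by
  intro p q h
  refine Subtype.ext (PiLp.ext fun o => ?_)
  cases o with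
  | none => exact h
  | some i => exact (h ▸ hasWeakDeriv p i).unique (hasWeakDeriv q i)

variable (Ω d) in
/-- The element of the Sobolev space given by a test function. -/
def ofTest : testFunctions E →ₗ[ℂ] sobolevHilbert Ω d where
  toFun := fun f => ⟨WithLp.toLp 2 fun o => o.elim (testFunctions.toL2 _ f)
    fun i => testFunctions.toL2 _ (testFunctions.deriv (d i) f), fun i => (testFunctions.hasWeakDeriv f)⟩
  map_add' := fun f g => by
    refine Subtype.ext (PiLp.ext fun o => ?_)
    cases o <;> simp
  map_smul' := fun c f => by
    refine Subtype.ext (PiLp.ext fun o => ?_)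
    cases o <;> simp

@[simp]
theorem incl_ofTest (f : testFunctions E) : incl Ω d (ofTest Ω d f) = testFunctions.toL2 _ f := rfl

@[simp]
theorem pderiv_ofTest (f : testFunctions E) (i : ι) :
    pderiv Ω d i (ofTest Ω d f) = testFunctions.toL2 _ (testFunctions.deriv (d i) f) := rfl

/-- The space `W^{1,2}(Ω)` of pairs of functions and derivatives is the Sobolev space. -/
def equivSobolev (hd : Submodule.span ℝ (range d) = ⊤) : sobolevHilbert Ω d ≃ₗ[ℂ] sobolev Ω where
  toFun := fun p => ⟨incl Ω d p, exists_hasWeakDeriv hd fun i => ⟨_, hasWeakDeriv p i⟩⟩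
  map_add' := fun p q => Subtype.ext (map_add (incl Ω d) p q)
  map_smul' := fun c p => Subtype.ext (map_smul (incl Ω d) c p)
  invFun := fun u => ⟨WithLp.toLp 2 fun o => o.elim (u : L2 Ω) fun i => weakDeriv Ω (d i) u,
    fun i => weakDeriv_spec u (d i)⟩
  left_inv := fun _ => incl_injective rfl
  right_inv := fun _ => rfl

theorem coe_equivSobolev (hd : Submodule.span ℝ (range d) = ⊤) (p : sobolevHilbert Ω d) :
    (equivSobolev hd p : L2 Ω) = incl Ω d p := rfl

theorem weakDeriv_equivSobolev (hd : Submodule.span ℝ (range d) = ⊤) (p : sobolevHilbert Ω d)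
    (i : ι) : weakDeriv Ω (d i) (equivSobolev hd p) = pderiv Ω d i p :=
  weakDeriv_eq (hasWeakDeriv p i)

/-- The test functions with support in `Ω` are dense in `L²(Ω)`. -/
theorem exists_test_ne_zero {w : L2 Ω} (hw : w ≠ 0) : ∃ f : testFunctions E,
    tsupport (f : E → ℂ) ⊆ (Ω : Set E) ∧ inner ℂ (testFunctions.toL2 _ f) w ≠ 0 := by
  by_contra! hcon
  refine hw (eq_zero_of_forall_integral_smul fun φ h1 h2 h3 => ?_)
  have hs : (fun x => (φ x : ℂ)) = Complex.ofReal ∘ φ := rfl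
  have := hcon ⟨fun x => (φ x : ℂ), Complex.ofRealCLM.contDiff.comp h1,
    h2.comp_left Complex.ofReal_zero⟩
    ((closure_mono (Function.support_comp_subset Complex.ofReal_zero φ)).trans h3)
  rw [← this, L2.inner_def]
  refine integral_congr_ae ?_
  filter_upwards [testFunctions.coeFn_toL2 (volume.restrict (Ω : Set E)) ⟨fun x => (φ x : ℂ),
    Complex.ofRealCLM.contDiff.comp h1, h2.comp_left Complex.ofReal_zero⟩] with x hx
  rw [hx]
  simp [mul_comm]

variable (Ω d) in
/-- The closure `W₀^{1,2}(Ω)` of the test functions with support in `Ω`. -/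
def zero : Submodule ℂ (sobolevHilbert Ω d) :=
  (Submodule.map (ofTest Ω d)
    { carrier := {f | tsupport (f : E → ℂ) ⊆ (Ω : Set E)}
      add_mem' := fun hf hg => (tsupport_add _ _).trans (union_subset hf hg)
      zero_mem' := by simp
      smul_mem' := fun c f hf =>
        (closure_mono (Function.support_const_smul_subset c (f : E → ℂ))).trans hf }).topologicalClosure

instance : CompleteSpace (zero Ω d) :=
  (Submodule.isClosed_topologicalClosure _).completeSpace_coe

theorem ofTest_mem_zero {f : testFunctions E} (hf : tsupport (f : E → ℂ) ⊆ (Ω : Set E)) :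
    ofTest Ω d f ∈ zero Ω d := Submodule.le_topologicalClosure _ ⟨f, hf, rfl⟩

theorem mem_zero_iff {p : sobolevHilbert Ω d} : p ∈ zero Ω d ↔ ∃ f : ℕ → testFunctions E,
    (∀ k, tsupport (f k : E → ℂ) ⊆ (Ω : Set E)) ∧
      Tendsto (fun k => ofTest Ω d (f k)) atTop (𝓝 p) := by
  rw [zero, ← SetLike.mem_coe, Submodule.topologicalClosure_coe, mem_closure_iff_seq_limit]
  constructor
  · rintro ⟨x, hx, hlim⟩
    choose f hf hfx using hx
    exact ⟨f, hf, by simpa only [hfx] using hlim⟩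
  · rintro ⟨f, hf, hlim⟩
    exact ⟨_, fun k => ⟨f k, hf k, rfl⟩, hlim⟩

/-- A closed inequality on `W₀^{1,2}(Ω)` may be checked on test functions. -/
theorem zero_induction {P : sobolevHilbert Ω d → Prop} (hP : IsClosed {p | P p})
    (h : ∀ f : testFunctions E, tsupport (f : E → ℂ) ⊆ (Ω : Set E) → P (ofTest Ω d f))
    {p : sobolevHilbert Ω d} (hp : p ∈ zero Ω d) : P p := by
  obtain ⟨f, hf, hlim⟩ := mem_zero_iff.mp hp
  exact hP.mem_of_tendsto hlim (Eventually.of_forall fun k => h _ (hf k))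

theorem tendsto_ofTest_iff {p : sobolevHilbert Ω d} {f : ℕ → testFunctions E} :
    Tendsto (fun k => ofTest Ω d (f k)) atTop (𝓝 p) ↔
      Tendsto (fun k => testFunctions.toL2 (volume.restrict (Ω : Set E)) (f k)) atTop
        (𝓝 (incl Ω d p)) ∧
      ∀ i, Tendsto (fun k => testFunctions.toL2 (volume.restrict (Ω : Set E))
        (testFunctions.deriv (d i) (f k))) atTop (𝓝 (pderiv Ω d i p)) := by
  rw [tendsto_subtype_rng, (PiLp.homeomorph 2 fun _ : Option ι => L2 Ω).isInducing.tendsto_nhds_iff,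
    tendsto_pi_nhds]
  exact ⟨fun h => ⟨h none, fun i => h (some i)⟩, fun h o => by
    cases o with
    | none => exact h.1
    | some i => exact h.2 i⟩

theorem tendsto_toL2_iff {u : L2 Ω} {f : ℕ → testFunctions E} :
    Tendsto (fun k => testFunctions.toL2 (volume.restrict (Ω : Set E)) (f k)) atTop (𝓝 u) ↔
    Tendsto (fun k => eLpNorm (fun x => u x - (f k : E → ℂ) x) 2 (volume.restrict (Ω : Set E)))
      atTop (𝓝 0) := by
  rw [Lp.tendsto_Lp_iff_tendsto_eLpNorm']
  refine tendsto_congr fun k => ?_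
  rw [eLpNorm_sub_comm]
  refine eLpNorm_congr_ae ?_
  filter_upwards [testFunctions.coeFn_toL2 (volume.restrict (Ω : Set E)) (f k)] with x hx
  rw [Pi.sub_apply, hx]

end sobolevHilbert

/-- The graph of the operator generated by a form, for a densely and injectively embedded form
domain. -/
theorem mem_graph_formOperator {H V : Type*} [NormedAddCommGroup H] [InnerProductSpace ℂ H]
    [AddCommGroup V] [Module ℂ V] {j : V →ₗ[ℂ] H} {h : V →ₗ⋆[ℂ] V →ₗ[ℂ] ℂ}
    (hj : Function.Injective j) (hd : ∀ w, (∀ v, inner ℂ (j v) w = 0) → w = 0) (f w : H) :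
    (f, w) ∈ (formOperator j h).graph ↔ ∃ u, j u = f ∧ ∀ v, h v u = inner ℂ (j v) w := by
  rw [formOperator, Submodule.toLinearPMap_graph_eq]
  · rfl
  · rintro ⟨f, w⟩ ⟨u, hu, huw⟩ (rfl : f = 0)
    have hu0 : u = 0 := hj (by rw [map_zero]; exact hu)
    refine hd w fun v => ?_
    rw [← huw v, hu0, map_zero]

end SobolevHilbert

/-! ### The Dirichlet eigenfunctions of an interval -/

section Interval

open Real (pi sqrt)

/-- The Dirichlet eigenvalues `(π (k+1) / ℓ)²` of the interval `(0, ℓ)`, for `k = 0, 1, …`. -/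
def dirichletFreq (ℓ : ℝ) (k : ℕ) : ℝ := (Real.pi * (k + 1) / ℓ) ^ 2

/-- The normalized Dirichlet eigenfunctions of the interval `(0, ℓ)`. -/
def sineMode (ℓ : ℝ) (k : ℕ) (s : ℝ) : ℝ := √(2 / ℓ) * Real.sin (Real.pi * (k + 1) / ℓ * s)

/-- The derivatives of the normalized Dirichlet eigenfunctions. -/
def sineModeDeriv (ℓ : ℝ) (k : ℕ) (s : ℝ) : ℝ :=
  √(2 / ℓ) * (Real.pi * (k + 1) / ℓ * Real.cos (Real.pi * (k + 1) / ℓ * s))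

theorem hasDerivAt_sineMode (ℓ : ℝ) (k : ℕ) (s : ℝ) :
    HasDerivAt (sineMode ℓ k) (sineModeDeriv ℓ k s) s := by
  have h1 : HasDerivAt (fun s => Real.pi * (k + 1) / ℓ * s) (Real.pi * (k + 1) / ℓ) s := by
    simpa using (hasDerivAt_id s).const_mul (Real.pi * (k + 1) / ℓ)
  have h2 := (h1.sin).const_mul √(2 / ℓ)
  refine h2.congr_deriv ?_
  rw [sineModeDeriv]
  ring

theorem contDiff_sineMode (ℓ : ℝ) (k : ℕ) : ContDiff ℝ ∞ (sineMode ℓ k) :=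
  contDiff_const.mul (Real.contDiff_sin.comp (contDiff_const.mul contDiff_id))

theorem continuous_sineMode (ℓ : ℝ) (k : ℕ) : Continuous (sineMode ℓ k) :=
  (contDiff_sineMode ℓ k).continuous

theorem continuous_sineModeDeriv (ℓ : ℝ) (k : ℕ) : Continuous (sineModeDeriv ℓ k) := by
  unfold sineModeDeriv
  fun_prop

theorem sineMode_zero (ℓ : ℝ) (k : ℕ) : sineMode ℓ k 0 = 0 := by simp [sineMode]

theorem sineMode_length {ℓ : ℝ} (hℓ : 0 < ℓ) (k : ℕ) : sineMode ℓ k ℓ = 0 := by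
  have : Real.pi * (k + 1) / ℓ * ℓ = ((k + 1 : ℕ) : ℝ) * Real.pi := by
    push_cast
    field_simp
  rw [sineMode, this, Real.sin_nat_mul_pi, mul_zero]

theorem dirichletFreq_strictMono {ℓ : ℝ} (hℓ : 0 < ℓ) : StrictMono (dirichletFreq ℓ) := by
  intro j k hjk
  have : (j : ℝ) < k := by exact_mod_cast hjk
  unfold dirichletFreq
  have := Real.pi_pos
  gcongr

theorem tendsto_dirichletFreq {ℓ : ℝ} (hℓ : 0 < ℓ) : Tendsto (dirichletFreq ℓ) atTop atTop := by
  have h1 : Tendsto (fun k : ℕ => Real.pi * ((k : ℝ) + 1) / ℓ) atTop atTop := by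
    refine Tendsto.atTop_div_const hℓ (Tendsto.const_mul_atTop Real.pi_pos ?_)
    exact tendsto_atTop_add_const_right _ _ tendsto_natCast_atTop_atTop
  exact (tendsto_pow_atTop two_ne_zero).comp h1

theorem dirichletFreq_pos {ℓ : ℝ} (hℓ : 0 < ℓ) (k : ℕ) : 0 < dirichletFreq ℓ k := by
  unfold dirichletFreq
  have := Real.pi_pos
  positivity

theorem integral_cos_int {ℓ : ℝ} (hℓ : 0 < ℓ) (n : ℤ) :
    ∫ s in (0 : ℝ)..ℓ, Real.cos (Real.pi * n / ℓ * s) = if n = 0 then ℓ else 0 := by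
  split_ifs with h
  · simp [h]
  · have hn : Real.pi * n / ℓ ≠ 0 := by
      have : (n : ℝ) ≠ 0 := by exact_mod_cast h
      have := Real.pi_pos.ne'
      positivity
    rw [intervalIntegral.integral_comp_mul_left (fun x => Real.cos x) hn, integral_cos]
    have : Real.pi * n / ℓ * ℓ = n * Real.pi := by field_simp
    rw [this, Real.sin_int_mul_pi]
    simp

theorem integral_sineMode_mul {ℓ : ℝ} (hℓ : 0 < ℓ) (j k : ℕ) :
    ∫ s in (0 : ℝ)..ℓ, sineMode ℓ j s * sineMode ℓ k s = if j = k then 1 else 0 := by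
  have h : ∀ s, sineMode ℓ j s * sineMode ℓ k s =
      ℓ⁻¹ * (Real.cos (Real.pi * ((j - k : ℤ) : ℝ) / ℓ * s) -
        Real.cos (Real.pi * ((j + k + 2 : ℤ) : ℝ) / ℓ * s)) := by
    intro s
    have e1 : Real.pi * ((j - k : ℤ) : ℝ) / ℓ * s =
        Real.pi * (j + 1) / ℓ * s - Real.pi * (k + 1) / ℓ * s := by push_cast; ring
    have e2 : Real.pi * ((j + k + 2 : ℤ) : ℝ) / ℓ * s =
        Real.pi * (j + 1) / ℓ * s + Real.pi * (k + 1) / ℓ * s := by push_cast; ring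
    rw [e1, e2, Real.cos_sub, Real.cos_add, sineMode, sineMode]
    have hs : √(2 / ℓ) * √(2 / ℓ) = 2 / ℓ := Real.mul_self_sqrt (by positivity)
    calc _ = (√(2 / ℓ) * √(2 / ℓ)) * (Real.sin (Real.pi * (j + 1) / ℓ * s) *
        Real.sin (Real.pi * (k + 1) / ℓ * s)) := by ring
      _ = _ := by rw [hs]; ring
  simp only [h]
  rw [intervalIntegral.integral_const_mul, intervalIntegral.integral_sub
    ((by fun_prop : Continuous _).intervalIntegrable _ _)
    ((by fun_prop : Continuous _).intervalIntegrable _ _), integral_cos_int hℓ, integral_cos_int hℓ]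
  have h2 : (j + k + 2 : ℤ) ≠ 0 := by positivity
  rw [if_neg h2]
  by_cases hjk : j = k
  · simp [hjk, hℓ.ne']
  · have : (j - k : ℤ) ≠ 0 := by omega
    simp [hjk, this]

theorem integral_sineModeDeriv_mul {ℓ : ℝ} (hℓ : 0 < ℓ) (j k : ℕ) :
    ∫ s in (0 : ℝ)..ℓ, sineModeDeriv ℓ j s * sineModeDeriv ℓ k s =
      if j = k then dirichletFreq ℓ k else 0 := by
  have h : ∀ s, sineModeDeriv ℓ j s * sineModeDeriv ℓ k s =
      ℓ⁻¹ * (Real.pi * (j + 1) / ℓ * (Real.pi * (k + 1) / ℓ)) *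
        (Real.cos (Real.pi * ((j - k : ℤ) : ℝ) / ℓ * s) +
        Real.cos (Real.pi * ((j + k + 2 : ℤ) : ℝ) / ℓ * s)) := by
    intro s
    have e1 : Real.pi * ((j - k : ℤ) : ℝ) / ℓ * s =
        Real.pi * (j + 1) / ℓ * s - Real.pi * (k + 1) / ℓ * s := by push_cast; ring
    have e2 : Real.pi * ((j + k + 2 : ℤ) : ℝ) / ℓ * s =
        Real.pi * (j + 1) / ℓ * s + Real.pi * (k + 1) / ℓ * s := by push_cast; ring
    rw [e1, e2, Real.cos_sub, Real.cos_add, sineModeDeriv, sineModeDeriv]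
    have hs : √(2 / ℓ) * √(2 / ℓ) = 2 / ℓ := Real.mul_self_sqrt (by positivity)
    calc _ = (√(2 / ℓ) * √(2 / ℓ)) * (Real.pi * (j + 1) / ℓ * (Real.pi * (k + 1) / ℓ)) *
        (Real.cos (Real.pi * (j + 1) / ℓ * s) * Real.cos (Real.pi * (k + 1) / ℓ * s)) := by ring
      _ = _ := by rw [hs]; ring
  simp only [h]
  rw [intervalIntegral.integral_const_mul, intervalIntegral.integral_add
    ((by fun_prop : Continuous _).intervalIntegrable _ _)
    ((by fun_prop : Continuous _).intervalIntegrable _ _), integral_cos_int hℓ, integral_cos_int hℓ]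
  have h2 : (j + k + 2 : ℤ) ≠ 0 := by positivity
  rw [if_neg h2]
  by_cases hjk : j = k
  · simp [hjk, dirichletFreq]
    field_simp
  · have : (j - k : ℤ) ≠ 0 := by omega
    simp [hjk, this]

/-- The Fourier coefficient of `f` with respect to a Dirichlet eigenfunction. -/
def sineCoeff (ℓ : ℝ) (k : ℕ) (f : ℝ → ℂ) : ℂ := ∫ s in (0 : ℝ)..ℓ, (sineMode ℓ k s : ℂ) * f s

/-- The odd extension of a function on `[0, ∞)`. -/
def oddExtension (g : ℝ → ℂ) (s : ℝ) : ℂ := if 0 ≤ s then g s else -g (-s)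

/-- The Fourier series of the odd extension on `(-ℓ, ℓ)` is the sine series of `g`. -/
theorem fourierCoeffOn_oddExtension {ℓ : ℝ} (hℓ : 0 < ℓ) {g : ℝ → ℂ} (hg : Continuous g)
    (hG : Continuous (oddExtension g)) (n : ℤ) :
    fourierCoeffOn (show -ℓ < ℓ by linarith) (oddExtension g) n =
      -(Complex.I / ℓ) * ∫ s in (0 : ℝ)..ℓ, (Real.sin (Real.pi * n / ℓ * s) : ℂ) * g s := by
  rw [fourierCoeffOn_eq_integral]
  have hexp : ∀ s : ℝ, fourier (-n) (s : AddCircle (ℓ - -ℓ)) =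
      Complex.exp (-(Real.pi * n / ℓ * s : ℝ) * Complex.I) := by
    intro s
    rw [fourier_coe_apply]
    congr 1
    have : (ℓ : ℂ) ≠ 0 := by exact_mod_cast hℓ.ne'
    push_cast
    have h2 : (ℓ : ℂ) - -ℓ = 2 * ℓ := by ring
    rw [h2]
    field_simp
  simp only [hexp, smul_eq_mul]
  have hc : Continuous fun s : ℝ =>
      Complex.exp (-(Real.pi * n / ℓ * s : ℝ) * Complex.I) * oddExtension g s := by fun_prop
  rw [← intervalIntegral.integral_add_adjacent_intervals (b := 0) (hc.intervalIntegrable _ _)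
    (hc.intervalIntegrable _ _)]
  have h1 : ∫ s in (-ℓ)..0, Complex.exp (-(Real.pi * n / ℓ * s : ℝ) * Complex.I) * oddExtension g s =
      ∫ s in (0 : ℝ)..ℓ, -(Complex.exp ((Real.pi * n / ℓ * s : ℝ) * Complex.I) * g s) := by
    rw [← neg_zero, ← intervalIntegral.integral_comp_neg, neg_zero]
    refine intervalIntegral.integral_congr_Ioo_of_le hℓ.le fun s hs => ?_
    have : ¬ (0 ≤ -s) := by have := hs.1; linarith
    simp only [oddExtension, this, if_false]
    push_cast
    ring_nf
  have h2 : ∫ s in (0 : ℝ)..ℓ, Complex.exp (-(Real.pi * n / ℓ * s : ℝ) * Complex.I) * oddExtension g s =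
      ∫ s in (0 : ℝ)..ℓ, Complex.exp (-(Real.pi * n / ℓ * s : ℝ) * Complex.I) * g s := by
    refine intervalIntegral.integral_congr_Ioo_of_le hℓ.le fun s hs => ?_
    simp only [oddExtension, hs.1.le, if_true]
  rw [h1, h2, ← intervalIntegral.integral_add
    ((by fun_prop : Continuous _).intervalIntegrable _ _)
    ((by fun_prop : Continuous _).intervalIntegrable _ _), ← intervalIntegral.integral_const_mul,
    ← intervalIntegral.integral_smul]
  refine intervalIntegral.integral_congr fun s _ => ?_
  have hsin : (Real.sin (Real.pi * n / ℓ * s) : ℂ) =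
      (Complex.exp (-(Real.pi * n / ℓ * s : ℝ) * Complex.I) -
        Complex.exp ((Real.pi * n / ℓ * s : ℝ) * Complex.I)) * Complex.I / 2 := by
    rw [Complex.ofReal_sin, Complex.sin]
  simp only [hsin, Complex.real_smul]
  have : (ℓ : ℂ) ≠ 0 := by exact_mod_cast hℓ.ne'
  generalize Complex.exp (-(Real.pi * n / ℓ * s : ℝ) * Complex.I) = a
  generalize Complex.exp ((Real.pi * n / ℓ * s : ℝ) * Complex.I) = b
  push_cast
  have h3 : (ℓ : ℂ) - -ℓ = 2 * ℓ := by ring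
  rw [h3]
  field_simp
  linear_combination (g s * (a - b)) * Complex.I_sq

theorem norm_sq_fourierCoeffOn_oddExtension {ℓ : ℝ} (hℓ : 0 < ℓ) {g : ℝ → ℂ} (hg : Continuous g)
    (hG : Continuous (oddExtension g)) (k : ℕ) {n : ℤ} (hn : n = k + 1 ∨ n = -(k + 1)) :
    ‖fourierCoeffOn (show -ℓ < ℓ by linarith) (oddExtension g) n‖ ^ 2 =
      ‖sineCoeff ℓ k g‖ ^ 2 / (2 * ℓ) := by
  rw [fourierCoeffOn_oddExtension hℓ hg hG]
  have h1 : ‖∫ s in (0 : ℝ)..ℓ, (Real.sin (Real.pi * n / ℓ * s) : ℂ) * g s‖ =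
      ‖∫ s in (0 : ℝ)..ℓ, (Real.sin (Real.pi * (k + 1) / ℓ * s) : ℂ) * g s‖ := by
    rcases hn with rfl | rfl
    · push_cast; rfl
    · rw [← norm_neg, ← intervalIntegral.integral_neg]
      congr 1
      refine intervalIntegral.integral_congr fun s _ => ?_
      have : Real.pi * ((-(k + 1) : ℤ) : ℝ) / ℓ * s = -(Real.pi * (k + 1) / ℓ * s) := by
        push_cast; ring
      simp only [this, Real.sin_neg]
      push_cast
      ring
  have h2 : sineCoeff ℓ k g =
      (√(2 / ℓ) : ℂ) * ∫ s in (0 : ℝ)..ℓ, (Real.sin (Real.pi * (k + 1) / ℓ * s) : ℂ) * g s := by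
    rw [sineCoeff, ← intervalIntegral.integral_const_mul]
    refine intervalIntegral.integral_congr fun s _ => ?_
    simp only [sineMode]
    push_cast
    ring
  have h3 : √(2 / ℓ) ^ 2 = 2 / ℓ := Real.sq_sqrt (by positivity)
  rw [h2, norm_mul, norm_mul, h1, mul_pow, mul_pow, Complex.norm_real, Real.norm_eq_abs, sq_abs, h3,
    norm_neg, norm_div, Complex.norm_I, Complex.norm_real, Real.norm_eq_abs, div_pow, sq_abs]
  field_simp

theorem integral_comp_abs_symm {ℓ : ℝ} {h : ℝ → ℝ} (hh : Continuous h) :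
    ∫ s in (-ℓ)..ℓ, h |s| = 2 * ∫ s in (0 : ℝ)..ℓ, h |s| := by
  have hc : Continuous fun s : ℝ => h |s| := by fun_prop
  rw [← intervalIntegral.integral_add_adjacent_intervals (b := 0) (hc.intervalIntegrable _ _)
    (hc.intervalIntegrable _ _)]
  have : ∫ s in (-ℓ)..0, h |s| = ∫ s in (0 : ℝ)..ℓ, h |s| := by
    rw [← neg_zero, ← intervalIntegral.integral_comp_neg, neg_zero]
    simp
  rw [this]
  ring

/-- The odd extension has the right derivative of the even extension of `g'`, without any condition
on `g 0`; at the jump at `0` only the right derivative exists. -/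
theorem hasDerivWithinAt_oddExtension {g g' : ℝ → ℂ} (hg : ∀ s, HasDerivAt g (g' s) s) (s : ℝ) :
    HasDerivWithinAt (oddExtension g) (g' |s|) (Ioi s) s := by
  rcases le_or_gt 0 s with hs | hs
  · rw [abs_of_nonneg hs]
    refine (hg s).hasDerivWithinAt.congr (fun y hy => ?_) ?_
    · simp only [oddExtension, (hs.trans (mem_Ioi.mp hy).le), if_true]
    · simp only [oddExtension, hs, if_true]
  · rw [abs_of_neg hs]
    refine HasDerivAt.hasDerivWithinAt ?_
    have h1 : HasDerivAt (fun y => -g (-y)) (g' (-s)) s := by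
      have := ((hg (-s)).scomp s (hasDerivAt_neg s)).neg
      rw [neg_smul, one_smul, neg_neg] at this
      exact this
    refine h1.congr_of_eventuallyEq ?_
    filter_upwards [Iio_mem_nhds hs] with y hy
    simp only [oddExtension, not_le.mpr (mem_Iio.mp hy), if_false]

/-- **Poincaré inequality** on an interval: the Dirichlet energy is at least `x` on the functions
orthogonal to the eigenfunctions with eigenvalue less than `x`. -/
theorem dirichlet_energy_lower_bound {ℓ : ℝ} (hℓ : 0 < ℓ) {g g' : ℝ → ℂ}
    (hg : ∀ s, HasDerivAt g (g' s) s) (hg' : Continuous g') (h0 : g 0 = 0) (hl : g ℓ = 0)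
    {x : ℝ} (hx : 0 ≤ x) {K : ℕ} (hK : x ≤ dirichletFreq ℓ K) :
    x * ∫ s in (0 : ℝ)..ℓ, ‖g s‖ ^ 2 ≤
      (∫ s in (0 : ℝ)..ℓ, ‖g' s‖ ^ 2) + x * ∑ k ∈ Finset.range K, ‖sineCoeff ℓ k g‖ ^ 2 := by
  have hgc : Continuous g := continuous_iff_continuousAt.mpr fun s => (hg s).continuousAt
  have hG : Continuous (oddExtension g) := by
    unfold oddExtension
    refine Continuous.if_le hgc (hgc.comp continuous_neg).neg continuous_const continuous_id ?_
    rintro s (rfl : (0 : ℝ) = s)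
    simp [h0]
  have hG' : Continuous fun s : ℝ => g' |s| := by fun_prop
  have hlt : -ℓ < ℓ := by linarith
  have hmem : ∀ f : ℝ → ℂ, Continuous f → MemLp f 2 (volume.restrict (Ioc (-ℓ) ℓ)) := by
    intro f hf
    obtain ⟨C, hC⟩ := isCompact_Icc.exists_bound_of_continuousOn (hf.continuousOn (s := Icc (-ℓ) ℓ))
    exact MemLp.of_bound hf.aestronglyMeasurable C
      ((ae_restrict_iff' measurableSet_Ioc).mpr (Eventually.of_forall fun s hs =>
        hC s (Ioc_subset_Icc_self hs)))
  have hA := hasSum_sq_fourierCoeffOn hlt (hmem _ hG)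
  have hB := hasSum_sq_fourierCoeffOn hlt (hmem _ hG')
  set c : ℤ → ℂ := fourierCoeffOn hlt (oddExtension g) with hc
  have hcoef : ∀ n : ℤ, (Real.pi * n / ℓ) ^ 2 * ‖c n‖ ^ 2 ≤
      ‖fourierCoeffOn hlt (fun s => g' |s|) n‖ ^ 2 := by
    intro n
    by_cases hn : n = 0
    · simp only [hn, Int.cast_zero, mul_zero, zero_div, ne_eq, OfNat.ofNat_ne_zero,
        not_false_eq_true, zero_pow, zero_mul]
      positivity
    have h1 := fourierCoeffOn_of_hasDeriv_right hlt hn (f := oddExtension g)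
      (f' := fun s => g' |s|) hG.continuousOn (fun s _ => hasDerivWithinAt_oddExtension hg s)
      (hG'.intervalIntegrable _ _)
    have e1 : oddExtension g ℓ = 0 := by simp [oddExtension, hℓ.le, hl]
    have e2 : oddExtension g (-ℓ) = 0 := by simp [oddExtension, not_le.mpr hℓ, hl]
    rw [e1, e2, sub_zero, mul_zero, zero_sub] at h1
    have hn' : (n : ℝ) ≠ 0 := by exact_mod_cast hn
    have hpi := Real.pi_pos.ne'
    have h2 : ‖c n‖ = 1 / (2 * Real.pi * |(n : ℝ)|) *
        (2 * ℓ * ‖fourierCoeffOn hlt (fun s => g' |s|) n‖) := by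
      rw [hc, h1]
      have : ((ℓ : ℂ) - (-ℓ : ℝ)) = ((2 * ℓ : ℝ) : ℂ) := by push_cast; ring
      rw [this]
      simp only [norm_mul, norm_neg, norm_div, Complex.norm_real, Complex.norm_I, norm_one,
        Complex.norm_intCast, Real.norm_eq_abs, abs_of_pos Real.pi_pos, Complex.norm_ofNat,
        abs_mul, abs_of_pos hℓ, Nat.abs_ofNat, mul_one]
    rw [h2]
    refine le_of_eq ?_
    have h3 : |(n : ℝ)| ^ 2 = (n : ℝ) ^ 2 := sq_abs _
    have h4 : |(n : ℝ)| ≠ 0 := abs_ne_zero.mpr hn'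
    rw [div_pow, mul_pow, mul_pow, mul_pow, ← h3]
    field_simp
  -- the frequencies `±(k + 1)` with `k < K`
  set F : Finset ℤ := (Finset.range K).image (fun k : ℕ => (k + 1 : ℤ)) ∪
    (Finset.range K).image (fun k : ℕ => -(k + 1 : ℤ)) with hF
  have hF' : HasSum (fun n => if n ∈ F then x * ‖c n‖ ^ 2 else 0) (∑ n ∈ F, x * ‖c n‖ ^ 2) := by
    have : HasSum (fun n => if n ∈ F then x * ‖c n‖ ^ 2 else 0)
        (∑ n ∈ F, if n ∈ F then x * ‖c n‖ ^ 2 else 0) :=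
      hasSum_sum_of_ne_finset_zero fun n hn => if_neg hn
    convert this using 1
    exact Finset.sum_congr rfl fun n hn => (if_pos hn).symm
  have hc0 : c 0 = 0 := by
    rw [hc, fourierCoeffOn_oddExtension hℓ hgc hG]
    simp
  have hle : x * ((ℓ - -ℓ)⁻¹ • ∫ s in (-ℓ)..ℓ, ‖oddExtension g s‖ ^ 2) ≤
      ((ℓ - -ℓ)⁻¹ • ∫ s in (-ℓ)..ℓ, ‖g' |s|‖ ^ 2) + ∑ n ∈ F, x * ‖c n‖ ^ 2 := by
    refine hasSum_le (fun n => ?_) (hA.mul_left x) (hB.add hF')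
    have h1 := hcoef n
    have h2 : 0 ≤ x * ‖c n‖ ^ 2 := by positivity
    split_ifs with hnF
    · have : 0 ≤ ‖fourierCoeffOn hlt (fun s => g' |s|) n‖ ^ 2 := by positivity
      linarith
    · rw [add_zero]
      by_cases hn : n = 0
      · rw [hn, hc0, norm_zero]
        simp only [ne_eq, OfNat.ofNat_ne_zero, not_false_eq_true, zero_pow, mul_zero]
        positivity
      refine le_trans ?_ h1
      refine mul_le_mul_of_nonneg_right (hK.trans ?_) (by positivity)
      have hKn : ((K : ℝ) + 1) ≤ |(n : ℝ)| := by
        by_contra hlt'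
        have h5 : |n| < K + 1 := by
          have : ((|n| : ℤ) : ℝ) < ((K + 1 : ℤ) : ℝ) := by push_cast; linarith
          exact_mod_cast this
        have h7 := abs_lt.mp h5
        refine hnF (Finset.mem_union.mpr ?_)
        rcases lt_trichotomy n 0 with h | h | h
        · refine Or.inr (Finset.mem_image.mpr ⟨n.natAbs - 1, Finset.mem_range.mpr ?_, ?_⟩) <;> omega
        · exact absurd h hn
        · refine Or.inl (Finset.mem_image.mpr ⟨n.natAbs - 1, Finset.mem_range.mpr ?_, ?_⟩) <;> omega
      have h6 : (Real.pi * n / ℓ) ^ 2 = (Real.pi * |(n : ℝ)| / ℓ) ^ 2 := by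
        rw [div_pow, mul_pow, div_pow, mul_pow, sq_abs]
      have := Real.pi_pos
      rw [h6, dirichletFreq]
      gcongr
  have hFsum : ∑ n ∈ F, x * ‖c n‖ ^ 2 = ∑ k ∈ Finset.range K, x * (‖sineCoeff ℓ k g‖ ^ 2 / ℓ) := by
    rw [hF, Finset.sum_union, Finset.sum_image (by intro a _ b _ h; simpa using h),
      Finset.sum_image (by intro a _ b _ h; simpa using h), ← Finset.sum_add_distrib]
    · refine Finset.sum_congr rfl fun k _ => ?_
      rw [hc, norm_sq_fourierCoeffOn_oddExtension hℓ hgc hG k (Or.inl rfl),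
        norm_sq_fourierCoeffOn_oddExtension hℓ hgc hG k (Or.inr rfl)]
      field_simp
      ring
    · rw [Finset.disjoint_left]
      intro n h1 h2
      obtain ⟨a, _, rfl⟩ := Finset.mem_image.mp h1
      obtain ⟨b, _, h⟩ := Finset.mem_image.mp h2
      omega
  have hI1 : ∫ s in (-ℓ)..ℓ, ‖oddExtension g s‖ ^ 2 = 2 * ∫ s in (0 : ℝ)..ℓ, ‖g s‖ ^ 2 := by
    have h1 : ∀ s, ‖oddExtension g s‖ ^ 2 = ‖g |s|‖ ^ 2 := by
      intro s
      rcases le_or_gt 0 s with hs | hs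
      · simp only [oddExtension, hs, if_true, abs_of_nonneg hs]
      · simp only [oddExtension, not_le.mpr hs, if_false, abs_of_neg hs, norm_neg]
    simp only [h1]
    rw [integral_comp_abs_symm (h := fun s => ‖g s‖ ^ 2) (by fun_prop)]
    congr 1
    refine intervalIntegral.integral_congr fun s hs => ?_
    rw [uIcc_of_le hℓ.le] at hs
    simp only [abs_of_nonneg hs.1]
  have hI2 : ∫ s in (-ℓ)..ℓ, ‖g' |s|‖ ^ 2 = 2 * ∫ s in (0 : ℝ)..ℓ, ‖g' s‖ ^ 2 := by
    rw [integral_comp_abs_symm (h := fun s => ‖g' s‖ ^ 2) (by fun_prop)]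
    congr 1
    refine intervalIntegral.integral_congr fun s hs => ?_
    rw [uIcc_of_le hℓ.le] at hs
    simp only [abs_of_nonneg hs.1]
  rw [hI1, hI2, hFsum, ← Finset.mul_sum, ← Finset.sum_div] at hle
  simp only [smul_eq_mul] at hle
  have e : (ℓ - -ℓ)⁻¹ = (2 * ℓ)⁻¹ := by ring_nf
  rw [e] at hle
  have := mul_le_mul_of_nonneg_left hle hℓ.le
  have e1 : ∀ y : ℝ, (2 * ℓ)⁻¹ * (2 * y) = y / ℓ := by intro y; field_simp
  rw [e1, e1] at this
  calc _ = ℓ * (x * ((∫ s in (0 : ℝ)..ℓ, ‖g s‖ ^ 2) / ℓ)) := by field_simp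
    _ ≤ _ := this
    _ = _ := by field_simp

theorem norm_add_sq_le_weighted {V : Type*} [SeminormedAddCommGroup V] (a b : V) {ε : ℝ}
    (hε : 0 < ε) : ‖a + b‖ ^ 2 ≤ (1 + ε) * ‖a‖ ^ 2 + (1 + ε⁻¹) * ‖b‖ ^ 2 := by
  have h1 : ‖a + b‖ ^ 2 ≤ (‖a‖ + ‖b‖) ^ 2 := by gcongr; exact norm_add_le a b
  have h2 : 0 ≤ ε⁻¹ * (ε * ‖a‖ - ‖b‖) ^ 2 := by positivity
  have h3 : ε⁻¹ * (ε * ‖a‖ - ‖b‖) ^ 2 = ε * ‖a‖ ^ 2 - 2 * ‖a‖ * ‖b‖ + ε⁻¹ * ‖b‖ ^ 2 := by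
    field_simp
    ring
  nlinarith

theorem norm_sineCoeff_le {ℓ : ℝ} (hℓ : 0 < ℓ) (k : ℕ) {f : ℝ → ℂ} {C : ℝ}
    (hf : ∀ s ∈ Ioc 0 ℓ, ‖f s‖ ≤ C) : ‖sineCoeff ℓ k f‖ ^ 2 ≤ 2 * ℓ * C ^ 2 := by
  have h1 : ‖sineCoeff ℓ k f‖ ≤ √(2 / ℓ) * C * |ℓ - 0| := by
    refine intervalIntegral.norm_integral_le_of_norm_le_const fun s hs => ?_
    rw [uIoc_of_le hℓ.le] at hs
    rw [norm_mul, Complex.norm_real]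
    refine mul_le_mul ?_ (hf s hs) (norm_nonneg _) (Real.sqrt_nonneg _)
    rw [sineMode, norm_mul, Real.norm_of_nonneg (Real.sqrt_nonneg _)]
    exact mul_le_of_le_one_right (Real.sqrt_nonneg _) (Real.abs_sin_le_one _)
  have h2 : ‖sineCoeff ℓ k f‖ ^ 2 ≤ (√(2 / ℓ) * C * |ℓ - 0|) ^ 2 := by gcongr
  have h3 : √(2 / ℓ) ^ 2 = 2 / ℓ := Real.sq_sqrt (by positivity)
  rw [mul_pow, mul_pow, h3, sq_abs, sub_zero] at h2
  refine h2.trans (le_of_eq ?_)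
  field_simp

/-- The energy with a strong Robin condition at the ends is almost as large as the Dirichlet
energy: subtract the linear interpolant of the boundary values and apply the Dirichlet bound. -/
theorem robin_energy_lower_bound {ℓ : ℝ} (hℓ : 0 < ℓ) {f f' : ℝ → ℂ}
    (hf : ∀ s, HasDerivAt f (f' s) s) (hf' : Continuous f') {x : ℝ} (hx : 0 < x) {K : ℕ}
    (hK : x ≤ dirichletFreq ℓ K) {β : ℝ} (hβ : 0 < β) (hβK : 8 * x * K * ℓ ≤ β) :
    x * ∫ s in (0 : ℝ)..ℓ, ‖f s‖ ^ 2 ≤ (1 + 2 * x * ℓ / β) *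
      ((∫ s in (0 : ℝ)..ℓ, ‖f' s‖ ^ 2) + β * (‖f 0‖ ^ 2 + ‖f ℓ‖ ^ 2) +
        2 * x * ∑ k ∈ Finset.range K, ‖sineCoeff ℓ k f‖ ^ 2) := by
  have hfc : Continuous f := continuous_iff_continuousAt.mpr fun s => (hf s).continuousAt
  set v : ℂ := (f ℓ - f 0) / ℓ with hv
  set L : ℝ → ℂ := fun s => f 0 + s * v with hL
  have hℓ' : (ℓ : ℂ) ≠ 0 := by exact_mod_cast hℓ.ne'
  have hLd : ∀ s, HasDerivAt L v s := by
    intro s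
    have := ((Complex.ofRealCLM.hasDerivAt (x := s)).mul_const v).const_add (f 0)
    rw [Complex.ofRealCLM_apply, Complex.ofReal_one, one_mul] at this
    exact this
  have hLc : Continuous L := by rw [hL]; fun_prop
  set p : ℝ := ‖f 0‖ ^ 2 + ‖f ℓ‖ ^ 2 with hp
  have hp0 : 0 ≤ p := by positivity
  have hLp : ∀ s ∈ Icc (0 : ℝ) ℓ, ‖L s‖ ^ 2 ≤ p := by
    intro s hs
    have e : L s = ((1 - s / ℓ : ℝ) : ℂ) * f 0 + ((s / ℓ : ℝ) : ℂ) * f ℓ := by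
      simp only [hL, hv]
      push_cast
      field_simp
      ring
    have t0 : 0 ≤ s / ℓ := div_nonneg hs.1 hℓ.le
    have t1 : s / ℓ ≤ 1 := (div_le_one hℓ).mpr hs.2
    have h1 : ‖L s‖ ≤ (1 - s / ℓ) * ‖f 0‖ + s / ℓ * ‖f ℓ‖ := by
      rw [e]
      refine (norm_add_le _ _).trans (le_of_eq ?_)
      rw [norm_mul, norm_mul, Complex.norm_of_nonneg (by linarith), Complex.norm_of_nonneg t0]
    have h2 : ‖L s‖ ^ 2 ≤ ((1 - s / ℓ) * ‖f 0‖ + s / ℓ * ‖f ℓ‖) ^ 2 := by gcongr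
    refine h2.trans ?_
    generalize s / ℓ = t at t0 t1
    have h3 : 0 ≤ t * (1 - t) * (‖f 0‖ - ‖f ℓ‖) ^ 2 := by
      have : 0 ≤ 1 - t := by linarith
      positivity
    have h4 : 0 ≤ t * ‖f 0‖ ^ 2 := by positivity
    have h5 : 0 ≤ (1 - t) * ‖f ℓ‖ ^ 2 := by
      have : 0 ≤ 1 - t := by linarith
      positivity
    nlinarith
  set g : ℝ → ℂ := fun s => f s - L s with hg
  set g' : ℝ → ℂ := fun s => f' s - v with hg'
  have hgd : ∀ s, HasDerivAt g (g' s) s := fun s => (hf s).sub (hLd s)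
  have hgc : Continuous g := hfc.sub hLc
  have hg0 : g 0 = 0 := by simp [hg, hL]
  have hgl : g ℓ = 0 := by
    simp only [hg, hL, hv]
    field_simp
    ring
  have hD := dirichlet_energy_lower_bound hℓ hgd (by fun_prop) hg0 hgl hx.le hK
  -- the linear interpolant is orthogonal to `g` for the Dirichlet form
  have hE : ∫ s in (0 : ℝ)..ℓ, ‖g' s‖ ^ 2 ≤ ∫ s in (0 : ℝ)..ℓ, ‖f' s‖ ^ 2 := by
    have e1 : ∀ s, ‖f' s‖ ^ 2 = ‖g' s‖ ^ 2 + (‖v‖ ^ 2 + 2 * (inner ℝ (g' s) v)) := by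
      intro s
      have : f' s = g' s + v := by simp [hg']
      rw [this, norm_add_sq_real]
      ring
    have e2 : ∫ s in (0 : ℝ)..ℓ, inner ℝ (g' s) v = 0 := by
      have h1 : ∀ s, HasDerivAt (fun s => inner ℝ (g s) v) (inner ℝ (g' s) v) s := by
        intro s
        have := (hgd s).inner ℝ (hasDerivAt_const s v)
        simpa using this
      rw [intervalIntegral.integral_eq_sub_of_hasDerivAt (fun s _ => h1 s)
        ((by fun_prop : Continuous _).intervalIntegrable _ _), hg0, hgl]
      simp
    simp only [e1]
    rw [intervalIntegral.integral_add ((by fun_prop : Continuous _).intervalIntegrable _ _)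
      ((by fun_prop : Continuous _).intervalIntegrable _ _),
      intervalIntegral.integral_add ((by fun_prop : Continuous _).intervalIntegrable _ _)
      ((by fun_prop : Continuous _).intervalIntegrable _ _),
      intervalIntegral.integral_const_mul, e2]
    simp only [intervalIntegral.integral_const, smul_eq_mul, sub_zero, mul_zero, add_zero]
    have : 0 ≤ ℓ * ‖v‖ ^ 2 := by positivity
    linarith
  have hcoef : ∀ k, ‖sineCoeff ℓ k g‖ ^ 2 ≤ 2 * ‖sineCoeff ℓ k f‖ ^ 2 + 4 * ℓ * p := by
    intro k
    have e1 : sineCoeff ℓ k g = sineCoeff ℓ k f + -sineCoeff ℓ k L := by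
      have := (continuous_sineMode ℓ k)
      rw [sineCoeff, sineCoeff, sineCoeff, ← sub_eq_add_neg, ← intervalIntegral.integral_sub
        ((by fun_prop : Continuous _).intervalIntegrable _ _)
        ((by fun_prop : Continuous _).intervalIntegrable _ _)]
      simp only [hg, mul_sub]
    have h1 := norm_add_sq_le_weighted (sineCoeff ℓ k f) (-sineCoeff ℓ k L) one_pos
    have h2 : ‖sineCoeff ℓ k L‖ ^ 2 ≤ 2 * ℓ * √p ^ 2 :=
      norm_sineCoeff_le hℓ k fun s hs => Real.le_sqrt_of_sq_le (hLp s (Ioc_subset_Icc_self hs))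
    rw [Real.sq_sqrt hp0] at h2
    rw [e1]
    rw [norm_neg] at h1
    norm_num at h1
    linarith
  have hsum : ∑ k ∈ Finset.range K, ‖sineCoeff ℓ k g‖ ^ 2 ≤
      2 * ∑ k ∈ Finset.range K, ‖sineCoeff ℓ k f‖ ^ 2 + K * (4 * ℓ * p) := by
    refine (Finset.sum_le_sum fun k _ => hcoef k).trans (le_of_eq ?_)
    rw [Finset.sum_add_distrib, ← Finset.mul_sum]
    simp
  set ε : ℝ := 2 * x * ℓ / β with hε
  have hε0 : 0 < ε := by positivity
  have hnorm : ∫ s in (0 : ℝ)..ℓ, ‖f s‖ ^ 2 ≤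
      (1 + ε) * (∫ s in (0 : ℝ)..ℓ, ‖g s‖ ^ 2) + (1 + ε⁻¹) * (ℓ * p) := by
    have : ∫ s in (0 : ℝ)..ℓ, ‖f s‖ ^ 2 ≤
        ∫ s in (0 : ℝ)..ℓ, ((1 + ε) * ‖g s‖ ^ 2 + (1 + ε⁻¹) * p) := by
      refine intervalIntegral.integral_mono_on hℓ.le
        ((by fun_prop : Continuous _).intervalIntegrable _ _)
        ((by fun_prop : Continuous _).intervalIntegrable _ _) fun s hs => ?_
      have e : f s = g s + L s := by simp [hg]
      rw [e]
      refine (norm_add_sq_le_weighted _ _ hε0).trans ?_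
      gcongr
      exact hLp s hs
    refine this.trans (le_of_eq ?_)
    rw [intervalIntegral.integral_add ((by fun_prop : Continuous _).intervalIntegrable _ _)
      ((by fun_prop : Continuous _).intervalIntegrable _ _), intervalIntegral.integral_const_mul]
    simp only [intervalIntegral.integral_const, smul_eq_mul, sub_zero]
    ring
  set Sf := ∑ k ∈ Finset.range K, ‖sineCoeff ℓ k f‖ ^ 2
  set Sg := ∑ k ∈ Finset.range K, ‖sineCoeff ℓ k g‖ ^ 2
  set If := ∫ s in (0 : ℝ)..ℓ, ‖f s‖ ^ 2
  set Ig := ∫ s in (0 : ℝ)..ℓ, ‖g s‖ ^ 2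
  set Jf := ∫ s in (0 : ℝ)..ℓ, ‖f' s‖ ^ 2
  set Jg := ∫ s in (0 : ℝ)..ℓ, ‖g' s‖ ^ 2
  have k1 : x * Ig ≤ Jf + x * (2 * Sf + K * (4 * ℓ * p)) := by
    have := mul_le_mul_of_nonneg_left hsum hx.le
    linarith
  have k2 : x * (1 + ε⁻¹) * (ℓ * p) = (1 + ε) * (β / 2) * p := by
    rw [hε]
    field_simp
    ring
  calc x * If ≤ x * ((1 + ε) * Ig + (1 + ε⁻¹) * (ℓ * p)) := by gcongr
    _ = (1 + ε) * (x * Ig) + x * (1 + ε⁻¹) * (ℓ * p) := by ring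
    _ = (1 + ε) * (x * Ig + β / 2 * p) := by rw [k2]; ring
    _ ≤ (1 + ε) * (Jf + β * p + 2 * x * Sf) := by
        refine mul_le_mul_of_nonneg_left ?_ (by positivity)
        have := mul_le_mul_of_nonneg_right hβK hp0
        linarith

end Interval

/-! ### Test functions close to the Dirichlet eigenfunctions -/

section Approximation

theorem exists_bound_deriv_smoothTransition :
    ∃ C : ℝ, ∀ y : ℝ, |(y + 1) * deriv Real.smoothTransition y| ≤ C := by
  have hc : Continuous fun y : ℝ => (y + 1) * deriv Real.smoothTransition y :=
    (by fun_prop : Continuous fun y : ℝ => y + 1).mul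
      ((Real.smoothTransition.contDiff (n := 1)).continuous_deriv le_rfl)
  have hs : HasCompactSupport fun y : ℝ => (y + 1) * deriv Real.smoothTransition y := by
    refine HasCompactSupport.intro (isCompact_Icc (a := (0 : ℝ)) (b := 1)) fun y hy => ?_
    have : deriv Real.smoothTransition y = 0 := by
      rcases lt_or_ge y 0 with h | h
      · have : Real.smoothTransition =ᶠ[𝓝 y] fun _ => 0 := by
          filter_upwards [Iio_mem_nhds h] with z hz
          exact Real.smoothTransition.zero_of_nonpos (mem_Iio.mp hz).le
        rw [this.deriv_eq, deriv_const]
      · have h1 : 1 < y := by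
          by_contra hcon
          exact hy ⟨h, not_lt.mp hcon⟩
        have : Real.smoothTransition =ᶠ[𝓝 y] fun _ => 1 := by
          filter_upwards [Ioi_mem_nhds h1] with z hz
          exact Real.smoothTransition.one_of_one_le (mem_Ioi.mp hz).le
        rw [this.deriv_eq, deriv_const]
    rw [this, mul_zero]
  obtain ⟨C, hC⟩ := hs.exists_bound_of_continuous hc
  exact ⟨C, hC⟩

/-- A smooth cutoff function of the interval `(0, ℓ)`, equal to `1` at distance `2/n` from the
ends and vanishing at distance `1/n`. -/
def intervalCutoff (ℓ : ℝ) (n : ℕ) (s : ℝ) : ℝ :=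
  Real.smoothTransition (n * s - 1) * Real.smoothTransition (n * (ℓ - s) - 1)

/-- The derivative of `intervalCutoff`. -/
def intervalCutoffDeriv (ℓ : ℝ) (n : ℕ) (s : ℝ) : ℝ :=
  deriv Real.smoothTransition (n * s - 1) * n * Real.smoothTransition (n * (ℓ - s) - 1) +
    Real.smoothTransition (n * s - 1) * (deriv Real.smoothTransition (n * (ℓ - s) - 1) * (-n))

theorem hasDerivAt_intervalCutoff (ℓ : ℝ) (n : ℕ) (s : ℝ) :
    HasDerivAt (intervalCutoff ℓ n) (intervalCutoffDeriv ℓ n s) s := by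
  have hσ : ∀ y, HasDerivAt Real.smoothTransition (deriv Real.smoothTransition y) y := fun y =>
    ((Real.smoothTransition.contDiff (n := 1)).differentiable (by simp) y).hasDerivAt
  have h1 : HasDerivAt (fun s : ℝ => n * s - 1) (n : ℝ) s := by
    simpa using ((hasDerivAt_id s).const_mul (n : ℝ)).sub_const 1
  have h2 : HasDerivAt (fun s : ℝ => n * (ℓ - s) - 1) (-(n : ℝ)) s := by
    simpa using (((hasDerivAt_id s).const_sub ℓ).const_mul (n : ℝ)).sub_const 1
  exact ((hσ _).comp s h1).mul ((hσ _).comp s h2)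

theorem contDiff_intervalCutoff (ℓ : ℝ) (n : ℕ) : ContDiff ℝ ∞ (intervalCutoff ℓ n) :=
  (Real.smoothTransition.contDiff.comp (by fun_prop)).mul
    (Real.smoothTransition.contDiff.comp (by fun_prop))

theorem abs_intervalCutoff_le (ℓ : ℝ) (n : ℕ) (s : ℝ) : |intervalCutoff ℓ n s| ≤ 1 := by
  rw [intervalCutoff, abs_mul, abs_of_nonneg (Real.smoothTransition.nonneg _),
    abs_of_nonneg (Real.smoothTransition.nonneg _)]
  exact mul_le_one₀ (Real.smoothTransition.le_one _) (Real.smoothTransition.nonneg _)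
    (Real.smoothTransition.le_one _)

theorem intervalCutoff_eq_zero {ℓ : ℝ} {n : ℕ} {s : ℝ} (hn : 1 ≤ n)
    (hs : s ∉ Icc (1 / (n : ℝ)) (ℓ - 1 / n)) : intervalCutoff ℓ n s = 0 := by
  have hn' : (0 : ℝ) < n := by exact_mod_cast hn
  rw [intervalCutoff]
  by_cases h : s < 1 / n
  · rw [Real.smoothTransition.zero_of_nonpos, zero_mul]
    rw [lt_div_iff₀ hn'] at h
    linarith
  · rw [Real.smoothTransition.zero_of_nonpos (x := n * (ℓ - s) - 1), mul_zero]
    have h2 : ℓ - s < 1 / n := by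
      by_contra hcon
      exact hs ⟨not_lt.mp h, by linarith⟩
    rw [lt_div_iff₀ hn'] at h2
    linarith

theorem eventually_intervalCutoff {ℓ s : ℝ} (hs : s ∈ Ioo 0 ℓ) :
    ∀ᶠ n : ℕ in atTop, intervalCutoff ℓ n s = 1 ∧ intervalCutoffDeriv ℓ n s = 0 := by
  have h1 : Tendsto (fun n : ℕ => (n : ℝ) * s - 1) atTop atTop :=
    tendsto_atTop_add_const_right _ _ (tendsto_natCast_atTop_atTop.atTop_mul_const hs.1)
  have h2 : Tendsto (fun n : ℕ => (n : ℝ) * (ℓ - s) - 1) atTop atTop :=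
    tendsto_atTop_add_const_right _ _
      (tendsto_natCast_atTop_atTop.atTop_mul_const (sub_pos.mpr hs.2))
  have hd : ∀ y : ℝ, 1 < y → deriv Real.smoothTransition y = 0 := by
    intro y hy
    have : Real.smoothTransition =ᶠ[𝓝 y] fun _ => 1 := by
      filter_upwards [Ioi_mem_nhds hy] with z hz
      exact Real.smoothTransition.one_of_one_le (mem_Ioi.mp hz).le
    rw [this.deriv_eq, deriv_const]
  filter_upwards [h1.eventually_gt_atTop 1, h2.eventually_gt_atTop 1] with n hn1 hn2
  rw [intervalCutoff, intervalCutoffDeriv, hd _ hn1, hd _ hn2,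
    Real.smoothTransition.one_of_one_le hn1.le, Real.smoothTransition.one_of_one_le hn2.le]
  simp

theorem abs_sineMode_le (ℓ : ℝ) (k : ℕ) (s : ℝ) : |sineMode ℓ k s| ≤ √(2 / ℓ) := by
  rw [sineMode, abs_mul, abs_of_nonneg (Real.sqrt_nonneg _)]
  exact mul_le_of_le_one_right (Real.sqrt_nonneg _) (Real.abs_sin_le_one _)

theorem abs_sineModeDeriv_le (ℓ : ℝ) (k : ℕ) (s : ℝ) :
    |sineModeDeriv ℓ k s| ≤ √(2 / ℓ) * |Real.pi * (k + 1) / ℓ| := by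
  rw [sineModeDeriv, abs_mul, abs_mul, abs_of_nonneg (Real.sqrt_nonneg _)]
  refine mul_le_mul_of_nonneg_left ?_ (Real.sqrt_nonneg _)
  exact mul_le_of_le_one_right (abs_nonneg _) (Real.abs_cos_le_one _)

theorem abs_sineMode_sub_le (ℓ : ℝ) (k : ℕ) (s t : ℝ) :
    |sineMode ℓ k s - sineMode ℓ k t| ≤ √(2 / ℓ) * |Real.pi * (k + 1) / ℓ| * |s - t| := by
  have := Convex.norm_image_sub_le_of_norm_hasDerivWithin_le (s := univ) (x := t) (y := s)
    (fun y _ => (hasDerivAt_sineMode ℓ k y).hasDerivWithinAt)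
    (fun y _ => abs_sineModeDeriv_le ℓ k y) convex_univ (mem_univ _) (mem_univ _)
  exact this

/-- The Dirichlet eigenfunctions are limits in `W^{1,2}` of test functions with support in
`(0, ℓ)`. -/
theorem exists_test_near_sineMode {ℓ : ℝ} (hℓ : 0 < ℓ) (k : ℕ) {ε : ℝ} (hε : 0 < ε) :
    ∃ χ : testFunctions ℝ, tsupport (χ : ℝ → ℂ) ⊆ Ioo 0 ℓ ∧
      (∫ s in Ioo 0 ℓ, ‖(χ : ℝ → ℂ) s - sineMode ℓ k s‖ ^ 2) ≤ ε ∧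
      (∫ s in Ioo 0 ℓ, ‖fderiv ℝ (χ : ℝ → ℂ) s 1 - sineModeDeriv ℓ k s‖ ^ 2) ≤ ε := by
  obtain ⟨C, hC⟩ := exists_bound_deriv_smoothTransition
  have hC0 : 0 ≤ C := (abs_nonneg _).trans (hC 0)
  set B := √(2 / ℓ) * |Real.pi * (k + 1) / ℓ| with hB
  have hB0 : 0 ≤ B := by positivity
  set F : ℕ → ℝ → ℝ := fun n s => intervalCutoff ℓ n s * sineMode ℓ k s with hF
  set F' : ℕ → ℝ → ℝ := fun n s => intervalCutoffDeriv ℓ n s * sineMode ℓ k s +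
    intervalCutoff ℓ n s * sineModeDeriv ℓ k s with hF'
  have hFd : ∀ n s, HasDerivAt (F n) (F' n s) s := fun n s =>
    (hasDerivAt_intervalCutoff ℓ n s).mul (hasDerivAt_sineMode ℓ k s)
  have hFs : ∀ n, ContDiff ℝ ∞ (F n) := fun n =>
    (contDiff_intervalCutoff ℓ n).mul (contDiff_sineMode ℓ k)
  have hF'c : ∀ n, Continuous (F' n) := fun n => by
    have : F' n = deriv (F n) := funext fun s => (hFd n s).deriv.symm
    rw [this]
    exact (hFs n).continuous_deriv (by simp)
  have hmode : Continuous (sineMode ℓ k) := continuous_sineMode ℓ k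
  have hmode' : Continuous (sineModeDeriv ℓ k) := continuous_sineModeDeriv ℓ k
  have hbound' : ∀ n, ∀ s ∈ Ioo 0 ℓ, |F' n s - sineModeDeriv ℓ k s| ≤ 2 * (C * B) + 2 * B := by
    intro n s hs
    have h1 : |sineMode ℓ k s| ≤ B * s := by
      have := abs_sineMode_sub_le ℓ k s 0
      rwa [sineMode_zero, sub_zero, sub_zero, abs_of_pos hs.1] at this
    have h2 : |sineMode ℓ k s| ≤ B * (ℓ - s) := by
      have := abs_sineMode_sub_le ℓ k s ℓ
      rwa [sineMode_length hℓ, sub_zero, abs_sub_comm s ℓ,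
        abs_of_pos (sub_pos.mpr hs.2)] at this
    have hn0 : (0 : ℝ) ≤ n := Nat.cast_nonneg n
    have h3 : |deriv Real.smoothTransition (n * s - 1) * n *
        Real.smoothTransition (n * (ℓ - s) - 1) * sineMode ℓ k s| ≤ C * B := by
      have e := hC (n * s - 1)
      rw [sub_add_cancel, abs_mul, abs_mul, abs_of_nonneg hn0, abs_of_pos hs.1] at e
      rw [abs_mul, abs_mul, abs_mul, abs_of_nonneg hn0,
        abs_of_nonneg (Real.smoothTransition.nonneg _)]
      calc |deriv Real.smoothTransition (n * s - 1)| * n *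
          Real.smoothTransition (n * (ℓ - s) - 1) * |sineMode ℓ k s|
          ≤ |deriv Real.smoothTransition (n * s - 1)| * n * 1 * (B * s) := by
            gcongr
            exact Real.smoothTransition.le_one _
        _ = n * s * |deriv Real.smoothTransition (n * s - 1)| * B := by ring
        _ ≤ C * B := by gcongr
    have h4 : |Real.smoothTransition (n * s - 1) *
        (deriv Real.smoothTransition (n * (ℓ - s) - 1) * (-n)) * sineMode ℓ k s| ≤ C * B := by
      have e := hC (n * (ℓ - s) - 1)
      rw [sub_add_cancel, abs_mul, abs_mul, abs_of_nonneg hn0,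
        abs_of_pos (sub_pos.mpr hs.2)] at e
      rw [abs_mul, abs_mul, abs_mul, abs_neg, abs_of_nonneg hn0,
        abs_of_nonneg (Real.smoothTransition.nonneg _)]
      calc Real.smoothTransition (n * s - 1) *
          (|deriv Real.smoothTransition (n * (ℓ - s) - 1)| * n) * |sineMode ℓ k s|
          ≤ 1 * (|deriv Real.smoothTransition (n * (ℓ - s) - 1)| * n) * (B * (ℓ - s)) := by
            gcongr
            exact Real.smoothTransition.le_one _
        _ = n * (ℓ - s) * |deriv Real.smoothTransition (n * (ℓ - s) - 1)| * B := by ring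
        _ ≤ C * B := by gcongr
    have h5 : |intervalCutoff ℓ n s * sineModeDeriv ℓ k s| ≤ B := by
      rw [abs_mul]
      calc _ ≤ 1 * B := by
            gcongr
            · exact abs_intervalCutoff_le ℓ n s
            · exact abs_sineModeDeriv_le ℓ k s
        _ = B := one_mul B
    have h6 := abs_sineModeDeriv_le ℓ k s
    rw [← hB] at h6
    simp only [hF', intervalCutoffDeriv, add_mul]
    rw [abs_le] at *
    constructor <;> linarith [h3.1, h3.2, h4.1, h4.2, h5.1, h5.2, h6.1, h6.2]
  have hbound : ∀ n s, |F n s - sineMode ℓ k s| ≤ 2 * √(2 / ℓ) := by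
    intro n s
    have h5 : |F n s| ≤ √(2 / ℓ) := by
      rw [hF, abs_mul]
      calc _ ≤ 1 * √(2 / ℓ) := by
            gcongr
            · exact abs_intervalCutoff_le ℓ n s
            · exact abs_sineMode_le ℓ k s
        _ = _ := one_mul _
    have h6 := abs_sineMode_le ℓ k s
    rw [abs_le] at *
    constructor <;> linarith [h5.1, h5.2, h6.1, h6.2]
  have hfin : IsFiniteMeasure ((volume : Measure ℝ).restrict (Ioo 0 ℓ)) :=
    ⟨by rw [Measure.restrict_apply_univ, Real.volume_Ioo]; exact ENNReal.ofReal_lt_top⟩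
  have hlim1 : Tendsto (fun n => ∫ s in Ioo 0 ℓ, ‖F n s - sineMode ℓ k s‖ ^ 2) atTop (𝓝 0) := by
    suffices h : Tendsto (fun n => ∫ s in Ioo 0 ℓ, ‖F n s - sineMode ℓ k s‖ ^ 2) atTop
        (𝓝 (∫ _ in Ioo 0 ℓ, (0 : ℝ))) by simpa only [integral_zero] using h
    refine tendsto_integral_of_dominated_convergence (fun _ => (2 * √(2 / ℓ)) ^ 2) (fun n => ?_)
      (integrable_const _) (fun n => Eventually.of_forall fun s => ?_) ?_
    · exact ((((hFs n).continuous.sub hmode).norm).pow 2).aestronglyMeasurable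
    · rw [Real.norm_of_nonneg (by positivity)]
      have := hbound n s
      gcongr
      exact this
    · refine (ae_restrict_iff' measurableSet_Ioo).mpr (Eventually.of_forall fun s hs => ?_)
      refine tendsto_const_nhds.congr' ?_
      filter_upwards [eventually_intervalCutoff hs] with n hn
      simp [hF, hn.1]
  have hlim2 : Tendsto (fun n => ∫ s in Ioo 0 ℓ, ‖F' n s - sineModeDeriv ℓ k s‖ ^ 2) atTop
      (𝓝 0) := by
    suffices h : Tendsto (fun n => ∫ s in Ioo 0 ℓ, ‖F' n s - sineModeDeriv ℓ k s‖ ^ 2) atTop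
        (𝓝 (∫ _ in Ioo 0 ℓ, (0 : ℝ))) by simpa only [integral_zero] using h
    refine tendsto_integral_of_dominated_convergence (fun _ => (2 * (C * B) + 2 * B) ^ 2)
      (fun n => ?_) (integrable_const _) (fun n => ?_) ?_
    · exact ((((hF'c n).sub hmode').norm).pow 2).aestronglyMeasurable
    · refine (ae_restrict_iff' measurableSet_Ioo).mpr (Eventually.of_forall fun s hs => ?_)
      rw [Real.norm_of_nonneg (by positivity)]
      have := hbound' n s hs
      gcongr
      exact this
    · refine (ae_restrict_iff' measurableSet_Ioo).mpr (Eventually.of_forall fun s hs => ?_)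
      refine tendsto_const_nhds.congr' ?_
      filter_upwards [eventually_intervalCutoff hs] with n hn
      simp [hF', hn.1, hn.2]
  obtain ⟨n, hn1, hn2, hn⟩ := ((hlim1.eventually_le_const hε).and
    ((hlim2.eventually_le_const hε).and (eventually_ge_atTop 1))).exists
  have hn' : (0 : ℝ) < n := by exact_mod_cast hn
  have hsupp : Function.support (fun s => (F n s : ℂ)) ⊆ Icc (1 / (n : ℝ)) (ℓ - 1 / n) := by
    intro s hs
    by_contra hcon
    exact hs (by simp [hF, intervalCutoff_eq_zero hn hcon])
  refine ⟨⟨fun s => (F n s : ℂ), Complex.ofRealCLM.contDiff.comp (hFs n),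
    HasCompactSupport.of_support_subset_isCompact isCompact_Icc hsupp⟩, ?_, ?_, ?_⟩
  · refine (closure_minimal hsupp isClosed_Icc).trans fun s hs => ?_
    have : 0 < 1 / (n : ℝ) := by positivity
    exact ⟨by linarith [hs.1], by linarith [hs.2]⟩
  · refine le_trans (le_of_eq ?_) hn1
    refine integral_congr_ae (Eventually.of_forall fun s => ?_)
    simp only
    rw [← Complex.ofReal_sub, Complex.norm_real]
  · refine le_trans (le_of_eq ?_) hn2
    refine integral_congr_ae (Eventually.of_forall fun s => ?_)
    have h : HasDerivAt (fun s => (F n s : ℂ)) (F' n s : ℂ) s := (hFd n s).ofReal_comp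
    simp only [fderiv_apply_one_eq_deriv]
    rw [h.deriv, ← Complex.ofReal_sub, Complex.norm_real]

theorem norm_sq_eq_of_inner_eq {H : Type*} [NormedAddCommGroup H] [InnerProductSpace ℂ H] {x : H}
    {r : ℝ} (h : (inner ℂ x x : ℂ) = (r : ℂ)) : ‖x‖ ^ 2 = r := by
  rw [@norm_sq_eq_re_inner ℂ, h]
  rfl

/-- The Rayleigh quotient of a linear combination is stable under small perturbations. -/
theorem exists_perturbation_bound {H ι : Type*} [NormedAddCommGroup H] [InnerProductSpace ℂ H]
    [Fintype ι] {Φ Ψ : ι → H} (hΦ : Orthonormal ℂ Φ) {ν : ι → ℝ}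
    (hΨ : ∀ i j, i ≠ j → inner ℂ (Ψ i) (Ψ j) = 0) (hΨ' : ∀ i, ‖Ψ i‖ ^ 2 = ν i) {μ η : ℝ}
    (hμ : 0 ≤ μ) (hν : ∀ i, ν i ≤ μ) (hη : 0 < η) :
    ∃ ε > 0, ∀ X X' : ι → H, (∀ i, ‖X i - Φ i‖ ≤ ε) → (∀ i, ‖X' i - Ψ i‖ ≤ ε) → ∀ c : ι → ℂ,
      ‖∑ i, c i • X' i‖ ^ 2 ≤ (μ + η) * ‖∑ i, c i • X i‖ ^ 2 ∧
      ∑ i, ‖c i‖ ^ 2 ≤ 4 * ‖∑ i, c i • X i‖ ^ 2 := by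
  classical
  have hev : ∀ᶠ e : ℝ in 𝓝[>] 0, (√μ + e) ^ 2 < (μ + η) * (1 - e) ^ 2 ∧ e < 1 / 2 := by
    refine nhdsWithin_le_nhds ?_
    refine Filter.Eventually.and ?_ (gt_mem_nhds (by norm_num))
    refine ContinuousAt.eventually_lt (by fun_prop) (by fun_prop) ?_
    simp [Real.sq_sqrt hμ, hη]
  obtain ⟨e, ⟨he1, he2⟩, he0⟩ := (hev.and self_mem_nhdsWithin).exists
  have he0 : 0 < e := he0
  set N : ℝ := Fintype.card ι + 1 with hN
  have hN0 : 0 < N := by positivity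
  refine ⟨e / N, by positivity, fun X X' hX hX' c => ?_⟩
  set r : ℝ := √(∑ i, ‖c i‖ ^ 2) with hr
  have hr2 : r ^ 2 = ∑ i, ‖c i‖ ^ 2 := Real.sq_sqrt (Finset.sum_nonneg fun i _ => sq_nonneg _)
  have hr0 : 0 ≤ r := Real.sqrt_nonneg _
  have hci : ∀ i, ‖c i‖ ≤ r := fun i => Real.le_sqrt_of_sq_le
    (Finset.single_le_sum (f := fun i => ‖c i‖ ^ 2) (fun i _ => sq_nonneg _) (Finset.mem_univ i))
  have hdiff : ∀ Y Z : ι → H, (∀ i, ‖Y i - Z i‖ ≤ e / N) →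
      ‖∑ i, c i • Y i - ∑ i, c i • Z i‖ ≤ e * r := by
    intro Y Z hYZ
    rw [← Finset.sum_sub_distrib]
    calc ‖∑ i, (c i • Y i - c i • Z i)‖ ≤ ∑ i, ‖c i • Y i - c i • Z i‖ := norm_sum_le _ _
      _ ≤ ∑ _i : ι, r * (e / N) := Finset.sum_le_sum fun i _ => by
          rw [← smul_sub, norm_smul]
          gcongr
          · exact hci i
          · exact hYZ i
      _ = e * r * (Fintype.card ι / N) := by simp; ring
      _ ≤ e * r * 1 := by
          gcongr
          rw [div_le_one hN0]
          linarith
      _ = e * r := mul_one _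
  have hP : ‖∑ i, c i • Φ i‖ ^ 2 = r ^ 2 := by
    have h : (inner ℂ (∑ i, c i • Φ i) (∑ i, c i • Φ i) : ℂ) = ((r ^ 2 : ℝ) : ℂ) := by
      rw [hΦ.inner_sum, hr2, Complex.ofReal_sum]
      refine Finset.sum_congr rfl fun i _ => ?_
      rw [← Complex.normSq_eq_conj_mul_self, Complex.normSq_eq_norm_sq]
    exact norm_sq_eq_of_inner_eq h
  have hQ : ‖∑ i, c i • Ψ i‖ ^ 2 ≤ μ * r ^ 2 := by
    have h : (inner ℂ (∑ i, c i • Ψ i) (∑ i, c i • Ψ i) : ℂ) =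
        ((∑ i, ‖c i‖ ^ 2 * ν i : ℝ) : ℂ) := by
      rw [sum_inner, Complex.ofReal_sum]
      refine Finset.sum_congr rfl fun i _ => ?_
      rw [inner_sum, Finset.sum_eq_single i]
      · rw [inner_smul_left, inner_smul_right, inner_self_eq_norm_sq_to_K, ← mul_assoc,
          ← Complex.normSq_eq_conj_mul_self, Complex.normSq_eq_norm_sq, ← hΨ']
        push_cast
        rfl
      · intro j _ hji
        rw [inner_smul_left, inner_smul_right, hΨ i j (Ne.symm hji), mul_zero, mul_zero]
      · exact fun h => absurd (Finset.mem_univ i) h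
    rw [norm_sq_eq_of_inner_eq h, hr2, Finset.mul_sum]
    refine Finset.sum_le_sum fun i _ => ?_
    rw [mul_comm]
    exact mul_le_mul_of_nonneg_right (hν i) (sq_nonneg _)
  have hP' : ‖∑ i, c i • Φ i‖ = r := by
    rw [← abs_of_nonneg (norm_nonneg (∑ i, c i • Φ i)), ← abs_of_nonneg hr0]
    exact sq_eq_sq_iff_abs_eq_abs _ _ |>.mp hP
  have hQ' : ‖∑ i, c i • Ψ i‖ ≤ √μ * r := by
    rw [← Real.sqrt_sq hr0, ← Real.sqrt_mul hμ]
    exact Real.le_sqrt_of_sq_le hQ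
  have h1 := hdiff X Φ hX
  have h2 := hdiff X' Ψ hX'
  have h3 : (1 - e) * r ≤ ‖∑ i, c i • X i‖ := by
    have := norm_sub_norm_le (∑ i, c i • Φ i) (∑ i, c i • X i)
    rw [norm_sub_rev, hP'] at this
    linarith
  have h4 : ‖∑ i, c i • X' i‖ ≤ (√μ + e) * r := by
    have := norm_sub_norm_le (∑ i, c i • X' i) (∑ i, c i • Ψ i)
    linarith
  have h5 : ((1 - e) * r) ^ 2 ≤ ‖∑ i, c i • X i‖ ^ 2 := by
    have : 0 ≤ (1 - e) * r := mul_nonneg (by linarith) hr0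
    gcongr
  constructor
  · calc ‖∑ i, c i • X' i‖ ^ 2 ≤ ((√μ + e) * r) ^ 2 := by gcongr
      _ = (√μ + e) ^ 2 * r ^ 2 := by ring
      _ ≤ (μ + η) * (1 - e) ^ 2 * r ^ 2 := by gcongr
      _ = (μ + η) * ((1 - e) * r) ^ 2 := by ring
      _ ≤ _ := by gcongr
  · rw [← hr2]
    have h6 : (1 / 2 * r) ^ 2 ≤ ((1 - e) * r) ^ 2 := by
      gcongr
      linarith
    nlinarith

end Approximation

/-! ### Counting the Dirichlet eigenvalues of a family of intervals -/

section Counting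

/-- A family of reals with finite sublevel sets has an `m`th smallest member. -/
theorem exists_level {ι : Type*} [Infinite ι] {ν : ι → ℝ} (hfin : ∀ x, {i | ν i ≤ x}.Finite) {m : ℕ}
    (hm : 1 ≤ m) : ∃ μ, μ ∈ range ν ∧ {i | ν i < μ}.ncard < m ∧ m ≤ {i | ν i ≤ μ}.ncard := by
  have hfin' : ∀ x, {i | ν i < x}.Finite := fun x => (hfin x).subset fun i hi => by
    have hi : ν i < x := hi
    exact hi.le
  -- the largest value on a finite nonempty set
  have hmax : ∀ t : Set ι, t.Finite → t.Nonempty → ∃ i ∈ t, ∀ j ∈ t, ν j ≤ ν i :=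
    fun t ht hne => t.exists_max_image ν ht hne
  obtain ⟨t, ht⟩ := Infinite.exists_subset_card_eq ι m
  obtain ⟨i₀, -, hi₀⟩ := hmax t t.finite_toSet
    (Finset.coe_nonempty.mpr (Finset.card_pos.mp (by omega)))
  set S := {i | m ≤ {j | ν j ≤ ν i}.ncard} with hS
  have hi₀S : i₀ ∈ S := by
    have : (t : Set ι) ⊆ {j | ν j ≤ ν i₀} := hi₀
    have := Set.ncard_le_ncard this (hfin _)
    rw [Set.ncard_coe_finset, ht] at this
    exact this
  obtain ⟨i, hi, hmin⟩ := (S ∩ {j | ν j ≤ ν i₀}).exists_min_image ν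
    ((hfin _).subset inter_subset_right) ⟨i₀, hi₀S, le_refl (ν i₀)⟩
  refine ⟨ν i, ⟨i, rfl⟩, ?_, hi.1⟩
  by_contra! hcon
  obtain ⟨j, hj, hjmax⟩ := hmax {j | ν j < ν i} (hfin' _)
    (Set.nonempty_of_ncard_ne_zero (by omega))
  have hj' : ν j < ν i := hj
  have hjS : j ∈ S := by
    refine hcon.trans (Set.ncard_le_ncard (fun k hk => hjmax k hk) (hfin _))
  have hi2 : ν i ≤ ν i₀ := hi.2
  exact absurd (hmin j ⟨hjS, hj'.le.trans hi2⟩) (not_le.mpr hj')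

theorem exists_modeCount {ℓ : ℝ} (hℓ : 0 < ℓ) (x : ℝ) : ∃ K : ℕ, ∀ k, dirichletFreq ℓ k < x ↔ k < K := by
  classical
  have h : ∃ K, x ≤ dirichletFreq ℓ K :=
    ((tendsto_dirichletFreq hℓ).eventually_ge_atTop x).exists
  refine ⟨Nat.find h, fun k => ⟨fun hk => ?_, fun hk => not_le.mp (Nat.find_min h hk)⟩⟩
  by_contra! hcon
  have := (dirichletFreq_strictMono hℓ).monotone hcon
  linarith [Nat.find_spec h]

open Classical in
/-- The number of Dirichlet eigenvalues of `(0, ℓ)` less than `x`. -/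
def modeCount (ℓ x : ℝ) : ℕ :=
  if h : ∃ K : ℕ, ∀ k, dirichletFreq ℓ k < x ↔ k < K then h.choose else 0

theorem lt_modeCount_iff {ℓ : ℝ} (hℓ : 0 < ℓ) {x : ℝ} {k : ℕ} :
    k < modeCount ℓ x ↔ dirichletFreq ℓ k < x := by
  rw [modeCount, dif_pos (exists_modeCount hℓ x)]
  exact ((exists_modeCount hℓ x).choose_spec k).symm

theorem le_dirichletFreq_modeCount {ℓ : ℝ} (hℓ : 0 < ℓ) (x : ℝ) :
    x ≤ dirichletFreq ℓ (modeCount ℓ x) :=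
  not_lt.mp fun h => lt_irrefl _ ((lt_modeCount_iff hℓ).mpr h)

variable {N : Type*} [Fintype N]

/-- The indices `(n, k)` of the Dirichlet eigenvalues of the intervals `(0, ℓ n)` that are less than
`x`. -/
def lowModes (ℓ : N → ℝ) (x : ℝ) : Finset (N × ℕ) :=
  (Finset.univ.sigma fun n => Finset.range (modeCount (ℓ n) x)).map
    (Equiv.sigmaEquivProd N ℕ).toEmbedding

theorem mem_lowModes {ℓ : N → ℝ} (hℓ : ∀ n, 0 < ℓ n) {x : ℝ} {p : N × ℕ} :
    p ∈ lowModes ℓ x ↔ dirichletFreq (ℓ p.1) p.2 < x := by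
  rw [← lt_modeCount_iff (hℓ p.1), lowModes, Finset.mem_map]
  constructor
  · rintro ⟨⟨n, k⟩, h, rfl⟩
    simpa using h
  · intro h
    exact ⟨⟨p.1, p.2⟩, by simpa using h, rfl⟩

theorem sum_lowModes {R : Type*} [AddCommMonoid R] (ℓ : N → ℝ) (x : ℝ) (f : N × ℕ → R) :
    ∑ p ∈ lowModes ℓ x, f p = ∑ n, ∑ k ∈ Finset.range (modeCount (ℓ n) x), f (n, k) := by
  rw [lowModes, Finset.sum_map, Finset.sum_sigma]
  rfl

theorem finite_freq_le {ℓ : N → ℝ} (hℓ : ∀ n, 0 < ℓ n) (x : ℝ) :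
    {p : N × ℕ | dirichletFreq (ℓ p.1) p.2 ≤ x}.Finite := by
  refine (lowModes ℓ (x + 1)).finite_toSet.subset fun p hp => ?_
  have hp : dirichletFreq (ℓ p.1) p.2 ≤ x := hp
  exact Finset.mem_coe.mpr ((mem_lowModes hℓ).mpr (by linarith))

/-- The `m`th smallest `μ` of the Dirichlet eigenvalues of the intervals: fewer than `m` of them are
less than `μ`, and at least `m` are at most `μ`. -/
theorem exists_dirichlet_level [Nonempty N] {ℓ : N → ℝ} (hℓ : ∀ n, 0 < ℓ n) {m : ℕ} (hm : 1 ≤ m) :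
    ∃ μ > 0, (lowModes ℓ μ).card < m ∧ ∃ S : Finset (N × ℕ), m ≤ S.card ∧
      ∀ p ∈ S, dirichletFreq (ℓ p.1) p.2 ≤ μ := by
  obtain ⟨μ, ⟨p, hp⟩, h1, h2⟩ := exists_level (finite_freq_le hℓ) hm
  refine ⟨μ, hp ▸ dirichletFreq_pos (hℓ _) _, ?_, (finite_freq_le hℓ μ).toFinset, ?_, ?_⟩
  · rw [← Set.ncard_coe_finset]
    convert h1 using 2
    ext q
    exact mem_lowModes hℓ
  · rwa [← Set.ncard_eq_toFinset_card _ (finite_freq_le hℓ μ)]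
  · intro q hq
    simpa using hq

end Counting

/-! ### Finite families of vectors as auxiliary maps and test spaces -/

section Families

variable {H W : Type*} [NormedAddCommGroup H] [InnerProductSpace ℂ H]
  [NormedAddCommGroup W] [InnerProductSpace ℂ W] {ι : Type*} [Fintype ι]

/-- The inner products with a finite family of vectors. -/
def innerFamily (Φ : ι → H) : H →L[ℂ] EuclideanSpace ℂ ι :=
  (EuclideanSpace.equiv ι ℂ).symm.toContinuousLinearMap ∘L
    ContinuousLinearMap.pi fun i => innerSL ℂ (Φ i)

theorem norm_sq_innerFamily (Φ : ι → H) (u : H) :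
    ‖innerFamily Φ u‖ ^ 2 = ∑ i, ‖(inner ℂ (Φ i) u : ℂ)‖ ^ 2 := by
  rw [EuclideanSpace.norm_sq_eq]
  rfl

/-- A lower bound up to the components along finitely many vectors of `H` is a lower bound up to a
finite-rank map. -/
theorem boundedBelowUpTo_innerFamily {j : W →L[ℂ] H} {A : W →L[ℂ] W} {b C : ℝ} (hC : 0 ≤ C)
    {Φ : ι → H} (h : ∀ u, b * ‖j u‖ ^ 2 ≤
      (inner ℂ u (A u)).re + C * ∑ i, ‖(inner ℂ (Φ i) (j u) : ℂ)‖ ^ 2) :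
    BoundedBelowUpTo j A b ((√C : ℂ) • (innerFamily Φ ∘L j)) := by
  intro u
  refine (h u).trans (le_of_eq ?_)
  rw [ContinuousLinearMap.smul_apply, norm_smul, mul_pow, ContinuousLinearMap.comp_apply,
    norm_sq_innerFamily, Complex.norm_real, Real.norm_eq_abs, sq_abs, Real.sq_sqrt hC]

variable [CompleteSpace H] [CompleteSpace W]

/-- The min-max principle with a test space given by a parametrization. -/
theorem IsFormOperator.exists_isNth_of_family {j : W →L[ℂ] H} {A : W →L[ℂ] W} {T : H →ₗ.[ℂ] H}
    (hT : IsFormOperator j A T) {F : Type*} [NormedAddCommGroup F] [InnerProductSpace ℂ F]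
    [FiniteDimensional ℂ F] {a b : ℝ} {B : W →L[ℂ] F} (hB : BoundedBelowUpTo j A b B) (hab : a < b)
    (L : (ι → ℂ) →ₗ[ℂ] W) (hL : ∀ c, L c = 0 → c = 0)
    (hLa : ∀ c, (inner ℂ (L c) (A (L c))).re ≤ a * ‖j (L c)‖ ^ 2) {m : ℕ} (hm : 1 ≤ m)
    (hmι : m ≤ Fintype.card ι) : ∃ E ≤ a, IsNthDiscreteEigenvalue T m E := by
  refine hT.exists_isNthDiscreteEigenvalue hB hab (LinearMap.range L) ?_ hm ?_
  · rintro _ ⟨c, rfl⟩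
    exact hLa c
  · rw [LinearMap.finrank_range_of_inj (LinearMap.ker_eq_bot.mp (LinearMap.ker_eq_bot'.mpr hL)),
      Module.finrank_pi]
    exact hmι

end Families

/-! ### Test families on a family of intervals -/

section TestFamily

theorem memLp_interval_of_continuous (ℓ : ℝ) {f : ℝ → ℂ} (hf : Continuous f) :
    MemLp f 2 (volume.restrict (interval ℓ : Set ℝ)) := by
  obtain ⟨C, hC⟩ := (isCompact_Icc (a := (0 : ℝ)) (b := ℓ)).exists_bound_of_continuousOn
    hf.continuousOn
  have : IsFiniteMeasure ((volume : Measure ℝ).restrict (interval ℓ : Set ℝ)) :=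
    ⟨by rw [Measure.restrict_apply_univ]; exact measure_Ioo_lt_top⟩
  refine MemLp.of_bound hf.aestronglyMeasurable C ?_
  refine (ae_restrict_iff' (interval ℓ).isOpen.measurableSet).mpr (Eventually.of_forall fun s hs => ?_)
  exact hC s (Ioo_subset_Icc_self hs)

/-- The class in `L²(0, ℓ)` of a continuous function. -/
def intervalL2 (ℓ : ℝ) {f : ℝ → ℂ} (hf : Continuous f) : L2 (interval ℓ) :=
  (memLp_interval_of_continuous ℓ hf).toLp f

theorem coeFn_intervalL2 (ℓ : ℝ) {f : ℝ → ℂ} (hf : Continuous f) :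
    intervalL2 ℓ hf =ᵐ[volume.restrict (interval ℓ : Set ℝ)] f :=
  (memLp_interval_of_continuous ℓ hf).coeFn_toLp

theorem inner_intervalL2 {ℓ : ℝ} (hℓ : 0 < ℓ) {f g : ℝ → ℂ} (hf : Continuous f) (hg : Continuous g) :
    inner ℂ (intervalL2 ℓ hf) (intervalL2 ℓ hg) =
      ∫ s in (0 : ℝ)..ℓ, (starRingEnd ℂ) (f s) * g s := by
  rw [L2.inner_def, intervalIntegral.integral_of_le hℓ.le, integral_Ioc_eq_integral_Ioo]
  refine integral_congr_ae ?_
  filter_upwards [coeFn_intervalL2 ℓ hf, coeFn_intervalL2 ℓ hg] with s h1 h2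
  rw [h1, h2, RCLike.inner_apply, mul_comm]

theorem inner_intervalL2_ofReal {ℓ : ℝ} (hℓ : 0 < ℓ) {f g : ℝ → ℝ} (hf : Continuous f)
    (hg : Continuous g) :
    inner ℂ (intervalL2 ℓ (Complex.continuous_ofReal.comp hf))
      (intervalL2 ℓ (Complex.continuous_ofReal.comp hg)) =
      ((∫ s in (0 : ℝ)..ℓ, f s * g s : ℝ) : ℂ) := by
  rw [inner_intervalL2 hℓ, ← intervalIntegral.integral_ofReal]
  refine intervalIntegral.integral_congr fun s _ => ?_
  simp

theorem norm_sq_toL2_sub_intervalL2 (ℓ : ℝ) (χ : testFunctions ℝ) {f : ℝ → ℂ} (hf : Continuous f) :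
    ‖testFunctions.toL2 (volume.restrict (interval ℓ : Set ℝ)) χ - intervalL2 ℓ hf‖ ^ 2 =
      ∫ s in Ioo 0 ℓ, ‖(χ : ℝ → ℂ) s - f s‖ ^ 2 := by
  rw [norm_sq_eq_integral]
  refine integral_congr_ae ?_
  filter_upwards [Lp.coeFn_sub (testFunctions.toL2 (volume.restrict (interval ℓ : Set ℝ)) χ)
    (intervalL2 ℓ hf), coeFn_intervalL2 ℓ hf,
    testFunctions.coeFn_toL2 (volume.restrict (interval ℓ : Set ℝ)) χ] with s h1 h2 h3
  rw [h1, Pi.sub_apply, h2, h3]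

variable {N : Type*} [Fintype N] [DecidableEq N]

/-- The component on the `n`th interval of the linear combination with coefficients `c` of the
functions `χ p`, where `χ p` lives on the interval with number `p.1`. -/
def modeSum (S : Finset (N × ℕ)) (χ : N × ℕ → testFunctions ℝ) (n : N) :
    (S → ℂ) →ₗ[ℂ] testFunctions ℝ :=
  ∑ p : S, if p.1.1 = n then (LinearMap.proj p).smulRight (χ p) else 0

theorem modeSum_apply (S : Finset (N × ℕ)) (χ : N × ℕ → testFunctions ℝ) (n : N) (c : S → ℂ) :
    modeSum S χ n c = ∑ p : S, c p • (if p.1.1 = n then χ p else 0) := by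
  rw [modeSum, LinearMap.sum_apply]
  refine Finset.sum_congr rfl fun p _ => ?_
  split_ifs <;> simp

theorem tsupport_modeSum {S : Finset (N × ℕ)} {χ : N × ℕ → testFunctions ℝ} {I : N → Set ℝ}
    (h : ∀ p ∈ S, tsupport (χ p : ℝ → ℂ) ⊆ I p.1) (n : N) (c : S → ℂ) :
    tsupport (modeSum S χ n c : ℝ → ℂ) ⊆ I n := by
  rw [modeSum_apply]
  refine Finset.sum_induction _ (fun f : testFunctions ℝ => tsupport (f : ℝ → ℂ) ⊆ I n)
    (fun f g hf hg => (tsupport_add _ _).trans (union_subset hf hg)) (by simp) fun p _ => ?_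
  split_ifs with hp
  · exact (closure_mono (Function.support_const_smul_subset (c p) (χ p : ℝ → ℂ))).trans
      (hp ▸ h p p.2)
  · simp

/-- There are test functions on the intervals `(0, ℓ n)` whose linear combinations have Rayleigh
quotient close to that of the combinations of finitely many Dirichlet eigenfunctions. -/
theorem exists_test_family {ℓ : N → ℝ} (hℓ : ∀ n, 0 < ℓ n) (S : Finset (N × ℕ)) {μ : ℝ} (hμ : 0 ≤ μ)
    (hS : ∀ p ∈ S, dirichletFreq (ℓ p.1) p.2 ≤ μ) {η : ℝ} (hη : 0 < η) :
    ∃ χ : N × ℕ → testFunctions ℝ, (∀ p ∈ S, tsupport (χ p : ℝ → ℂ) ⊆ Ioo 0 (ℓ p.1)) ∧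
      ∀ c : S → ℂ,
        ∑ n, ‖testFunctions.toL2 (volume.restrict (interval (ℓ n) : Set ℝ))
            (testFunctions.deriv 1 (modeSum S χ n c))‖ ^ 2 ≤ (μ + η) *
          ∑ n, ‖testFunctions.toL2 (volume.restrict (interval (ℓ n) : Set ℝ)) (modeSum S χ n c)‖ ^ 2 ∧
        ∑ p, ‖c p‖ ^ 2 ≤ 4 *
          ∑ n, ‖testFunctions.toL2 (volume.restrict (interval (ℓ n) : Set ℝ)) (modeSum S χ n c)‖ ^ 2 := by
  set H := PiLp 2 fun n => L2 (interval (ℓ n)) with hH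
  -- the vectors concentrated on one interval
  set V : (∀ n, L2 (interval (ℓ n))) → N → H := fun v i =>
    WithLp.toLp 2 fun n => if i = n then v n else 0 with hV
  have hVV : ∀ (v w : ∀ n, L2 (interval (ℓ n))) (i k : N), (inner ℂ (V v i) (V w k) : ℂ) =
      if i = k then inner ℂ (v i) (w i) else 0 := by
    intro v w i k
    rw [PiLp.inner_apply, Finset.sum_eq_single i]
    · by_cases h : i = k
      · simp [hV, h]
      · simp [hV, h, Ne.symm h]
    · intro n _ hn
      simp [hV, Ne.symm hn]
    · simp
  have hVn : ∀ (v w : ∀ n, L2 (interval (ℓ n))) (i : N), ‖V v i - V w i‖ = ‖v i - w i‖ := by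
    intro v w i
    have h1 : V v i - V w i = V (v - w) i := by
      refine PiLp.ext fun n => ?_
      change (if i = n then v n else 0) - (if i = n then w n else 0) =
        if i = n then v n - w n else 0
      split_ifs <;> simp
    rw [h1, ← sq_eq_sq₀ (norm_nonneg _) (norm_nonneg _), @norm_sq_eq_re_inner ℂ, hVV, if_pos rfl,
      ← @norm_sq_eq_re_inner ℂ]
    rfl
  set Φ : S → H := fun p => V (fun n => intervalL2 (ℓ n)
    (Complex.continuous_ofReal.comp (continuous_sineMode (ℓ n) p.1.2))) p.1.1 with hΦ
  set Ψ : S → H := fun p => V (fun n => intervalL2 (ℓ n)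
    (Complex.continuous_ofReal.comp (continuous_sineModeDeriv (ℓ n) p.1.2))) p.1.1 with hΨ
  have hΦo : Orthonormal ℂ Φ := by
    rw [orthonormal_iff_ite]
    intro p q
    rw [hVV, inner_intervalL2_ofReal (hℓ _) (continuous_sineMode _ _) (continuous_sineMode _ _),
      integral_sineMode_mul (hℓ _)]
    have hpq : p = q ↔ p.1.1 = q.1.1 ∧ p.1.2 = q.1.2 := by rw [Subtype.ext_iff, Prod.ext_iff]
    rw [if_congr hpq rfl rfl]
    by_cases h1 : p.1.1 = q.1.1 <;> by_cases h2 : p.1.2 = q.1.2 <;> simp [h1, h2]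
  have hΨo : ∀ p q, (inner ℂ (Ψ p) (Ψ q) : ℂ) =
      if p = q then (dirichletFreq (ℓ p.1.1) p.1.2 : ℂ) else 0 := by
    intro p q
    rw [hVV, inner_intervalL2_ofReal (hℓ _) (continuous_sineModeDeriv _ _)
      (continuous_sineModeDeriv _ _), integral_sineModeDeriv_mul (hℓ _)]
    have hpq : p = q ↔ p.1.1 = q.1.1 ∧ p.1.2 = q.1.2 := by rw [Subtype.ext_iff, Prod.ext_iff]
    rw [if_congr hpq rfl rfl]
    by_cases h1 : p.1.1 = q.1.1 <;> by_cases h2 : p.1.2 = q.1.2 <;> simp [h1, h2]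
  obtain ⟨ε, hε, key⟩ := exists_perturbation_bound hΦo (Ψ := Ψ)
    (ν := fun p => dirichletFreq (ℓ p.1.1) p.1.2)
    (fun p q hpq => by rw [hΨo, if_neg hpq])
    (fun p => norm_sq_eq_of_inner_eq (by rw [hΨo, if_pos rfl])) hμ (fun p => hS p p.2) hη
  choose χ hχ1 hχ2 hχ3 using fun p : N × ℕ =>
    exists_test_near_sineMode (hℓ p.1) p.2 (ε := ε ^ 2) (by positivity)
  refine ⟨χ, fun p _ => hχ1 p, fun c => ?_⟩
  have hsum : ∀ (T : ∀ n, testFunctions ℝ →ₗ[ℂ] L2 (interval (ℓ n))),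
      ‖∑ p : S, c p • V (fun n => T n (χ p)) p.1.1‖ ^ 2 = ∑ n, ‖T n (modeSum S χ n c)‖ ^ 2 := by
    intro T
    rw [PiLp.norm_sq_eq_of_L2]
    refine Finset.sum_congr rfl fun n _ => ?_
    congr 2
    rw [modeSum_apply, map_sum, WithLp.ofLp_sum, Finset.sum_apply]
    refine Finset.sum_congr rfl fun p _ => ?_
    rw [map_smul, WithLp.ofLp_smul, Pi.smul_apply]
    congr 1
    by_cases h : p.1.1 = n <;> simp [hV, h]
  have := key (fun p => V (fun n => testFunctions.toL2 _ (χ p)) p.1.1)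
    (fun p => V (fun n => (testFunctions.toL2 _ ∘ₗ testFunctions.deriv 1) (χ p)) p.1.1)
    (fun p => by
      rw [hΦ, hVn, ← abs_of_nonneg (norm_nonneg _), ← abs_of_pos hε]
      refine sq_le_sq.mp ?_
      rw [norm_sq_toL2_sub_intervalL2]
      exact hχ2 p)
    (fun p => by
      rw [hΨ, hVn, ← abs_of_nonneg (norm_nonneg _), ← abs_of_pos hε]
      refine sq_le_sq.mp ?_
      rw [LinearMap.comp_apply, norm_sq_toL2_sub_intervalL2]
      exact hχ3 p) c
  rw [hsum, hsum] at this
  exact this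

end TestFamily

/-! ### Direct sums of form operators -/

section DirectSum

variable {N : Type*} [Fintype N] {H W : N → Type*} [∀ n, NormedAddCommGroup (H n)]
  [∀ n, InnerProductSpace ℂ (H n)] [∀ n, NormedAddCommGroup (W n)]
  [∀ n, InnerProductSpace ℂ (W n)]

/-- The map between Hilbert direct sums acting componentwise. -/
def piLpMap (T : ∀ n, W n →L[ℂ] H n) : PiLp 2 W →L[ℂ] PiLp 2 H :=
  (PiLp.continuousLinearEquiv 2 ℂ H).symm.toContinuousLinearMap ∘L
    ContinuousLinearMap.pi fun n => T n ∘L PiLp.proj 2 W n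

@[simp]
theorem piLpMap_apply (T : ∀ n, W n →L[ℂ] H n) (u : PiLp 2 W) (n : N) :
    piLpMap T u n = T n (u n) := rfl

theorem mem_graph_directSum {T : ∀ n, H n →ₗ.[ℂ] H n} {f w : PiLp 2 H} :
    (f, w) ∈ (directSum T).graph ↔ ∀ n, (f n, w n) ∈ (T n).graph := by
  rw [LinearPMap.mem_graph_iff]
  constructor
  · rintro ⟨u, rfl, rfl⟩ n
    exact (T n).mem_graph ⟨(u : PiLp 2 H) n, u.2 n⟩
  · intro h
    have h' : ∀ n, ∃ u : (T n).domain, (u : H n) = f n ∧ T n u = w n := fun n =>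
      (LinearPMap.mem_graph_iff _).mp (h n)
    choose u hu hw using h'
    refine ⟨⟨f, fun n => hu n ▸ (u n).2⟩, rfl, PiLp.ext fun n => ?_⟩
    rw [← hw n]
    change T n ⟨f n, _⟩ = T n (u n)
    congr 1
    exact Subtype.ext (hu n).symm

theorem IsFormOperator.directSum {j : ∀ n, W n →L[ℂ] H n} {A : ∀ n, W n →L[ℂ] W n}
    {T : ∀ n, H n →ₗ.[ℂ] H n} (h : ∀ n, IsFormOperator (j n) (A n) (T n)) :
    IsFormOperator (piLpMap j) (piLpMap A) (RobinExterior.directSum T) where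
  injective := fun u v huv => PiLp.ext fun n =>
    (h n).injective (congrArg (fun w : PiLp 2 H => w n) huv)
  symm := fun u v => by
    rw [PiLp.inner_apply, PiLp.inner_apply]
    exact Finset.sum_congr rfl fun n _ => (h n).symm _ _
  coercive := by
    choose δ hδ c hc using fun n => (h n).coercive
    have hpos : ∀ n, 0 < (δ n)⁻¹ := fun n => inv_pos.mpr (hδ n)
    have hle : ∀ n, (δ n)⁻¹ ≤ 1 + ∑ k, (δ k)⁻¹ := fun n =>
      (Finset.single_le_sum (f := fun k => (δ k)⁻¹) (fun k _ => (hpos k).le)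
        (Finset.mem_univ n)).trans (by linarith)
    have hsum : 0 ≤ ∑ k, (δ k)⁻¹ := Finset.sum_nonneg fun k _ => (hpos k).le
    refine ⟨(1 + ∑ k, (δ k)⁻¹)⁻¹, by positivity, ∑ n, |c n|, fun u => ?_⟩
    rw [PiLp.norm_sq_eq_of_L2, PiLp.norm_sq_eq_of_L2, PiLp.inner_apply, Complex.re_sum,
      Finset.mul_sum, Finset.mul_sum, ← Finset.sum_add_distrib]
    refine Finset.sum_le_sum fun n _ => ?_
    have h1 : (1 + ∑ k, (δ k)⁻¹)⁻¹ ≤ δ n := by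
      rw [inv_le_comm₀ (by positivity) (hδ n)]
      exact hle n
    have h2 : c n ≤ ∑ k, |c k| := (le_abs_self _).trans
      (Finset.single_le_sum (f := fun k => |c k|) (fun k _ => abs_nonneg _) (Finset.mem_univ n))
    have h3 := hc n (u n)
    have h4 := mul_le_mul_of_nonneg_right h1 (sq_nonneg ‖u n‖)
    have h5 := mul_le_mul_of_nonneg_right h2 (sq_nonneg ‖j n (u n)‖)
    simp only [piLpMap_apply]
    linarith
  mem_graph := fun f w => by
    classical
    rw [mem_graph_directSum]
    constructor
    · intro hf
      choose u hu huw using fun n => ((h n).mem_graph _ _).mp (hf n)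
      refine ⟨WithLp.toLp 2 u, PiLp.ext hu, fun v => ?_⟩
      rw [PiLp.inner_apply, PiLp.inner_apply]
      exact Finset.sum_congr rfl fun n _ => huw n (v n)
    · rintro ⟨u, rfl, huw⟩ n
      refine ((h n).mem_graph _ _).mpr ⟨u n, rfl, fun v => ?_⟩
      have := huw (WithLp.toLp 2 (Pi.single n v))
      rw [PiLp.inner_apply, PiLp.inner_apply, Finset.sum_eq_single n, Finset.sum_eq_single n] at this
      · simpa using this
      · intro k _ hk
        simp [Pi.single_eq_of_ne hk]
      · simp
      · intro k _ hk
        simp [Pi.single_eq_of_ne hk]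
      · simp

end DirectSum

/-- The graph of the operator generated by a form, with the form domain replaced by an isomorphic
Hilbert space on which the form is represented by an operator `A`. -/
theorem mem_graph_formOperator_of_surjective {H V W : Type*} [NormedAddCommGroup H]
    [InnerProductSpace ℂ H] [AddCommGroup V] [Module ℂ V] [NormedAddCommGroup W]
    [InnerProductSpace ℂ W] {i : V →ₗ[ℂ] H} {h : V →ₗ⋆[ℂ] V →ₗ[ℂ] ℂ} {j : W →L[ℂ] H}
    {A : W →L[ℂ] W} {e : W → V} (he : Function.Surjective e) (hi : Function.Injective i)
    (hd : ∀ w, (∀ v, inner ℂ (i v) w = 0) → w = 0) (hj : ∀ p, i (e p) = j p)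
    (hA : ∀ v u, h (e v) (e u) = inner ℂ v (A u)) (f w : H) :
    (f, w) ∈ (formOperator i h).graph ↔ ∃ u, j u = f ∧ ∀ v, inner ℂ v (A u) = inner ℂ (j v) w := by
  rw [mem_graph_formOperator hi hd, he.exists]
  refine exists_congr fun p => ?_
  rw [he.forall, hj]
  simp only [hA, hj]

/-! ### The form of the Dirichlet Laplacian -/

section Dirichlet

/-- The single direction on the line. -/
abbrev lineDir : Unit → ℝ := fun _ => 1

theorem span_lineDir : Submodule.span ℝ (range lineDir) = ⊤ := by
  rw [range_const, Submodule.eq_top_iff']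
  intro x
  rw [Submodule.mem_span_singleton]
  exact ⟨x, by simp⟩

/-- The form domain `W₀^{1,2}(0, ℓ)`. -/
def dirichletSpace (ℓ : ℝ) : Type := sobolevHilbert.zero (interval ℓ) lineDir

instance (ℓ : ℝ) : NormedAddCommGroup (dirichletSpace ℓ) :=
  inferInstanceAs (NormedAddCommGroup (sobolevHilbert.zero (interval ℓ) lineDir))

instance (ℓ : ℝ) : InnerProductSpace ℂ (dirichletSpace ℓ) :=
  inferInstanceAs (InnerProductSpace ℂ (sobolevHilbert.zero (interval ℓ) lineDir))

instance (ℓ : ℝ) : CompleteSpace (dirichletSpace ℓ) :=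
  inferInstanceAs (CompleteSpace (sobolevHilbert.zero (interval ℓ) lineDir))

/-- The inclusion of the form domain in `L²(0, ℓ)`. -/
def dirichletIncl (ℓ : ℝ) : dirichletSpace ℓ →L[ℂ] L2 (interval ℓ) :=
  show sobolevHilbert.zero (interval ℓ) lineDir →L[ℂ] L2 (interval ℓ) from
  sobolevHilbert.incl (interval ℓ) lineDir ∘L (sobolevHilbert.zero (interval ℓ) lineDir).subtypeL

/-- The derivative on the form domain. -/
def dirichletDeriv (ℓ : ℝ) : dirichletSpace ℓ →L[ℂ] L2 (interval ℓ) :=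
  show sobolevHilbert.zero (interval ℓ) lineDir →L[ℂ] L2 (interval ℓ) from
  sobolevHilbert.pderiv (interval ℓ) lineDir () ∘L
    (sobolevHilbert.zero (interval ℓ) lineDir).subtypeL

/-- The operator on the form domain that represents the form `∫ |f'|²`. -/
def dirichletEnergy (ℓ : ℝ) : dirichletSpace ℓ →L[ℂ] dirichletSpace ℓ :=
  ContinuousLinearMap.adjoint (dirichletDeriv ℓ) ∘L dirichletDeriv ℓ

theorem inner_dirichletEnergy {ℓ : ℝ} (v u : dirichletSpace ℓ) :
    (inner ℂ v (dirichletEnergy ℓ u) : ℂ) = inner ℂ (dirichletDeriv ℓ v) (dirichletDeriv ℓ u) := by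
  rw [dirichletEnergy, ContinuousLinearMap.comp_apply, ContinuousLinearMap.adjoint_inner_right]

theorem re_inner_dirichletEnergy {ℓ : ℝ} (u : dirichletSpace ℓ) :
    (inner ℂ u (dirichletEnergy ℓ u) : ℂ).re = ‖dirichletDeriv ℓ u‖ ^ 2 := by
  rw [inner_dirichletEnergy, @norm_sq_eq_re_inner ℂ]
  rfl

theorem norm_sq_dirichletSpace {ℓ : ℝ} (u : dirichletSpace ℓ) :
    ‖u‖ ^ 2 = ‖dirichletIncl ℓ u‖ ^ 2 + ‖dirichletDeriv ℓ u‖ ^ 2 := by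
  change ‖u.1‖ ^ 2 = _
  rw [sobolevHilbert.norm_sq, Fintype.sum_unique]
  rfl

theorem equivSobolev_mem_sobolevZero_iff {ℓ : ℝ} (p : sobolevHilbert (interval ℓ) lineDir) :
    sobolevHilbert.equivSobolev span_lineDir p ∈ sobolevZero (interval ℓ) ↔
      p ∈ sobolevHilbert.zero (interval ℓ) lineDir := by
  rw [sobolevHilbert.mem_zero_iff]
  simp only [sobolevHilbert.tendsto_ofTest_iff, sobolevHilbert.tendsto_toL2_iff]
  constructor
  · rintro ⟨φ, h1, h2, h3⟩
    refine ⟨fun k => ⟨φ k, (h1 k).1, (h1 k).2.1⟩, fun k => (h1 k).2.2, h2, fun i => ?_⟩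
    have := h3 1
    rw [sobolevHilbert.weakDeriv_equivSobolev span_lineDir p ()] at this
    exact this
  · rintro ⟨f, h1, h2, h3⟩
    refine ⟨fun k => (f k : ℝ → ℂ), fun k => ⟨testFunctions.contDiff _,
      testFunctions.hasCompactSupport _, h1 k⟩, h2, fun e => ?_⟩
    have hw : weakDeriv (interval ℓ) e (sobolevHilbert.equivSobolev span_lineDir p) =
        (e : ℂ) • sobolevHilbert.pderiv (interval ℓ) lineDir () p := by
      refine weakDeriv_eq ?_
      have := (sobolevHilbert.hasWeakDeriv p ()).smul_dir e
      simpa [sobolevHilbert.coe_equivSobolev] using this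
    have := tendsto_eLpNorm_smul (e : ℂ) (h3 ()) (Lp.coeFn_smul (e : ℂ) _)
    rw [hw]
    refine this.congr fun k => ?_
    congr 1
    ext x
    congr 1
    rw [testFunctions.deriv_apply]
    conv_rhs => rw [show e = e • (1 : ℝ) by simp, map_smul]
    simp

/-- The two descriptions of the form domain are identified. -/
def dirichletEquiv (ℓ : ℝ) (p : dirichletSpace ℓ) : sobolevZero (interval ℓ) :=
  ⟨sobolevHilbert.equivSobolev span_lineDir p.1, (equivSobolev_mem_sobolevZero_iff _).mpr p.2⟩

theorem dirichletEquiv_surjective (ℓ : ℝ) : Function.Surjective (dirichletEquiv ℓ) := fun u =>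
  ⟨⟨(sobolevHilbert.equivSobolev span_lineDir).symm u, by
    rw [← equivSobolev_mem_sobolevZero_iff, LinearEquiv.apply_symm_apply]
    exact u.2⟩, Subtype.ext (LinearEquiv.apply_symm_apply _ _)⟩

theorem weakDeriv_dirichletEquiv {ℓ : ℝ} (p : dirichletSpace ℓ) :
    weakDeriv (interval ℓ) 1 (dirichletEquiv ℓ p) = dirichletDeriv ℓ p := by
  have h : HasWeakDeriv (interval ℓ) 1 (dirichletEquiv ℓ p : sobolev (interval ℓ))
    (dirichletDeriv ℓ p) := p.1.2 ()
  exact weakDeriv_eq h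

theorem isFormOperator_dirichletLaplacian (ℓ : ℝ) :
    IsFormOperator (W := dirichletSpace ℓ) (dirichletIncl ℓ) (dirichletEnergy ℓ)
      (dirichletLaplacian ℓ) where
  injective := fun u v h => Subtype.ext (sobolevHilbert.incl_injective h)
  symm := fun u v => by
    rw [inner_dirichletEnergy, ← inner_conj_symm (𝕜 := ℂ) (dirichletEnergy ℓ u) v,
      inner_dirichletEnergy, inner_conj_symm]
  coercive := by
    refine ⟨1, one_pos, 1, fun u => ?_⟩
    rw [re_inner_dirichletEnergy, one_mul, one_mul, norm_sq_dirichletSpace, add_comm]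
  mem_graph := by
    refine mem_graph_formOperator_of_surjective (dirichletEquiv_surjective ℓ) ?_ ?_ (fun p => rfl)
      fun v u => ?_
    · exact fun u v h => Subtype.ext (Subtype.ext h)
    · intro w hw
      by_contra hw0
      obtain ⟨f, hf, hfw⟩ := sobolevHilbert.exists_test_ne_zero hw0
      exact hfw (hw (dirichletEquiv ℓ ⟨_, sobolevHilbert.ofTest_mem_zero hf⟩))
    · rw [inner_dirichletEnergy, ← weakDeriv_dirichletEquiv, ← weakDeriv_dirichletEquiv]
      rfl

end Dirichlet

/-! ### The eigenvalues of the direct sum of the Dirichlet Laplacians -/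

section DirichletEigenvalues

/-- The Dirichlet eigenfunction as a vector of `L²(0, ℓ)`. -/
def sineL2 (ℓ : ℝ) (k : ℕ) : L2 (interval ℓ) :=
  intervalL2 ℓ (Complex.continuous_ofReal.comp (continuous_sineMode ℓ k))

theorem inner_sineL2_toL2 {ℓ : ℝ} (hℓ : 0 < ℓ) (k : ℕ) (f : testFunctions ℝ) :
    inner ℂ (sineL2 ℓ k) (testFunctions.toL2 (volume.restrict (interval ℓ : Set ℝ)) f) =
      sineCoeff ℓ k f := by
  rw [L2.inner_def, sineCoeff, intervalIntegral.integral_of_le hℓ.le, integral_Ioc_eq_integral_Ioo]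
  refine integral_congr_ae ?_
  filter_upwards [coeFn_intervalL2 ℓ (Complex.continuous_ofReal.comp (continuous_sineMode ℓ k)),
    testFunctions.coeFn_toL2 (volume.restrict (interval ℓ : Set ℝ)) f] with s h1 h2
  rw [sineL2, h1, h2, RCLike.inner_apply, mul_comm]
  simp

theorem norm_sq_toL2_interval {ℓ : ℝ} (hℓ : 0 < ℓ) (f : testFunctions ℝ) :
    ‖testFunctions.toL2 (volume.restrict (interval ℓ : Set ℝ)) f‖ ^ 2 =
      ∫ s in (0 : ℝ)..ℓ, ‖(f : ℝ → ℂ) s‖ ^ 2 := by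
  rw [testFunctions.norm_sq_toL2, intervalIntegral.integral_of_le hℓ.le,
    integral_Ioc_eq_integral_Ioo]
  rfl

/-- The Poincaré inequality on `W₀^{1,2}(0, ℓ)`, by closure from the test functions. -/
theorem norm_sq_dirichletIncl_le {ℓ : ℝ} (hℓ : 0 < ℓ) {x : ℝ} (hx : 0 ≤ x) (u : dirichletSpace ℓ) :
    x * ‖dirichletIncl ℓ u‖ ^ 2 ≤ ‖dirichletDeriv ℓ u‖ ^ 2 +
      x * ∑ k ∈ Finset.range (modeCount ℓ x), ‖(inner ℂ (sineL2 ℓ k) (dirichletIncl ℓ u) : ℂ)‖ ^ 2 := by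
  refine sobolevHilbert.zero_induction (P := fun p : sobolevHilbert (interval ℓ) lineDir =>
    x * ‖sobolevHilbert.incl _ _ p‖ ^ 2 ≤ ‖sobolevHilbert.pderiv _ _ () p‖ ^ 2 +
      x * ∑ k ∈ Finset.range (modeCount ℓ x),
        ‖(inner ℂ (sineL2 ℓ k) (sobolevHilbert.incl _ _ p) : ℂ)‖ ^ 2) ?_ (fun f hf => ?_) u.2
  · refine isClosed_le (by fun_prop) ?_
    refine Continuous.add (by fun_prop) (continuous_const.mul (continuous_finsetSum _ fun k _ => ?_))
    exact ((continuous_const.inner (sobolevHilbert.incl _ _).continuous).norm).pow 2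
  · have hz : ∀ s ∉ Ioo 0 ℓ, (f : ℝ → ℂ) s = 0 := fun s hs =>
      image_eq_zero_of_notMem_tsupport fun h => hs (hf h)
    simp only [sobolevHilbert.incl_ofTest, sobolevHilbert.pderiv_ofTest, inner_sineL2_toL2 hℓ]
    rw [norm_sq_toL2_interval hℓ, norm_sq_toL2_interval hℓ]
    refine dirichlet_energy_lower_bound hℓ (fun s => ?_) (testFunctions.continuous _)
      (hz 0 (by simp)) (hz ℓ (by simp)) hx (le_dirichletFreq_modeCount hℓ x)
    rw [testFunctions.deriv_apply]
    exact (testFunctions.differentiable f s).hasFDerivAt.hasDerivAt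

variable {N : Type*} [Fintype N] [DecidableEq N]

/-- The eigenfunctions of the direct sum of the Dirichlet Laplacians. -/
def sineVector (ℓ : N → ℝ) (p : N × ℕ) : PiLp 2 fun n => L2 (interval (ℓ n)) :=
  WithLp.toLp 2 fun n => if p.1 = n then sineL2 (ℓ n) p.2 else 0

theorem inner_sineVector (ℓ : N → ℝ) (p : N × ℕ) (f : PiLp 2 fun n => L2 (interval (ℓ n))) :
    (inner ℂ (sineVector ℓ p) f : ℂ) = inner ℂ (sineL2 (ℓ p.1) p.2) (f p.1) := by
  rw [PiLp.inner_apply, Finset.sum_eq_single p.1]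
  · simp [sineVector]
  · intro n _ hn
    simp [sineVector, Ne.symm hn]
  · simp

/-- The form domain of the direct sum of the Dirichlet Laplacians. -/
abbrev DirichletSum (ℓ : N → ℝ) : Type _ := PiLp 2 fun n => dirichletSpace (ℓ n)

/-- The inclusion of the form domain of the direct sum of the Dirichlet Laplacians. -/
def dirichletSumIncl (ℓ : N → ℝ) : DirichletSum ℓ →L[ℂ] PiLp 2 fun n => L2 (interval (ℓ n)) :=
  piLpMap (W := fun n => dirichletSpace (ℓ n)) fun n => dirichletIncl (ℓ n)

/-- The operator representing the form of the direct sum of the Dirichlet Laplacians. -/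
def dirichletSumEnergy (ℓ : N → ℝ) : DirichletSum ℓ →L[ℂ] DirichletSum ℓ :=
  piLpMap (W := fun n => dirichletSpace (ℓ n)) (H := fun n => dirichletSpace (ℓ n))
    fun n => dirichletEnergy (ℓ n)

theorem isFormOperator_dirichletSum (ℓ : N → ℝ) :
    IsFormOperator (W := DirichletSum ℓ) (dirichletSumIncl ℓ) (dirichletSumEnergy ℓ)
      (directSum fun n => dirichletLaplacian (ℓ n)) :=
  IsFormOperator.directSum (W := fun n => dirichletSpace (ℓ n))
    (H := fun n => L2 (interval (ℓ n))) fun n => isFormOperator_dirichletLaplacian (ℓ n)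

theorem boundedBelowUpTo_dirichlet {ℓ : N → ℝ} (hℓ : ∀ n, 0 < ℓ n) {x : ℝ} (hx : 0 ≤ x) :
    BoundedBelowUpTo (W := DirichletSum ℓ) (dirichletSumIncl ℓ) (dirichletSumEnergy ℓ) x
      ((√x : ℂ) • (innerFamily (fun p : lowModes ℓ x => sineVector ℓ p) ∘L dirichletSumIncl ℓ)) := by
  refine boundedBelowUpTo_innerFamily (W := DirichletSum ℓ) hx fun u => ?_
  rw [Finset.sum_coe_sort (lowModes ℓ x) fun p => ‖(inner ℂ (sineVector ℓ p)
    (dirichletSumIncl ℓ u) : ℂ)‖ ^ 2, sum_lowModes, PiLp.norm_sq_eq_of_L2,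
    PiLp.inner_apply, Complex.re_sum, Finset.mul_sum, Finset.mul_sum, ← Finset.sum_add_distrib]
  refine Finset.sum_le_sum fun n _ => ?_
  simp only [inner_sineVector]
  refine (norm_sq_dirichletIncl_le (hℓ n) hx (u n)).trans (le_of_eq ?_)
  rw [← re_inner_dirichletEnergy]
  rfl

/-- The Dirichlet eigenvalues of a family of intervals are the numbers `(πk/ℓₙ)²`, in increasing
order. -/
theorem isNthDiscreteEigenvalue_directSum_dirichletLaplacian {ℓ : N → ℝ} (hℓ : ∀ n, 0 < ℓ n) {m : ℕ}
    (hm : 1 ≤ m) {μ : ℝ} (hμ : 0 < μ) (hμm : (lowModes ℓ μ).card < m) {S : Finset (N × ℕ)}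
    (hmS : m ≤ S.card) (hS : ∀ p ∈ S, dirichletFreq (ℓ p.1) p.2 ≤ μ) :
    IsNthDiscreteEigenvalue (directSum fun n => dirichletLaplacian (ℓ n)) m μ := by
  have hT := isFormOperator_dirichletSum ℓ
  have key : ∀ η > 0, η < 1 → ∃ E ≤ μ + η,
      IsNthDiscreteEigenvalue (directSum fun n => dirichletLaplacian (ℓ n)) m E := by
    intro η hη hη1
    obtain ⟨χ, hχ, hc⟩ := exists_test_family hℓ S hμ.le hS hη
    set L : (S → ℂ) →ₗ[ℂ] PiLp 2 fun n => dirichletSpace (ℓ n) :=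
      (WithLp.linearEquiv 2 ℂ (∀ n, dirichletSpace (ℓ n))).symm.toLinearMap ∘ₗ
        LinearMap.pi fun n => ((sobolevHilbert.ofTest (interval (ℓ n)) lineDir) ∘ₗ
          modeSum S χ n).codRestrict (sobolevHilbert.zero (interval (ℓ n)) lineDir)
            fun c => sobolevHilbert.ofTest_mem_zero (tsupport_modeSum (I := fun n => Ioo 0 (ℓ n)) hχ n c) with hL
    have hj : ∀ c, ‖dirichletSumIncl ℓ (L c)‖ ^ 2 = ∑ n,
        ‖testFunctions.toL2 (volume.restrict (interval (ℓ n) : Set ℝ)) (modeSum S χ n c)‖ ^ 2 :=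
      fun c => by rw [PiLp.norm_sq_eq_of_L2]; rfl
    refine hT.exists_isNth_of_family (boundedBelowUpTo_dirichlet hℓ (x := μ + 1) (by positivity))
      (by linarith) L (fun c h0 => ?_) (fun c => ?_) hm (by simpa using hmS)
    · have h1 := (hc c).2
      rw [← hj, h0, map_zero, norm_zero] at h1
      have h2 : ∑ p, ‖c p‖ ^ 2 = 0 := le_antisymm (by simpa using h1) (by positivity)
      rw [Finset.sum_eq_zero_iff_of_nonneg fun _ _ => by positivity] at h2
      funext p
      simpa using h2 p (Finset.mem_univ p)
    · rw [hj]
      refine le_trans (le_of_eq ?_) (hc c).1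
      rw [PiLp.inner_apply, Complex.re_sum]
      exact Finset.sum_congr rfl fun n _ => re_inner_dirichletEnergy _
  obtain ⟨E, hE1, hE⟩ := key (1 / 2) (by norm_num) (by norm_num)
  have hle : μ ≤ E := hT.le_of_isNthDiscreteEigenvalue (boundedBelowUpTo_dirichlet hℓ hμ.le) hE
    (by simpa using hμm)
  have hge : E ≤ μ := by
    refine le_of_forall_pos_lt_add fun η hη => ?_
    obtain ⟨E', hE'1, hE'⟩ := key (min (η / 2) (1 / 2)) (by positivity)
      ((min_le_right _ _).trans_lt (by norm_num))
    rw [hE.unique hE']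
    linarith [min_le_left (η / 2) (1 / 2)]
  rwa [le_antisymm hge hle] at hE

end DirichletEigenvalues

/-! ### Geometry of convex polygons -/

section Geometry

variable {M : ℕ}

/-- The closed convex polygon. -/
abbrev hull (P : Polygon Plane M) : Set Plane := convexHull ℝ (range P.vertices)

theorem val_finRotate (hM : 3 ≤ M) (n : Fin M) :
    ((finRotate M n : Fin M) : ℕ) = if (n : ℕ) = M - 1 then 0 else (n : ℕ) + 1 := by
  obtain ⟨k, rfl⟩ : ∃ k, M = k + 1 := ⟨M - 1, by omega⟩
  have h := coe_finRotate n
  simp only [Fin.ext_iff, Fin.val_last] at h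
  exact h

theorem finRotate_ne_self (hM : 3 ≤ M) (n : Fin M) : finRotate M n ≠ n := by
  rw [Ne, Fin.ext_iff, val_finRotate hM]
  split_ifs <;> omega

theorem finRotate_finRotate_ne_self (hM : 3 ≤ M) (n : Fin M) :
    finRotate M (finRotate M n) ≠ n := by
  rw [Ne, Fin.ext_iff, val_finRotate hM, val_finRotate hM]
  split_ifs <;> omega

variable {P : Polygon Plane M}

theorem vertex_mem_hull (n : Fin M) : P n ∈ hull P := subset_convexHull ℝ _ ⟨n, rfl⟩

namespace IsConvexPolygon

theorem notMem_segment (hP : IsConvexPolygon P) {i j k : Fin M} (hj : i ≠ j) (hk : i ≠ k) :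
    P i ∉ segment ℝ (P j) (P k) := by
  intro h
  rw [← convexHull_pair] at h
  have := hP.convexIndependent {j, k} i (by rwa [image_pair])
  simp [hj, hk] at this

/-- No three vertices are on a line. -/
theorem not_collinear (hP : IsConvexPolygon P) {i j k : Fin M} (hij : i ≠ j) (hik : i ≠ k)
    (hjk : j ≠ k) (q u : Plane) (r : Fin M → ℝ) (hi : P i = q + r i • u) (hj : P j = q + r j • u)
    (hk : P k = q + r k • u) : False := by
  have key : ∀ {i j k : Fin M}, i ≠ j → i ≠ k → P i = q + r i • u → P j = q + r j • u →
      P k = q + r k • u → r j ≤ r i → r i ≤ r k → False := by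
    intro i j k hij hik hi hj hk h1 h2
    refine hP.notMem_segment hij hik ?_
    have h := image_segment ℝ (AffineMap.lineMap q (q + u)) (r j) (r k)
    have hl : ∀ t : ℝ, AffineMap.lineMap q (q + u) t = q + t • u := fun t => by
      rw [AffineMap.lineMap_apply]
      simp [add_comm]
    rw [hl, hl, ← hj, ← hk] at h
    rw [← h, hi, ← hl]
    refine ⟨r i, ?_, rfl⟩
    rw [segment_eq_Icc (h1.trans h2)]
    exact ⟨h1, h2⟩
  rcases le_total (r i) (r j) with h1 | h1 <;> rcases le_total (r j) (r k) with h2 | h2 <;>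
    rcases le_total (r i) (r k) with h3 | h3
  · exact key hij.symm hjk hj hi hk h1 h2
  · exact key hij.symm hjk hj hi hk h1 h2
  · exact key hik.symm hjk.symm hk hi hj h3 h2
  · exact key hik hij hi hk hj h3 h1
  · exact key hij hik hi hj hk h1 h3
  · exact key hjk.symm hik.symm hk hj hi h2 h3
  · exact key hjk hij.symm hj hk hi h2 h1
  · exact key hjk hij.symm hj hk hi h2 h1

theorem nonempty_interior (hP : IsConvexPolygon P) : (interior (hull P)).Nonempty := by
  have hM := hP.three_le
  -- three consecutive vertices form a non-degenerate triangle
  set n : Fin M := ⟨0, by omega⟩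
  set i := finRotate M n
  set j := finRotate M i
  have hni : n ≠ i := (finRotate_ne_self hM n).symm
  have hij : i ≠ j := (finRotate_ne_self hM i).symm
  have hnj : n ≠ j := (finRotate_finRotate_ne_self hM n).symm
  rw [interior_convexHull_nonempty_iff_affineSpan_eq_top]
  have hind : AffineIndependent ℝ ![P n, P i, P j] := by
    rw [affineIndependent_iff_not_collinear_set, collinear_iff_exists_forall_eq_smul_vadd]
    rintro ⟨q, u, h⟩
    choose! r hr using h
    refine hP.not_collinear hni hnj hij q u (fun k => r (P k)) ?_ ?_ ?_
    · rw [add_comm]; exact hr (P n) (by simp)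
    · rw [add_comm]; exact hr (P i) (by simp)
    · rw [add_comm]; exact hr (P j) (by simp)
  have htop := hind.affineSpan_eq_top_iff_card_eq_finrank_add_one.mpr (by simp)
  refine top_unique (htop ▸ affineSpan_mono ℝ ?_)
  rintro _ ⟨k, rfl⟩
  fin_cases k
  exacts [⟨n, rfl⟩, ⟨i, rfl⟩, ⟨j, rfl⟩]

theorem sideLength_pos (hP : IsConvexPolygon P) (n : Fin M) : 0 < sideLength P n := by
  rw [sideLength, dist_pos]
  intro h
  exact finRotate_ne_self hP.three_le n (hP.convexIndependent.injective h).symm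

end IsConvexPolygon

/-- Orthonormal bases `b n` adapted to the sides of the polygon: `b n 0` is the unit tangent vector
along the `n`th side and `b n 1` is the unit normal that points out of the polygon. -/
structure IsSideFrame (P : Polygon Plane M) (b : Fin M → OrthonormalBasis (Fin 2) ℝ Plane) :
    Prop where
  next : ∀ n, P (finRotate M n) = P n + sideLength P n • b n 0
  inner_le : ∀ n, ∀ x ∈ hull P, inner ℝ (x - P n) (b n 1) ≤ 0

/-- The outward normal of a side comes from a supporting line at its midpoint. -/
theorem IsConvexPolygon.exists_isSideFrame (hP : IsConvexPolygon P) : ∃ b, IsSideFrame P b := by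
  have h : ∀ n, ∃ b : OrthonormalBasis (Fin 2) ℝ Plane,
      P (finRotate M n) = P n + sideLength P n • b 0 ∧
      ∀ x ∈ hull P, inner ℝ (x - P n) (b 1) ≤ 0 := by
    intro n
    have hℓ := hP.sideLength_pos n
    set q : Plane := midpoint ℝ (P n) (P (finRotate M n)) with hq
    have hqf : q ∈ frontier (hull P) := by
      rw [hP.frontier_eq, Polygon.boundary]
      refine mem_iUnion.mpr ⟨n, ?_⟩
      rw [Polygon.edgeSet, affineSegment_eq_segment]
      exact midpoint_mem_segment _ _
    obtain ⟨f, hf0, hf⟩ := geometric_hahn_banach_of_nonempty_interior_point (convex_convexHull ℝ _)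
      hqf.2 hP.nonempty_interior
    set w : Plane := (InnerProductSpace.toDual ℝ Plane).symm f with hw
    have hfw : ∀ x, f x = inner ℝ x w := fun x => by
      rw [real_inner_comm, hw, InnerProductSpace.toDual_symm_apply]
    have hw0 : w ≠ 0 := fun h => hf0 (by simpa [hw] using h)
    have hwn : 0 < ‖w‖ := norm_pos_iff.mpr hw0
    -- the functional attains its maximum at both ends of the side, as it does so at the midpoint
    have h1 := hf _ (vertex_mem_hull n)
    have h2 := hf _ (vertex_mem_hull (finRotate M n))
    have h3 : f q = (f (P n) + f (P (finRotate M n))) / 2 := by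
      rw [hq, midpoint_eq_smul_add, map_smul, map_add, smul_eq_mul]
      simp
      ring
    have h4 : f (P (finRotate M n)) = f (P n) := by linarith
    have h5 : f q = f (P n) := by linarith
    set τ : Plane := (sideLength P n)⁻¹ • (P (finRotate M n) - P n) with hτ
    have hτn : ‖τ‖ = 1 := by
      rw [hτ, norm_smul, norm_inv, Real.norm_eq_abs, abs_of_pos hℓ, ← dist_eq_norm, dist_comm]
      exact inv_mul_cancel₀ hℓ.ne'
    have hτw : inner ℝ τ w = 0 := by
      rw [← hfw, hτ, map_smul, map_sub, h4, sub_self, smul_zero]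
    have hon : Orthonormal ℝ ![τ, ‖w‖⁻¹ • w] := by
      rw [orthonormal_vecCons_iff]
      refine ⟨hτn, fun i => ?_, ?_⟩
      · fin_cases i
        simp [inner_smul_right, hτw]
      · rw [orthonormal_vecCons_iff]
        refine ⟨?_, fun i => i.elim0, ?_⟩
        · rw [norm_smul, norm_inv, norm_norm, inv_mul_cancel₀ hwn.ne']
        · exact ⟨fun i => i.elim0, fun i => i.elim0⟩
    have hspan := hon.linearIndependent.span_eq_top_of_card_eq_finrank' (by simp)
    refine ⟨OrthonormalBasis.mk hon hspan.ge, ?_, fun x hx => ?_⟩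
    · rw [OrthonormalBasis.coe_mk]
      simp only [Matrix.cons_val_zero, hτ]
      rw [smul_inv_smul₀ hℓ.ne', add_sub_cancel]
    · rw [OrthonormalBasis.coe_mk]
      simp only [Matrix.cons_val_one, Matrix.cons_val_fin_one]
      rw [inner_smul_right, ← hfw, map_sub]
      have := hf x hx
      exact mul_nonpos_of_nonneg_of_nonpos (by positivity) (by linarith)
  choose b hb using h
  exact ⟨b, fun n => (hb n).1, fun n => (hb n).2⟩

/-- The coordinates along and normal to the `n`th side. -/
def chart (P : Polygon Plane M) (b : Fin M → OrthonormalBasis (Fin 2) ℝ Plane) (n : Fin M)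
    (p : ℝ × ℝ) : Plane := P n + (p.1 • b n 0 + p.2 • b n 1)

/-- Oblique coordinates at the end of the `n`th side, along the outward normals of the two sides
that meet there. -/
def corner (P : Polygon Plane M) (b : Fin M → OrthonormalBasis (Fin 2) ℝ Plane) (n : Fin M)
    (p : ℝ × ℝ) : Plane := P (finRotate M n) + (p.1 • b n 1 + p.2 • b (finRotate M n) 1)

/-- The half-strip on the outer side of the `n`th side. -/
def strip (P : Polygon Plane M) (b : Fin M → OrthonormalBasis (Fin 2) ℝ Plane) (n : Fin M) :
    Set Plane := chart P b n '' (Ioo 0 (sideLength P n) ×ˢ Ioi 0)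

/-- The sector at the end of the `n`th side between the two adjacent half-strips. -/
def sector (P : Polygon Plane M) (b : Fin M → OrthonormalBasis (Fin 2) ℝ Plane) (n : Fin M) :
    Set Plane := corner P b n '' (Ioi 0 ×ˢ Ioi 0)

variable {b : Fin M → OrthonormalBasis (Fin 2) ℝ Plane}

theorem inner_chart_zero (n : Fin M) (p : ℝ × ℝ) :
    inner ℝ (chart P b n p - P n) (b n 0) = p.1 := by
  simp [chart, inner_add_left, inner_smul_left, OrthonormalBasis.inner_eq_ite]

theorem inner_chart_one (n : Fin M) (p : ℝ × ℝ) :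
    inner ℝ (chart P b n p - P n) (b n 1) = p.2 := by
  simp [chart, inner_add_left, inner_smul_left, OrthonormalBasis.inner_eq_ite]

theorem chart_inner (n : Fin M) (x : Plane) :
    chart P b n (inner ℝ (x - P n) (b n 0), inner ℝ (x - P n) (b n 1)) = x := by
  have := (b n).sum_repr' (x - P n)
  rw [Fin.sum_univ_two] at this
  rw [chart, real_inner_comm, real_inner_comm (b n 1), this, add_sub_cancel]

theorem chart_injective (n : Fin M) : Function.Injective (chart P b n) := fun p q h =>
  Prod.ext (by rw [← inner_chart_zero (P := P) (b := b) n p, h, inner_chart_zero])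
    (by rw [← inner_chart_one (P := P) (b := b) n p, h, inner_chart_one])

theorem mem_strip_iff {n : Fin M} {x : Plane} : x ∈ strip P b n ↔
    inner ℝ (x - P n) (b n 0) ∈ Ioo 0 (sideLength P n) ∧ 0 < inner ℝ (x - P n) (b n 1) := by
  constructor
  · rintro ⟨p, hp, rfl⟩
    rw [inner_chart_zero, inner_chart_one]
    exact hp
  · intro h
    exact ⟨_, h, chart_inner n x⟩

/-- `p` is the nearest point to `x` in the convex set `K`. -/
def IsFoot (K : Set Plane) (x p : Plane) : Prop := p ∈ K ∧ ∀ y ∈ K, inner ℝ (x - p) (y - p) ≤ 0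

theorem IsFoot.unique {K : Set Plane} {x p q : Plane} (hp : IsFoot K x p) (hq : IsFoot K x q) :
    p = q := by
  have h1 := hp.2 q hq.1
  have h2 := hq.2 p hp.1
  have h3 : inner ℝ (x - p) (q - p) + inner ℝ (x - q) (p - q) = ‖q - p‖ ^ 2 := by
    rw [← real_inner_self_eq_norm_sq, ← neg_sub q p, inner_neg_right, ← sub_eq_add_neg,
      ← inner_sub_left]
    congr 1
    abel
  have h4 : ‖q - p‖ = 0 := by nlinarith [sq_nonneg ‖q - p‖]
  exact (sub_eq_zero.mp (norm_eq_zero.mp h4)).symm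

theorem IsFoot.notMem {K : Set Plane} {x p : Plane} (hp : IsFoot K x p) (hx : x ≠ p) : x ∉ K :=
  fun h => hx (IsFoot.unique (p := x) (q := p) ⟨h, fun y _ => by simp⟩ hp)

namespace IsSideFrame

theorem chart_eq_lineMap (hb : IsSideFrame P b) (hP : IsConvexPolygon P) (n : Fin M) (s : ℝ) :
    chart P b n (s, 0) = AffineMap.lineMap (P n) (P (finRotate M n)) (s / sideLength P n) := by
  rw [AffineMap.lineMap_apply, hb.next, chart, vsub_eq_sub, add_sub_cancel_left, smul_smul,
    div_mul_cancel₀ _ (hP.sideLength_pos n).ne', zero_smul, add_zero, vadd_eq_add, add_comm]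

theorem edgeSet_eq (hb : IsSideFrame P b) (hP : IsConvexPolygon P) (n : Fin M) :
    P.edgeSet ℝ n = (fun s => chart P b n (s, 0)) '' Icc 0 (sideLength P n) := by
  have hℓ := hP.sideLength_pos n
  rw [Polygon.edgeSet, affineSegment]
  ext x
  constructor
  · rintro ⟨s, hs, rfl⟩
    refine ⟨s * sideLength P n, ⟨mul_nonneg hs.1 hℓ.le, mul_le_of_le_one_left hℓ.le hs.2⟩, ?_⟩
    simp only
    rw [hb.chart_eq_lineMap hP, mul_div_cancel_right₀ _ hℓ.ne']
  · rintro ⟨s, hs, rfl⟩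
    exact ⟨s / sideLength P n, ⟨div_nonneg hs.1 hℓ.le, (div_le_one hℓ).mpr hs.2⟩,
      (hb.chart_eq_lineMap hP n s).symm⟩

theorem frontier_eq (hb : IsSideFrame P b) (hP : IsConvexPolygon P) :
    frontier (exterior P : Set Plane) =
      ⋃ n, (fun s => chart P b n (s, 0)) '' Icc 0 (sideLength P n) := by
  rw [exterior, TopologicalSpace.Opens.coe_mk, frontier_compl, hP.frontier_eq, Polygon.boundary]
  simp only [hb.edgeSet_eq hP]

theorem chart_mem_hull (hb : IsSideFrame P b) (hP : IsConvexPolygon P) (n : Fin M) {s : ℝ}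
    (hs : s ∈ Icc 0 (sideLength P n)) : chart P b n (s, 0) ∈ hull P := by
  have hℓ := hP.sideLength_pos n
  rw [hb.chart_eq_lineMap hP]
  exact (convex_convexHull ℝ _).lineMap_mem (vertex_mem_hull _) (vertex_mem_hull _)
    ⟨div_nonneg hs.1 hℓ.le, (div_le_one hℓ).mpr hs.2⟩

theorem inner_next (hb : IsSideFrame P b) (n : Fin M) :
    inner ℝ (P (finRotate M n) - P n) (b n 1) = 0 := by
  rw [hb.next]
  simp [inner_smul_left, OrthonormalBasis.inner_eq_ite]

/-- Only the end points of a side are on the line through it. -/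
theorem eq_or_eq (hb : IsSideFrame P b) (hP : IsConvexPolygon P) {n k : Fin M}
    (h : inner ℝ (P k - P n) (b n 1) = 0) : k = n ∨ k = finRotate M n := by
  by_contra! hcon
  have hline : ∀ j, inner ℝ (P j - P n) (b n 1) = 0 →
      P j = P n + (inner ℝ (P j - P n) (b n 0) : ℝ) • b n 0 := by
    intro j hj
    have := chart_inner (P := P) (b := b) n (P j)
    rw [hj, chart, zero_smul, add_zero] at this
    exact this.symm
  exact hP.not_collinear hcon.1 hcon.2 (finRotate_ne_self hP.three_le n).symm (P n) (b n 0)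
    (fun j => inner ℝ (P j - P n) (b n 0)) (hline k h) (hline n (by simp))
    (hline _ (hb.inner_next n))

/-- The points of the closed half-strip project to the side. -/
theorem isFoot_chart (hb : IsSideFrame P b) (hP : IsConvexPolygon P) (n : Fin M) {s t : ℝ}
    (hs : s ∈ Icc 0 (sideLength P n)) (ht : 0 ≤ t) :
    IsFoot (hull P) (chart P b n (s, t)) (chart P b n (s, 0)) := by
  refine ⟨hb.chart_mem_hull hP n hs, fun y hy => ?_⟩
  have h1 : chart P b n (s, t) - chart P b n (s, 0) = t • b n 1 := by
    simp only [chart]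
    module
  have h2 : inner ℝ (y - chart P b n (s, 0)) (b n 1) = inner ℝ (y - P n) (b n 1) := by
    have := inner_chart_one (P := P) (b := b) n (s, 0)
    rw [← sub_sub_sub_cancel_right y _ (P n), inner_sub_left, this, sub_zero]
  rw [h1, inner_smul_left, real_inner_comm, h2]
  exact mul_nonpos_of_nonneg_of_nonpos ht (hb.inner_le n y hy)

/-- The points of the closed sector project to the vertex: they differ from it by an element of its
normal cone. -/
theorem isFoot_corner (hb : IsSideFrame P b) (n : Fin M) {p : ℝ × ℝ} (hp1 : 0 ≤ p.1)
    (hp2 : 0 ≤ p.2) : IsFoot (hull P) (corner P b n p) (P (finRotate M n)) := by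
  refine ⟨vertex_mem_hull _, fun y hy => ?_⟩
  have h1 := hb.inner_le n y hy
  have h2 := hb.inner_le (finRotate M n) y hy
  have h3 : inner ℝ (y - P (finRotate M n)) (b n 1) = inner ℝ (y - P n) (b n 1) := by
    rw [← sub_sub_sub_cancel_right y _ (P n), inner_sub_left, hb.inner_next, sub_zero]
  rw [corner, add_sub_cancel_left, real_inner_comm, inner_add_right, inner_smul_right,
    inner_smul_right, h3]
  exact add_nonpos (mul_nonpos_of_nonneg_of_nonpos hp1 h1) (mul_nonpos_of_nonneg_of_nonpos hp2 h2)

/-- The normals of adjacent sides are linearly independent. -/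
theorem linearIndependent_normals (hb : IsSideFrame P b) (hP : IsConvexPolygon P) (n : Fin M) :
    LinearIndependent ℝ ![b n 1, b (finRotate M n) 1] := by
  rw [LinearIndependent.pair_iff' ((b n).orthonormal.ne_zero 1)]
  intro c hc
  have h0 : inner ℝ (P n - P (finRotate M n)) (b (finRotate M n) 1) = 0 := by
    rw [← hc, inner_smul_right, ← neg_sub, inner_neg_left, hb.inner_next, neg_zero, mul_zero]
  rcases hb.eq_or_eq hP h0 with h | h
  · exact finRotate_ne_self hP.three_le n h.symm
  · exact finRotate_finRotate_ne_self hP.three_le n h.symm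

theorem strip_subset (hb : IsSideFrame P b) (hP : IsConvexPolygon P) (n : Fin M) :
    strip P b n ⊆ (exterior P : Set Plane) := by
  rintro _ ⟨⟨s, t⟩, ⟨hs, ht : 0 < t⟩, rfl⟩
  refine (hb.isFoot_chart hP n (Ioo_subset_Icc_self hs) ht.le).notMem fun h => ?_
  exact ht.ne' (congrArg Prod.snd (chart_injective n h))

theorem corner_ne (hb : IsSideFrame P b) (hP : IsConvexPolygon P) (n : Fin M) {p : ℝ × ℝ}
    (hp : 0 < p.1) : corner P b n p ≠ P (finRotate M n) := by
  intro h
  rw [corner, add_eq_left] at h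
  exact hp.ne' (LinearIndependent.pair_iff.mp (hb.linearIndependent_normals hP n) _ _ h).1

theorem sector_subset (hb : IsSideFrame P b) (hP : IsConvexPolygon P) (n : Fin M) :
    sector P b n ⊆ (exterior P : Set Plane) := by
  rintro _ ⟨p, ⟨hp1 : 0 < p.1, hp2 : 0 < p.2⟩, rfl⟩
  exact (hb.isFoot_corner n hp1.le hp2.le).notMem (hb.corner_ne hP n hp1)

/-- The line through a side meets the relative interior of no other side. -/
theorem eq_of_chart_eq_chart (hb : IsSideFrame P b) (hP : IsConvexPolygon P) {n k : Fin M}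
    {s s' : ℝ} (hs' : s' ∈ Ioo 0 (sideLength P k))
    (h : chart P b n (s, 0) = chart P b k (s', 0)) : n = k := by
  have hℓ := hP.sideLength_pos k
  -- the normal coordinate with respect to the first side vanishes at both ends of the second
  have h0 := inner_chart_one (P := P) (b := b) n (s, 0)
  have h1 := hb.inner_le n _ (vertex_mem_hull k)
  have h2 := hb.inner_le n _ (vertex_mem_hull (finRotate M k))
  have h3 : inner ℝ (P (finRotate M k) - P n) (b n 1) =
      inner ℝ (P k - P n) (b n 1) + sideLength P k * inner ℝ (b k 0) (b n 1) := by
    rw [hb.next, add_sub_right_comm, inner_add_left, real_inner_smul_left]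
  have h4 : inner ℝ (chart P b k (s', 0) - P n) (b n 1) =
      inner ℝ (P k - P n) (b n 1) + s' * inner ℝ (b k 0) (b n 1) := by
    rw [chart, zero_smul, add_zero, add_sub_right_comm, inner_add_left, real_inner_smul_left]
  rw [← h, h0] at h4
  simp only at h4
  rw [h3] at h2
  have h5 : inner ℝ (b k 0) (b n 1) = (0 : ℝ) := by
    rcases lt_trichotomy (inner ℝ (b k 0) (b n 1) : ℝ) 0 with hlt | heq | hgt
    · nlinarith [hs'.1]
    · exact heq
    · nlinarith [hs'.2]
  rw [h5, mul_zero, add_zero] at h4 h3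
  rcases hb.eq_or_eq hP h4.symm with hk | hk
  · exact hk.symm
  · rcases hb.eq_or_eq hP (h3.trans h4.symm) with hk' | hk'
    · rw [hk] at hk'
      exact absurd hk' (finRotate_finRotate_ne_self hP.three_le n)
    · exact ((finRotate M).injective hk').symm

/-- A point of two half-strips would have two nearest points in the polygon. -/
theorem disjoint_strip_strip (hb : IsSideFrame P b) (hP : IsConvexPolygon P) {n k : Fin M}
    (hnk : n ≠ k) : Disjoint (strip P b n) (strip P b k) := by
  rw [Set.disjoint_left]
  rintro _ ⟨⟨s, t⟩, ⟨hs, ht : 0 < t⟩, rfl⟩ ⟨⟨s', t'⟩, ⟨hs', ht' : 0 < t'⟩, h⟩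
  have h1 := hb.isFoot_chart hP k (Ioo_subset_Icc_self hs') ht'.le
  rw [h] at h1
  exact hnk (hb.eq_of_chart_eq_chart hP hs'
    ((hb.isFoot_chart hP n (Ioo_subset_Icc_self hs) ht.le).unique h1))

theorem chart_ne_vertex (hb : IsSideFrame P b) (hP : IsConvexPolygon P) {n k : Fin M} {s : ℝ}
    (hs : s ∈ Ioo 0 (sideLength P n)) : chart P b n (s, 0) ≠ P k := by
  intro h
  have h0 := inner_chart_one (P := P) (b := b) n (s, 0)
  have h1 := inner_chart_zero (P := P) (b := b) n (s, 0)
  rw [h] at h0 h1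
  rcases hb.eq_or_eq hP h0 with rfl | rfl
  · rw [sub_self, inner_zero_left] at h1
    exact hs.1.ne h1
  · rw [hb.next, add_sub_cancel_left, real_inner_smul_left] at h1
    simp only [OrthonormalBasis.inner_eq_ite, if_true, mul_one] at h1
    exact hs.2.ne h1.symm

theorem disjoint_strip_sector (hb : IsSideFrame P b) (hP : IsConvexPolygon P) (n k : Fin M) :
    Disjoint (strip P b n) (sector P b k) := by
  rw [Set.disjoint_left]
  rintro _ ⟨⟨s, t⟩, ⟨hs, ht : 0 < t⟩, rfl⟩ ⟨p, ⟨hp1 : 0 < p.1, hp2 : 0 < p.2⟩, h⟩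
  have h1 := hb.isFoot_corner k hp1.le hp2.le
  rw [h] at h1
  exact hb.chart_ne_vertex hP hs ((hb.isFoot_chart hP n (Ioo_subset_Icc_self hs) ht.le).unique h1)

theorem disjoint_sector_sector (hb : IsSideFrame P b) (hP : IsConvexPolygon P) {n k : Fin M}
    (hnk : n ≠ k) : Disjoint (sector P b n) (sector P b k) := by
  rw [Set.disjoint_left]
  rintro _ ⟨p, ⟨hp1 : 0 < p.1, hp2 : 0 < p.2⟩, rfl⟩ ⟨q, ⟨hq1 : 0 < q.1, hq2 : 0 < q.2⟩, h⟩
  have h1 := hb.isFoot_corner k hq1.le hq2.le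
  rw [h] at h1
  exact hnk ((finRotate M).injective (hP.convexIndependent.injective
    ((hb.isFoot_corner n hp1.le hp2.le).unique h1)))

/-- Near a compact part of a side, the inner side of that side belongs to the polygon. -/
theorem exists_chart_mem_hull (hb : IsSideFrame P b) (hP : IsConvexPolygon P) (n : Fin M)
    {I : Set ℝ} (hI : IsCompact I) (hIn : I ⊆ Ioo 0 (sideLength P n)) :
    ∃ δ > 0, ∀ s ∈ I, ∀ t, -δ ≤ t → t ≤ 0 → chart P b n (s, t) ∈ hull P := by
  -- a vertex that is not on the line through the side
  obtain ⟨k, hk⟩ : ∃ k, inner ℝ (P k - P n) (b n 1) < 0 := by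
    refine ⟨finRotate M (finRotate M n), lt_of_le_of_ne (hb.inner_le n _ (vertex_mem_hull _)) ?_⟩
    intro h
    rcases hb.eq_or_eq hP h with h | h
    · exact finRotate_finRotate_ne_self hP.three_le n h
    · exact finRotate_ne_self hP.three_le _ h
  set z := inner ℝ (P k - P n) (b n 0) with hz
  set y := inner ℝ (P k - P n) (b n 1) with hy
  have hPk : chart P b n (z, y) = P k := chart_inner n (P k)
  -- the points of the triangle over the side: `t = θ y` and `s = θ z + (1 - θ) s'`
  have hev : ∀ᶠ t in 𝓝 (0 : ℝ), ∀ s ∈ I, 0 < s - t / y * z ∧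
      s - t / y * z < (1 - t / y) * sideLength P n := by
    refine hI.eventually_forall_of_forall_eventually fun s hs => ?_
    have hs' := hIn hs
    refine Filter.Eventually.and ?_ ?_
    · refine ContinuousAt.eventually_lt continuousAt_const ?_ (by simpa using hs'.1)
      fun_prop
    · refine ContinuousAt.eventually_lt ?_ ?_ (by simpa using hs'.2) <;> fun_prop
  obtain ⟨δ, hδ, hball⟩ := Metric.eventually_nhds_iff.mp hev
  set ε := min (δ / 2) (-y / 2) with hε
  have hε1 : ε ≤ δ / 2 := min_le_left _ _
  have hε2 : ε ≤ -y / 2 := min_le_right _ _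
  refine ⟨ε, lt_min (by linarith) (by linarith), fun s hs t ht ht0 => ?_⟩
  obtain ⟨h1, h2⟩ := hball (y := t) (by
    rw [Real.dist_eq, sub_zero, abs_of_nonpos ht0]
    linarith) s hs
  set θ := t / y with hθ
  have hθ0 : 0 ≤ θ := div_nonneg_of_nonpos ht0 hk.le
  have hθ1 : θ < 1 := by
    rw [hθ, div_lt_one_of_neg hk]
    linarith
  have hθy : θ * y = t := div_mul_cancel₀ t hk.ne
  have hmem := convex_convexHull ℝ (range P.vertices) (vertex_mem_hull k)
    (hb.chart_mem_hull hP n (s := (s - θ * z) / (1 - θ)) ⟨by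
      have : 0 < 1 - θ := by linarith
      positivity, by
      rw [div_le_iff₀ (by linarith)]
      linarith⟩) hθ0 (b := 1 - θ) (by linarith) (by ring)
  convert hmem using 1
  rw [← hPk]
  have h3 : (1 - θ) * ((s - θ * z) / (1 - θ)) = s - θ * z :=
    mul_div_cancel₀ _ (by linarith : (1 - θ) ≠ 0)
  simp only [chart, ← hθy]
  rw [zero_smul, add_zero, smul_add (1 - θ), smul_smul, h3]
  module

end IsSideFrame

end Geometry

/-! ### Inequalities on the half-line -/

section HalfLine

variable {w w' : ℝ → ℂ}

theorem integrable_norm_sq (hw : Continuous w) (hc : HasCompactSupport w) :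
    Integrable (fun t => ‖w t‖ ^ 2) :=
  (hw.norm.pow 2).integrable_of_hasCompactSupport
    (hc.mono fun t ht h0 => ht (by simp [h0]))

theorem eventually_eq_zero_atTop (hc : HasCompactSupport w) : ∀ᶠ t in atTop, w t = 0 := by
  obtain ⟨B, hB⟩ := hc.isCompact.bddAbove
  filter_upwards [eventually_gt_atTop B] with t ht
  exact image_eq_zero_of_notMem_tsupport fun h => not_lt.mpr (hB h) ht

/-- Trace inequality: the boundary value is controlled by the function and its derivative. -/
theorem norm_sq_zero_le (hw : ∀ t, HasDerivAt w (w' t) t) (hw' : Continuous w')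
    (hc : HasCompactSupport w) (hc' : HasCompactSupport w') {ε : ℝ} (hε : 0 < ε) :
    ‖w 0‖ ^ 2 ≤ ε * (∫ t in Ioi 0, ‖w' t‖ ^ 2) + ε⁻¹ * ∫ t in Ioi 0, ‖w t‖ ^ 2 := by
  have hwc : Continuous w := continuous_iff_continuousAt.mpr fun s => (hw s).continuousAt
  have hint : Integrable fun t => 2 * inner ℝ (w t) (w' t) := by
    refine (continuous_const.mul (hwc.inner hw')).integrable_of_hasCompactSupport ?_
    refine hc.mono fun t ht h0 => ht ?_
    simp only [h0, inner_zero_left, mul_zero]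
  have hlim : Tendsto (fun t => ‖w t‖ ^ 2) atTop (𝓝 0) := by
    refine tendsto_const_nhds.congr' ?_
    filter_upwards [eventually_eq_zero_atTop hc] with t ht
    rw [ht, norm_zero, zero_pow two_ne_zero]
  have h : ∫ t in Ioi 0, 2 * inner ℝ (w t) (w' t) = 0 - ‖w 0‖ ^ 2 :=
    integral_Ioi_of_hasDerivAt_of_tendsto (f := fun t => ‖w t‖ ^ 2)
      (hwc.norm.pow 2).continuousWithinAt (fun t _ => (hw t).norm_sq) hint.integrableOn hlim
  have i1 : IntegrableOn (fun t => ε * ‖w' t‖ ^ 2) (Ioi 0) :=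
    (integrable_norm_sq hw' hc').integrableOn.const_mul ε
  have i2 : IntegrableOn (fun t => ε⁻¹ * ‖w t‖ ^ 2) (Ioi 0) :=
    (integrable_norm_sq hwc hc).integrableOn.const_mul ε⁻¹
  have h1 : ‖w 0‖ ^ 2 = ∫ t in Ioi 0, -(2 * inner ℝ (w t) (w' t)) := by
    rw [integral_neg, h]
    ring
  rw [h1, ← integral_const_mul, ← integral_const_mul, ← integral_add i1 i2]
  refine integral_mono (Integrable.neg hint.integrableOn) (i1.add i2) fun t => ?_
  have h2 := abs_real_inner_le_norm (w t) (w' t)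
  have h3 := neg_abs_le (inner ℝ (w t) (w' t))
  have h4 : ε * ‖w' t‖ ^ 2 + ε⁻¹ * ‖w t‖ ^ 2 - 2 * (‖w t‖ * ‖w' t‖) =
      ε * (‖w' t‖ - ε⁻¹ * ‖w t‖) ^ 2 := by
    field_simp
    ring
  have h5 : 0 ≤ ε * (‖w' t‖ - ε⁻¹ * ‖w t‖) ^ 2 := by positivity
  change -(2 * inner ℝ (w t) (w' t)) ≤ ε * ‖w' t‖ ^ 2 + ε⁻¹ * ‖w t‖ ^ 2
  linarith

/-- The normalized transverse ground state `√(2α) exp (-α t)` on the half-line. -/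
def groundState (α t : ℝ) : ℝ := √(2 * α) * Real.exp (-α * t)

theorem continuous_groundState (α : ℝ) : Continuous (groundState α) := by
  unfold groundState
  fun_prop

theorem groundState_sq {α : ℝ} (hα : 0 < α) (t : ℝ) :
    groundState α t ^ 2 = 2 * α * Real.exp (-(2 * α) * t) := by
  rw [groundState, mul_pow, Real.sq_sqrt (by positivity), ← Real.exp_nat_mul]
  congr 2
  push_cast
  ring

theorem integrableOn_groundState {α : ℝ} (hα : 0 < α) : IntegrableOn (groundState α) (Ioi 0) :=
  (integrableOn_exp_mul_Ioi (neg_lt_zero.mpr hα) 0).const_mul _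

theorem integrableOn_groundState_sq {α : ℝ} (hα : 0 < α) :
    IntegrableOn (fun t => groundState α t ^ 2) (Ioi 0) := by
  simp only [groundState_sq hα]
  exact (integrableOn_exp_mul_Ioi (neg_lt_zero.mpr (by positivity)) 0).const_mul _

theorem integral_groundState_sq {α : ℝ} (hα : 0 < α) : ∫ t in Ioi 0, groundState α t ^ 2 = 1 := by
  simp only [groundState_sq hα]
  rw [integral_const_mul, integral_exp_mul_Ioi (neg_lt_zero.mpr (by positivity)), mul_zero,
    Real.exp_zero]
  field_simp

/-- The component along the transverse ground state. -/
def groundCoeff (α : ℝ) (w : ℝ → ℂ) : ℂ := ∫ t in Ioi 0, (groundState α t : ℂ) * w t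

theorem integrable_groundState_mul (α : ℝ) (hw : Continuous w) (hc : HasCompactSupport w) :
    Integrable fun t => (groundState α t : ℂ) * w t :=
  ((Complex.continuous_ofReal.comp (continuous_groundState α)).mul hw).integrable_of_hasCompactSupport
    hc.mul_left

/-- Bessel's inequality for the normalized ground state. -/
theorem norm_sq_groundCoeff_le {α : ℝ} (hα : 0 < α) (hw : Continuous w)
    (hc : HasCompactSupport w) : ‖groundCoeff α w‖ ^ 2 ≤ ∫ t in Ioi 0, ‖w t‖ ^ 2 := by
  set c := groundCoeff α w with hcd
  have h0 : ∀ t, ‖w t - c * groundState α t‖ ^ 2 = ‖w t‖ ^ 2 -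
      2 * ((starRingEnd ℂ) c * ((groundState α t : ℂ) * w t)).re + ‖c‖ ^ 2 * groundState α t ^ 2 := by
    intro t
    rw [← Complex.normSq_eq_norm_sq, ← Complex.normSq_eq_norm_sq, ← Complex.normSq_eq_norm_sq,
      Complex.normSq_apply, Complex.normSq_apply, Complex.normSq_apply]
    simp
    ring
  have hI := (integrable_groundState_mul α hw hc).integrableOn (s := Ioi 0)
  have h1 : 0 ≤ ∫ t in Ioi 0, ‖w t - c * groundState α t‖ ^ 2 :=
    integral_nonneg fun t => by positivity
  simp only [h0] at h1
  have hre : IntegrableOn (fun t => 2 * ((starRingEnd ℂ) c * ((groundState α t : ℂ) * w t)).re)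
      (Ioi 0) := (hI.const_mul ((starRingEnd ℂ) c)).re.const_mul 2
  have hw2 := (integrable_norm_sq hw hc).integrableOn (s := Ioi 0)
  have hsub : IntegrableOn (fun t => ‖w t‖ ^ 2 -
      2 * ((starRingEnd ℂ) c * ((groundState α t : ℂ) * w t)).re) (Ioi 0) := hw2.sub hre
  rw [integral_add hsub ((integrableOn_groundState_sq hα).const_mul _), integral_sub hw2 hre,
    integral_const_mul, integral_const_mul, integral_groundState_sq hα] at h1
  have h2 : ∫ t in Ioi 0, ((starRingEnd ℂ) c * ((groundState α t : ℂ) * w t)).re = ‖c‖ ^ 2 := by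
    have := integral_re (hI.const_mul ((starRingEnd ℂ) c))
    simp only [RCLike.re_eq_complex_re] at this
    rw [this, integral_const_mul]
    change ((starRingEnd ℂ) c * c).re = _
    rw [← Complex.normSq_eq_conj_mul_self, Complex.ofReal_re, Complex.normSq_eq_norm_sq]
  rw [h2] at h1
  linarith

/-- The form `∫ |w'|² - α |w 0|²` is non-negative orthogonally to the ground state, on which it
takes the value `-α²`. -/
theorem norm_sq_zero_le_groundCoeff {α : ℝ} (hα : 0 < α) (hw : ∀ t, HasDerivAt w (w' t) t)
    (hw' : Continuous w') (hc : HasCompactSupport w) (hc' : HasCompactSupport w') :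
    α * ‖w 0‖ ^ 2 ≤ (∫ t in Ioi 0, ‖w' t‖ ^ 2) + α ^ 2 * ‖groundCoeff α w‖ ^ 2 := by
  have hwc : Continuous w := continuous_iff_continuousAt.mpr fun s => (hw s).continuousAt
  -- With `a = groundCoeff α w` and `a' = groundCoeff α w'`, integration by parts gives
  -- `√(2α) w 0 = α a - a'`, and `2 |w 0|² α = |α a - a'|² ≤ 2 (α² |a|² + |a'|²)`, where
  -- `|a'|² ≤ ∫ |w'|²` by Bessel's inequality.
  set ψ : ℝ → ℂ := fun t => (groundState α t : ℂ) with hψ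
  have hψd : ∀ t, HasDerivAt ψ (-α * ψ t) t := by
    intro t
    have h : HasDerivAt (groundState α) (-α * groundState α t) t := by
      refine (((hasDerivAt_id' t).const_mul (-α)).exp.const_mul √(2 * α)).congr_deriv ?_
      unfold groundState
      ring
    exact h.ofReal_comp.congr_deriv (by push_cast; rfl)
  have i1 := (integrable_groundState_mul α hwc hc).integrableOn (s := Ioi 0)
  have i2 := (integrable_groundState_mul α hw' hc').integrableOn (s := Ioi 0)
  have hlim : Tendsto (fun t => ψ t * w t) atTop (𝓝 0) := by
    refine tendsto_const_nhds.congr' ?_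
    filter_upwards [eventually_eq_zero_atTop hc] with t ht
    rw [ht, mul_zero]
  have hint : IntegrableOn (fun t => -α * ψ t * w t + ψ t * w' t) (Ioi 0) := by
    have := (i1.const_mul (-α : ℂ)).add i2
    refine this.congr (Eventually.of_forall fun t => ?_)
    simp only [Pi.add_apply, hψ]
    ring
  have h := integral_Ioi_of_hasDerivAt_of_tendsto (a := 0) (f := fun t => ψ t * w t)
    ((continuous_iff_continuousAt.mpr fun t => (hψd t).continuousAt).mul hwc).continuousWithinAt
    (fun t _ => (hψd t).mul (hw t)) hint hlim
  -- integration by parts relates the components of `w` and of `w'`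
  have hpart : groundCoeff α w' = α * groundCoeff α w - √(2 * α) * w 0 := by
    have h1 : ∫ t in Ioi 0, (-α * ψ t * w t + ψ t * w' t) =
        -α * groundCoeff α w + groundCoeff α w' := by
      rw [groundCoeff, groundCoeff, ← integral_const_mul, ← integral_add (i1.const_mul _) i2]
      refine integral_congr_ae (Eventually.of_forall fun t => ?_)
      simp only [hψ]
      ring
    rw [h1] at h
    have h2 : ψ 0 = √(2 * α) := by simp [hψ, groundState]
    rw [h2] at h
    linear_combination h
  have h3 := norm_sq_groundCoeff_le hα hw' hc'
  have h4 : ‖(√(2 * α) : ℂ) * w 0‖ ^ 2 = 2 * α * ‖w 0‖ ^ 2 := by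
    rw [norm_mul, mul_pow, Complex.norm_real, Real.norm_eq_abs, sq_abs,
      Real.sq_sqrt (by positivity)]
  have h5 : ‖(α : ℂ) * groundCoeff α w‖ ^ 2 = α ^ 2 * ‖groundCoeff α w‖ ^ 2 := by
    rw [norm_mul, mul_pow, Complex.norm_real, Real.norm_eq_abs, sq_abs]
  have h6 : (√(2 * α) : ℂ) * w 0 = α * groundCoeff α w - groundCoeff α w' := by
    rw [hpart]
    ring
  have h7 := parallelogram_law_with_norm ℝ ((α : ℂ) * groundCoeff α w) (groundCoeff α w')
  rw [h6] at h4
  nlinarith [sq_nonneg ‖(α : ℂ) * groundCoeff α w + groundCoeff α w'‖]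

end HalfLine

/-! ### Affine coordinates in the plane -/

section Coordinates

/-- Affine coordinates with origin `A` and axes spanned by `v` and `w`. -/
def planeChart (A v w : Plane) (p : ℝ × ℝ) : Plane := A + (p.1 • v + p.2 • w)

theorem continuous_planeChart (A v w : Plane) : Continuous (planeChart A v w) := by
  unfold planeChart
  fun_prop

/-- Affine coordinates as a homeomorphism. -/
def planeHomeo (A : Plane) {v w : Plane} (h : LinearIndependent ℝ ![v, w]) : (ℝ × ℝ) ≃ₜ Plane :=
  (LinearMap.linearEquivOfInjective
    ((LinearMap.fst ℝ ℝ ℝ).smulRight v + (LinearMap.snd ℝ ℝ ℝ).smulRight w)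
    (by
      rw [← LinearMap.ker_eq_bot, LinearMap.ker_eq_bot']
      intro p hp
      have := LinearIndependent.pair_iff.mp h p.1 p.2 hp
      exact Prod.ext this.1 this.2)
    (by simp)).toContinuousLinearEquiv.toHomeomorph.trans (Homeomorph.addLeft A)

theorem coe_planeHomeo (A : Plane) {v w : Plane} (h : LinearIndependent ℝ ![v, w]) :
    ⇑(planeHomeo A h) = planeChart A v w := rfl

/-- The Jacobian of affine coordinates is a positive constant. -/
theorem exists_setIntegral_planeChart (A : Plane) {v w : Plane} (h : LinearIndependent ℝ ![v, w]) :
    ∃ c > 0, ∀ (F : Plane → ℝ) (S : Set (ℝ × ℝ)),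
      ∫ x in planeChart A v w '' S, F x = c * ∫ p in S, F (planeChart A v w p) := by
  set L := (LinearMap.linearEquivOfInjective
    ((LinearMap.fst ℝ ℝ ℝ).smulRight v + (LinearMap.snd ℝ ℝ ℝ).smulRight w)
    (by
      rw [← LinearMap.ker_eq_bot, LinearMap.ker_eq_bot']
      intro p hp
      have := LinearIndependent.pair_iff.mp h p.1 p.2 hp
      exact Prod.ext this.1 this.2)
    (by simp)).toContinuousLinearEquiv with hL
  have hLc : ∀ p, planeChart A v w p = A + L p := fun p => rfl
  set ν : Measure Plane := Measure.map L volume with hν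
  have : ν.IsAddHaarMeasure := L.isAddHaarMeasure_map volume
  set c := Measure.addHaarScalarFactor ν (volume : Measure Plane) with hc
  have hν2 : ν = c • (volume : Measure Plane) := Measure.isAddLeftInvariant_eq_smul _ _
  have hc0 : 0 < c := Measure.addHaarScalarFactor_pos_of_isAddHaarMeasure _ _
  have hmap : MeasurePreserving (planeChart A v w) volume (c • (volume : Measure Plane)) := by
    refine ⟨(continuous_planeChart A v w).measurable, ?_⟩
    have h1 : planeChart A v w = (fun x => A + x) ∘ L := funext hLc
    rw [h1, ← Measure.map_map (measurable_const_add A) L.continuous.measurable, ← hν, hν2,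
      Measure.map_smul, map_add_left_eq_self]
  have hemb : MeasurableEmbedding (planeChart A v w) :=
    (planeHomeo A h).measurableEmbedding
  refine ⟨(c : ℝ)⁻¹, by positivity, fun F S => ?_⟩
  rw [← hmap.setIntegral_image_emb hemb, Measure.restrict_smul, integral_smul_nnreal_measure,
    NNReal.smul_def, smul_eq_mul, inv_mul_cancel_left₀ (by positivity)]

theorem measurePreserving_planeChart (A : Plane) (b : OrthonormalBasis (Fin 2) ℝ Plane) :
    MeasurePreserving (planeChart A (b 0) (b 1)) volume volume := by
  have h1 := (volume_preserving_finTwoArrow ℝ).symm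
  have h2 := (b.measurePreserving_repr_symm).comp ((PiLp.volume_preserving_toLp (Fin 2)).comp h1)
  have h3 := (measurePreserving_add_left (volume : Measure Plane) A).comp h2
  convert h3 using 1
  funext p
  simp only [Function.comp_apply, planeChart]
  congr 1
  rw [← b.sum_repr (b.repr.symm _), Fin.sum_univ_two]
  simp

theorem linearIndependent_pair (b : OrthonormalBasis (Fin 2) ℝ Plane) :
    LinearIndependent ℝ ![b 0, b 1] := by
  have h : ![b 0, b 1] = b := by
    funext i
    fin_cases i <;> rfl
  rw [h]
  exact b.orthonormal.linearIndependent

theorem setIntegral_planeChart (A : Plane) (b : OrthonormalBasis (Fin 2) ℝ Plane) {E : Type*}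
    [NormedAddCommGroup E] [NormedSpace ℝ E] (F : Plane → E) (S : Set (ℝ × ℝ)) :
    ∫ x in planeChart A (b 0) (b 1) '' S, F x = ∫ p in S, F (planeChart A (b 0) (b 1) p) := by
  exact (measurePreserving_planeChart A b).setIntegral_image_emb
    (planeHomeo A (linearIndependent_pair b)).measurableEmbedding F S

end Coordinates

/-! ### Gradients of test functions -/

section Gradient

/-- The square of the norm of the gradient. -/
def gradSq (u : testFunctions Plane) (x : Plane) : ℝ :=
  ∑ i : Fin 2, ‖fderiv ℝ (u : Plane → ℂ) x (EuclideanSpace.single i 1)‖ ^ 2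

theorem sum_sq_apply_orthonormalBasis (f : Plane →L[ℝ] ℝ) (b : OrthonormalBasis (Fin 2) ℝ Plane) :
    ∑ i, f (b i) ^ 2 = ‖(InnerProductSpace.toDual ℝ Plane).symm f‖ ^ 2 := by
  rw [← b.sum_sq_norm_inner_left]
  refine Finset.sum_congr rfl fun i _ => ?_
  rw [InnerProductSpace.toDual_symm_apply, Real.norm_eq_abs, sq_abs]

theorem gradSq_eq (b : OrthonormalBasis (Fin 2) ℝ Plane) (u : testFunctions Plane) (x : Plane) :
    gradSq u x = ‖fderiv ℝ (u : Plane → ℂ) x (b 0)‖ ^ 2 + ‖fderiv ℝ (u : Plane → ℂ) x (b 1)‖ ^ 2 := by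
  set D := fderiv ℝ (u : Plane → ℂ) x with hD
  have h : ∀ b' : OrthonormalBasis (Fin 2) ℝ Plane, ∑ i, ‖D (b' i)‖ ^ 2 =
      ‖(InnerProductSpace.toDual ℝ Plane).symm (Complex.reCLM ∘L D)‖ ^ 2 +
        ‖(InnerProductSpace.toDual ℝ Plane).symm (Complex.imCLM ∘L D)‖ ^ 2 := by
    intro b'
    rw [← sum_sq_apply_orthonormalBasis _ b', ← sum_sq_apply_orthonormalBasis _ b',
      ← Finset.sum_add_distrib]
    refine Finset.sum_congr rfl fun i _ => ?_
    rw [← Complex.normSq_eq_norm_sq, Complex.normSq_apply]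
    simp [sq]
  have h1 := (h (EuclideanSpace.basisFun (Fin 2) ℝ)).trans (h b).symm
  rw [Fin.sum_univ_two (fun i => ‖D (b i)‖ ^ 2)] at h1
  rw [← h1, gradSq]
  simp [hD]

theorem continuous_gradSq (u : testFunctions Plane) : Continuous (gradSq u) :=
  continuous_finsetSum _ fun i _ =>
    (testFunctions.continuous (testFunctions.deriv (EuclideanSpace.single i 1) u)).norm.pow 2

theorem gradSq_nonneg (u : testFunctions Plane) (x : Plane) : 0 ≤ gradSq u x :=
  Finset.sum_nonneg fun _ _ => by positivity

theorem hasCompactSupport_gradSq (u : testFunctions Plane) : HasCompactSupport (gradSq u) := by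
  refine ((testFunctions.hasCompactSupport u).fderiv (𝕜 := ℝ)).mono fun x hx h0 => hx ?_
  simp [gradSq, h0]

theorem integrable_gradSq (u : testFunctions Plane) : Integrable (gradSq u) :=
  (continuous_gradSq u).integrable_of_hasCompactSupport (hasCompactSupport_gradSq u)

theorem continuous_normSq (u : testFunctions Plane) :
    Continuous fun x => ‖(u : Plane → ℂ) x‖ ^ 2 := (testFunctions.continuous u).norm.pow 2

theorem hasCompactSupport_normSq (u : testFunctions Plane) :
    HasCompactSupport fun x => ‖(u : Plane → ℂ) x‖ ^ 2 :=
  (testFunctions.hasCompactSupport u).mono fun x hx h0 => hx (by simp [h0])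

theorem integrable_normSq (u : testFunctions Plane) :
    Integrable fun x => ‖(u : Plane → ℂ) x‖ ^ 2 :=
  (continuous_normSq u).integrable_of_hasCompactSupport (hasCompactSupport_normSq u)

end Gradient

/-! ### Separation of variables in a half-strip and in a sector -/

section Slices

variable {A v w : Plane}

theorem hasCompactSupport_comp_planeChart {X : Type*} [Zero X] {F : Plane → X}
    (hF : HasCompactSupport F) (h : LinearIndependent ℝ ![v, w]) :
    HasCompactSupport fun p => F (planeChart A v w p) := hF.comp_homeomorph (planeHomeo A h)

theorem hasCompactSupport_slice_snd {X : Type*} [Zero X] {F : Plane → X}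
    (hF : HasCompactSupport F) (h : LinearIndependent ℝ ![v, w]) (s : ℝ) :
    HasCompactSupport fun t => F (planeChart A v w (s, t)) := by
  refine (hasCompactSupport_comp_planeChart (A := A) hF h).comp_isClosedEmbedding (g := fun t => (s, t)) ?_
  exact IsClosedEmbedding.of_continuous_injective_isClosedMap (by fun_prop)
    (fun t t' ht => congrArg Prod.snd ht) (isClosedMap_prodMk_left s)

theorem hasCompactSupport_slice_fst {X : Type*} [Zero X] {F : Plane → X}
    (hF : HasCompactSupport F) (h : LinearIndependent ℝ ![v, w]) (t : ℝ) :
    HasCompactSupport fun s => F (planeChart A v w (s, t)) := by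
  refine (hasCompactSupport_comp_planeChart (A := A) hF h).comp_isClosedEmbedding (g := fun s => (s, t)) ?_
  exact IsClosedEmbedding.of_continuous_injective_isClosedMap (by fun_prop)
    (fun s s' hs => congrArg Prod.fst hs) (isClosedMap_prodMk_right t)

theorem hasDerivAt_slice_fst (u : testFunctions Plane) (s t : ℝ) :
    HasDerivAt (fun s => (u : Plane → ℂ) (planeChart A v w (s, t)))
      ((testFunctions.deriv v u : Plane → ℂ) (planeChart A v w (s, t))) s := by
  have h1 : HasDerivAt (fun s => planeChart A v w (s, t)) v s := by
    have := (((hasDerivAt_id s).smul_const v).add_const (t • w)).const_add A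
    rw [one_smul] at this
    exact this
  rw [testFunctions.deriv_apply]
  exact (testFunctions.differentiable u _).hasFDerivAt.comp_hasDerivAt s h1

theorem hasDerivAt_slice_snd (u : testFunctions Plane) (s t : ℝ) :
    HasDerivAt (fun t => (u : Plane → ℂ) (planeChart A v w (s, t)))
      ((testFunctions.deriv w u : Plane → ℂ) (planeChart A v w (s, t))) t := by
  have h1 : HasDerivAt (fun t => planeChart A v w (s, t)) w t := by
    have := (((hasDerivAt_id t).smul_const w).const_add (s • v)).const_add A
    rw [one_smul] at this
    exact this
  rw [testFunctions.deriv_apply]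
  exact (testFunctions.differentiable u _).hasFDerivAt.comp_hasDerivAt t h1

theorem continuous_slice_fst {X : Type*} [TopologicalSpace X] {F : Plane → X} (hF : Continuous F)
    (t : ℝ) : Continuous fun s => F (planeChart A v w (s, t)) :=
  hF.comp ((continuous_planeChart A v w).comp (by fun_prop))

theorem continuous_slice_snd {X : Type*} [TopologicalSpace X] {F : Plane → X} (hF : Continuous F)
    (s : ℝ) : Continuous fun t => F (planeChart A v w (s, t)) :=
  hF.comp ((continuous_planeChart A v w).comp (by fun_prop))

theorem integrable_comp_planeChart {F : Plane → ℝ} (hF : Continuous F) (hc : HasCompactSupport F)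
    (h : LinearIndependent ℝ ![v, w]) : Integrable fun p => F (planeChart A v w p) :=
  (hF.comp (continuous_planeChart A v w)).integrable_of_hasCompactSupport
    (hasCompactSupport_comp_planeChart hc h)

theorem setIntegral_prod_planeChart {F : Plane → ℝ} (hF : Continuous F) (hc : HasCompactSupport F)
    (h : LinearIndependent ℝ ![v, w]) (I J : Set ℝ) :
    ∫ p in I ×ˢ J, F (planeChart A v w p) = ∫ s in I, ∫ t in J, F (planeChart A v w (s, t)) := by
  rw [Measure.volume_eq_prod]
  exact setIntegral_prod _ (integrable_comp_planeChart hF hc h).integrableOn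

theorem integrableOn_integral_planeChart {F : Plane → ℝ} (hF : Continuous F)
    (hc : HasCompactSupport F) (h : LinearIndependent ℝ ![v, w]) (I J : Set ℝ) :
    IntegrableOn (fun s => ∫ t in J, F (planeChart A v w (s, t))) I := by
  have h1 : Integrable (fun p => F (planeChart A v w p))
      (((volume : Measure ℝ).restrict I).prod ((volume : Measure ℝ).restrict J)) := by
    rw [Measure.prod_restrict, ← Measure.volume_eq_prod]
    exact (integrable_comp_planeChart hF hc h).integrableOn
  exact h1.integral_prod_left

/-- The component of `u` along the transverse ground state, as a function of the coordinate along
the first axis. -/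
def transCoeff (A v w : Plane) (α : ℝ) (u : testFunctions Plane) (s : ℝ) : ℂ :=
  groundCoeff α fun t => (u : Plane → ℂ) (planeChart A v w (s, t))

theorem exists_norm_le (u : testFunctions Plane) : ∃ C, ∀ x, ‖(u : Plane → ℂ) x‖ ≤ C :=
  (testFunctions.hasCompactSupport u).exists_bound_of_continuous (testFunctions.continuous u)

theorem norm_groundState_mul_le {α C : ℝ} {z : ℂ} (hz : ‖z‖ ≤ C) (t : ℝ) :
    ‖(groundState α t : ℂ) * z‖ ≤ groundState α t * C := by
  have h : 0 ≤ groundState α t := by unfold groundState; positivity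
  rw [norm_mul, Complex.norm_real, Real.norm_eq_abs, abs_of_nonneg h]
  exact mul_le_mul_of_nonneg_left hz h

theorem continuous_transCoeff {α : ℝ} (hα : 0 < α) (u : testFunctions Plane) :
    Continuous (transCoeff A v w α u) := by
  obtain ⟨C, hC⟩ := exists_norm_le u
  refine continuous_of_dominated (bound := fun t => groundState α t * C) (fun s => ?_)
    (fun s => Eventually.of_forall fun t => norm_groundState_mul_le (hC _) t)
    ((integrableOn_groundState hα).mul_const C) (Eventually.of_forall fun t => ?_)
  · exact ((Complex.continuous_ofReal.comp (continuous_groundState α)).mul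
      (continuous_slice_snd (testFunctions.continuous u) s)).aestronglyMeasurable
  · exact continuous_const.mul (continuous_slice_fst (testFunctions.continuous u) t)

theorem hasDerivAt_transCoeff {α : ℝ} (hα : 0 < α) (h : LinearIndependent ℝ ![v, w])
    (u : testFunctions Plane) (s : ℝ) :
    HasDerivAt (transCoeff A v w α u) (transCoeff A v w α (testFunctions.deriv v u) s) s := by
  obtain ⟨C, hC⟩ := exists_norm_le (testFunctions.deriv v u)
  have hmeas : ∀ (f : testFunctions Plane) (s : ℝ), AEStronglyMeasurable
      (fun t => (groundState α t : ℂ) * (f : Plane → ℂ) (planeChart A v w (s, t)))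
      (volume.restrict (Ioi 0)) := fun f s =>
    ((Complex.continuous_ofReal.comp (continuous_groundState α)).mul
      (continuous_slice_snd (testFunctions.continuous f) s)).aestronglyMeasurable
  refine (hasDerivAt_integral_of_dominated_loc_of_deriv_le (s := univ) univ_mem
    (bound := fun t => groundState α t * C)
    (F' := fun s t => (groundState α t : ℂ) *
      (testFunctions.deriv v u : Plane → ℂ) (planeChart A v w (s, t)))
    (Eventually.of_forall (hmeas u))
    (integrable_groundState_mul α (continuous_slice_snd (testFunctions.continuous u) s)
      (hasCompactSupport_slice_snd (testFunctions.hasCompactSupport u) h s)).integrableOn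
    (hmeas _ s) (Eventually.of_forall fun t s _ => norm_groundState_mul_le (hC _) t)
    ((integrableOn_groundState hα).mul_const C) (Eventually.of_forall fun t s' _ => ?_)).2
  exact (hasDerivAt_slice_fst (A := A) (v := v) (w := w) u s' t).const_mul (groundState α t : ℂ)

theorem norm_sq_transCoeff_le {α : ℝ} (hα : 0 < α) (h : LinearIndependent ℝ ![v, w])
    (u : testFunctions Plane) (s : ℝ) : ‖transCoeff A v w α u s‖ ^ 2 ≤
      ∫ t in Ioi 0, ‖(u : Plane → ℂ) (planeChart A v w (s, t))‖ ^ 2 :=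
  norm_sq_groundCoeff_le hα (continuous_slice_snd (testFunctions.continuous u) s)
    (hasCompactSupport_slice_snd (testFunctions.hasCompactSupport u) h s)

end Slices

section Strip

variable (A : Plane) (b : OrthonormalBasis (Fin 2) ℝ Plane) (ℓ : ℝ)

/-- The half-strip in adapted coordinates. -/
def halfStrip : Set Plane := planeChart A (b 0) (b 1) '' (Ioo 0 ℓ ×ˢ Ioi 0)

variable {A b ℓ}

theorem setIntegral_halfStrip {F : Plane → ℝ} (hF : Continuous F) (hc : HasCompactSupport F) :
    ∫ x in halfStrip A b ℓ, F x =
      ∫ s in Ioo 0 ℓ, ∫ t in Ioi 0, F (planeChart A (b 0) (b 1) (s, t)) := by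
  rw [halfStrip, setIntegral_planeChart, setIntegral_prod_planeChart hF hc (linearIndependent_pair b)]

theorem integrableOn_Ioo_norm_sq {f : ℝ → ℂ} (hf : Continuous f) :
    IntegrableOn (fun s => ‖f s‖ ^ 2) (Ioo 0 ℓ) :=
  ((hf.norm.pow 2).integrableOn_Icc (a := 0) (b := ℓ)).mono_set Ioo_subset_Icc_self

theorem integral_sq_transCoeff_le {α : ℝ} (hα : 0 < α) (u : testFunctions Plane) :
    ∫ s in Ioo 0 ℓ, ‖transCoeff A (b 0) (b 1) α u s‖ ^ 2 ≤
      ∫ x in halfStrip A b ℓ, ‖(u : Plane → ℂ) x‖ ^ 2 := by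
  rw [setIntegral_halfStrip (continuous_normSq u) (hasCompactSupport_normSq u)]
  exact integral_mono (integrableOn_Ioo_norm_sq (continuous_transCoeff hα u))
    (integrableOn_integral_planeChart (continuous_normSq u) (hasCompactSupport_normSq u)
      (linearIndependent_pair b) _ _)
    fun s => norm_sq_transCoeff_le hα (linearIndependent_pair b) u s

theorem integral_gradSq_slice (u : testFunctions Plane) (s : ℝ) :
    ∫ t in Ioi 0, gradSq u (planeChart A (b 0) (b 1) (s, t)) =
      (∫ t in Ioi 0, ‖(testFunctions.deriv (b 0) u : Plane → ℂ) (planeChart A (b 0) (b 1) (s, t))‖ ^ 2) +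
      ∫ t in Ioi 0, ‖(testFunctions.deriv (b 1) u : Plane → ℂ) (planeChart A (b 0) (b 1) (s, t))‖ ^ 2 := by
  have hi : ∀ f : testFunctions Plane, IntegrableOn
      (fun t => ‖(f : Plane → ℂ) (planeChart A (b 0) (b 1) (s, t))‖ ^ 2) (Ioi 0) := fun f =>
    (integrable_norm_sq (continuous_slice_snd (testFunctions.continuous f) s)
      (hasCompactSupport_slice_snd (testFunctions.hasCompactSupport f)
        (linearIndependent_pair b) s)).integrableOn
  rw [← integral_add (hi _) (hi _)]
  refine integral_congr_ae (Eventually.of_forall fun t => ?_)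
  simp only [gradSq_eq b, testFunctions.deriv_apply]

/-- The Robin form in a half-strip is, after adding `α²` on the transverse ground state, at least the
energy of the component along the transverse ground state. -/
theorem halfStrip_form_ge {α : ℝ} (hα : 0 < α) (u : testFunctions Plane) :
    (∫ s in Ioo 0 ℓ, ‖transCoeff A (b 0) (b 1) α (testFunctions.deriv (b 0) u) s‖ ^ 2) +
      α * (∫ s in Ioo 0 ℓ, ‖(u : Plane → ℂ) (planeChart A (b 0) (b 1) (s, 0))‖ ^ 2) ≤
    (∫ x in halfStrip A b ℓ, gradSq u x) +
      α ^ 2 * ∫ s in Ioo 0 ℓ, ‖transCoeff A (b 0) (b 1) α u s‖ ^ 2 := by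
  have hli := linearIndependent_pair b
  have i1 := integrableOn_Ioo_norm_sq (ℓ := ℓ) (continuous_transCoeff (A := A) (v := b 0)
    (w := b 1) hα (testFunctions.deriv (b 0) u))
  have i2 := integrableOn_Ioo_norm_sq (ℓ := ℓ) (continuous_slice_fst (A := A) (v := b 0)
    (w := b 1) (testFunctions.continuous u) 0)
  have i3 := integrableOn_integral_planeChart (A := A) (continuous_gradSq u)
    (hasCompactSupport_gradSq u) hli (Ioo 0 ℓ) (Ioi 0)
  have i4 := integrableOn_Ioo_norm_sq (ℓ := ℓ) (continuous_transCoeff (A := A) (v := b 0)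
    (w := b 1) hα u)
  rw [setIntegral_halfStrip (continuous_gradSq u) (hasCompactSupport_gradSq u),
    ← integral_const_mul, ← integral_const_mul, ← integral_add i1 (i2.const_mul α),
    ← integral_add i3 (i4.const_mul (α ^ 2))]
  refine integral_mono (i1.add (i2.const_mul α)) (i3.add (i4.const_mul (α ^ 2))) fun s => ?_
  have h1 := norm_sq_transCoeff_le (A := A) hα hli (testFunctions.deriv (b 0) u) s
  have h2 := norm_sq_zero_le_groundCoeff hα (fun t => hasDerivAt_slice_snd (A := A) (v := b 0)
    (w := b 1) u s t) (continuous_slice_snd (testFunctions.continuous _) s)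
    (hasCompactSupport_slice_snd (testFunctions.hasCompactSupport u) hli s)
    (hasCompactSupport_slice_snd (testFunctions.hasCompactSupport _) hli s)
  have h3 := integral_gradSq_slice (A := A) (b := b) u s
  simp only
  rw [h3]
  simp only [transCoeff] at h1 h2 ⊢
  linarith

/-- The one-dimensional trace inequality, integrated along the side. -/
theorem halfStrip_trace_le {ε : ℝ} (hε : 0 < ε) (u : testFunctions Plane) :
    ∫ s in Ioo 0 ℓ, ‖(u : Plane → ℂ) (planeChart A (b 0) (b 1) (s, 0))‖ ^ 2 ≤
      ε * (∫ x in halfStrip A b ℓ, gradSq u x) +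
        ε⁻¹ * ∫ x in halfStrip A b ℓ, ‖(u : Plane → ℂ) x‖ ^ 2 := by
  have hli := linearIndependent_pair b
  have i2 := integrableOn_Ioo_norm_sq (ℓ := ℓ) (continuous_slice_fst (A := A) (v := b 0)
    (w := b 1) (testFunctions.continuous u) 0)
  have i3 := integrableOn_integral_planeChart (A := A) (continuous_gradSq u)
    (hasCompactSupport_gradSq u) hli (Ioo 0 ℓ) (Ioi 0)
  have i4 := integrableOn_integral_planeChart (A := A) (continuous_normSq u)
    (hasCompactSupport_normSq u) hli (Ioo 0 ℓ) (Ioi 0)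
  rw [setIntegral_halfStrip (continuous_gradSq u) (hasCompactSupport_gradSq u),
    setIntegral_halfStrip (continuous_normSq u) (hasCompactSupport_normSq u),
    ← integral_const_mul, ← integral_const_mul, ← integral_add (i3.const_mul ε) (i4.const_mul ε⁻¹)]
  refine integral_mono i2 ((i3.const_mul ε).add (i4.const_mul ε⁻¹)) fun s => ?_
  have h2 := norm_sq_zero_le (fun t => hasDerivAt_slice_snd (A := A) (v := b 0)
    (w := b 1) u s t) (continuous_slice_snd (testFunctions.continuous _) s)
    (hasCompactSupport_slice_snd (testFunctions.hasCompactSupport u) hli s)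
    (hasCompactSupport_slice_snd (testFunctions.hasCompactSupport _) hli s) hε
  have h3 := integral_gradSq_slice (A := A) (b := b) u s
  have h4 : 0 ≤ ∫ t in Ioi 0,
      ‖(testFunctions.deriv (b 0) u : Plane → ℂ) (planeChart A (b 0) (b 1) (s, t))‖ ^ 2 :=
    integral_nonneg fun t => by positivity
  simp only [Pi.add_apply]
  rw [h3]
  nlinarith

end Strip

section Sector

variable {A v w : Plane}

theorem norm_sq_deriv_le_gradSq {b : OrthonormalBasis (Fin 2) ℝ Plane} (u : testFunctions Plane)
    (i : Fin 2) (x : Plane) : ‖(testFunctions.deriv (b i) u : Plane → ℂ) x‖ ^ 2 ≤ gradSq u x := by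
  rw [gradSq_eq b, testFunctions.deriv_apply]
  fin_cases i
  · exact le_add_of_nonneg_right (by positivity)
  · exact le_add_of_nonneg_left (by positivity)

/-- The restriction to one side of a sector is controlled by the function in the sector. -/
theorem sector_ray_le (h : LinearIndependent ℝ ![v, w]) {u : testFunctions Plane}
    (hw : ∀ x, ‖(testFunctions.deriv w u : Plane → ℂ) x‖ ^ 2 ≤ gradSq u x) {α : ℝ} (hα : 0 < α) :
    α * ∫ s in Ioi 0, ‖(u : Plane → ℂ) (planeChart A v w (s, 0))‖ ^ 2 ≤
      (∫ p in Ioi (0 : ℝ) ×ˢ Ioi (0 : ℝ), gradSq u (planeChart A v w p)) +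
        α ^ 2 * ∫ p in Ioi (0 : ℝ) ×ˢ Ioi (0 : ℝ), ‖(u : Plane → ℂ) (planeChart A v w p)‖ ^ 2 := by
  have i2 : IntegrableOn (fun s => ‖(u : Plane → ℂ) (planeChart A v w (s, 0))‖ ^ 2) (Ioi 0) :=
    (integrable_norm_sq (continuous_slice_fst (testFunctions.continuous u) 0)
      (hasCompactSupport_slice_fst (testFunctions.hasCompactSupport u) h 0)).integrableOn
  have i3 := integrableOn_integral_planeChart (A := A) (continuous_gradSq u)
    (hasCompactSupport_gradSq u) h (Ioi 0) (Ioi 0)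
  have i4 := integrableOn_integral_planeChart (A := A) (continuous_normSq u)
    (hasCompactSupport_normSq u) h (Ioi 0) (Ioi 0)
  rw [setIntegral_prod_planeChart (continuous_gradSq u) (hasCompactSupport_gradSq u) h,
    setIntegral_prod_planeChart (continuous_normSq u) (hasCompactSupport_normSq u) h,
    ← integral_const_mul, ← integral_const_mul, ← integral_add i3 (i4.const_mul (α ^ 2))]
  refine integral_mono (i2.const_mul α) (i3.add (i4.const_mul (α ^ 2))) fun s => ?_
  have h2 := norm_sq_zero_le (fun t => hasDerivAt_slice_snd (A := A) (v := v)
    (w := w) u s t) (continuous_slice_snd (testFunctions.continuous _) s)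
    (hasCompactSupport_slice_snd (testFunctions.hasCompactSupport u) h s)
    (hasCompactSupport_slice_snd (testFunctions.hasCompactSupport _) h s) (inv_pos.mpr hα)
  have h3 : ∫ t in Ioi 0, ‖(testFunctions.deriv w u : Plane → ℂ) (planeChart A v w (s, t))‖ ^ 2 ≤
      ∫ t in Ioi 0, gradSq u (planeChart A v w (s, t)) := by
    refine integral_mono (integrable_norm_sq (continuous_slice_snd (testFunctions.continuous _) s)
      (hasCompactSupport_slice_snd (testFunctions.hasCompactSupport _) h s)).integrableOn ?_
      fun t => hw _
    exact ((continuous_slice_snd (continuous_gradSq u) s).integrable_of_hasCompactSupport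
      (hasCompactSupport_slice_snd (hasCompactSupport_gradSq u) h s)).integrableOn
  -- the trace inequality was used with the length scale `ε = 1 / α`
  have h4 := mul_le_mul_of_nonneg_left h2 hα.le
  rw [mul_add, ← mul_assoc, ← mul_assoc, mul_inv_cancel₀ hα.ne', one_mul, inv_inv, ← sq] at h4
  simp only
  linarith

theorem image_planeChart_swap (A v w : Plane) :
    planeChart A w v '' (Ioi 0 ×ˢ Ioi 0) = planeChart A v w '' (Ioi 0 ×ˢ Ioi 0) := by
  have h : ∀ v w, planeChart A w v '' (Ioi 0 ×ˢ Ioi 0) ⊆ planeChart A v w '' (Ioi 0 ×ˢ Ioi 0) := by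
    rintro v w _ ⟨p, hp, rfl⟩
    refine ⟨p.swap, ⟨hp.2, hp.1⟩, ?_⟩
    simp only [planeChart, Prod.fst_swap, Prod.snd_swap]
    rw [add_comm (p.2 • v)]
  exact (h v w).antisymm (h w v)

/-- The restrictions to both sides of a sector are controlled by the function in the sector. -/
theorem exists_sector_rays_le (h : LinearIndependent ℝ ![v, w]) : ∃ κ > 0,
    ∀ u : testFunctions Plane,
    (∀ x, ‖(testFunctions.deriv v u : Plane → ℂ) x‖ ^ 2 ≤ gradSq u x) →
    (∀ x, ‖(testFunctions.deriv w u : Plane → ℂ) x‖ ^ 2 ≤ gradSq u x) → ∀ α > 0,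
    κ * α * ((∫ s in Ioi (0 : ℝ), ‖(u : Plane → ℂ) (A + s • v)‖ ^ 2) +
      ∫ s in Ioi (0 : ℝ), ‖(u : Plane → ℂ) (A + s • w)‖ ^ 2) ≤
      (∫ x in planeChart A v w '' (Ioi 0 ×ˢ Ioi 0), gradSq u x) +
        α ^ 2 * ∫ x in planeChart A v w '' (Ioi 0 ×ˢ Ioi 0), ‖(u : Plane → ℂ) x‖ ^ 2 := by
  have h' : LinearIndependent ℝ ![w, v] := LinearIndependent.pair_symm_iff.mp h
  obtain ⟨c, hc, hcF⟩ := exists_setIntegral_planeChart A h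
  obtain ⟨c', hc', hcF'⟩ := exists_setIntegral_planeChart A h'
  refine ⟨min c c' / 2, by positivity, fun u hv hw α hα => ?_⟩
  have h1 := sector_ray_le (A := A) h hw hα
  have h2 := sector_ray_le (A := A) h' hv hα
  have h3 : ∀ v w : Plane, ∀ s : ℝ, planeChart A v w (s, 0) = A + s • v := fun v w s => by
    simp [planeChart]
  simp only [h3] at h1 h2
  set R1 := ∫ s in Ioi (0 : ℝ), ‖(u : Plane → ℂ) (A + s • v)‖ ^ 2 with hR1
  set R2 := ∫ s in Ioi (0 : ℝ), ‖(u : Plane → ℂ) (A + s • w)‖ ^ 2 with hR2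
  have hR1' : 0 ≤ R1 := integral_nonneg fun _ => by positivity
  have hR2' : 0 ≤ R2 := integral_nonneg fun _ => by positivity
  set X := (∫ x in planeChart A v w '' (Ioi 0 ×ˢ Ioi 0), gradSq u x) +
        α ^ 2 * ∫ x in planeChart A v w '' (Ioi 0 ×ˢ Ioi 0), ‖(u : Plane → ℂ) x‖ ^ 2 with hX
  have h4 : c * (α * R1) ≤ X := by
    rw [hX, hcF, hcF]
    exact (mul_le_mul_of_nonneg_left h1 hc.le).trans (le_of_eq (by ring))
  have h5 : c' * (α * R2) ≤ X := by
    rw [hX, ← image_planeChart_swap, hcF', hcF']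
    exact (mul_le_mul_of_nonneg_left h2 hc'.le).trans (le_of_eq (by ring))
  have h6 : min c c' * (α * R1) ≤ c * (α * R1) :=
    mul_le_mul_of_nonneg_right (min_le_left _ _) (by positivity)
  have h7 : min c c' * (α * R2) ≤ c' * (α * R2) :=
    mul_le_mul_of_nonneg_right (min_le_right _ _) (by positivity)
  linarith

end Sector

/-! ### The Robin form of test functions -/

section PolygonForm

variable {M : ℕ} {P : Polygon Plane M} {b : Fin M → OrthonormalBasis (Fin 2) ℝ Plane}
  {α : ℝ}

/-- The parametrization of the line through the `n`th side by arc length. -/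
def edgeMap (P : Polygon Plane M) (b : Fin M → OrthonormalBasis (Fin 2) ℝ Plane) (n : Fin M)
    (s : ℝ) : Plane := chart P b n (s, 0)

theorem isometry_edgeMap (n : Fin M) : Isometry (edgeMap P b n) := by
  refine Isometry.of_dist_eq fun s s' => ?_
  have h : edgeMap P b n s - edgeMap P b n s' = (s - s') • b n 0 := by
    simp only [edgeMap, chart]
    module
  rw [dist_eq_norm, h, norm_smul, (b n).orthonormal.1 0, mul_one, Real.dist_eq, Real.norm_eq_abs]

/-- Distinct sides meet at most in vertices. -/
theorem IsSideFrame.aedisjoint_edges (hb : IsSideFrame P b) (hP : IsConvexPolygon P) {n k : Fin M}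
    (hnk : n ≠ k) : AEDisjoint (Measure.hausdorffMeasure 1 : Measure Plane)
      (edgeMap P b n '' Icc 0 (sideLength P n)) (edgeMap P b k '' Icc 0 (sideLength P k)) := by
  have : NullSingletonClass (Measure.hausdorffMeasure 1 : Measure Plane) :=
    Measure.nullSingletonClass_hausdorff Plane one_pos
  refine measure_mono_null (t := {edgeMap P b k 0, edgeMap P b k (sideLength P k)}) ?_
    ((toFinite _).measure_zero _)
  rintro _ ⟨⟨s, hs, rfl⟩, ⟨s', hs', h⟩⟩
  rw [mem_insert_iff, mem_singleton_iff, ← h]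
  by_contra! hcon
  refine hnk (hb.eq_of_chart_eq_chart hP (s' := s') ⟨lt_of_le_of_ne hs'.1 fun h0 => ?_,
    lt_of_le_of_ne hs'.2 fun h0 => ?_⟩ h.symm)
  · exact hcon.1 (by rw [h0])
  · exact hcon.2 (by rw [h0])

/-- The length measure on the boundary is the sum of the Lebesgue measures on the sides. -/
theorem IsSideFrame.boundaryMeasure_eq (hb : IsSideFrame P b) (hP : IsConvexPolygon P) :
    boundaryMeasure (exterior P) =
      ∑ n, Measure.map (edgeMap P b n) (volume.restrict (Icc 0 (sideLength P n))) := by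
  have hemb : ∀ n, MeasurableEmbedding (edgeMap P b n) := fun n =>
    (isometry_edgeMap n).isClosedEmbedding.measurableEmbedding
  rw [boundaryMeasure, hb.frontier_eq hP]
  change Measure.restrict _ (⋃ n, edgeMap P b n '' Icc 0 (sideLength P n)) = _
  rw [Measure.restrict_iUnion_ae (fun n k hnk => hb.aedisjoint_edges hP hnk)
    (fun n => ((hemb n).measurableSet_image.mpr measurableSet_Icc).nullMeasurableSet),
    Measure.sum_fintype]
  refine Finset.sum_congr rfl fun n _ => ?_
  have h1 := (isometry_edgeMap (P := P) (b := b) n).map_hausdorffMeasure (d := 1) (Or.inl zero_le_one)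
  rw [hausdorffMeasure_real] at h1
  rw [← Measure.restrict_restrict_of_subset (image_subset_range _ _), ← h1, (hemb n).restrict_map,
    preimage_image_eq _ (hemb n).injective]

theorem IsSideFrame.isFiniteMeasure_boundaryMeasure (hb : IsSideFrame P b)
    (hP : IsConvexPolygon P) : IsFiniteMeasure (boundaryMeasure (exterior P)) := by
  rw [hb.boundaryMeasure_eq hP]
  infer_instance

theorem IsSideFrame.integral_boundaryMeasure (hb : IsSideFrame P b) (hP : IsConvexPolygon P)
    {F : Plane → ℝ} (hF : Continuous F) : ∫ x, F x ∂(boundaryMeasure (exterior P)) =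
      ∑ n, ∫ s in Ioo 0 (sideLength P n), F (edgeMap P b n s) := by
  have hemb : ∀ n, MeasurableEmbedding (edgeMap P b n) := fun n =>
    (isometry_edgeMap n).isClosedEmbedding.measurableEmbedding
  rw [hb.boundaryMeasure_eq hP, integral_finsetSum_measure]
  · refine Finset.sum_congr rfl fun n _ => ?_
    rw [(hemb n).integral_map, integral_Icc_eq_integral_Ioc, integral_Ioc_eq_integral_Ioo]
  · intro n _
    rw [(hemb n).integrable_map_iff]
    exact (hF.comp (isometry_edgeMap n).continuous).integrableOn_Icc

/-- The half-strips and sectors are disjoint subsets of the exterior. -/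
theorem IsSideFrame.sum_setIntegral_le (hb : IsSideFrame P b) (hP : IsConvexPolygon P)
    {F : Plane → ℝ} (hF : Integrable F) (hF0 : ∀ x, 0 ≤ F x) :
    (∑ n, ∫ x in strip P b n, F x) + ∑ n, ∫ x in sector P b n, F x ≤
      ∫ x in (exterior P : Set Plane), F x := by
  have hm : ∀ i, MeasurableSet (Sum.elim (strip P b) (sector P b) i) := by
    rintro (n | n)
    · exact (planeHomeo (P n) (linearIndependent_pair (b n))).measurableEmbedding.measurableSet_image.mpr
        (measurableSet_Ioo.prod measurableSet_Ioi)
    · exact (planeHomeo (P (finRotate M n))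
        (hb.linearIndependent_normals hP n)).measurableEmbedding.measurableSet_image.mpr
        (measurableSet_Ioi.prod measurableSet_Ioi)
  have hd : Pairwise (Function.onFun Disjoint (Sum.elim (strip P b) (sector P b))) := by
    rintro (n | n) (k | k) hnk
    · exact hb.disjoint_strip_strip hP fun h => hnk (by rw [h])
    · exact hb.disjoint_strip_sector hP n k
    · exact (hb.disjoint_strip_sector hP k n).symm
    · exact hb.disjoint_sector_sector hP fun h => hnk (by rw [h])
  have h := integral_iUnion_fintype hm hd fun i => hF.integrableOn
  rw [Fintype.sum_sum_type] at h
  refine (le_of_eq h.symm).trans ?_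
  refine setIntegral_mono_set hF.integrableOn (Eventually.of_forall hF0) (Eventually.of_forall ?_)
  refine iUnion_subset ?_
  rintro (n | n)
  · exact hb.strip_subset hP n
  · exact hb.sector_subset hP n

/-- The function on the `n`th side that multiplies the transverse ground state. -/
abbrev sideCoeff (P : Polygon Plane M) (b : Fin M → OrthonormalBasis (Fin 2) ℝ Plane) (α : ℝ)
    (n : Fin M) (u : testFunctions Plane) : ℝ → ℂ := transCoeff (P n) (b n 0) (b n 1) α u

/-- The value of the coefficient at the end of a side is controlled by `u` on the ray that separates
the half-strip from the sector. -/
theorem IsSideFrame.norm_sq_sideCoeff_zero_le (hα : 0 < α) (u : testFunctions Plane) (n : Fin M) :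
    ‖sideCoeff P b α n u 0‖ ^ 2 ≤ ∫ t in Ioi (0 : ℝ), ‖(u : Plane → ℂ) (P n + t • b n 1)‖ ^ 2 := by
  refine (norm_sq_transCoeff_le hα (linearIndependent_pair (b n)) u 0).trans (le_of_eq ?_)
  simp [planeChart]

theorem IsSideFrame.norm_sq_sideCoeff_length_le (hb : IsSideFrame P b) (hα : 0 < α)
    (u : testFunctions Plane) (n : Fin M) : ‖sideCoeff P b α n u (sideLength P n)‖ ^ 2 ≤
      ∫ t in Ioi (0 : ℝ), ‖(u : Plane → ℂ) (P (finRotate M n) + t • b n 1)‖ ^ 2 := by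
  refine (norm_sq_transCoeff_le hα (linearIndependent_pair (b n)) u _).trans (le_of_eq ?_)
  simp only [planeChart, hb.next, add_assoc]

/-- The Robin form, shifted by `α²`, is bounded below by the sum over the sides of the energies of
the transverse ground state components, with a strong Robin condition at the vertices that comes
from the sectors. -/
theorem IsSideFrame.exists_form_ge (hb : IsSideFrame P b) (hP : IsConvexPolygon P) :
    ∃ κ > 0, ∀ α > 0, ∀ u : testFunctions Plane,
      (∑ n, ((∫ s in Ioo 0 (sideLength P n),
          ‖sideCoeff P b α n (testFunctions.deriv (b n 0) u) s‖ ^ 2) +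
        κ * α * (‖sideCoeff P b α n u 0‖ ^ 2 + ‖sideCoeff P b α n u (sideLength P n)‖ ^ 2))) +
      α ^ 2 / 2 * ((∫ x in (exterior P : Set Plane), ‖(u : Plane → ℂ) x‖ ^ 2) -
        ∑ n, ∫ s in Ioo 0 (sideLength P n), ‖sideCoeff P b α n u s‖ ^ 2) ≤
      (∫ x in (exterior P : Set Plane), gradSq u x) -
        α * (∫ x, ‖(u : Plane → ℂ) x‖ ^ 2 ∂(boundaryMeasure (exterior P))) +
        α ^ 2 * ∫ x in (exterior P : Set Plane), ‖(u : Plane → ℂ) x‖ ^ 2 := by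
  have hM := hP.three_le
  have : Nonempty (Fin M) := ⟨⟨0, by omega⟩⟩
  choose κ hκ hκ' using fun n => exists_sector_rays_le (A := P (finRotate M n))
    (hb.linearIndependent_normals hP n)
  obtain ⟨n₀, hn₀⟩ := Finite.exists_min κ
  refine ⟨κ n₀ / 2, by linarith [hκ n₀], fun α hα u => ?_⟩
  set N := ∫ x in (exterior P : Set Plane), ‖(u : Plane → ℂ) x‖ ^ 2 with hN
  set G := ∫ x in (exterior P : Set Plane), gradSq u x with hG
  set a := fun n => ∫ s in Ioo 0 (sideLength P n),
    ‖sideCoeff P b α n (testFunctions.deriv (b n 0) u) s‖ ^ 2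
  set f := fun n => ∫ s in Ioo 0 (sideLength P n), ‖sideCoeff P b α n u s‖ ^ 2
  set e := fun n => ∫ s in Ioo 0 (sideLength P n), ‖(u : Plane → ℂ) (edgeMap P b n s)‖ ^ 2
  set g := fun n => ∫ x in strip P b n, gradSq u x
  set g' := fun n => ∫ x in sector P b n, gradSq u x
  set m := fun n => ∫ x in strip P b n, ‖(u : Plane → ℂ) x‖ ^ 2
  set m' := fun n => ∫ x in sector P b n, ‖(u : Plane → ℂ) x‖ ^ 2
  set R := fun n => ∫ t in Ioi (0 : ℝ), ‖(u : Plane → ℂ) (P n + t • b n 1)‖ ^ 2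
  set R' := fun n => ∫ t in Ioi (0 : ℝ), ‖(u : Plane → ℂ) (P (finRotate M n) + t • b n 1)‖ ^ 2
  have hgG : ∑ n, g n + ∑ n, g' n ≤ G := hb.sum_setIntegral_le hP (integrable_gradSq u)
    (gradSq_nonneg u)
  have hmN : ∑ n, m n + ∑ n, m' n ≤ N := hb.sum_setIntegral_le hP (integrable_normSq u)
    fun x => by positivity
  have hσ : ∫ x, ‖(u : Plane → ℂ) x‖ ^ 2 ∂(boundaryMeasure (exterior P)) = ∑ n, e n :=
    hb.integral_boundaryMeasure hP (continuous_normSq u)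
  have h1 : ∀ n, a n + α * e n ≤ g n + α ^ 2 * f n := fun n => halfStrip_form_ge hα u
  have h2 : ∀ n, f n ≤ m n := fun n => integral_sq_transCoeff_le hα u
  have h3 : ∀ n, κ n * α * (R' n + R (finRotate M n)) ≤ g' n + α ^ 2 * m' n := fun n =>
    hκ' n u (fun x => norm_sq_deriv_le_gradSq u 1 x) (fun x => norm_sq_deriv_le_gradSq u 1 x) α hα
  have hR : ∀ n, 0 ≤ R n := fun n => integral_nonneg fun _ => by positivity
  have hR' : ∀ n, 0 ≤ R' n := fun n => integral_nonneg fun _ => by positivity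
  have h4 : ∀ n, κ n₀ * α * (R' n + R (finRotate M n)) ≤ g' n + α ^ 2 * m' n := fun n =>
    (mul_le_mul_of_nonneg_right (mul_le_mul_of_nonneg_right (hn₀ n) hα.le)
      (add_nonneg (hR' n) (hR _))).trans (h3 n)
  have h5 : ∀ n, 0 ≤ g' n := fun n => integral_nonneg fun _ => gradSq_nonneg _ _
  -- the rays at the beginning of the sides are renumbered
  have h6 : ∑ n, R (finRotate M n) = ∑ n, R n := Equiv.sum_comp (finRotate M) R
  have s1 := Finset.sum_le_sum fun n (_ : n ∈ Finset.univ) => h1 n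
  have s2 := Finset.sum_le_sum fun n (_ : n ∈ Finset.univ) => h2 n
  have s4 := Finset.sum_le_sum fun n (_ : n ∈ Finset.univ) => h4 n
  have s5 := Finset.sum_nonneg fun n (_ : n ∈ Finset.univ) => h5 n
  have s7 : ∑ n, (‖sideCoeff P b α n u 0‖ ^ 2 + ‖sideCoeff P b α n u (sideLength P n)‖ ^ 2) ≤
      ∑ n, (R n + R' n) := Finset.sum_le_sum fun n _ =>
    add_le_add (norm_sq_sideCoeff_zero_le hα u n) (hb.norm_sq_sideCoeff_length_le hα u n)
  simp only [Finset.sum_add_distrib, ← Finset.mul_sum] at s1 s2 s4 s7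
  rw [h6] at s4
  rw [hσ]
  simp only [Finset.sum_add_distrib, ← Finset.mul_sum]
  -- Half of the bound from the sectors is used, and `α² / 2` times the norm in the sectors is left
  -- over for the components orthogonal to the transverse ground states.
  have s8 := mul_le_mul_of_nonneg_left s7 (by have := hκ n₀; positivity : 0 ≤ κ n₀ / 2 * α)
  have s9 := mul_le_mul_of_nonneg_left hmN (by positivity : 0 ≤ α ^ 2 / 2)
  have s10 := mul_le_mul_of_nonneg_left s2 (by positivity : 0 ≤ α ^ 2 / 2)
  change ∑ n, a n + _ + α ^ 2 / 2 * (N - ∑ n, f n) ≤ _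
  linarith

/-- The boundary values are controlled by the Sobolev norm. -/
theorem IsSideFrame.trace_le (hb : IsSideFrame P b) (hP : IsConvexPolygon P) {ε : ℝ} (hε : 0 < ε)
    (u : testFunctions Plane) : ∫ x, ‖(u : Plane → ℂ) x‖ ^ 2 ∂(boundaryMeasure (exterior P)) ≤
      ε * (∫ x in (exterior P : Set Plane), gradSq u x) +
        ε⁻¹ * ∫ x in (exterior P : Set Plane), ‖(u : Plane → ℂ) x‖ ^ 2 := by
  rw [hb.integral_boundaryMeasure hP (continuous_normSq u)]
  have h1 := Finset.sum_le_sum fun n (_ : n ∈ Finset.univ) =>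
    halfStrip_trace_le (A := P n) (b := b n) (ℓ := sideLength P n) hε u
  rw [Finset.sum_add_distrib, ← Finset.mul_sum, ← Finset.mul_sum] at h1
  have h2 := hb.sum_setIntegral_le hP (integrable_gradSq u) (gradSq_nonneg u)
  have h3 := hb.sum_setIntegral_le hP (integrable_normSq u) fun x => by positivity
  have h4 : 0 ≤ ∑ n, ∫ x in sector P b n, gradSq u x :=
    Finset.sum_nonneg fun n _ => integral_nonneg fun _ => gradSq_nonneg _ _
  have h5 : 0 ≤ ∑ n, ∫ x in sector P b n, ‖(u : Plane → ℂ) x‖ ^ 2 :=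
    Finset.sum_nonneg fun n _ => integral_nonneg fun _ => by positivity
  refine h1.trans (add_le_add (mul_le_mul_of_nonneg_left ?_ hε.le)
    (mul_le_mul_of_nonneg_left ?_ (inv_pos.mpr hε).le))
  · exact (le_add_of_nonneg_right h4).trans h2
  · exact (le_add_of_nonneg_right h5).trans h3

end PolygonForm

/-! ### Products of Dirichlet eigenfunctions and transverse ground states -/

section StripModes

variable (A : Plane) (b : OrthonormalBasis (Fin 2) ℝ Plane) (ℓ : ℝ) (k : ℕ) (α : ℝ)

/-- The product of a Dirichlet eigenfunction and the transverse ground state, on a half-strip. -/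
def stripMode : Plane → ℂ := (halfStrip A b ℓ).indicator fun x =>
  ((sineMode ℓ k (inner ℝ (x - A) (b 0)) * groundState α (inner ℝ (x - A) (b 1)) : ℝ) : ℂ)

variable {A b ℓ k α}

theorem continuous_stripProfile : Continuous fun x : Plane =>
    ((sineMode ℓ k (inner ℝ (x - A) (b 0)) * groundState α (inner ℝ (x - A) (b 1)) : ℝ) : ℂ) := by
  refine Complex.continuous_ofReal.comp (Continuous.mul ?_ ?_)
  · exact (continuous_sineMode ℓ k).comp (by fun_prop)
  · exact (continuous_groundState α).comp (by fun_prop)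

theorem measurableSet_halfStrip : MeasurableSet (halfStrip A b ℓ) :=
  (planeHomeo A (linearIndependent_pair b)).measurableEmbedding.measurableSet_image.mpr
    (measurableSet_Ioo.prod measurableSet_Ioi)

theorem inner_planeChart_zero (p : ℝ × ℝ) :
    inner ℝ (planeChart A (b 0) (b 1) p - A) (b 0) = p.1 := by
  simp [planeChart, inner_add_left, inner_smul_left, OrthonormalBasis.inner_eq_ite]

theorem inner_planeChart_one (p : ℝ × ℝ) :
    inner ℝ (planeChart A (b 0) (b 1) p - A) (b 1) = p.2 := by
  simp [planeChart, inner_add_left, inner_smul_left, OrthonormalBasis.inner_eq_ite]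

theorem memLp_stripMode (hα : 0 < α) : MemLp (stripMode A b ℓ k α) 2 volume := by
  have hm := continuous_stripProfile (A := A) (b := b) (ℓ := ℓ) (k := k) (α := α)
  rw [stripMode, memLp_indicator_iff_restrict measurableSet_halfStrip,
    memLp_two_iff_integrable_sq_norm hm.aestronglyMeasurable]
  change IntegrableOn _ (planeChart A (b 0) (b 1) '' (Ioo 0 ℓ ×ˢ Ioi 0)) volume
  rw [(measurePreserving_planeChart A b).integrableOn_image
    (planeHomeo A (linearIndependent_pair b)).measurableEmbedding, IntegrableOn,
    Measure.volume_eq_prod, ← Measure.prod_restrict]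
  have h1 : Integrable (fun s => sineMode ℓ k s ^ 2) ((volume : Measure ℝ).restrict (Ioo 0 ℓ)) :=
    (((continuous_sineMode ℓ k).pow 2).integrableOn_Icc (a := 0) (b := ℓ)).mono_set
      Ioo_subset_Icc_self
  refine (h1.mul_prod (integrableOn_groundState_sq hα)).congr (Eventually.of_forall fun p => ?_)
  simp only [Function.comp_apply, inner_planeChart_zero, inner_planeChart_one, Complex.norm_real,
    Real.norm_eq_abs, sq_abs]
  ring

/-- The product of a Dirichlet eigenfunction and the transverse ground state as a vector of
`L²(Ω)`. -/
def stripVector (Ω : TopologicalSpace.Opens Plane) (A : Plane)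
    (b : OrthonormalBasis (Fin 2) ℝ Plane) (ℓ : ℝ) (k : ℕ) {α : ℝ} (hα : 0 < α) : L2 Ω :=
  ((memLp_stripMode (A := A) (b := b) (ℓ := ℓ) (k := k) hα).restrict (Ω : Set Plane)).toLp _

theorem inner_stripVector {Ω : TopologicalSpace.Opens Plane} (hΩ : halfStrip A b ℓ ⊆ (Ω : Set Plane))
    (hℓ : 0 < ℓ) (hα : 0 < α) (u : testFunctions Plane) :
    inner ℂ (stripVector Ω A b ℓ k hα) (testFunctions.toL2 (volume.restrict (Ω : Set Plane)) u) =
      sineCoeff ℓ k (transCoeff A (b 0) (b 1) α u) := by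
  have hli := linearIndependent_pair b
  set F : Plane → ℂ := fun x => ((sineMode ℓ k (inner ℝ (x - A) (b 0)) *
    groundState α (inner ℝ (x - A) (b 1)) : ℝ) : ℂ) * (u : Plane → ℂ) x with hF
  have hFc : Continuous F := continuous_stripProfile.mul (testFunctions.continuous u)
  have hFs : HasCompactSupport F := (testFunctions.hasCompactSupport u).mul_left
  have h1 : inner ℂ (stripVector Ω A b ℓ k hα)
      (testFunctions.toL2 (volume.restrict (Ω : Set Plane)) u) =
      ∫ x in (Ω : Set Plane), (halfStrip A b ℓ).indicator F x := by
    rw [L2.inner_def]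
    refine integral_congr_ae ?_
    filter_upwards [((memLp_stripMode (A := A) (b := b) (ℓ := ℓ) (k := k) hα).restrict
      (Ω : Set Plane)).coeFn_toLp, testFunctions.coeFn_toL2 (volume.restrict (Ω : Set Plane)) u]
      with x h1 h2
    rw [stripVector, h1, h2, RCLike.inner_apply, stripMode]
    by_cases hx : x ∈ halfStrip A b ℓ
    · rw [indicator_of_mem hx, indicator_of_mem hx, Complex.conj_ofReal, mul_comm]
    · rw [indicator_of_notMem hx, indicator_of_notMem hx, map_zero, mul_zero]
  rw [h1, setIntegral_indicator measurableSet_halfStrip, inter_eq_self_of_subset_right hΩ, halfStrip,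
    setIntegral_planeChart, Measure.volume_eq_prod, setIntegral_prod, sineCoeff,
    intervalIntegral.integral_of_le hℓ.le, integral_Ioc_eq_integral_Ioo]
  · refine setIntegral_congr_fun measurableSet_Ioo fun s _ => ?_
    simp only [hF, transCoeff, groundCoeff]
    rw [← integral_const_mul]
    refine integral_congr_ae (Eventually.of_forall fun t => ?_)
    simp only [inner_planeChart_zero, inner_planeChart_one]
    push_cast
    ring
  · exact ((hFc.comp (continuous_planeChart A _ _)).integrable_of_hasCompactSupport
      (hasCompactSupport_comp_planeChart hFs hli)).integrableOn

end StripModes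

/-! ### The lower bound for the Robin form -/

section LowerBound

variable {M : ℕ} {P : Polygon Plane M} {b : Fin M → OrthonormalBasis (Fin 2) ℝ Plane}

/-- For large `α` the Robin form is bounded below by almost `-α² + x` on the test functions
orthogonal to the products of the transverse ground state and the Dirichlet eigenfunctions with
eigenvalue below `x`. -/
theorem IsSideFrame.exists_lower_bound (hb : IsSideFrame P b) (hP : IsConvexPolygon P) {x : ℝ}
    (hx : 0 < x) : ∃ C > 0, ∃ α₀ > 0, ∀ α ≥ α₀, ∀ u : testFunctions Plane,
      (x - C / α) * (∫ y in (exterior P : Set Plane), ‖(u : Plane → ℂ) y‖ ^ 2) ≤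
      (∫ y in (exterior P : Set Plane), gradSq u y) -
        α * (∫ y, ‖(u : Plane → ℂ) y‖ ^ 2 ∂(boundaryMeasure (exterior P))) +
        α ^ 2 * (∫ y in (exterior P : Set Plane), ‖(u : Plane → ℂ) y‖ ^ 2) +
        2 * x * ∑ p ∈ lowModes (sideLength P) x,
          ‖sineCoeff (sideLength P p.1) p.2 (sideCoeff P b α p.1 u)‖ ^ 2 := by
  have hℓ := hP.sideLength_pos
  obtain ⟨κ, hκ, hform⟩ := hb.exists_form_ge hP
  set L := ∑ n, sideLength P n with hL
  have hLn : ∀ n, sideLength P n ≤ L := fun n =>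
    Finset.single_le_sum (fun k _ => (hℓ k).le) (Finset.mem_univ n)
  have hL0 : 0 ≤ L := Finset.sum_nonneg fun n _ => (hℓ n).le
  set B := ∑ n, 8 * x * modeCount (sideLength P n) x * sideLength P n with hB
  have hBn : ∀ n, 8 * x * modeCount (sideLength P n) x * sideLength P n ≤ B := fun n =>
    Finset.single_le_sum (f := fun n => 8 * x * modeCount (sideLength P n) x * sideLength P n)
      (fun k _ => by have := hℓ k; positivity) (Finset.mem_univ n)
  set C := 2 * x ^ 2 * L / κ + 1 with hC
  refine ⟨C, by positivity, max 1 (max (B / κ) (2 * x)), by positivity, fun α hα u => ?_⟩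
  have hα1 : 1 ≤ α := (le_max_left _ _).trans hα
  have hαB : B / κ ≤ α := ((le_max_left _ _).trans (le_max_right _ _)).trans hα
  have hαx : 2 * x ≤ α := ((le_max_right _ _).trans (le_max_right _ _)).trans hα
  have hα0 : 0 < α := by linarith
  have hF := hform α hα0 u
  set N := ∫ y in (exterior P : Set Plane), ‖(u : Plane → ℂ) y‖ ^ 2 with hN
  set f := fun n => ∫ s in Ioo 0 (sideLength P n), ‖sideCoeff P b α n u s‖ ^ 2 with hf
  set S := fun n => (∫ s in Ioo 0 (sideLength P n),
          ‖sideCoeff P b α n (testFunctions.deriv (b n 0) u) s‖ ^ 2) +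
        κ * α * (‖sideCoeff P b α n u 0‖ ^ 2 + ‖sideCoeff P b α n u (sideLength P n)‖ ^ 2) with hS
  set c := fun n => ∑ k ∈ Finset.range (modeCount (sideLength P n) x),
    ‖sineCoeff (sideLength P n) k (sideCoeff P b α n u)‖ ^ 2 with hc
  have hf0 : ∀ n, 0 ≤ f n := fun n => integral_nonneg fun _ => by positivity
  have hc0 : ∀ n, 0 ≤ c n := fun n => Finset.sum_nonneg fun _ _ => by positivity
  have hS0 : ∀ n, 0 ≤ S n := fun n =>
    add_nonneg (integral_nonneg fun _ => by positivity) (by positivity)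
  have hfN : ∑ n, f n ≤ N := by
    have h1 : ∀ n, f n ≤ ∫ y in strip P b n, ‖(u : Plane → ℂ) y‖ ^ 2 := fun n =>
      integral_sq_transCoeff_le hα0 u
    refine (Finset.sum_le_sum fun n _ => h1 n).trans ?_
    refine le_trans (le_add_of_nonneg_right ?_)
      (hb.sum_setIntegral_le hP (integrable_normSq u) fun y => by positivity)
    exact Finset.sum_nonneg fun n _ => integral_nonneg fun _ => by positivity
  -- the relative loss in `robin_energy_lower_bound` for the Robin parameter `κ α`
  set θ := 1 + 2 * x * L / (κ * α) with hθ
  have hθ1 : 1 ≤ θ := le_add_of_nonneg_right (by positivity)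
  have hside : ∀ n, x * f n ≤ θ * (S n + 2 * x * c n) := by
    intro n
    have h := robin_energy_lower_bound (hℓ n)
      (fun s => hasDerivAt_transCoeff (A := P n) hα0 (linearIndependent_pair (b n)) u s)
      (continuous_transCoeff hα0 _) hx (le_dirichletFreq_modeCount (hℓ n) x)
      (β := κ * α) (by positivity) ((hBn n).trans (by
        rw [div_le_iff₀ hκ] at hαB
        linarith))
    simp only [intervalIntegral.integral_of_le (hℓ n).le, integral_Ioc_eq_integral_Ioo] at h
    refine h.trans (mul_le_mul_of_nonneg_right ?_ ?_)
    · have := hLn n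
      rw [hθ]
      gcongr
    · exact add_nonneg (hS0 n) (by have := hc0 n; positivity)
  have hsum := Finset.sum_le_sum fun n (_ : n ∈ Finset.univ) => hside n
  rw [← Finset.mul_sum, ← Finset.mul_sum, Finset.sum_add_distrib, ← Finset.mul_sum] at hsum
  set f1 := ∑ n, f n with hf1
  set S1 := ∑ n, S n with hS1
  set c1 := ∑ n, c n with hc1
  have hf10 : 0 ≤ f1 := Finset.sum_nonneg fun n _ => hf0 n
  have hcl : ∑ p ∈ lowModes (sideLength P) x,
      ‖sineCoeff (sideLength P p.1) p.2 (sideCoeff P b α p.1 u)‖ ^ 2 = c1 := sum_lowModes _ _ _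
  rw [hcl]
  -- `x / θ ≥ x - C / α`
  have hxθ : (x - C / α) * θ ≤ x := by
    have h1 : C / α = 2 * x ^ 2 * L / (κ * α) + 1 / α := by
      rw [hC]
      field_simp
    have h2 : x * θ = x + 2 * x ^ 2 * L / (κ * α) := by
      rw [hθ]
      ring
    have h3 : 0 ≤ 2 * x ^ 2 * L / (κ * α) := by positivity
    have h4 : 0 ≤ 1 / α := by positivity
    rw [sub_mul, h2]
    nlinarith
  have h1 : (x - C / α) * f1 ≤ S1 + 2 * x * c1 := by
    have h2 : θ * ((x - C / α) * f1) ≤ θ * (S1 + 2 * x * c1) := by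
      refine le_trans ?_ hsum
      rw [← mul_assoc, mul_comm θ]
      exact mul_le_mul_of_nonneg_right hxθ hf10
    exact le_of_mul_le_mul_left h2 (by linarith)
  -- the components orthogonal to the transverse ground states have much larger energy
  have h2 : (x - C / α) * (N - f1) ≤ α ^ 2 / 2 * (N - f1) := by
    refine mul_le_mul_of_nonneg_right ?_ (by linarith)
    have : 0 ≤ C / α := by positivity
    nlinarith
  change S1 + α ^ 2 / 2 * (N - f1) ≤ _ at hF
  linarith

end LowerBound

/-! ### Density of the test functions in the Sobolev space outside a convex body -/

section Density

variable {E : Type*} [NormedAddCommGroup E] [InnerProductSpace ℝ E] [FiniteDimensional ℝ E]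
  [MeasurableSpace E] [BorelSpace E]

/-- The mollification of `U` with a normalised bump function. -/
def mollify (φ : ContDiffBump (0 : E)) (U : E → ℂ) : E → ℂ :=
  convolution (φ.normed volume) U (ContinuousLinearMap.lsmul ℝ ℝ) volume

theorem mollify_apply (φ : ContDiffBump (0 : E)) (U : E → ℂ) (x : E) :
    mollify φ U x = ∫ q, φ.normed volume q • U (x - q) := rfl

theorem mollify_eq_swap (φ : ContDiffBump (0 : E)) (U : E → ℂ) (x : E) :
    mollify φ U x = ∫ q, φ.normed volume (x - q) • U q := convolution_lsmul_swap

theorem contDiff_mollify (φ : ContDiffBump (0 : E)) {U : E → ℂ} (hU : LocallyIntegrable U volume) :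
    ContDiff ℝ ∞ (mollify φ U) :=
  φ.hasCompactSupport_normed.contDiff_convolution_left _ φ.contDiff_normed hU

theorem mollify_sub (φ : ContDiffBump (0 : E)) {U V : E → ℂ} (hU : LocallyIntegrable U volume)
    (hV : LocallyIntegrable V volume) : mollify φ (U - V) = mollify φ U - mollify φ V := by
  ext x
  have h : ∀ {W : E → ℂ}, LocallyIntegrable W volume →
      Integrable fun q => φ.normed volume q • W (x - q) := fun hW =>
    φ.hasCompactSupport_normed.convolutionExists_left (ContinuousLinearMap.lsmul ℝ ℝ (E := ℂ))
      φ.continuous_normed hW x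
  rw [Pi.sub_apply, mollify_apply, mollify_apply, mollify_apply, ← integral_sub (h hU) (h hV)]
  simp only [Pi.sub_apply, smul_sub]

/-- Young's inequality for the convolution with a probability density, by Jensen's inequality for
this density. -/
theorem eLpNorm_mollify_le (φ : ContDiffBump (0 : E)) {U : E → ℂ} (hU : StronglyMeasurable U) :
    eLpNorm (mollify φ U) 2 volume ≤ eLpNorm U 2 volume := by
  set w : E → ENNReal := fun q => ENNReal.ofReal (φ.normed volume q) with hw
  have hwm : Measurable w := φ.continuous_normed.measurable.ennreal_ofReal
  set ν : Measure E := volume.withDensity w with hν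
  have hν1 : IsProbabilityMeasure ν := ⟨by
    rw [hν, withDensity_apply _ MeasurableSet.univ, Measure.restrict_univ,
      ← ofReal_integral_eq_lintegral_ofReal φ.integrable_normed
        (Eventually.of_forall φ.nonneg_normed), φ.integral_normed, ENNReal.ofReal_one]⟩
  have hp : ∀ x, ‖mollify φ U x‖ₑ ^ 2 ≤ ∫⁻ q, ‖U (x - q)‖ₑ ^ 2 ∂ν := by
    intro x
    have hm : StronglyMeasurable fun q => U (x - q) :=
      hU.comp_measurable (measurable_const.sub measurable_id)
    have h1 : mollify φ U x = ∫ q, U (x - q) ∂ν := by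
      rw [hν, integral_withDensity_eq_integral_toReal_smul hwm
        (Eventually.of_forall fun q => ENNReal.ofReal_lt_top), mollify_apply]
      simp only [hw, ENNReal.toReal_ofReal (φ.nonneg_normed _)]
    have h2 : ‖mollify φ U x‖ₑ ≤ eLpNorm (fun q => U (x - q)) 2 ν := by
      rw [h1]
      refine (enorm_integral_le_lintegral_enorm _).trans ?_
      rw [← eLpNorm_one_eq_lintegral_enorm]
      exact eLpNorm_le_eLpNorm_of_exponent_le (by norm_num) hm.aestronglyMeasurable
    have h3 := eLpNorm_nnreal_pow_eq_lintegral (μ := ν) (f := fun q => U (x - q)) (p := 2)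
      (by norm_num)
    calc ‖mollify φ U x‖ₑ ^ 2 ≤ (eLpNorm (fun q => U (x - q)) 2 ν) ^ 2 := by gcongr
      _ = ∫⁻ q, ‖U (x - q)‖ₑ ^ 2 ∂ν := by simpa using h3
  have hmeas : Measurable fun z : E × E => ‖U (z.1 - z.2)‖ₑ ^ 2 :=
    (hU.comp_measurable (measurable_fst.sub measurable_snd)).enorm.pow_const 2
  have key : eLpNorm (mollify φ U) 2 volume ^ 2 ≤ eLpNorm U 2 volume ^ 2 := by
    have h1 := eLpNorm_nnreal_pow_eq_lintegral (μ := (volume : Measure E)) (f := mollify φ U)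
      (p := 2) (by norm_num)
    have h2 := eLpNorm_nnreal_pow_eq_lintegral (μ := (volume : Measure E)) (f := U)
      (p := 2) (by norm_num)
    simp only [ENNReal.coe_ofNat, NNReal.coe_ofNat, ENNReal.rpow_ofNat] at h1 h2
    rw [h1, h2]
    calc ∫⁻ x, ‖mollify φ U x‖ₑ ^ 2 ≤ ∫⁻ x, ∫⁻ q, ‖U (x - q)‖ₑ ^ 2 ∂ν := lintegral_mono hp
      _ = ∫⁻ q, (∫⁻ x, ‖U (x - q)‖ₑ ^ 2) ∂ν := lintegral_lintegral_swap hmeas.aemeasurable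
      _ = ∫⁻ _, (∫⁻ x, ‖U x‖ₑ ^ 2) ∂ν := by
        refine lintegral_congr fun q => ?_
        exact lintegral_sub_right_eq_self (fun x => ‖U x‖ₑ ^ 2) q
      _ = ∫⁻ x, ‖U x‖ₑ ^ 2 := by simp
  exact (ENNReal.pow_le_pow_left_iff two_ne_zero).mp key

theorem eLpNorm_comp_dilation_le {s : ℝ} (hs : 1 ≤ s) (a : E) {W : E → ℂ} (hW : Continuous W) :
    eLpNorm (fun x => W (s • x - a)) 2 volume ≤ eLpNorm W 2 volume := by
  have h1 : eLpNorm (fun x => W (s • x - a)) 2 volume =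
      eLpNorm (fun x => W (x - a)) 2 (Measure.map (fun x : E => s • x) volume) :=
    (eLpNorm_map_measure (hW.comp (continuous_id.sub continuous_const)).aestronglyMeasurable
      (continuous_const_smul s).measurable.aemeasurable).symm
  have h2 : eLpNorm (fun x => W (x - a)) 2 volume = eLpNorm W 2 volume :=
    eLpNorm_comp_measurePreserving hW.aestronglyMeasurable (measurePreserving_sub_right volume a)
  rw [h1, ← h2, Measure.map_addHaar_smul _ (by positivity)]
  refine eLpNorm_mono_measure _ ?_
  have : ENNReal.ofReal |(s ^ Module.finrank ℝ E)⁻¹| ≤ 1 := by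
    rw [ENNReal.ofReal_le_one, abs_of_nonneg (by positivity)]
    exact inv_le_one_of_one_le₀ (one_le_pow₀ hs)
  intro A
  calc _ = ENNReal.ofReal |(s ^ Module.finrank ℝ E)⁻¹| * volume A := rfl
    _ ≤ 1 * volume A := by gcongr
    _ = volume A := one_mul _

/-- The weak derivative commutes with the mollification, away from the boundary. -/
theorem fderiv_mollify {Ω : TopologicalSpace.Opens E} {e : E} {u g : L2 Ω}
    (h : HasWeakDeriv Ω e u g) (φ : ContDiffBump (0 : E)) {y : E}
    (hy : Metric.closedBall y φ.rOut ⊆ (Ω : Set E))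
    (hu : LocallyIntegrable ((Ω : Set E).indicator u) volume) :
    fderiv ℝ (mollify φ ((Ω : Set E).indicator u)) y e =
      mollify φ ((Ω : Set E).indicator g) y := by
  have hc := φ.hasCompactSupport_normed (μ := (volume : Measure E))
  have hs : ContDiff ℝ ∞ (φ.normed (volume : Measure E)) := φ.contDiff_normed
  have h1 := hc.hasFDerivAt_convolution_left (ContinuousLinearMap.lsmul ℝ ℝ (E := ℂ))
    (hs.of_le (by simp)) hu y
  have h2 := ((hc.fderiv ℝ).convolutionExists_left
    ((ContinuousLinearMap.lsmul ℝ ℝ (E := ℂ)).precompL E)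
    (hs.continuous_fderiv (by simp)) hu) y
  have h3 : fderiv ℝ (mollify φ ((Ω : Set E).indicator u)) y e =
      ∫ q, fderiv ℝ (φ.normed volume) q e • (Ω : Set E).indicator u (y - q) := by
    rw [mollify, h1.fderiv, convolution_def, ContinuousLinearMap.integral_apply h2]
    rfl
  have hind : ∀ (w : E → ℝ) (v : E → ℂ), ∫ q, w q • (Ω : Set E).indicator v q =
      ∫ q in (Ω : Set E), w q • v q := by
    intro w v
    rw [← integral_indicator Ω.isOpen.measurableSet]
    congr 1
    ext q
    by_cases hq : q ∈ (Ω : Set E) <;> simp [hq]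
  rw [h3, ← integral_sub_left_eq_self _ volume y, mollify_eq_swap, hind]
  simp only [sub_sub_cancel]
  rw [hind]
  have h4 := h (fun z => φ.normed volume (y - z)) (hs.comp (contDiff_const.sub contDiff_id))
    (hc.comp_homeomorph (Homeomorph.subLeft y)) ?_
  · rw [← neg_eq_iff_eq_neg] at h4
    rw [← h4, ← integral_neg]
    refine integral_congr_ae (Eventually.of_forall fun z => ?_)
    have h5 : fderiv ℝ (fun z => φ.normed volume (y - z)) z = -fderiv ℝ (φ.normed volume) (y - z) := by
      have := ((hs.differentiable (by simp)) (y - z)).hasFDerivAt.comp z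
        ((hasFDerivAt_const y z).sub (hasFDerivAt_id z))
      refine this.fderiv.trans ?_
      ext v
      simp
    simp only [h5]
    simp
  · refine (closure_minimal ?_ Metric.isClosed_closedBall).trans hy
    intro z hz
    have : y - z ∈ Function.support (φ.normed (volume : Measure E)) := hz
    rw [φ.support_normed_eq, mem_ball_zero_iff] at this
    rw [mem_closedBall_iff_norm']
    exact this.le

/-- A dilation about an interior point of a convex set moves the points outside the set away from
the set. -/
theorem closedBall_dilation_subset_compl {K : Set E} (hK : Convex ℝ K) {c : E} {r : ℝ}
    (hr : Metric.closedBall c r ⊆ K) {h : ℝ} (hh : 0 < h) {x : E} (hx : x ∉ K) :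
    Metric.closedBall ((1 + h) • x - h • c) (h * r) ⊆ Kᶜ := by
  intro y hy hyK
  refine hx ?_
  set z := h⁻¹ • ((1 + h) • x - y) with hz
  have hzK : z ∈ K := by
    refine hr ?_
    rw [mem_closedBall_iff_norm] at hy ⊢
    have : z - c = -(h⁻¹ • (y - ((1 + h) • x - h • c))) := by
      rw [hz]
      have hcc : c = h⁻¹ • h • c := by rw [smul_smul, inv_mul_cancel₀ hh.ne', one_smul]
      conv_lhs => rw [hcc]
      module
    rw [this, norm_neg, norm_smul, norm_inv, Real.norm_of_nonneg hh.le, inv_mul_le_iff₀ hh]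
    exact hy
  have hxe : x = (1 / (1 + h)) • y + (h / (1 + h)) • z := by
    rw [hz, smul_smul]
    have h1 : h / (1 + h) * h⁻¹ = 1 / (1 + h) := by field_simp
    rw [h1, ← smul_add, add_sub_cancel, smul_smul, one_div, inv_mul_cancel₀ (by positivity),
      one_smul]
  rw [hxe]
  exact hK hyK hzK (by positivity) (by positivity) (by field_simp)

variable (E) in
/-- A smooth cutoff function, equal to `1` on the unit ball. -/
def cutoff : ContDiffBump (0 : E) := ⟨1, 2, one_pos, one_lt_two⟩

theorem contDiff_coe_cutoff : ContDiff ℝ ∞ (cutoff E) := (cutoff E).contDiff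

/-- The dilation parameter `1 / (k + 1)`. -/
def step (k : ℕ) : ℝ := 1 / (k + 1)

theorem step_pos (k : ℕ) : 0 < step k := Nat.one_div_pos_of_nat

theorem step_le_one (k : ℕ) : step k ≤ 1 := by
  rw [step, div_le_one (by positivity)]
  linarith [k.cast_nonneg (α := ℝ)]

theorem tendsto_step : Tendsto step atTop (𝓝 0) := tendsto_one_div_add_atTop_nhds_zero_nat

variable (E) in
/-- A bump function on the ball of radius `r / (k + 1)`. -/
def stepBump {r : ℝ} (hr : 0 < r) (k : ℕ) : ContDiffBump (0 : E) :=
  ⟨step k * r / 2, step k * r, by have := step_pos k; positivity,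
    half_lt_self (mul_pos (step_pos k) hr)⟩

/-- The average of `U` over the dilations by the factor `1 + h` about the points of the ball of
centre `c` and radius `r`, where `h = 1 / (k + 1)`. -/
def dilationAverage (c : E) {r : ℝ} (hr : 0 < r) (k : ℕ) (U : E → ℂ) (x : E) : ℂ :=
  mollify (stepBump E hr k) U ((1 + step k) • x - step k • c)

/-- The average of the dilations, cut off at the distance `k + 1`. -/
def smoothing (c : E) {r : ℝ} (hr : 0 < r) (k : ℕ) (U : E → ℂ) (x : E) : ℂ :=
  cutoff E (step k • x) • dilationAverage c hr k U x

variable {c : E} {r : ℝ} {hr : 0 < r}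

theorem eLpNorm_dilationAverage_le (k : ℕ) {U : E → ℂ} (hU : StronglyMeasurable U)
    (hUl : LocallyIntegrable U volume) :
    eLpNorm (dilationAverage c hr k U) 2 volume ≤ eLpNorm U 2 volume :=
  (eLpNorm_comp_dilation_le (by linarith [step_pos k]) _
    (contDiff_mollify _ hUl).continuous).trans (eLpNorm_mollify_le _ hU)

theorem eLpNorm_smoothing_le (k : ℕ) {U : E → ℂ} (hU : StronglyMeasurable U)
    (hUl : LocallyIntegrable U volume) :
    eLpNorm (smoothing c hr k U) 2 volume ≤ eLpNorm U 2 volume := by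
  refine (eLpNorm_mono fun x => ?_).trans (eLpNorm_dilationAverage_le (c := c) (hr := hr) k hU hUl)
  rw [smoothing, norm_smul, Real.norm_of_nonneg (ContDiffBump.nonneg _)]
  exact mul_le_of_le_one_left (norm_nonneg _) (ContDiffBump.le_one _)

theorem contDiff_dilationAverage (k : ℕ) {U : E → ℂ} (hUl : LocallyIntegrable U volume) :
    ContDiff ℝ ∞ (dilationAverage c hr k U) :=
  (contDiff_mollify _ hUl).comp ((contDiff_const_smul _).sub contDiff_const)

theorem contDiff_cutoff (k : ℕ) : ContDiff ℝ ∞ fun x : E => cutoff E (step k • x) :=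
  contDiff_coe_cutoff.comp (contDiff_const_smul _)

theorem contDiff_smoothing (k : ℕ) {U : E → ℂ} (hUl : LocallyIntegrable U volume) :
    ContDiff ℝ ∞ (smoothing c hr k U) :=
  (contDiff_cutoff k).smul (contDiff_dilationAverage k hUl)

theorem hasCompactSupport_smoothing (k : ℕ) (U : E → ℂ) :
    HasCompactSupport (smoothing c hr k U) := by
  refine HasCompactSupport.smul_right (f := fun x : E => cutoff E (step k • x)) ?_
  exact (cutoff E).hasCompactSupport.comp_homeomorph (Homeomorph.smulOfNeZero _ (step_pos k).ne')

/-- On continuous functions with compact support the approximation is uniform. -/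
theorem tendsto_smoothing_of_continuous (c : E) {r : ℝ} (hr : 0 < r) {V : E → ℂ} (hV : Continuous V)
    (hVc : HasCompactSupport V) :
    Tendsto (fun k => eLpNorm (smoothing c hr k V - V) 2 volume) atTop (𝓝 0) := by
  obtain ⟨R, hR0, hR⟩ : ∃ R > 0, tsupport V ⊆ Metric.closedBall 0 R := by
    obtain ⟨R, hR⟩ := hVc.isCompact.isBounded.subset_closedBall (0 : E)
    exact ⟨max R 1, by positivity, hR.trans (Metric.closedBall_subset_closedBall (le_max_left _ _))⟩
  set R' : ℝ := R + ‖c‖ + r with hR'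
  have hnn : 0 ≤ ‖c‖ := norm_nonneg c
  have hVR : ∀ x, R < ‖x‖ → V x = 0 := fun x hx =>
    image_eq_zero_of_notMem_tsupport fun h => by
      have := hR h
      rw [mem_closedBall_zero_iff] at this
      linarith
  set v : ENNReal := volume (Metric.closedBall (0 : E) R') with hv
  have hvt : v ≠ ⊤ := measure_closedBall_lt_top.ne
  have hUC := hVc.uniformContinuous_of_continuous hV
  have hsupp : ∀ k, Function.support (smoothing c hr k V - V) ⊆ Metric.closedBall 0 R' := by
    intro k x hx
    by_contra hxR
    rw [mem_closedBall_zero_iff, not_le] at hxR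
    refine hx ?_
    rw [Pi.sub_apply, hVR x (by linarith), sub_zero, smoothing, dilationAverage, mollify_apply,
      integral_eq_zero_of_ae, smul_zero]
    refine Eventually.of_forall fun q => ?_
    by_cases hq : q ∈ Metric.ball (0 : E) (stepBump E hr k).rOut
    · change _ • V _ = 0
      rw [hVR, smul_zero]
      have hq' : ‖q‖ < step k * r := mem_ball_zero_iff.mp hq
      have h1 : ‖(1 + step k) • x‖ = (1 + step k) * ‖x‖ := by
        rw [norm_smul, Real.norm_of_nonneg (by linarith [step_pos k])]
      have h2 : ‖step k • c‖ = step k * ‖c‖ := by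
        rw [norm_smul, Real.norm_of_nonneg (step_pos k).le]
      have h3 : ‖(1 + step k) • x‖ ≤ ‖(1 + step k) • x - step k • c - q‖ + ‖step k • c‖ + ‖q‖ := by
        have := norm_add₃_le (a := (1 + step k) • x - step k • c - q) (b := step k • c) (c := q)
        rwa [show (1 + step k) • x - step k • c - q + step k • c + q = (1 + step k) • x by module]
          at this
      have := step_pos k
      have := step_le_one k
      nlinarith [norm_nonneg x]
    · rw [← (stepBump E hr k).support_normed_eq (μ := volume), Function.notMem_support] at hq
      change _ • V _ = 0
      rw [hq, zero_smul]
  rw [ENNReal.tendsto_nhds_zero]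
  intro ε hε
  -- the uniform bound needed on the ball that contains the supports
  obtain ⟨η, hη0, hη⟩ : ∃ η : ℝ, 0 < η ∧ v ^ ((2 : ENNReal).toReal⁻¹) * ENNReal.ofReal η ≤ ε := by
    have hvt' : v ^ ((2 : ENNReal).toReal⁻¹) ≠ ⊤ := ENNReal.rpow_ne_top_of_nonneg (by positivity) hvt
    have h1 : Tendsto (fun η : ℝ => v ^ ((2 : ENNReal).toReal⁻¹) * ENNReal.ofReal η) (𝓝[>] 0)
        (𝓝 0) := by
      have : Tendsto (fun η : ℝ => ENNReal.ofReal η) (𝓝[>] 0) (𝓝 0) := by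
        have := ENNReal.continuous_ofReal.tendsto (0 : ℝ)
        rw [ENNReal.ofReal_zero] at this
        exact this.mono_left nhdsWithin_le_nhds
      simpa using ENNReal.Tendsto.const_mul this (Or.inr hvt')
    obtain ⟨η, h2, h3⟩ := ((ENNReal.tendsto_nhds_zero.mp h1 ε hε).and self_mem_nhdsWithin).exists
    exact ⟨η, h3, h2⟩
  obtain ⟨δ, hδ0, hδ⟩ := Metric.uniformContinuous_iff.mp hUC η hη0
  have hs1 : ∀ᶠ k in atTop, step k * (R' + ‖c‖ + r) < δ := by
    have := tendsto_step.mul_const (R' + ‖c‖ + r)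
    rw [zero_mul] at this
    exact this.eventually (gt_mem_nhds hδ0)
  have hs2 : ∀ᶠ k in atTop, step k * R' < 1 := by
    have := tendsto_step.mul_const R'
    rw [zero_mul] at this
    exact this.eventually (gt_mem_nhds one_pos)
  filter_upwards [hs1, hs2] with k hk1 hk2
  rw [← eLpNorm_restrict_eq_of_support_subset (hsupp k)]
  refine (eLpNorm_le_of_ae_bound (C := η) ?_).trans (by rw [Measure.restrict_apply_univ]; exact hη)
  rw [ae_restrict_iff' measurableSet_closedBall]
  refine Eventually.of_forall fun x hx => ?_
  rw [mem_closedBall_zero_iff] at hx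
  have hk0 := step_pos k
  have hχ : cutoff E (step k • x) = 1 := by
    refine (cutoff E).one_of_mem_closedBall ?_
    rw [mem_closedBall_zero_iff, norm_smul, Real.norm_of_nonneg hk0.le]
    change _ ≤ (1 : ℝ)
    nlinarith
  rw [Pi.sub_apply, smoothing, hχ, one_smul, ← dist_eq_norm]
  refine dist_convolution_le hη0.le (stepBump E hr k).support_normed_eq.subset
    (stepBump E hr k).nonneg_normed (stepBump E hr k).integral_normed hV.aestronglyMeasurable
    fun y hy => (hδ ?_).le
  rw [mem_ball_iff_norm] at hy
  rw [dist_eq_norm]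
  change _ < step k * r at hy
  have h1 : y - x = (y - ((1 + step k) • x - step k • c)) + step k • x - step k • c := by module
  have h2 : ‖step k • c‖ = step k * ‖c‖ := by rw [norm_smul, Real.norm_of_nonneg hk0.le]
  have h3 : ‖step k • x‖ = step k * ‖x‖ := by rw [norm_smul, Real.norm_of_nonneg hk0.le]
  rw [h1]
  refine (norm_sub_le _ _).trans_lt ?_
  have h4 := norm_add_le (y - ((1 + step k) • x - step k • c)) (step k • x)
  nlinarith

theorem smoothing_sub (k : ℕ) {U V : E → ℂ} (hU : LocallyIntegrable U volume)
    (hV : LocallyIntegrable V volume) :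
    smoothing c hr k (U - V) = smoothing c hr k U - smoothing c hr k V := by
  ext x
  simp only [smoothing, dilationAverage, mollify_sub _ hU hV, Pi.sub_apply, smul_sub]

theorem tendsto_smoothing (c : E) {r : ℝ} (hr : 0 < r) {U : E → ℂ} (hU : StronglyMeasurable U)
    (hU2 : MemLp U 2 volume) :
    Tendsto (fun k => eLpNorm (smoothing c hr k U - U) 2 volume) atTop (𝓝 0) := by
  have hUl := hU2.locallyIntegrable (by norm_num)
  rw [ENNReal.tendsto_nhds_zero]
  intro ε hε
  have hε3 : ε / 3 ≠ 0 := by simp [hε.ne']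
  obtain ⟨V, hVc, hUV, hV, hV2⟩ := hU2.exists_hasCompactSupport_eLpNorm_sub_le (by simp) hε3
  have hVl := hV2.locallyIntegrable (by norm_num)
  filter_upwards [ENNReal.tendsto_nhds_zero.mp (tendsto_smoothing_of_continuous c hr hV hVc) (ε / 3)
    (pos_iff_ne_zero.mpr hε3)] with k hk
  have h1 : smoothing c hr k U - U =
      smoothing c hr k (U - V) + (smoothing c hr k V - V) + (V - U) := by
    rw [smoothing_sub k hUl hVl]
    abel
  have hc1 : AEStronglyMeasurable (smoothing c hr k (U - V)) volume :=
    (contDiff_smoothing k (hUl.sub hVl)).continuous.aestronglyMeasurable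
  have hc2 : AEStronglyMeasurable (smoothing c hr k V - V) volume :=
    ((contDiff_smoothing k hVl).continuous.sub hV).aestronglyMeasurable
  rw [h1]
  calc _ ≤ eLpNorm (smoothing c hr k (U - V)) 2 volume + eLpNorm (smoothing c hr k V - V) 2 volume
        + eLpNorm (V - U) 2 volume :=
        (eLpNorm_add_le (hc1.add hc2) (hV.aestronglyMeasurable.sub hU.aestronglyMeasurable)
          (by norm_num)).trans (add_le_add_left (eLpNorm_add_le hc1 hc2 (by norm_num)) _)
    _ ≤ ε / 3 + ε / 3 + ε / 3 := by
        refine add_le_add (add_le_add ?_ hk) ?_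
        · exact (eLpNorm_smoothing_le k (hU.sub hV.stronglyMeasurable) (hUl.sub hVl)).trans hUV
        · rwa [← eLpNorm_neg, neg_sub]
    _ = ε := ENNReal.add_thirds ε

/-- The derivative of the approximation is, up to a small error from the cutoff, the approximation
of the weak derivative. -/
theorem fderiv_smoothing {Ω : TopologicalSpace.Opens E} {K : Set E} (hΩ : (Ω : Set E) = Kᶜ)
    (hK : Convex ℝ K) (hcK : Metric.closedBall c r ⊆ K) {e : E} {u g : L2 Ω}
    (h : HasWeakDeriv Ω e u g) (hu : LocallyIntegrable ((Ω : Set E).indicator u) volume) (k : ℕ)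
    {x : E} (hx : x ∈ (Ω : Set E)) :
    fderiv ℝ (smoothing c hr k ((Ω : Set E).indicator u)) x e =
      (1 + step k : ℝ) • smoothing c hr k ((Ω : Set E).indicator g) x +
      (step k * fderiv ℝ (cutoff E) (step k • x) e) •
        dilationAverage c hr k ((Ω : Set E).indicator u) x := by
  have hball : Metric.closedBall ((1 + step k) • x - step k • c) (stepBump E hr k).rOut ⊆
      (Ω : Set E) := by
    rw [hΩ] at hx ⊢
    exact closedBall_dilation_subset_compl hK hcK (step_pos k) hx
  have h1 : HasFDerivAt (fun x : E => cutoff E (step k • x)) _ x :=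
    (contDiff_coe_cutoff.differentiable (by simp) (step k • x)).hasFDerivAt.comp x
      ((hasFDerivAt_id x).const_smul (step k))
  have h2 : HasFDerivAt (dilationAverage c hr k ((Ω : Set E).indicator u)) _ x :=
    (((contDiff_mollify (stepBump E hr k) hu).differentiable (by simp)
      ((1 + step k) • x - step k • c)).hasFDerivAt.comp x
      (((hasFDerivAt_id x).const_smul (1 + step k)).sub_const (step k • c)))
  have h3 := h1.smul h2
  have h4 : fderiv ℝ (smoothing c hr k ((Ω : Set E).indicator u)) x = _ := h3.fderiv
  rw [h4]
  have h5 := fderiv_mollify h (stepBump E hr k) hball hu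
  simp only [ContinuousLinearMap.add_apply, ContinuousLinearMap.smul_apply,
    ContinuousLinearMap.comp_apply, ContinuousLinearMap.smulRight_apply,
    ContinuousLinearMap.id_apply, map_smul]
  rw [h5, smul_comm]
  simp only [smoothing, dilationAverage, smul_eq_mul]

variable {ι : Type*} [Fintype ι]

/-- The test functions are dense in the Sobolev space on the complement of a convex set with
interior points. -/
theorem denseRange_ofTest {Ω : TopologicalSpace.Opens E} {K : Set E} (hΩ : (Ω : Set E) = Kᶜ)
    (hK : Convex ℝ K) (hKi : (interior K).Nonempty) (d : ι → E) :
    DenseRange (sobolevHilbert.ofTest Ω d) := by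
  obtain ⟨c, hc⟩ := hKi
  obtain ⟨r, hr, hcr⟩ := Metric.nhds_basis_closedBall.mem_iff.mp (mem_interior_iff_mem_nhds.mp hc)
  have hΩm := Ω.isOpen.measurableSet
  intro p
  have hsm : ∀ w : L2 Ω, StronglyMeasurable ((Ω : Set E).indicator w) := fun w =>
    (Lp.stronglyMeasurable w).indicator hΩm
  have hmem : ∀ w : L2 Ω, MemLp ((Ω : Set E).indicator w) 2 volume := fun w =>
    (memLp_indicator_iff_restrict hΩm).mpr (Lp.memLp w)
  have hli : ∀ w : L2 Ω, LocallyIntegrable ((Ω : Set E).indicator w) volume := fun w =>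
    (hmem w).locallyIntegrable (by norm_num)
  -- convergence on `Ω` of the approximations
  have hconv : ∀ w : L2 Ω, Tendsto (fun k => eLpNorm
      (fun x => w x - smoothing c hr k ((Ω : Set E).indicator w) x) 2
      (volume.restrict (Ω : Set E))) atTop (𝓝 0) := by
    intro w
    refine tendsto_of_tendsto_of_tendsto_of_le_of_le tendsto_const_nhds
      (tendsto_smoothing c hr (hsm w) (hmem w)) (fun _ => zero_le) fun k => ?_
    change eLpNorm _ 2 _ ≤ eLpNorm _ 2 _
    refine le_trans (le_of_eq ?_) (eLpNorm_mono_measure _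
      (Measure.restrict_le_self (s := (Ω : Set E))))
    rw [← eLpNorm_neg]
    refine eLpNorm_congr_ae ?_
    filter_upwards [ae_restrict_mem hΩm] with x hx
    simp [hx]
  set u := sobolevHilbert.incl Ω d p with hu
  set f : ℕ → testFunctions E := fun k => ⟨smoothing c hr k ((Ω : Set E).indicator u),
    contDiff_smoothing k (hli u), hasCompactSupport_smoothing k _⟩ with hf
  refine mem_closure_of_tendsto (f := fun k => sobolevHilbert.ofTest Ω d (f k)) (b := atTop) ?_
    (Eventually.of_forall fun k => ⟨f k, rfl⟩)
  rw [sobolevHilbert.tendsto_ofTest_iff]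
  refine ⟨sobolevHilbert.tendsto_toL2_iff.mpr (hconv u), fun i => ?_⟩
  rw [sobolevHilbert.tendsto_toL2_iff]
  set g := sobolevHilbert.pderiv Ω d i p with hg
  obtain ⟨C, hC⟩ := (((cutoff E).hasCompactSupport.fderiv ℝ).exists_bound_of_continuous
    (contDiff_coe_cutoff.continuous_fderiv (by simp)))
  have hC0 : 0 ≤ C := (norm_nonneg _).trans (hC 0)
  set B : ℝ := C * ‖d i‖ with hB
  -- the error term: `g - ∂f` is the sum of `g - S g`, `- h S g` and the contribution of the cutoff
  have hbd : ∀ k, eLpNorm (fun x => g x - (testFunctions.deriv (d i) (f k) : E → ℂ) x) 2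
      (volume.restrict (Ω : Set E)) ≤
      eLpNorm (fun x => g x - smoothing c hr k ((Ω : Set E).indicator g) x) 2
        (volume.restrict (Ω : Set E)) +
      (ENNReal.ofReal (step k) * eLpNorm ((Ω : Set E).indicator g) 2 volume +
      ENNReal.ofReal (step k * B) * eLpNorm ((Ω : Set E).indicator u) 2 volume) := by
    intro k
    have hS : Continuous (smoothing c hr k ((Ω : Set E).indicator g)) :=
      (contDiff_smoothing k (hli g)).continuous
    have hD : Continuous (dilationAverage c hr k ((Ω : Set E).indicator u)) :=
      (contDiff_dilationAverage k (hli u)).continuous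
    have hχ : Continuous fun x => fderiv ℝ (cutoff E) (step k • x) (d i) :=
      ((contDiff_coe_cutoff.continuous_fderiv (by simp)).comp
        (continuous_const_smul _)).clm_apply continuous_const
    set A1 : E → ℂ := fun x => g x - smoothing c hr k ((Ω : Set E).indicator g) x
    set A2 : E → ℂ := fun x => -(step k • smoothing c hr k ((Ω : Set E).indicator g) x)
    set A3 : E → ℂ := fun x => -((step k * fderiv ℝ (cutoff E) (step k • x) (d i)) •
        dilationAverage c hr k ((Ω : Set E).indicator u) x)
    have hA1 : AEStronglyMeasurable A1 (volume.restrict (Ω : Set E)) :=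
      (Lp.aestronglyMeasurable g).sub hS.aestronglyMeasurable
    have hA2 : Continuous A2 := (hS.const_smul (step k)).neg
    have hA3 : Continuous A3 := ((continuous_const.mul hχ).smul hD).neg
    have heq : eLpNorm (fun x => g x - (testFunctions.deriv (d i) (f k) : E → ℂ) x) 2
        (volume.restrict (Ω : Set E)) = eLpNorm (A1 + (A2 + A3)) 2 (volume.restrict (Ω : Set E)) := by
      refine eLpNorm_congr_ae ?_
      filter_upwards [ae_restrict_mem hΩm] with x hx
      have := fderiv_smoothing (hr := hr) hΩ hK hcr (sobolevHilbert.hasWeakDeriv p i) (hli u) k hx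
      rw [testFunctions.deriv_apply]
      simp only [hf]
      rw [this]
      simp only [A1, A2, A3, Pi.add_apply, add_smul, one_smul]
      ring
    rw [heq]
    refine (eLpNorm_add_le hA1 (hA2.add hA3).aestronglyMeasurable (by norm_num)).trans ?_
    gcongr
    refine (eLpNorm_mono_measure _ Measure.restrict_le_self).trans ?_
    refine (eLpNorm_add_le hA2.aestronglyMeasurable hA3.aestronglyMeasurable (by norm_num)).trans ?_
    gcongr
    · refine (eLpNorm_le_mul_eLpNorm_of_ae_le_mul (g := smoothing c hr k ((Ω : Set E).indicator g))
        (c := step k) (Eventually.of_forall fun x => ?_) 2).trans ?_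
      · simp only [A2]
        rw [norm_neg, norm_smul, Real.norm_of_nonneg (step_pos k).le]
      · gcongr
        exact eLpNorm_smoothing_le k (hsm g) (hli g)
    · refine (eLpNorm_le_mul_eLpNorm_of_ae_le_mul
        (g := dilationAverage c hr k ((Ω : Set E).indicator u))
        (c := step k * B) (Eventually.of_forall fun x => ?_) 2).trans ?_
      · simp only [A3]
        rw [norm_neg, norm_smul, norm_mul, Real.norm_of_nonneg (step_pos k).le]
        gcongr
        · exact (step_pos k).le
        · exact (ContinuousLinearMap.le_opNorm _ _).trans
            (mul_le_mul_of_nonneg_right (hC _) (norm_nonneg _))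
      · gcongr
        exact eLpNorm_dilationAverage_le k (hsm u) (hli u)
  refine tendsto_of_tendsto_of_tendsto_of_le_of_le tendsto_const_nhds ?_ (fun _ => zero_le) hbd
  have h1 : Tendsto (fun k => ENNReal.ofReal (step k) * eLpNorm ((Ω : Set E).indicator g) 2 volume)
      atTop (𝓝 0) := by
    have := ENNReal.Tendsto.mul_const (b := eLpNorm ((Ω : Set E).indicator g) 2 volume)
      (ENNReal.tendsto_ofReal tendsto_step) (Or.inr (hmem g).2.ne)
    simpa using this
  have h2 : Tendsto (fun k => ENNReal.ofReal (step k * B) *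
      eLpNorm ((Ω : Set E).indicator u) 2 volume) atTop (𝓝 0) := by
    have := ENNReal.Tendsto.mul_const (b := eLpNorm ((Ω : Set E).indicator u) 2 volume)
      (ENNReal.tendsto_ofReal (tendsto_step.mul_const B)) (Or.inr (hmem u).2.ne)
    simpa using this
  simpa using (hconv g).add (h1.add h2)

end Density

/-! ### The boundary trace and the form of the Robin Laplacian -/

section Robin

/-- The coordinate directions in the plane. -/
abbrev planeDir : Fin 2 → Plane := fun i => EuclideanSpace.single i 1

theorem span_planeDir : Submodule.span ℝ (range planeDir) = ⊤ := by
  have h : planeDir = (EuclideanSpace.basisFun (Fin 2) ℝ).toBasis := by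
    ext1 i
    simp [planeDir]
  rw [h]
  exact (EuclideanSpace.basisFun (Fin 2) ℝ).toBasis.span_eq

/-- The domains for which the boundary trace is given by extension from the test functions, with
arbitrarily small relative form bound. -/
structure IsTraceDomain (Ω : TopologicalSpace.Opens Plane) : Prop where
  isFiniteMeasure : IsFiniteMeasure (boundaryMeasure Ω)
  denseRange : DenseRange (sobolevHilbert.ofTest Ω planeDir)
  trace_le : ∀ ε > 0, ∃ C, ∀ u : testFunctions Plane,
    ∫ x, ‖(u : Plane → ℂ) x‖ ^ 2 ∂(boundaryMeasure Ω) ≤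
      ε * (∫ x in (Ω : Set Plane), gradSq u x) + C * ∫ x in (Ω : Set Plane), ‖(u : Plane → ℂ) x‖ ^ 2

variable {Ω : TopologicalSpace.Opens Plane}

theorem sum_norm_sq_toL2_deriv (f : testFunctions Plane) :
    ∑ i, ‖testFunctions.toL2 (volume.restrict (Ω : Set Plane))
      (testFunctions.deriv (planeDir i) f)‖ ^ 2 = ∫ x in (Ω : Set Plane), gradSq f x := by
  simp only [testFunctions.norm_sq_toL2, gradSq]
  rw [integral_finsetSum]
  · rfl
  · exact fun i _ => (integrable_normSq (testFunctions.deriv (planeDir i) f)).integrableOn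

theorem norm_sq_ofTest (f : testFunctions Plane) : ‖sobolevHilbert.ofTest Ω planeDir f‖ ^ 2 =
    (∫ x in (Ω : Set Plane), ‖(f : Plane → ℂ) x‖ ^ 2) + ∫ x in (Ω : Set Plane), gradSq f x := by
  rw [sobolevHilbert.norm_sq, ← sum_norm_sq_toL2_deriv]
  simp only [sobolevHilbert.incl_ofTest, sobolevHilbert.pderiv_ofTest,
    testFunctions.norm_sq_toL2]

theorem norm_sq_equivSobolev (p : sobolevHilbert Ω planeDir) :
    ‖(sobolevHilbert.equivSobolev span_planeDir p : L2 Ω)‖ ^ 2 +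
      ∑ i, ‖partialDeriv Ω i (sobolevHilbert.equivSobolev span_planeDir p)‖ ^ 2 = ‖p‖ ^ 2 := by
  rw [sobolevHilbert.norm_sq]
  congr 1
  refine Finset.sum_congr rfl fun i _ => ?_
  rw [← sobolevHilbert.weakDeriv_equivSobolev span_planeDir]

/-- The trace is the continuous extension of the restriction of test functions to the boundary. -/
theorem IsTraceDomain.exists_trace (hΩ : IsTraceDomain Ω) : ∃ T, IsTrace Ω T := by
  have := hΩ.isFiniteMeasure
  obtain ⟨C, hC⟩ := hΩ.trace_le 1 one_pos
  set C' : ℝ := max 1 C with hC'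
  have hC0 : 0 ≤ C' := zero_le_one.trans (le_max_left _ _)
  have hb : ∀ f, ‖testFunctions.toL2 (boundaryMeasure Ω) f‖ ≤
      √C' * ‖sobolevHilbert.ofTest Ω planeDir f‖ := by
    intro f
    refine abs_le_of_sq_le_sq' ?_ (by positivity) |>.2
    rw [mul_pow, Real.sq_sqrt hC0, norm_sq_ofTest, testFunctions.norm_sq_toL2]
    have h1 : 0 ≤ ∫ x in (Ω : Set Plane), gradSq f x := integral_nonneg fun _ => gradSq_nonneg _ _
    have h2 : 0 ≤ ∫ x in (Ω : Set Plane), ‖(f : Plane → ℂ) x‖ ^ 2 :=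
      integral_nonneg fun _ => by positivity
    have h3 := mul_le_mul_of_nonneg_right (le_max_left 1 C) h1
    have h4 := mul_le_mul_of_nonneg_right (le_max_right 1 C) h2
    have := hC f
    rw [mul_add]
    linarith
  set T : sobolevHilbert Ω planeDir →L[ℂ] BoundaryL2 Ω :=
    (testFunctions.toL2 (boundaryMeasure Ω)).extendOfNorm (sobolevHilbert.ofTest Ω planeDir) with hT
  have hTf : ∀ f, T (sobolevHilbert.ofTest Ω planeDir f) =
      testFunctions.toL2 (boundaryMeasure Ω) f := fun f =>
    LinearMap.extendOfNorm_eq hΩ.denseRange ⟨_, hb⟩ f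
  set e := sobolevHilbert.equivSobolev (Ω := Ω) span_planeDir with he
  refine ⟨(T : sobolevHilbert Ω planeDir →ₗ[ℂ] BoundaryL2 Ω).comp e.symm.toLinearMap,
    ⟨‖T‖ ^ 2, fun u => ?_⟩, fun u f hf hfc huf => ?_⟩
  · obtain ⟨p, rfl⟩ := e.surjective u
    rw [norm_sq_equivSobolev, ← mul_pow]
    simp only [LinearMap.comp_apply, LinearEquiv.coe_coe, LinearEquiv.symm_apply_apply,
      ContinuousLinearMap.coe_coe]
    gcongr
    exact T.le_opNorm p
  · have hu : u = e (sobolevHilbert.ofTest Ω planeDir ⟨f, hf, hfc⟩) := by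
      refine Subtype.ext (Lp.ext (huf.trans ?_))
      exact (testFunctions.coeFn_toL2 _ (⟨f, hf, hfc⟩ : testFunctions Plane)).symm
    rw [hu]
    simp only [LinearMap.comp_apply, LinearEquiv.coe_coe, LinearEquiv.symm_apply_apply,
      ContinuousLinearMap.coe_coe, hTf]
    exact testFunctions.coeFn_toL2 _ (⟨f, hf, hfc⟩ : testFunctions Plane)

theorem IsTraceDomain.isTrace_trace (hΩ : IsTraceDomain Ω) : IsTrace Ω (trace Ω) := by
  have h := hΩ.exists_trace
  rw [trace, dif_pos h]
  exact h.choose_spec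

/-- The form domain `W^{1,2}(Ω)`. -/
def robinSpace (Ω : TopologicalSpace.Opens Plane) : Type := sobolevHilbert Ω planeDir

instance : NormedAddCommGroup (robinSpace Ω) :=
  inferInstanceAs (NormedAddCommGroup (sobolevHilbert Ω planeDir))

instance : InnerProductSpace ℂ (robinSpace Ω) :=
  inferInstanceAs (InnerProductSpace ℂ (sobolevHilbert Ω planeDir))

instance : CompleteSpace (robinSpace Ω) :=
  inferInstanceAs (CompleteSpace (sobolevHilbert Ω planeDir))

/-- The inclusion of the form domain in `L²(Ω)`. -/
def robinIncl (Ω : TopologicalSpace.Opens Plane) : robinSpace Ω →L[ℂ] L2 Ω :=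
  show sobolevHilbert Ω planeDir →L[ℂ] L2 Ω from sobolevHilbert.incl Ω planeDir

/-- The partial derivatives on the form domain. -/
def robinDeriv (Ω : TopologicalSpace.Opens Plane) (i : Fin 2) : robinSpace Ω →L[ℂ] L2 Ω :=
  show sobolevHilbert Ω planeDir →L[ℂ] L2 Ω from sobolevHilbert.pderiv Ω planeDir i

/-- The two descriptions of the form domain are identified. -/
def robinEquiv (Ω : TopologicalSpace.Opens Plane) : robinSpace Ω ≃ₗ[ℂ] sobolev Ω :=
  show sobolevHilbert Ω planeDir ≃ₗ[ℂ] sobolev Ω from sobolevHilbert.equivSobolev span_planeDir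

/-- The test functions as elements of the form domain. -/
def robinTest (Ω : TopologicalSpace.Opens Plane) : testFunctions Plane →ₗ[ℂ] robinSpace Ω :=
  show testFunctions Plane →ₗ[ℂ] sobolevHilbert Ω planeDir from sobolevHilbert.ofTest Ω planeDir

theorem partialDeriv_robinEquiv (i : Fin 2) (u : robinSpace Ω) :
    partialDeriv Ω i (robinEquiv Ω u) = robinDeriv Ω i u :=
  sobolevHilbert.weakDeriv_equivSobolev span_planeDir u i

theorem robinIncl_robinTest (f : testFunctions Plane) :
    robinIncl Ω (robinTest Ω f) = testFunctions.toL2 _ f := rfl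

theorem robinDeriv_robinTest (i : Fin 2) (f : testFunctions Plane) :
    robinDeriv Ω i (robinTest Ω f) = testFunctions.toL2 _ (testFunctions.deriv (planeDir i) f) := rfl

theorem IsTraceDomain.exists_norm_trace_le (hΩ : IsTraceDomain Ω) :
    ∃ C, ∀ u, ‖trace Ω (robinEquiv Ω u)‖ ≤ C * ‖u‖ := by
  obtain ⟨C, hC⟩ := hΩ.isTrace_trace.1
  refine ⟨√(max C 0), fun u => ?_⟩
  refine abs_le_of_sq_le_sq' ?_ (by positivity) |>.2
  rw [mul_pow, Real.sq_sqrt (le_max_right _ _)]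
  refine (hC (robinEquiv Ω u)).trans ?_
  have : ‖(robinEquiv Ω u : L2 Ω)‖ ^ 2 + ∑ i, ‖partialDeriv Ω i (robinEquiv Ω u)‖ ^ 2 = ‖u‖ ^ 2 :=
    norm_sq_equivSobolev (Ω := Ω) u
  rw [this]
  gcongr
  exact le_max_left _ _

/-- The boundary trace as a bounded operator on the form domain. -/
def robinTrace (hΩ : IsTraceDomain Ω) : robinSpace Ω →L[ℂ] BoundaryL2 Ω :=
  LinearMap.mkContinuousOfExistsBound ((trace Ω).comp (robinEquiv Ω).toLinearMap)
    hΩ.exists_norm_trace_le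

theorem robinTrace_apply (hΩ : IsTraceDomain Ω) (u : robinSpace Ω) :
    robinTrace hΩ u = trace Ω (robinEquiv Ω u) := rfl

theorem norm_sq_robinTrace_robinTest (hΩ : IsTraceDomain Ω) (f : testFunctions Plane) :
    ‖robinTrace hΩ (robinTest Ω f)‖ ^ 2 = ∫ x, ‖(f : Plane → ℂ) x‖ ^ 2 ∂(boundaryMeasure Ω) := by
  rw [norm_sq_eq_integral]
  refine integral_congr_ae ?_
  have := hΩ.isTrace_trace.2 (robinEquiv Ω (robinTest Ω f)) f (testFunctions.contDiff f)
    (testFunctions.hasCompactSupport f) (testFunctions.coeFn_toL2 _ f)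
  filter_upwards [this] with x hx
  rw [robinTrace_apply, hx]

/-- The operator on the form domain that represents the form `∫_Ω |∇u|² - α ∫_{∂Ω} |u|²`. -/
def robinEnergy (hΩ : IsTraceDomain Ω) (α : ℝ) : robinSpace Ω →L[ℂ] robinSpace Ω :=
  ∑ i, ContinuousLinearMap.adjoint (robinDeriv Ω i) ∘L robinDeriv Ω i -
    (α : ℂ) • (ContinuousLinearMap.adjoint (robinTrace hΩ) ∘L robinTrace hΩ)

theorem inner_robinEnergy (hΩ : IsTraceDomain Ω) (α : ℝ) (v u : robinSpace Ω) :
    (inner ℂ v (robinEnergy hΩ α u) : ℂ) = ∑ i, inner ℂ (robinDeriv Ω i v) (robinDeriv Ω i u) -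
      α * inner ℂ (robinTrace hΩ v) (robinTrace hΩ u) := by
  simp only [robinEnergy, ContinuousLinearMap.sub_apply, ContinuousLinearMap.sum_apply,
    ContinuousLinearMap.smul_apply, ContinuousLinearMap.comp_apply, inner_sub_right, inner_sum,
    inner_smul_right, ContinuousLinearMap.adjoint_inner_right]

theorem re_inner_robinEnergy (hΩ : IsTraceDomain Ω) (α : ℝ) (u : robinSpace Ω) :
    (inner ℂ u (robinEnergy hΩ α u) : ℂ).re =
      ∑ i, ‖robinDeriv Ω i u‖ ^ 2 - α * ‖robinTrace hΩ u‖ ^ 2 := by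
  rw [inner_robinEnergy, Complex.sub_re, Complex.re_sum, Complex.re_ofReal_mul,
    @norm_sq_eq_re_inner ℂ _ _ _ _ (robinTrace hΩ u)]
  congr 1
  exact Finset.sum_congr rfl fun i _ => (@norm_sq_eq_re_inner ℂ _ _ _ _ (robinDeriv Ω i u)).symm

theorem re_inner_robinEnergy_robinTest (hΩ : IsTraceDomain Ω) (α : ℝ) (f : testFunctions Plane) :
    (inner ℂ (robinTest Ω f) (robinEnergy hΩ α (robinTest Ω f)) : ℂ).re =
      (∫ x in (Ω : Set Plane), gradSq f x) -
        α * ∫ x, ‖(f : Plane → ℂ) x‖ ^ 2 ∂(boundaryMeasure Ω) := by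
  rw [re_inner_robinEnergy, norm_sq_robinTrace_robinTest]
  simp only [robinDeriv_robinTest]
  rw [sum_norm_sq_toL2_deriv]

theorem norm_sq_robinIncl_robinTest (f : testFunctions Plane) :
    ‖robinIncl Ω (robinTest Ω f)‖ ^ 2 = ∫ x in (Ω : Set Plane), ‖(f : Plane → ℂ) x‖ ^ 2 := by
  rw [robinIncl_robinTest, testFunctions.norm_sq_toL2]

/-- A closed condition on the form domain may be checked on test functions. -/
theorem IsTraceDomain.induction (hΩ : IsTraceDomain Ω) {p : robinSpace Ω → Prop}
    (hp : IsClosed {u | p u}) (h : ∀ f, p (robinTest Ω f)) (u : robinSpace Ω) : p u :=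
  hΩ.denseRange.induction_on (p := p) u hp h

/-- The boundary term is a small perturbation of the Dirichlet form: its relative bound is taken to
be `1 / 2`. -/
theorem IsTraceDomain.isFormOperator (hΩ : IsTraceDomain Ω) {α : ℝ} (hα : 0 < α) :
    IsFormOperator (W := robinSpace Ω) (robinIncl Ω) (robinEnergy hΩ α) (robinLaplacian Ω α) where
  injective := fun u v h => sobolevHilbert.incl_injective h
  symm := fun u v => by
    rw [← inner_conj_symm (𝕜 := ℂ) (robinEnergy hΩ α u) v, inner_robinEnergy, inner_robinEnergy,
      map_sub, map_sum, map_mul, inner_conj_symm, Complex.conj_ofReal]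
    simp only [inner_conj_symm]
  coercive := by
    obtain ⟨C, hC⟩ := hΩ.trace_le (1 / (2 * α)) (by positivity)
    refine ⟨1 / 2, by norm_num, 1 / 2 + α * C, hΩ.induction ?_ fun f => ?_⟩
    · exact isClosed_le (by fun_prop) (by fun_prop)
    · have h1 : ‖robinTest Ω f‖ ^ 2 = _ := norm_sq_ofTest f
      rw [re_inner_robinEnergy_robinTest, norm_sq_robinIncl_robinTest, h1]
      have h2 := mul_le_mul_of_nonneg_left (hC f) hα.le
      have h3 : α * (1 / (2 * α) * (∫ x in (Ω : Set Plane), gradSq f x)) =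
        1 / 2 * ∫ x in (Ω : Set Plane), gradSq f x := by field_simp
      rw [mul_add, h3] at h2
      linarith
  mem_graph := by
    refine mem_graph_formOperator_of_surjective (robinEquiv Ω).surjective Subtype.coe_injective ?_
      (fun p => rfl) fun v u => ?_
    · intro w hw
      by_contra hw0
      obtain ⟨f, hf, hfw⟩ := sobolevHilbert.exists_test_ne_zero hw0
      exact hfw (hw (robinEquiv Ω (robinTest Ω f)))
    · rw [inner_robinEnergy]
      simp only [← partialDeriv_robinEquiv, robinTrace_apply]
      simp [robinForm]

end Robin

section Exterior

variable {M : ℕ} {P : Polygon Plane M} {b : Fin M → OrthonormalBasis (Fin 2) ℝ Plane}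

theorem IsSideFrame.isTraceDomain (hb : IsSideFrame P b) (hP : IsConvexPolygon P) :
    IsTraceDomain (exterior P) where
  isFiniteMeasure := hb.isFiniteMeasure_boundaryMeasure hP
  denseRange := denseRange_ofTest (K := hull P) rfl (convex_convexHull ℝ _) hP.nonempty_interior _
  trace_le := fun _ hε => ⟨_, fun u => hb.trace_le hP hε u⟩

/-- The lower bound of the Robin form, in the form needed for the min-max principle. -/
theorem IsSideFrame.exists_boundedBelowUpTo (hb : IsSideFrame P b) (hP : IsConvexPolygon P) {x : ℝ}
    (hx : 0 < x) : ∃ C > 0, ∃ α₀ > 0, ∀ α ≥ α₀,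
      ∃ B : robinSpace (exterior P) →L[ℂ] EuclideanSpace ℂ (lowModes (sideLength P) x),
        BoundedBelowUpTo (W := robinSpace (exterior P)) (robinIncl (exterior P))
          (robinEnergy (hb.isTraceDomain hP) α) (x - C / α - α ^ 2) B := by
  obtain ⟨C, hC, α₀, hα₀, h⟩ := hb.exists_lower_bound hP hx
  refine ⟨C, hC, α₀, hα₀, fun α hα => ?_⟩
  have hα0 : 0 < α := hα₀.trans_le hα
  set Φ : lowModes (sideLength P) x → L2 (exterior P) := fun p =>
    stripVector (exterior P) (P p.1.1) (b p.1.1) (sideLength P p.1.1) p.1.2 hα0 with hΦ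
  refine ⟨_, boundedBelowUpTo_innerFamily (W := robinSpace (exterior P)) (C := 2 * x) (Φ := Φ)
    (by positivity) ?_⟩
  refine (hb.isTraceDomain hP).induction ?_ fun f => ?_
  · refine isClosed_le (by fun_prop) (by fun_prop)
  · rw [re_inner_robinEnergy_robinTest, norm_sq_robinIncl_robinTest]
    have h1 : ∑ p, ‖(inner ℂ (Φ p) (robinIncl (exterior P) (robinTest (exterior P) f)) : ℂ)‖ ^ 2 =
        ∑ p ∈ lowModes (sideLength P) x,
          ‖sineCoeff (sideLength P p.1) p.2 (sideCoeff P b α p.1 f)‖ ^ 2 := by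
      rw [← Finset.sum_coe_sort (lowModes (sideLength P) x) fun p =>
        ‖sineCoeff (sideLength P p.1) p.2 (sideCoeff P b α p.1 f)‖ ^ 2]
      refine Finset.sum_congr rfl fun p _ => ?_
      rw [robinIncl_robinTest, hΦ, inner_stripVector (hb.strip_subset hP p.1.1)
        (hP.sideLength_pos p.1.1) hα0]
    rw [h1]
    have := h α hα f
    linarith

end Exterior

/-! ### Trial functions supported near the sides -/

section Transverse

theorem integrable_sq_of_hasCompactSupport {f : ℝ → ℝ} (hf : Continuous f)
    (hc : HasCompactSupport f) : Integrable fun t => f t ^ 2 := by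
  simp only [sq]
  exact (hf.mul hf).integrable_of_hasCompactSupport hc.mul_left

/-- The transverse factor of the trial functions: the function `exp (-α t)`, cut off smoothly to
the interval `(-δ, 2)`, and equal to `exp (-α t)` for `0 ≤ t ≤ 1`. -/
def transverseProfile (δ α t : ℝ) : ℝ :=
  Real.smoothTransition (2 - t) * Real.smoothTransition (1 + t / δ) * Real.exp (-α * t)

theorem contDiff_transverseProfile (δ α : ℝ) : ContDiff ℝ ∞ (transverseProfile δ α) :=
  ((Real.smoothTransition.contDiff.comp (by fun_prop)).mul
    (Real.smoothTransition.contDiff.comp (by fun_prop))).mul (by fun_prop)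

theorem transverseProfile_eq_zero {δ : ℝ} (hδ : 0 < δ) {α t : ℝ} (ht : t ∉ Icc (-δ) 2) :
    transverseProfile δ α t = 0 := by
  rw [transverseProfile]
  by_cases h : t < -δ
  · rw [Real.smoothTransition.zero_of_nonpos (x := 1 + t / δ), mul_zero, zero_mul]
    have : t / δ ≤ -1 := by rw [div_le_iff₀ hδ]; linarith
    linarith
  · rw [Real.smoothTransition.zero_of_nonpos (x := 2 - t), zero_mul, zero_mul]
    by_contra! h'
    exact ht ⟨not_lt.mp h, by linarith⟩

/-- The cutoff at `-δ` does not affect the half-line. -/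
theorem transverseProfile_of_nonneg {δ : ℝ} (hδ : 0 < δ) {α t : ℝ} (ht : 0 ≤ t) :
    transverseProfile δ α t = Real.smoothTransition (2 - t) * Real.exp (-α * t) := by
  rw [transverseProfile, Real.smoothTransition.one_of_one_le (x := 1 + t / δ), mul_one]
  have : 0 ≤ t / δ := by positivity
  linarith

theorem hasDerivAt_transverseProfile {δ : ℝ} (hδ : 0 < δ) (α : ℝ) {t : ℝ} (ht : 0 < t) :
    HasDerivAt (transverseProfile δ α) (-deriv Real.smoothTransition (2 - t) * Real.exp (-α * t) -
      α * transverseProfile δ α t) t := by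
  have h1 : HasDerivAt (fun t => Real.smoothTransition (2 - t) * Real.exp (-α * t))
      (deriv Real.smoothTransition (2 - t) * (-1) * Real.exp (-α * t) +
        Real.smoothTransition (2 - t) * (Real.exp (-α * t) * -α)) t := by
    have h2 : HasDerivAt Real.smoothTransition (deriv Real.smoothTransition (2 - t)) (2 - t) :=
      ((Real.smoothTransition.contDiff (n := 1)).differentiable (by simp) _).hasDerivAt
    have h3 : HasDerivAt (fun t : ℝ => 2 - t) (-1) t := (hasDerivAt_id t).const_sub 2
    have h4 : HasDerivAt (fun t : ℝ => -α * t) (-α) t := by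
      simpa using (hasDerivAt_id t).const_mul (-α)
    exact (h2.comp t h3).mul h4.exp
  refine (h1.congr_of_eventuallyEq ?_).congr_deriv ?_
  · filter_upwards [lt_mem_nhds ht] with s hs
    exact transverseProfile_of_nonneg hδ hs.le
  · rw [transverseProfile_of_nonneg hδ ht.le]
    ring

theorem tsupport_transverseProfile {δ : ℝ} (hδ : 0 < δ) (α : ℝ) :
    tsupport (transverseProfile δ α) ⊆ Icc (-δ) 2 := closure_minimal (fun t ht => by
  by_contra h
  exact ht (transverseProfile_eq_zero hδ h)) isClosed_Icc

theorem hasCompactSupport_transverseProfile {δ : ℝ} (hδ : 0 < δ) (α : ℝ) :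
    HasCompactSupport (transverseProfile δ α) :=
  isCompact_Icc.of_isClosed_subset (isClosed_tsupport _) (tsupport_transverseProfile hδ α)

theorem continuous_deriv_transverseProfile (δ α : ℝ) : Continuous (deriv (transverseProfile δ α)) :=
  (contDiff_transverseProfile δ α).continuous_deriv (by simp)

theorem hasDerivAt_deriv_transverseProfile (δ α t : ℝ) :
    HasDerivAt (transverseProfile δ α) (deriv (transverseProfile δ α) t) t :=
  ((contDiff_transverseProfile δ α).differentiable (by simp) t).hasDerivAt

theorem transverseProfile_zero {δ : ℝ} (hδ : 0 < δ) (α : ℝ) : transverseProfile δ α 0 = 1 := by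
  rw [transverseProfile_of_nonneg hδ le_rfl, Real.smoothTransition.one_of_one_le (by norm_num)]
  simp

theorem integrable_transverseProfile_sq {δ : ℝ} (hδ : 0 < δ) (α : ℝ) :
    Integrable fun t => transverseProfile δ α t ^ 2 :=
  integrable_sq_of_hasCompactSupport (contDiff_transverseProfile δ α).continuous
    (hasCompactSupport_transverseProfile hδ α)

/-- On `[0, 1 / (2α)]` the cutoff equals `1` and the exponential is at least `exp (-1/2)`. -/
theorem le_integral_transverseProfile_sq {δ : ℝ} (hδ : 0 < δ) {α : ℝ} (hα : 1 ≤ α) :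
    Real.exp (-1) / (2 * α) ≤ ∫ t in Ioi 0, transverseProfile δ α t ^ 2 := by
  have hα0 : 0 < α := by linarith
  have hi1 := integrable_transverseProfile_sq hδ α
  have hsub : Ioc 0 (1 / (2 * α)) ⊆ Ioi 0 := fun t ht => ht.1
  calc Real.exp (-1) / (2 * α) = ∫ t in Ioc 0 (1 / (2 * α)), Real.exp (-1) := by
        rw [setIntegral_const, Measure.real, Real.volume_Ioc, ENNReal.toReal_ofReal (by
          rw [sub_zero]; positivity), sub_zero, smul_eq_mul]
        ring
    _ ≤ ∫ t in Ioc 0 (1 / (2 * α)), transverseProfile δ α t ^ 2 := by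
        refine setIntegral_mono_on (by simp) hi1.integrableOn measurableSet_Ioc fun t ht => ?_
        have ht1 : α * t ≤ 1 / 2 := by
          have := mul_le_mul_of_nonneg_left ht.2 hα0.le
          refine this.trans (le_of_eq ?_)
          field_simp
        have ht2 : t ≤ 1 := by nlinarith [ht.1]
        rw [transverseProfile_of_nonneg hδ ht.1.le,
          Real.smoothTransition.one_of_one_le (by linarith), one_mul, ← Real.exp_nat_mul]
        refine Real.exp_le_exp.mpr ?_
        push_cast
        linarith
    _ ≤ _ := setIntegral_mono_set hi1.integrableOn (Eventually.of_forall fun t => sq_nonneg _)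
        hsub.eventuallyLE

/-- The transverse energy as a sum of squares. -/
theorem transverse_energy_eq {δ : ℝ} (hδ : 0 < δ) (α : ℝ) :
    (∫ t in Ioi 0, deriv (transverseProfile δ α) t ^ 2) +
        α ^ 2 * (∫ t in Ioi 0, transverseProfile δ α t ^ 2) - α =
      ∫ t in Ioi 0, (deriv (transverseProfile δ α) t + α * transverseProfile δ α t) ^ 2 := by
  have hκc := hasCompactSupport_transverseProfile hδ α
  have hκ'c := continuous_deriv_transverseProfile δ α
  have hi1 := integrable_transverseProfile_sq hδ α
  have hi2 : Integrable fun t => deriv (transverseProfile δ α) t ^ 2 :=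
    integrable_sq_of_hasCompactSupport hκ'c hκc.deriv
  have hi3 : Integrable fun t => 2 * transverseProfile δ α t * deriv (transverseProfile δ α) t :=
    ((continuous_const.mul (contDiff_transverseProfile δ α).continuous).mul
      hκ'c).integrable_of_hasCompactSupport hκc.deriv.mul_left
  have hFTC : ∫ t in Ioi 0, 2 * transverseProfile δ α t * deriv (transverseProfile δ α) t = -1 := by
    have := integral_Ioi_of_hasDerivAt_of_tendsto' (a := 0)
      (f := fun t => transverseProfile δ α t ^ 2)
      (f' := fun t => 2 * transverseProfile δ α t * deriv (transverseProfile δ α) t) (m := 0)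
      (fun t _ => by simpa using (hasDerivAt_deriv_transverseProfile δ α t).fun_pow 2)
      hi3.integrableOn ?_
    · rw [this, transverseProfile_zero hδ]
      norm_num
    · refine tendsto_const_nhds.congr' ?_
      filter_upwards [eventually_gt_atTop 2] with t ht
      rw [transverseProfile_eq_zero hδ fun h => not_lt.mpr h.2 ht]
      norm_num
  have : ∀ t, (deriv (transverseProfile δ α) t + α * transverseProfile δ α t) ^ 2 =
      (deriv (transverseProfile δ α) t ^ 2 + α ^ 2 * transverseProfile δ α t ^ 2) +
        α * (2 * transverseProfile δ α t * deriv (transverseProfile δ α) t) := fun t => by ring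
  have hi4 : Integrable fun t => deriv (transverseProfile δ α) t ^ 2 +
      α ^ 2 * transverseProfile δ α t ^ 2 := hi2.add (hi1.const_mul _)
  simp only [this]
  rw [integral_add hi4.integrableOn (hi3.const_mul _).integrableOn,
    integral_add hi2.integrableOn (hi1.const_mul _).integrableOn, integral_const_mul,
    integral_const_mul, hFTC]
  ring

theorem deriv_smoothTransition_eq_zero {t : ℝ} (ht : t < 0 ∨ 1 < t) :
    deriv Real.smoothTransition t = 0 := by
  rcases ht with ht | ht
  · have : Real.smoothTransition =ᶠ[𝓝 t] fun _ => 0 := by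
      filter_upwards [gt_mem_nhds ht] with s hs
      exact Real.smoothTransition.zero_of_nonpos hs.le
    rw [this.deriv_eq, deriv_const]
  · have : Real.smoothTransition =ᶠ[𝓝 t] fun _ => 1 := by
      filter_upwards [lt_mem_nhds ht] with s hs
      exact Real.smoothTransition.one_of_one_le hs.le
    rw [this.deriv_eq, deriv_const]

/-- The error in the transverse energy comes from the interval `[1, 2]`, where the profile is
exponentially small. -/
theorem transverse_error_le {C₁ : ℝ}
    (hC₁ : ∀ t ∈ Icc (0 : ℝ) 1, |deriv Real.smoothTransition t| ≤ C₁) {δ : ℝ} (hδ : 0 < δ) {α : ℝ}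
    (hα : 0 ≤ α) :
    ∫ t in Ioi 0, (deriv (transverseProfile δ α) t + α * transverseProfile δ α t) ^ 2 ≤
      C₁ ^ 2 * Real.exp (-2 * α) := by
  have hκc := hasCompactSupport_transverseProfile hδ α
  have hκ'c := continuous_deriv_transverseProfile δ α
  have hpt : ∀ t ∈ Ioi (0 : ℝ), (deriv (transverseProfile δ α) t + α * transverseProfile δ α t) ^ 2 ≤
      (Icc (1 : ℝ) 2).indicator (fun _ => C₁ ^ 2 * Real.exp (-2 * α)) t := by
    intro t ht
    rw [(hasDerivAt_transverseProfile hδ α ht).deriv, sub_add_cancel, mul_pow, neg_sq]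
    by_cases h : t ∈ Icc (1 : ℝ) 2
    · rw [indicator_of_mem h, ← Real.exp_nat_mul]
      refine mul_le_mul ?_ (Real.exp_le_exp.mpr ?_) (by positivity) (by positivity)
      · rw [← sq_abs]
        exact pow_le_pow_left₀ (abs_nonneg _) (hC₁ _ ⟨by linarith [h.2], by linarith [h.1]⟩) 2
      · push_cast
        nlinarith [h.1]
    · rw [indicator_of_notMem h, deriv_smoothTransition_eq_zero]
      · simp
      · by_contra! h'
        exact h ⟨by linarith [h'.2], by linarith [h'.1]⟩
  have hii : Integrable ((Icc (1 : ℝ) 2).indicator fun _ => C₁ ^ 2 * Real.exp (-2 * α)) := by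
    rw [integrable_indicator_iff measurableSet_Icc]
    exact integrableOn_const (by simp)
  have hiq : Integrable
      fun t => (deriv (transverseProfile δ α) t + α * transverseProfile δ α t) ^ 2 :=
    integrable_sq_of_hasCompactSupport (hκ'c.add (continuous_const.mul
      (contDiff_transverseProfile δ α).continuous)) (hκc.deriv.add hκc.mul_left)
  refine (setIntegral_mono_on hiq.integrableOn hii.integrableOn measurableSet_Ioi hpt).trans ?_
  refine (setIntegral_le_integral hii (Eventually.of_forall fun t =>
    indicator_nonneg (fun _ _ => by positivity) t)).trans (le_of_eq ?_)
  rw [integral_indicator measurableSet_Icc, setIntegral_const, Measure.real, Real.volume_Icc]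
  norm_num

/-- The transverse energy of the trial functions is close to the ground state energy `-α²` of the
half-line. -/
theorem exists_transverse : ∃ C > 0, ∀ δ > 0, ∀ α ≥ 1, ∃ w : testFunctions ℝ,
    tsupport (w : ℝ → ℂ) ⊆ Ici (-δ) ∧ (w : ℝ → ℂ) 0 = 1 ∧ 0 < (∫ t in Ioi 0, ‖(w : ℝ → ℂ) t‖ ^ 2) ∧
      (∫ t in Ioi 0, ‖(testFunctions.deriv 1 w : ℝ → ℂ) t‖ ^ 2) +
        α ^ 2 * (∫ t in Ioi 0, ‖(w : ℝ → ℂ) t‖ ^ 2) - α ≤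
      C / α * ∫ t in Ioi 0, ‖(w : ℝ → ℂ) t‖ ^ 2 := by
  have hσc : Continuous (deriv Real.smoothTransition) :=
    (Real.smoothTransition.contDiff (n := 1)).continuous_deriv le_rfl
  obtain ⟨C₁, hC₁⟩ : ∃ C₁, ∀ t ∈ Icc (0 : ℝ) 1, |deriv Real.smoothTransition t| ≤ C₁ :=
    isCompact_Icc.exists_bound_of_continuousOn hσc.continuousOn
  refine ⟨2 * Real.exp 1 * (C₁ ^ 2 + 1), by positivity, fun δ hδ α hα => ?_⟩
  have hα0 : 0 < α := by linarith
  set w : testFunctions ℝ := ⟨fun t => (transverseProfile δ α t : ℂ),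
    Complex.ofRealCLM.contDiff.comp (contDiff_transverseProfile δ α),
    (hasCompactSupport_transverseProfile hδ α).comp_left Complex.ofReal_zero⟩ with hw
  have hw1 : ∀ t, ‖(w : ℝ → ℂ) t‖ ^ 2 = transverseProfile δ α t ^ 2 := fun t => by
    change ‖(transverseProfile δ α t : ℂ)‖ ^ 2 = _
    rw [Complex.norm_real, Real.norm_eq_abs, sq_abs]
  have hw2 : ∀ t, ‖(testFunctions.deriv 1 w : ℝ → ℂ) t‖ ^ 2 =
      deriv (transverseProfile δ α) t ^ 2 := fun t => by
    have := (hasDerivAt_deriv_transverseProfile δ α t).ofReal_comp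
    rw [testFunctions.deriv_apply, fderiv_apply_one_eq_deriv]
    change ‖deriv (fun t => (transverseProfile δ α t : ℂ)) t‖ ^ 2 = _
    rw [this.deriv, Complex.norm_real, Real.norm_eq_abs, sq_abs]
  have hN := le_integral_transverseProfile_sq hδ hα
  have hN0 : 0 < Real.exp (-1) / (2 * α) := by positivity
  refine ⟨w, ?_, ?_, ?_, ?_⟩
  · refine (closure_mono (Function.support_comp_subset Complex.ofReal_zero _)).trans
      ((tsupport_transverseProfile hδ α).trans Icc_subset_Ici_self)
  · change (transverseProfile δ α 0 : ℂ) = 1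
    rw [transverseProfile_zero hδ, Complex.ofReal_one]
  · simp only [hw1]
    exact hN0.trans_le hN
  · simp only [hw1, hw2]
    rw [transverse_energy_eq hδ]
    refine (transverse_error_le hC₁ hδ hα0.le).trans ?_
    have hexp : Real.exp (-2 * α) ≤ 1 / α ^ 2 := by
      have h1 : α ≤ Real.exp α := by linarith [Real.add_one_le_exp α]
      have h2 : Real.exp (-2 * α) = (Real.exp α ^ 2)⁻¹ := by
        rw [← Real.exp_nat_mul, ← Real.exp_neg]
        push_cast
        ring_nf
      rw [h2, one_div]
      gcongr
    calc C₁ ^ 2 * Real.exp (-2 * α) ≤ (C₁ ^ 2 + 1) * (1 / α ^ 2) := by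
          gcongr
          linarith
      _ = 2 * Real.exp 1 * (C₁ ^ 2 + 1) / α * (Real.exp (-1) / (2 * α)) := by
        rw [Real.exp_neg]
        field_simp
      _ ≤ _ := by gcongr

end Transverse

section Product

/-- The product of a function along a line and a function of the distance to the line. -/
def productTest (A : Plane) (b : OrthonormalBasis (Fin 2) ℝ Plane) (w : testFunctions ℝ) :
    testFunctions ℝ →ₗ[ℂ] testFunctions Plane where
  toFun := fun f => ⟨fun x => (f : ℝ → ℂ) (inner ℝ (x - A) (b 0)) *
      (w : ℝ → ℂ) (inner ℝ (x - A) (b 1)),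
    ((testFunctions.contDiff f).comp ((contDiff_id.sub contDiff_const).inner ℝ contDiff_const)).mul
      ((testFunctions.contDiff w).comp ((contDiff_id.sub contDiff_const).inner ℝ contDiff_const)), by
    refine HasCompactSupport.intro
      (((testFunctions.hasCompactSupport f).isCompact.prod
        (testFunctions.hasCompactSupport w).isCompact).image
          (continuous_planeChart A (b 0) (b 1))) fun x hx => ?_
    obtain ⟨p, rfl⟩ := (planeHomeo A (linearIndependent_pair b)).surjective x
    rw [coe_planeHomeo] at hx ⊢
    rw [inner_planeChart_zero, inner_planeChart_one]
    have hp : p ∉ tsupport (f : ℝ → ℂ) ×ˢ tsupport (w : ℝ → ℂ) := fun hp => hx ⟨p, hp, rfl⟩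
    rw [mem_prod, not_and_or] at hp
    rcases hp with hp | hp
    · rw [image_eq_zero_of_notMem_tsupport hp, zero_mul]
    · rw [image_eq_zero_of_notMem_tsupport hp, mul_zero]⟩
  map_add' := fun f g => by
    ext x
    simp [add_mul]
  map_smul' := fun c f => by
    ext x
    simp [mul_assoc]

variable {A : Plane} {b : OrthonormalBasis (Fin 2) ℝ Plane} {w f : testFunctions ℝ}

theorem productTest_apply (A : Plane) (b : OrthonormalBasis (Fin 2) ℝ Plane) (w f : testFunctions ℝ)
    (x : Plane) : (productTest A b w f : Plane → ℂ) x =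
      (f : ℝ → ℂ) (inner ℝ (x - A) (b 0)) * (w : ℝ → ℂ) (inner ℝ (x - A) (b 1)) := rfl

theorem productTest_planeChart (p : ℝ × ℝ) :
    (productTest A b w f : Plane → ℂ) (planeChart A (b 0) (b 1) p) =
      (f : ℝ → ℂ) p.1 * (w : ℝ → ℂ) p.2 := by
  rw [productTest_apply, inner_planeChart_zero, inner_planeChart_one]

theorem fderiv_productTest (x v : Plane) : fderiv ℝ (productTest A b w f : Plane → ℂ) x v =
    inner ℝ v (b 0) • (productTest A b w (testFunctions.deriv 1 f) : Plane → ℂ) x +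
    inner ℝ v (b 1) • (productTest A b (testFunctions.deriv 1 w) f : Plane → ℂ) x := by
  have hin : ∀ i, HasDerivAt (fun τ : ℝ => inner ℝ (x + τ • v - A) (b i)) (inner ℝ v (b i)) 0 := by
    intro i
    have h : (fun τ : ℝ => inner ℝ (x + τ • v - A) (b i)) =
        fun τ : ℝ => inner ℝ (x - A) (b i) + τ * inner ℝ v (b i) := by
      ext τ
      rw [add_sub_right_comm, inner_add_left, real_inner_smul_left]
    rw [h]
    simpa using ((hasDerivAt_id (0 : ℝ)).mul_const (inner ℝ v (b i))).const_add
      (inner ℝ (x - A) (b i))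
  have hd : ∀ (g : testFunctions ℝ) (s : ℝ), HasDerivAt (g : ℝ → ℂ)
      ((testFunctions.deriv 1 g : ℝ → ℂ) s) s := fun g s => by
    rw [testFunctions.deriv_apply, fderiv_apply_one_eq_deriv]
    exact (testFunctions.differentiable g s).hasDerivAt
  have hline : HasDerivAt (fun τ : ℝ => x + τ • v) v 0 := by
    simpa using ((hasDerivAt_id (0 : ℝ)).smul_const v).const_add x
  have h1 : HasDerivAt (fun τ : ℝ => (productTest A b w f : Plane → ℂ) (x + τ • v))
      (fderiv ℝ (productTest A b w f : Plane → ℂ) x v) 0 := by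
    refine HasFDerivAt.comp_hasDerivAt (0 : ℝ) (f := fun τ : ℝ => x + τ • v) ?_ hline
    simp only [zero_smul, add_zero]
    exact (testFunctions.differentiable (productTest A b w f) x).hasFDerivAt
  have h2 := ((hd f _).scomp (0 : ℝ) (hin 0)).mul ((hd w _).scomp (0 : ℝ) (hin 1))
  rw [h1.unique h2, productTest_apply, productTest_apply]
  simp only [zero_smul, add_zero, Function.comp_apply, smul_mul_assoc, mul_smul_comm]

theorem gradSq_productTest (x : Plane) : gradSq (productTest A b w f) x =
    ‖(productTest A b w (testFunctions.deriv 1 f) : Plane → ℂ) x‖ ^ 2 +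
    ‖(productTest A b (testFunctions.deriv 1 w) f : Plane → ℂ) x‖ ^ 2 := by
  rw [gradSq_eq b, fderiv_productTest, fderiv_productTest]
  simp [OrthonormalBasis.inner_eq_ite]

theorem setIntegral_norm_sq_productTest (ℓ : ℝ) :
    ∫ x in halfStrip A b ℓ, ‖(productTest A b w f : Plane → ℂ) x‖ ^ 2 =
      (∫ s in Ioo 0 ℓ, ‖(f : ℝ → ℂ) s‖ ^ 2) * ∫ t in Ioi 0, ‖(w : ℝ → ℂ) t‖ ^ 2 := by
  rw [setIntegral_halfStrip (continuous_normSq _) (hasCompactSupport_normSq _),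
    ← integral_mul_const]
  refine integral_congr_ae (Eventually.of_forall fun s => ?_)
  simp only [productTest_planeChart, norm_mul, mul_pow]
  rw [integral_const_mul]

theorem setIntegral_gradSq_productTest (ℓ : ℝ) :
    ∫ x in halfStrip A b ℓ, gradSq (productTest A b w f) x =
      (∫ s in Ioo 0 ℓ, ‖(testFunctions.deriv 1 f : ℝ → ℂ) s‖ ^ 2) *
        (∫ t in Ioi 0, ‖(w : ℝ → ℂ) t‖ ^ 2) +
      (∫ s in Ioo 0 ℓ, ‖(f : ℝ → ℂ) s‖ ^ 2) *
        ∫ t in Ioi 0, ‖(testFunctions.deriv 1 w : ℝ → ℂ) t‖ ^ 2 := by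
  simp only [gradSq_productTest]
  rw [integral_add (integrable_normSq _).integrableOn (integrable_normSq _).integrableOn,
    setIntegral_norm_sq_productTest, setIntegral_norm_sq_productTest]

theorem productTest_eq_zero {x : Plane} (h : inner ℝ (x - A) (b 0) ∈ tsupport (f : ℝ → ℂ) →
    inner ℝ (x - A) (b 1) ∉ tsupport (w : ℝ → ℂ)) :
    (productTest A b w f : Plane → ℂ) x = 0 := by
  rw [productTest_apply]
  by_cases hs : inner ℝ (x - A) (b 0) ∈ tsupport (f : ℝ → ℂ)
  · rw [image_eq_zero_of_notMem_tsupport (h hs), mul_zero]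
  · rw [image_eq_zero_of_notMem_tsupport hs, zero_mul]

theorem tsupport_deriv_subset (f : testFunctions ℝ) :
    tsupport (testFunctions.deriv 1 f : ℝ → ℂ) ⊆ tsupport (f : ℝ → ℂ) :=
  tsupport_fderiv_apply_subset (𝕜 := ℝ) (1 : ℝ)

theorem fderiv_productTest_eq_zero {x : Plane} (h : inner ℝ (x - A) (b 0) ∈ tsupport (f : ℝ → ℂ) →
    inner ℝ (x - A) (b 1) ∉ tsupport (w : ℝ → ℂ)) (v : Plane) :
    fderiv ℝ (productTest A b w f : Plane → ℂ) x v = 0 := by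
  rw [fderiv_productTest, productTest_eq_zero fun hs => h (tsupport_deriv_subset f hs),
    productTest_eq_zero fun hs ht => h hs (tsupport_deriv_subset w ht), smul_zero, smul_zero,
    add_zero]

end Product

section Sum

/-- If at most one summand is nonzero, the square of the norm is additive. -/
theorem norm_sq_sum_of_disjoint {N : Type*} [Fintype N] {z : N → ℂ}
    (h : ∀ n k, n ≠ k → z n = 0 ∨ z k = 0) : ‖∑ n, z n‖ ^ 2 = ∑ n, ‖z n‖ ^ 2 := by
  classical
  by_cases h0 : ∀ n, z n = 0
  · simp [h0]
  · push Not at h0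
    obtain ⟨n, hn⟩ := h0
    have hk : ∀ k, k ≠ n → z k = 0 := fun k hkn => (h k n hkn).resolve_right hn
    rw [Finset.sum_eq_single n (fun k _ hkn => hk k hkn) (by simp),
      Finset.sum_eq_single n (fun k _ hkn => by rw [hk k hkn]; simp) (by simp)]

variable {M : ℕ} {P : Polygon Plane M} {b : Fin M → OrthonormalBasis (Fin 2) ℝ Plane}

/-- The sum over the sides of the products of functions along the sides and a function of the
distance to the side. -/
def sideSum (P : Polygon Plane M) (b : Fin M → OrthonormalBasis (Fin 2) ℝ Plane)
    (w : testFunctions ℝ) : (Fin M → testFunctions ℝ) →ₗ[ℂ] testFunctions Plane :=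
  ∑ n, productTest (P n) (b n) w ∘ₗ LinearMap.proj n

theorem sideSum_apply (w : testFunctions ℝ) (f : Fin M → testFunctions ℝ) :
    sideSum P b w f = ∑ n, productTest (P n) (b n) w (f n) := by
  simp [sideSum]

theorem coe_sideSum_apply (w : testFunctions ℝ) (f : Fin M → testFunctions ℝ) (x : Plane) :
    (sideSum P b w f : Plane → ℂ) x =
      ∑ n, (productTest (P n) (b n) w (f n) : Plane → ℂ) x := by
  rw [sideSum_apply, Submodule.coe_sum, Finset.sum_apply]

theorem fderiv_sideSum_apply (w : testFunctions ℝ) (f : Fin M → testFunctions ℝ) (x v : Plane) :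
    fderiv ℝ (sideSum P b w f : Plane → ℂ) x v =
      ∑ n, fderiv ℝ (productTest (P n) (b n) w (f n) : Plane → ℂ) x v := by
  rw [← testFunctions.deriv_apply, sideSum_apply, map_sum, Submodule.coe_sum, Finset.sum_apply]
  rfl

/-- The factors along the sides vanish near the vertices, and the part of the support of the products
on the inner side of the boundary lies in the polygon.  In the exterior, the products then live in
disjoint half-strips. -/
def SupportedNear (P : Polygon Plane M) (b : Fin M → OrthonormalBasis (Fin 2) ℝ Plane)
    (w : testFunctions ℝ) (f : Fin M → testFunctions ℝ) : Prop :=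
  ∀ n, tsupport (f n : ℝ → ℂ) ⊆ Ioo 0 (sideLength P n) ∧
    ∀ s ∈ tsupport (f n : ℝ → ℂ), ∀ t ∈ tsupport (w : ℝ → ℂ), t ≤ 0 → chart P b n (s, t) ∈ hull P

variable {w : testFunctions ℝ} {f : Fin M → testFunctions ℝ}

/-- In the exterior the support of the `n`th product lies in the `n`th half-strip. -/
theorem SupportedNear.mem_strip (h : SupportedNear P b w f) {n : Fin M} {x : Plane}
    (hx : x ∈ (exterior P : Set Plane)) (hs : inner ℝ (x - P n) (b n 0) ∈ tsupport (f n : ℝ → ℂ))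
    (ht : inner ℝ (x - P n) (b n 1) ∈ tsupport (w : ℝ → ℂ)) : x ∈ strip P b n := by
  rw [mem_strip_iff]
  refine ⟨(h n).1 hs, ?_⟩
  by_contra! ht0
  have := (h n).2 _ hs _ ht ht0
  rw [chart_inner] at this
  exact hx this

theorem SupportedNear.eq_zero (h : SupportedNear P b w f) {n : Fin M} {x : Plane}
    (hx : x ∈ (exterior P : Set Plane)) (hxn : x ∉ strip P b n) :
    (productTest (P n) (b n) w (f n) : Plane → ℂ) x = 0 :=
  productTest_eq_zero fun hs ht => hxn (h.mem_strip hx hs ht)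

theorem SupportedNear.fderiv_eq_zero (h : SupportedNear P b w f) {n : Fin M} {x : Plane}
    (hx : x ∈ (exterior P : Set Plane)) (hxn : x ∉ strip P b n) (v : Plane) :
    fderiv ℝ (productTest (P n) (b n) w (f n) : Plane → ℂ) x v = 0 :=
  fderiv_productTest_eq_zero (fun hs ht => hxn (h.mem_strip hx hs ht)) v

theorem IsSideFrame.notMem_strip_or (hb : IsSideFrame P b) (hP : IsConvexPolygon P) {n k : Fin M}
    (hnk : n ≠ k) (x : Plane) : x ∉ strip P b n ∨ x ∉ strip P b k := by
  by_contra! hx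
  exact disjoint_left.mp (hb.disjoint_strip_strip hP hnk) hx.1 hx.2

theorem IsSideFrame.setIntegral_exterior_eq (hb : IsSideFrame P b) (hP : IsConvexPolygon P)
    {F : Fin M → Plane → ℝ} (hF : ∀ n, Integrable (F n))
    (h0 : ∀ n, ∀ x ∈ (exterior P : Set Plane), x ∉ strip P b n → F n x = 0) :
    ∫ x in (exterior P : Set Plane), ∑ n, F n x = ∑ n, ∫ x in strip P b n, F n x := by
  rw [integral_finsetSum _ fun n _ => (hF n).integrableOn]
  refine Finset.sum_congr rfl fun n _ => ?_
  exact setIntegral_eq_of_subset_of_forall_sdiff_eq_zero (exterior P).isOpen.measurableSet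
    (hb.strip_subset hP n) fun x hx => h0 n x hx.1 hx.2

theorem SupportedNear.integral_norm_sq (h : SupportedNear P b w f) (hb : IsSideFrame P b)
    (hP : IsConvexPolygon P) :
    ∫ x in (exterior P : Set Plane), ‖(sideSum P b w f : Plane → ℂ) x‖ ^ 2 =
      (∑ n, ∫ s in Ioo 0 (sideLength P n), ‖(f n : ℝ → ℂ) s‖ ^ 2) *
        ∫ t in Ioi 0, ‖(w : ℝ → ℂ) t‖ ^ 2 := by
  have h1 : ∫ x in (exterior P : Set Plane), ‖(sideSum P b w f : Plane → ℂ) x‖ ^ 2 =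
      ∫ x in (exterior P : Set Plane),
        ∑ n, ‖(productTest (P n) (b n) w (f n) : Plane → ℂ) x‖ ^ 2 := by
    refine setIntegral_congr_fun (exterior P).isOpen.measurableSet fun x hx => ?_
    simp only [coe_sideSum_apply]
    exact norm_sq_sum_of_disjoint fun n k hnk =>
      (hb.notMem_strip_or hP hnk x).imp (h.eq_zero hx) (h.eq_zero hx)
  rw [h1, hb.setIntegral_exterior_eq hP (fun n => integrable_normSq _) fun n x hx hxn => by
    rw [h.eq_zero hx hxn]; simp, Finset.sum_mul]
  exact Finset.sum_congr rfl fun n _ => setIntegral_norm_sq_productTest _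

theorem SupportedNear.integral_gradSq (h : SupportedNear P b w f) (hb : IsSideFrame P b)
    (hP : IsConvexPolygon P) :
    ∫ x in (exterior P : Set Plane), gradSq (sideSum P b w f) x =
      (∑ n, ∫ s in Ioo 0 (sideLength P n), ‖(testFunctions.deriv 1 (f n) : ℝ → ℂ) s‖ ^ 2) *
        (∫ t in Ioi 0, ‖(w : ℝ → ℂ) t‖ ^ 2) +
      (∑ n, ∫ s in Ioo 0 (sideLength P n), ‖(f n : ℝ → ℂ) s‖ ^ 2) *
        ∫ t in Ioi 0, ‖(testFunctions.deriv 1 w : ℝ → ℂ) t‖ ^ 2 := by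
  have h1 : ∫ x in (exterior P : Set Plane), gradSq (sideSum P b w f) x =
      ∫ x in (exterior P : Set Plane), ∑ n, gradSq (productTest (P n) (b n) w (f n)) x := by
    refine setIntegral_congr_fun (exterior P).isOpen.measurableSet fun x hx => ?_
    simp only [gradSq, fderiv_sideSum_apply]
    rw [Finset.sum_comm]
    refine Finset.sum_congr rfl fun i _ => ?_
    exact norm_sq_sum_of_disjoint fun n k hnk =>
      (hb.notMem_strip_or hP hnk x).imp (h.fderiv_eq_zero hx · _) (h.fderiv_eq_zero hx · _)
  rw [h1, hb.setIntegral_exterior_eq hP (fun n => integrable_gradSq _) fun n x hx hxn => by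
    simp [gradSq, h.fderiv_eq_zero hx hxn], Finset.sum_mul, Finset.sum_mul,
    ← Finset.sum_add_distrib]
  exact Finset.sum_congr rfl fun n _ => setIntegral_gradSq_productTest _

theorem SupportedNear.sideSum_edgeMap (h : SupportedNear P b w f) (hb : IsSideFrame P b)
    (hP : IsConvexPolygon P) {n : Fin M} {s : ℝ} (hs : s ∈ Ioo 0 (sideLength P n)) :
    (sideSum P b w f : Plane → ℂ) (edgeMap P b n s) = (f n : ℝ → ℂ) s * (w : ℝ → ℂ) 0 := by
  rw [coe_sideSum_apply, Finset.sum_eq_single n]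
  · exact productTest_planeChart (A := P n) (b := b n) (s, 0)
  · -- the other products vanish in the strip, hence also on its boundary
    intro k _ hkn
    have hc : Continuous fun t => (productTest (P k) (b k) w (f k) : Plane → ℂ) (chart P b n (s, t)) :=
      continuous_slice_snd (testFunctions.continuous _) s
    have h0 : ∀ t ∈ Ioi (0 : ℝ),
        (productTest (P k) (b k) w (f k) : Plane → ℂ) (chart P b n (s, t)) = 0 := by
      intro t ht
      have hmem : chart P b n (s, t) ∈ strip P b n := ⟨(s, t), ⟨hs, ht⟩, rfl⟩
      exact h.eq_zero (hb.strip_subset hP n hmem)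
        ((hb.notMem_strip_or hP hkn _).resolve_right (not_not.mpr hmem))
    have hcl : IsClosed {t | (productTest (P k) (b k) w (f k) : Plane → ℂ) (chart P b n (s, t)) = 0} :=
      isClosed_eq hc continuous_const
    have : (0 : ℝ) ∈ closure (Ioi (0 : ℝ)) := by rw [closure_Ioi]; exact self_mem_Ici
    exact closure_minimal h0 hcl this
  · simp

theorem SupportedNear.integral_boundary (h : SupportedNear P b w f) (hb : IsSideFrame P b)
    (hP : IsConvexPolygon P) (hw : (w : ℝ → ℂ) 0 = 1) :
    ∫ x, ‖(sideSum P b w f : Plane → ℂ) x‖ ^ 2 ∂(boundaryMeasure (exterior P)) =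
      ∑ n, ∫ s in Ioo 0 (sideLength P n), ‖(f n : ℝ → ℂ) s‖ ^ 2 := by
  rw [hb.integral_boundaryMeasure hP (continuous_normSq _)]
  refine Finset.sum_congr rfl fun n _ => ?_
  refine setIntegral_congr_fun measurableSet_Ioo fun s hs => ?_
  rw [h.sideSum_edgeMap hb hP hs, hw, mul_one]

/-- The trial space: for large `α` there is a space of test functions, parametrized by the
coefficients of finitely many Dirichlet eigenfunctions with eigenvalues at most `μ`, on which the
Robin form is at most `-α² + μ + C / α`. -/
theorem IsSideFrame.exists_trial_space (hb : IsSideFrame P b) (hP : IsConvexPolygon P)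
    (S : Finset (Fin M × ℕ)) {μ : ℝ} (hμ : 0 ≤ μ)
    (hS : ∀ p ∈ S, dirichletFreq (sideLength P p.1) p.2 ≤ μ) :
    ∃ C > 0, ∀ α ≥ 1, ∃ L : (S → ℂ) →ₗ[ℂ] testFunctions Plane,
      (∀ c, (∫ x in (exterior P : Set Plane), ‖(L c : Plane → ℂ) x‖ ^ 2) = 0 → c = 0) ∧
      ∀ c, (∫ x in (exterior P : Set Plane), gradSq (L c) x) -
          α * (∫ x, ‖(L c : Plane → ℂ) x‖ ^ 2 ∂(boundaryMeasure (exterior P))) ≤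
        (-α ^ 2 + μ + C / α) * ∫ x in (exterior P : Set Plane), ‖(L c : Plane → ℂ) x‖ ^ 2 := by
  obtain ⟨C, hC, htrans⟩ := exists_transverse
  refine ⟨C + 1, by positivity, fun α hα => ?_⟩
  have hα0 : 0 < α := by linarith
  obtain ⟨χ, hχ, hχ2⟩ := exists_test_family hP.sideLength_pos S hμ hS (η := 1 / α) (by positivity)
  -- compact subsets of the sides that contain the supports
  set I : Fin M → Set ℝ := fun n => ⋃ p ∈ S.filter fun p => p.1 = n, tsupport (χ p : ℝ → ℂ) with hI
  have hIc : ∀ n, IsCompact (I n) := fun n =>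
    Finset.isCompact_biUnion _ fun p _ => (testFunctions.hasCompactSupport (χ p)).isCompact
  have hIs : ∀ n, I n ⊆ Ioo 0 (sideLength P n) := fun n => iUnion₂_subset fun p hp => by
    obtain ⟨h1, rfl⟩ := Finset.mem_filter.mp hp
    exact hχ p h1
  have hχI : ∀ p ∈ S, tsupport (χ p : ℝ → ℂ) ⊆ I p.1 := fun p hp =>
    subset_biUnion_of_mem (u := fun p => tsupport (χ p : ℝ → ℂ))
      (Finset.mem_coe.mpr (Finset.mem_filter.mpr ⟨hp, rfl⟩))
  choose δ hδ0 hδ using fun n => hb.exists_chart_mem_hull hP n (hIc n) (hIs n)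
  obtain ⟨δ₀, hδ₀, hδn⟩ : ∃ δ₀ > 0, ∀ n, δ₀ ≤ δ n := by
    have := hP.three_le
    have hne : Nonempty (Fin M) := ⟨⟨0, by omega⟩⟩
    obtain ⟨n, hn⟩ := Finite.exists_min δ
    exact ⟨δ n, hδ0 n, hn⟩
  obtain ⟨w, hws, hw0, hwN, hwE⟩ := htrans δ₀ hδ₀ α hα
  have hsupp : ∀ c, SupportedNear P b w fun n => modeSum S χ n c := fun c n =>
    have h1 := tsupport_modeSum hχI n c
    ⟨h1.trans (hIs n), fun s hs t ht ht0 =>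
      hδ n s (h1 hs) t (by have : -δ₀ ≤ t := hws ht; linarith [hδn n]) ht0⟩
  refine ⟨sideSum P b w ∘ₗ LinearMap.pi fun n => modeSum S χ n, fun c hc => ?_, fun c => ?_⟩
  · change ∫ x in (exterior P : Set Plane),
      ‖(sideSum P b w (fun n => modeSum S χ n c) : Plane → ℂ) x‖ ^ 2 = 0 at hc
    rw [(hsupp c).integral_norm_sq hb hP, mul_eq_zero, or_iff_left hwN.ne'] at hc
    have h2 := (hχ2 c).2
    simp only [testFunctions.norm_sq_toL2] at h2
    have h3 : ∑ p, ‖c p‖ ^ 2 ≤ 0 := h2.trans (le_of_eq (mul_eq_zero_of_right 4 hc))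
    ext p
    have h4 := (Finset.sum_eq_zero_iff_of_nonneg fun p _ => sq_nonneg ‖c p‖).mp
      (le_antisymm h3 (Finset.sum_nonneg fun p _ => sq_nonneg ‖c p‖)) p (Finset.mem_univ p)
    simpa using h4
  · change (∫ x in (exterior P : Set Plane), gradSq (sideSum P b w fun n => modeSum S χ n c) x) -
        α * (∫ x, ‖(sideSum P b w (fun n => modeSum S χ n c) : Plane → ℂ) x‖ ^ 2
          ∂(boundaryMeasure (exterior P))) ≤ (-α ^ 2 + μ + (C + 1) / α) *
        ∫ x in (exterior P : Set Plane),
          ‖(sideSum P b w (fun n => modeSum S χ n c) : Plane → ℂ) x‖ ^ 2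
    have h2 := (hχ2 c).1
    simp only [testFunctions.norm_sq_toL2] at h2
    rw [(hsupp c).integral_norm_sq hb hP, (hsupp c).integral_gradSq hb hP,
      (hsupp c).integral_boundary hb hP hw0]
    set N := ∫ t in Ioi 0, ‖(w : ℝ → ℂ) t‖ ^ 2
    set D := ∫ t in Ioi 0, ‖(testFunctions.deriv 1 w : ℝ → ℂ) t‖ ^ 2
    have hF0 : 0 ≤ ∑ n, ∫ s in Ioo 0 (sideLength P n), ‖(modeSum S χ n c : ℝ → ℂ) s‖ ^ 2 :=
      Finset.sum_nonneg fun n _ => integral_nonneg fun s => sq_nonneg _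
    set F := ∑ n, ∫ s in Ioo 0 (sideLength P n), ‖(modeSum S χ n c : ℝ → ℂ) s‖ ^ 2
    set F' := ∑ n, ∫ s in Ioo 0 (sideLength P n),
      ‖(testFunctions.deriv 1 (modeSum S χ n c) : ℝ → ℂ) s‖ ^ 2
    have h3 : F' ≤ (μ + 1 / α) * F := h2
    have h4 := mul_le_mul_of_nonneg_right h3 hwN.le
    have h5 := mul_le_mul_of_nonneg_left hwE hF0
    have h6 : (C + 1) / α = C / α + 1 / α := add_div _ _ _
    rw [h6]
    nlinarith

end Sum

/-! ### Comparison of the eigenvalues -/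

section Comparison

variable {M : ℕ} {P : Polygon Plane M} {b : Fin M → OrthonormalBasis (Fin 2) ℝ Plane}

/-- The upper bound for the Robin eigenvalues, which includes their existence. -/
theorem IsSideFrame.exists_eigenvalue_le (hb : IsSideFrame P b) (hP : IsConvexPolygon P) {m : ℕ}
    (hm : 1 ≤ m) {S : Finset (Fin M × ℕ)} (hmS : m ≤ S.card) {μ : ℝ} (hμ : 0 < μ)
    (hS : ∀ p ∈ S, dirichletFreq (sideLength P p.1) p.2 ≤ μ) :
    ∃ C > 0, ∀ᶠ α : ℝ in atTop, ∃ E ≤ -α ^ 2 + μ + C / α,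
      IsNthDiscreteEigenvalue (robinLaplacian (exterior P) α) m E := by
  obtain ⟨C, hC, htrial⟩ := hb.exists_trial_space hP S hμ.le hS
  obtain ⟨C', hC', α₀, hα₀, hlow⟩ := hb.exists_boundedBelowUpTo hP (x := μ + 1) (by linarith)
  refine ⟨C, hC, ?_⟩
  filter_upwards [eventually_ge_atTop 1, eventually_ge_atTop α₀, eventually_gt_atTop (C + C')]
    with α h1 h2 h3
  have hα0 : 0 < α := by linarith
  have hΩ := hb.isTraceDomain hP
  obtain ⟨L, hL, hLa⟩ := htrial α h1
  obtain ⟨B, hB⟩ := hlow α h2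
  refine (hΩ.isFormOperator hα0).exists_isNth_of_family (W := robinSpace (exterior P)) hB ?_
    (robinTest (exterior P) ∘ₗ L) (fun c hc => hL c ?_) (fun c => ?_) hm ?_
  · -- the trial energy `-α² + μ + C / α` is less than the level `μ + 1 - C' / α - α²` below which
    -- the spectrum is discrete
    have h4 : C / α + C' / α < 1 := by rwa [← add_div, div_lt_one hα0]
    linarith
  · rw [← norm_sq_robinIncl_robinTest]
    have : robinTest (exterior P) (L c) = 0 := hc
    simp [this]
  · change (inner ℂ (robinTest (exterior P) (L c)) (robinEnergy hΩ α (robinTest (exterior P) (L c)))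
      : ℂ).re ≤ _ * ‖robinIncl (exterior P) (robinTest (exterior P) (L c))‖ ^ 2
    rw [re_inner_robinEnergy_robinTest, norm_sq_robinIncl_robinTest]
    exact hLa c
  · rwa [Fintype.card_coe]

/-- The lower bound for the Robin eigenvalues. -/
theorem IsSideFrame.exists_le_eigenvalue (hb : IsSideFrame P b) (hP : IsConvexPolygon P) {m : ℕ}
    {μ : ℝ} (hμ : 0 < μ) (hμm : (lowModes (sideLength P) μ).card < m) :
    ∃ C > 0, ∀ᶠ α : ℝ in atTop, ∀ E,
      IsNthDiscreteEigenvalue (robinLaplacian (exterior P) α) m E → -α ^ 2 + μ - C / α ≤ E := by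
  obtain ⟨C, hC, α₀, hα₀, hlow⟩ := hb.exists_boundedBelowUpTo hP hμ
  refine ⟨C, hC, ?_⟩
  filter_upwards [eventually_ge_atTop α₀] with α hα E hE
  obtain ⟨B, hB⟩ := hlow α hα
  have := ((hb.isTraceDomain hP).isFormOperator (hα₀.trans_le hα)).le_of_isNthDiscreteEigenvalue
    (W := robinSpace (exterior P)) hB hE (by rwa [finrank_euclideanSpace, Fintype.card_coe])
  linarith

end Comparison

end RobinExterior

end

theorem theorem1 {M : ℕ} (P : Polygon Plane M) (hP : IsConvexPolygon P) (m : ℕ) (hm : 1 ≤ m) :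
    ∃ (μ : ℝ) (E : ℝ → ℝ),
      IsNthDiscreteEigenvalue (directSum fun n : Fin M => dirichletLaplacian (sideLength P n)) m μ ∧
      (∀ᶠ α : ℝ in atTop, IsNthDiscreteEigenvalue (robinLaplacian (exterior P) α) m (E α)) ∧
      (fun α : ℝ => E α - (-α ^ 2 + μ)) =O[atTop] fun α : ℝ => 1 / √α := by
  classical
  have hne : Nonempty (Fin M) := ⟨⟨0, by have := hP.three_le; omega⟩⟩
  obtain ⟨b, hb⟩ := hP.exists_isSideFrame
  obtain ⟨μ, hμ, hμm, S, hmS, hS⟩ := exists_dirichlet_level hP.sideLength_pos hm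
  obtain ⟨C, hC, hup⟩ := hb.exists_eigenvalue_le hP hm hmS hμ hS
  obtain ⟨C', hC', hlow⟩ := hb.exists_le_eigenvalue hP hμ hμm
  set E : ℝ → ℝ := fun α =>
    if h : ∃ E, IsNthDiscreteEigenvalue (robinLaplacian (exterior P) α) m E then h.choose else 0
    with hE
  have hEα : ∀ {α E'}, IsNthDiscreteEigenvalue (robinLaplacian (exterior P) α) m E' →
      E α = E' := fun {α E'} h => by
    have h' : ∃ E, IsNthDiscreteEigenvalue (robinLaplacian (exterior P) α) m E := ⟨E', h⟩
    simp only [hE, dif_pos h']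
    exact h'.choose_spec.unique h
  refine ⟨μ, E, isNthDiscreteEigenvalue_directSum_dirichletLaplacian hP.sideLength_pos hm hμ hμm
    hmS hS, ?_, ?_⟩
  · filter_upwards [hup] with α ⟨E', _, h⟩
    rwa [hEα h]
  · refine Asymptotics.IsBigO.of_bound (C + C') ?_
    filter_upwards [hup, hlow, eventually_ge_atTop 1] with α ⟨E', hle, h⟩ hge hα
    have hα0 : 0 < α := by linarith
    have hge' := hge E' h
    rw [hEα h, Real.norm_eq_abs, Real.norm_eq_abs, abs_of_nonneg (show 0 ≤ 1 / √α by positivity)]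
    have h1 : 1 / α ≤ 1 / √α := by
      refine one_div_le_one_div_of_le (by positivity) ?_
      rw [Real.sqrt_le_left hα0.le]
      nlinarith
    have h2 : C / α ≤ C * (1 / √α) := by
      rw [div_eq_mul_one_div]
      exact mul_le_mul_of_nonneg_left h1 hC.le
    have h3 : C' / α ≤ C' * (1 / √α) := by
      rw [div_eq_mul_one_div]
      exact mul_le_mul_of_nonneg_left h1 hC'.le
    have h4 : 0 ≤ C * (1 / √α) := by positivity
    have h5 : 0 ≤ C' * (1 / √α) := by positivity
    rw [abs_le]
    constructor <;> linarith
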